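/- **Theorem (generalized Koszul theorem for almost twilled Lie-Rinehart algebras).** *Setting.* Let $R$ be a commutative ring and $A$ a commutative $R$-algebra. A Lie-Rinehart algebra $(A,L)$ is an $R$-Lie algebra $L$ that is an $A$-module and acts on $A$ by $R$-derivations, such that $(ax)(b)=a\,x(b)$ and $[x,ay]=x(a)y+a[x,y]$. An $(A,L)$-connection on an $A$-module $M$ is an $R$-bilinear pairing $(x,m)\mapsto\nabla_xm$ with $\nabla_{ax}m=a\nabla_xm$ and $\nabla_x(am)=x(a)m+a\nabla_xm$; it is flat, i.e. an $(A,L)$-module structure, if $\nabla_{[x,y]}=\nabla_x\nabla_y-\nabla_y\nabla_x$. Let $(A,L',L'')$ be an almost twilled Lie-Rinehart algebra: $(A,L')$ and $(A,L'')$ are Lie-Rinehart algebras, $L''$ carries an $(A,L')$-module structure $(x,\xi)\mapsto x\cdot\xi$ and $L'$ an $(A,L'')$-module structure $(\xi,x)\mapsto\xi\cdot x$. It is twilled if $L''\oplus L'$, with the sum of the two actions on $A$ and the bracket $[(\xi,x),(\eta,y)]=([\xi,\eta]+x\cdot\eta-y\cdot\xi,\ [x,y]+\xi\cdot y-\eta\cdot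 x)$, is a Lie-Rinehart algebra over $A$. Suppose that $L'$ is a finitely generated projective $A$-module of constant rank $n$. *Operators.* For a connection $\nabla$ on $M$ the Rinehart operator on $\mathrm{Alt}_A^*(L,M)$ is, for $f$ of degree $m$, $$(df)(x_0,\dots,x_m)=(-1)^{m+1}\Big(\sum_i(-1)^i\nabla_{x_i}\big(f(x_0,\dots,\widehat{x_i},\dots,x_m)\big)+\sum_{i<j}(-1)^{i+j}f([x_i,x_j],x_0,\dots,\widehat{x_i},\dots,\widehat{x_j},\dots,x_m)\Big).$$ Let $d''$ denote this operator on $\mathrm{Alt}_A(L'',\Lambda_AL')$ and on $\mathrm{Alt}_A(L'',\mathrm{Alt}_A(L',\Lambda_A^nL'))$, for the $L''$-module structures on the coefficients induced by that on $L'$. An $(A,L')$-connection $\nabla'$ on $\Lambda_A^nL'$ and the action of $L'$ on $L''$ induce a connection on $\mathrm{Alt}_A^q(L'',\Lambda_A^nL')$, and hence, after interchanging arguments, the operator of covariant derivative $\partial_{\nabla'}$ on $\mathrm{Alt}_A^q(L'',\mathrm{Alt}_A^*(L',\Lambda_A^nL'))$; by definition it is $(-1)^q$ times the Rinehart operator of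 the induced connection. The algebra $\mathrm{Alt}_A(L'',\Lambda_AL')$, with elements of $\mathrm{Alt}^q_A(L'',\Lambda^p_AL')$ of bidegree $(q,p)$ and total degree $q+p$, carries the shuffle product of forms induced by the exterior product of the values, multiplied by $(-1)^{(q+p)q'}$ for factors of bidegrees $(q,p)$ and $(q',p')$. Let $$\Phi\colon\mathrm{Alt}_A(L'',\Lambda_A^*L')\to\mathrm{Alt}_A(L'',\mathrm{Alt}_A^{n-*}(L',\Lambda_A^nL'))$$ be induced by $u\mapsto\varphi_u$, where $\varphi_u(y_1,\dots,y_{n-p})=y_1\wedge\dots\wedge y_{n-p}\wedge u$ for $u\in\Lambda^p_AL'$ (and $\Phi=0$ for $p>n$). *Brackets and generators.* A bigraded Gerstenhaber bracket on a bigraded commutative algebra is a bracket of bidegree $(0,-1)$ satisfying, for homogeneous $a$, $b$, $[a,b]=-(-1)^{(|a|-1)(|b|-1)}[b,a]$, $[a,[b,c]]=[[a,b],c]+(-1)^{(|a|-1)(|b|-1)}[b,[a,c]]$ and $[a,bc]=[a,b]c+(-1)^{(|a|-1)|b|}b[a,c]$. A generator of it is an $R$-linear operator $\Delta$ of bidegree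 $(0,-1)$ with $[a,b]=(-1)^{|a|}\big(\Delta(ab)-(\Delta a)b-(-1)^{|a|}a(\Delta b)\big)$; it is exact if $\Delta\Delta=0$. The crossed product bracket $[\cdot,\cdot]'$ on $\mathrm{Alt}_A(L'',\Lambda_AL')$ is the bigraded Gerstenhaber bracket that restricts to the Lie bracket on $L'$ and satisfies $[x,\alpha]'=x(\alpha)$ for $x\in L'$ and $\alpha\in\mathrm{Alt}_A(L'',A)$. The triple $(\mathrm{Alt}_A(L'',\Lambda_AL'),\Delta',d'')$ is a weak differential bigraded Batalin-Vilkovisky algebra if $d''$ is a differential of bidegree $(1,0)$ which is a derivation both of the product and of the bracket $[\cdot,\cdot]'$, $\Delta'$ is a generator of $[\cdot,\cdot]'$, and $d''\Delta'+\Delta'd''=0$; it is a (true) differential bigraded Batalin-Vilkovisky algebra if moreover $\Delta'\Delta'=0$. The connection $\nabla'$ on $\Lambda^n_AL'$ is $L''$-invariant if, for all $x\in L'$, $\xi\in L''$, $w\in\Lambda_A^nL'$, $$\xi(\nabla'_xw)-\nabla'_{\xi\cdot x}w=\nabla'_x(\xi(w))-(x\cdot\xi)(w).$$ *Conclusion.*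 1. $\Phi$ is an isomorphism of chain complexes $(\mathrm{Alt}_A(L'',\Lambda_A^*L'),d'')\to(\mathrm{Alt}_A(L'',\mathrm{Alt}_A^{n-*}(L',\Lambda_A^nL')),d'')$: it is bijective, $d''d''=0$ on both sides, and $\Phi d''=d''\Phi$. 2. The crossed product bracket $[\cdot,\cdot]'$ exists and is unique. 3. The relation $\Phi\Delta'=\partial_{\nabla'}\Phi$ is a bijective correspondence between the generators $\Delta'$ of $[\cdot,\cdot]'$ and the $(A,L')$-connections $\nabla'$ on $\Lambda^n_AL'$: for each generator there is exactly one such connection, and for each connection exactly one such generator. 4. Let $\Delta'$ and $\nabla'$ correspond to each other. Then $\Delta'$ is exact if and only if $\nabla'$ is flat. If $(A,L',L'')$ is twilled, then $(\mathrm{Alt}_A(L'',\Lambda_AL'),\Delta',d'')$ is a weak differential bigraded Batalin-Vilkovisky algebra if and only if $\nabla'$ is $L''$-invariant, and it is a true differential bigraded Batalin-Vilkovisky algebra if and only if $\nabla'$ is flat and $L''$-invariant. -/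

import Mathlib

open scoped DirectSum

/-!
# Twilled Lie-Rinehart algebras and differential bigraded Batalin-Vilkovisky algebras

Throughout, `L₁` plays the role of `L'` and `L₂` the role of `L''`.
-/

namespace LieRinehartBV

noncomputable section

set_option linter.unusedSectionVars false

/-! ## Bigraded algebras, Gerstenhaber brackets, generators -/

section Bigraded

variable {R : Type*} [CommRing R]
  {T : ℕ × ℕ → Type*} [∀ i, AddCommGroup (T i)] [∀ i, Module R (T i)]

/-- The homogeneous element of bidegree `i` given by `f : T i`. -/
abbrev hom (R : Type*) [CommRing R] {T : ℕ × ℕ → Type*} [∀ i, AddCommGroup (T i)]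
    [∀ i, Module R (T i)] (i : ℕ × ℕ) (f : T i) : ⨁ i, T i :=
  DirectSum.lof R (ℕ × ℕ) T i f

/-- Total degree. -/
abbrev tdeg (i : ℕ × ℕ) : ℕ := i.1 + i.2

/-- The operator `D` has bidegree `s`: it maps the component of bidegree `i` into the component of
bidegree `i + s` (and to zero if `i + s` has a negative entry). -/
def HasBidegree (s : ℤ × ℤ) (D : (⨁ i, T i) →ₗ[R] (⨁ i, T i)) : Prop :=
  ∀ (i : ℕ × ℕ) (f : T i) (k : ℕ × ℕ),
    ((k.1 : ℤ), (k.2 : ℤ)) ≠ (i.1 + s.1, i.2 + s.2) → D (hom R i f) k = 0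

/-- `(T, μ)` is a bigraded commutative `R`-algebra with unit `one`; the signs in the commutation
rule are governed by the total degree. -/
structure IsBigradedCommAlgebra (one : ⨁ i, T i)
    (μ : (⨁ i, T i) →ₗ[R] (⨁ i, T i) →ₗ[R] (⨁ i, T i)) : Prop where
  one_bidegree : ∃ u : T (0, 0), one = hom R (0, 0) u
  mul_bidegree : ∀ (i j : ℕ × ℕ) (f : T i) (g : T j) (k : ℕ × ℕ), k ≠ (i.1 + j.1, i.2 + j.2) →
    μ (hom R i f) (hom R j g) k = 0
  one_mul : ∀ x, μ one x = x
  mul_one : ∀ x, μ x one = x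
  mul_assoc : ∀ x y z, μ (μ x y) z = μ x (μ y z)
  mul_comm : ∀ (i j : ℕ × ℕ) (f : T i) (g : T j),
    μ (hom R i f) (hom R j g) = (-1 : ℤ) ^ (tdeg i * tdeg j) • μ (hom R j g) (hom R i f)

/-- `(T, μ, B)` is a bigraded Gerstenhaber algebra: `T` is a bigraded commutative algebra, and `B` is
a bracket of bidegree `(0, -1)` which is a graded Lie bracket once the second degree is
regraded down by one, such that `B x` is a derivation of `μ` for every homogeneous `x`.
In the exponents of the signs, `|x| - 1` is replaced by `|x| + 1`, which has the same parity. -/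
structure IsBigradedGerstenhaber (one : ⨁ i, T i)
    (μ B : (⨁ i, T i) →ₗ[R] (⨁ i, T i) →ₗ[R] (⨁ i, T i)) : Prop
    extends IsBigradedCommAlgebra one μ where
  bracket_bidegree : ∀ (i j : ℕ × ℕ) (f : T i) (g : T j) (k : ℕ × ℕ),
    ((k.1 : ℤ), (k.2 : ℤ)) ≠ ((i.1 : ℤ) + j.1, (i.2 : ℤ) + j.2 - 1) →
      B (hom R i f) (hom R j g) k = 0
  bracket_skew : ∀ (i j : ℕ × ℕ) (f : T i) (g : T j),
    B (hom R i f) (hom R j g) =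
      -((-1 : ℤ) ^ ((tdeg i + 1) * (tdeg j + 1)) • B (hom R j g) (hom R i f))
  bracket_jacobi : ∀ (i j : ℕ × ℕ) (f : T i) (g : T j) (z : ⨁ i, T i),
    B (hom R i f) (B (hom R j g) z) = B (B (hom R i f) (hom R j g)) z +
      (-1 : ℤ) ^ ((tdeg i + 1) * (tdeg j + 1)) • B (hom R j g) (B (hom R i f) z)
  bracket_leibniz : ∀ (i j : ℕ × ℕ) (f : T i) (g : T j) (z : ⨁ i, T i),
    B (hom R i f) (μ (hom R j g) z) = μ (B (hom R i f) (hom R j g)) z +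
      (-1 : ℤ) ^ ((tdeg i + 1) * tdeg j) • μ (hom R j g) (B (hom R i f) z)

/-- The `R`-linear operator `Δ` of bidegree `(0, -1)` is a generator of the bracket `B`:
`[a, b] = (-1)^|a| (Δ(ab) - (Δa) b - (-1)^|a| a (Δb))` for homogeneous `a`, `b`. -/
def IsGenerator (μ B : (⨁ i, T i) →ₗ[R] (⨁ i, T i) →ₗ[R] (⨁ i, T i))
    (Δ : (⨁ i, T i) →ₗ[R] (⨁ i, T i)) : Prop :=
  HasBidegree (0, -1) Δ ∧
  ∀ (i j : ℕ × ℕ) (f : T i) (g : T j),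
    B (hom R i f) (hom R j g) = (-1 : ℤ) ^ tdeg i •
      (Δ (μ (hom R i f) (hom R j g)) - μ (Δ (hom R i f)) (hom R j g)
        - (-1 : ℤ) ^ tdeg i • μ (hom R i f) (Δ (hom R j g)))

/-- A generator is exact if its square is zero. -/
def IsExact (Δ : (⨁ i, T i) →ₗ[R] (⨁ i, T i)) : Prop := Δ ∘ₗ Δ = 0

/-- `(T, μ, B, d)` is a differential bigraded Gerstenhaber algebra: `d` is a differential of bidegree
`(1, 0)`, a derivation of the product and a derivation of the bracket. -/
structure IsDiffBigradedGerstenhaber (one : ⨁ i, T i)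
    (μ B : (⨁ i, T i) →ₗ[R] (⨁ i, T i) →ₗ[R] (⨁ i, T i))
    (d : (⨁ i, T i) →ₗ[R] (⨁ i, T i)) : Prop
    extends IsBigradedGerstenhaber one μ B where
  d_bidegree : HasBidegree (1, 0) d
  d_d : d ∘ₗ d = 0
  d_mul : ∀ (i : ℕ × ℕ) (f : T i) (y : ⨁ i, T i),
    d (μ (hom R i f) y) = μ (d (hom R i f)) y + (-1 : ℤ) ^ tdeg i • μ (hom R i f) (d y)
  d_bracket : ∀ (i : ℕ × ℕ) (f : T i) (y : ⨁ i, T i),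
    d (B (hom R i f) y) = B (d (hom R i f)) y - (-1 : ℤ) ^ tdeg i • B (hom R i f) (d y)

/-- `(T, Δ, d)` is a weak differential bigraded Batalin-Vilkovisky algebra, with bracket `B`. -/
structure IsWeakDiffBV (one : ⨁ i, T i)
    (μ B : (⨁ i, T i) →ₗ[R] (⨁ i, T i) →ₗ[R] (⨁ i, T i))
    (Δ d : (⨁ i, T i) →ₗ[R] (⨁ i, T i)) : Prop
    extends IsDiffBigradedGerstenhaber one μ B d where
  generator : IsGenerator μ B Δ
  commutator : d ∘ₗ Δ + Δ ∘ₗ d = 0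

/-- `(T, Δ, d)` is a (true) differential bigraded Batalin-Vilkovisky algebra, with bracket `B`. -/
structure IsDiffBV (one : ⨁ i, T i)
    (μ B : (⨁ i, T i) →ₗ[R] (⨁ i, T i) →ₗ[R] (⨁ i, T i))
    (Δ d : (⨁ i, T i) →ₗ[R] (⨁ i, T i)) : Prop
    extends IsWeakDiffBV one μ B Δ d where
  exact_generator : IsExact Δ

end Bigraded

/-! ## Alternating maps and derivations -/

section AltDer

instance altScalarTower {R A M N ι : Type*} [CommRing R] [CommRing A] [Algebra R A]
    [AddCommGroup M] [Module A M] [AddCommGroup N] [Module A N] [Module R N]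
    [IsScalarTower R A N] : IsScalarTower R A (M [⋀^ι]→ₗ[A] N) :=
  ⟨fun r a f => by ext v; simp⟩

variable {A M N : Type*} [CommRing A] [AddCommGroup M] [Module A M] [AddCommGroup N] [Module A N]
  {q : ℕ}

/-- `∑ i, f (v₁, …, δ vᵢ, …, v_q)`. -/
def updSum (δ : N → N) (f : N [⋀^Fin q]→ₗ[A] M) (v : Fin q → N) : M :=
  ∑ i, f (Function.update v i (δ (v i)))

lemma updSum_update (δ : N → N) (f : N [⋀^Fin q]→ₗ[A] M) (v : Fin q → N) (i : Fin q) (n : N) :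
    updSum δ f (Function.update v i n) = f (Function.update v i (δ n)) +
      ∑ j ∈ Finset.univ.erase i,
        f (Function.update (Function.update v j (δ (v j))) i n) := by
  unfold updSum
  rw [← Finset.add_sum_erase _ _ (Finset.mem_univ i)]
  congr 1
  · simp
  · refine Finset.sum_congr rfl fun j hj => ?_
    have hji : j ≠ i := (Finset.mem_erase.1 hj).1
    rw [Function.update_of_ne hji, Function.update_comm hji]

lemma updSum_update_add (δ : N → N) (hδ : ∀ m n, δ (m + n) = δ m + δ n)
    (f : N [⋀^Fin q]→ₗ[A] M) (v : Fin q → N) (i : Fin q) (m n : N) :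
    updSum δ f (Function.update v i (m + n)) =
      updSum δ f (Function.update v i m) + updSum δ f (Function.update v i n) := by
  simp only [updSum_update, hδ, f.map_update_add, Finset.sum_add_distrib]
  abel

lemma updSum_update_smul (δ : N → N) (c a : A)
    (f : N [⋀^Fin q]→ₗ[A] M) (v : Fin q → N) (i : Fin q) (n : N)
    (h : δ (a • n) = a • δ n + c • n) :
    updSum δ f (Function.update v i (a • n)) =
      a • updSum δ f (Function.update v i n) + c • f (Function.update v i n) := by
  simp only [updSum_update, h, f.map_update_add, f.map_update_smul, smul_add, Finset.smul_sum]
  abel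

lemma updSum_eq_zero (δ : N → N) (f : N [⋀^Fin q]→ₗ[A] M) (v : Fin q → N) (i j : Fin q)
    (hv : v i = v j) (hij : i ≠ j) : updSum δ f v = 0 := by
  unfold updSum
  rw [Fintype.sum_eq_add i j hij]
  · have h : Function.update v i (δ (v i)) =
        Function.update v j (δ (v j)) ∘ Equiv.swap i j := by
      funext k
      rcases eq_or_ne k i with rfl | hki
      · simp [hv]
      · rcases eq_or_ne k j with rfl | hkj
        · simp [hij, hki, hv]
        · simp [Equiv.swap_apply_of_ne_of_ne hki hkj, hki, hkj]
    rw [h, f.map_swap _ hij, neg_add_cancel]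
  · intro k ⟨hki, hkj⟩
    exact f.map_eq_zero_of_eq _
      (by rw [Function.update_of_ne hki.symm, Function.update_of_ne hkj.symm, hv]) hij

end AltDer

/-! ## Connections -/

section Connections

variable (R A L : Type*) [CommRing R] [CommRing A] [Algebra R A]
  [LieRing L] [LieAlgebra R L] [Module A L] [LieRingModule L A] [LieRinehartRing A L]
  [LieRinehartAlgebra R A L]

/-- An `(A, L)`-connection on the `A`-module `M`: an `R`-bilinear pairing `(x, m) ↦ x(m)`
with `(a x)(m) = a (x(m))` and `x (a m) = x(a) m + a x(m)`. -/
structure Conn (M : Type*) [AddCommGroup M] [Module A M] [Module R M] [IsScalarTower R A M] where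
  /-- The pairing. -/
  act : L →ₗ[A] M →ₗ[R] M
  leibniz : ∀ (x : L) (a : A) (m : M), act x (a • m) = ⁅x, a⁆ • m + a • act x m

variable {R A L}

namespace Conn

variable {M N : Type*} [AddCommGroup M] [Module A M] [Module R M] [IsScalarTower R A M]
  [AddCommGroup N] [Module A N] [Module R N] [IsScalarTower R A N]

/-- A connection is flat if it is an `(A, L)`-module structure. -/
def IsFlat (C : Conn R A L M) : Prop :=
  ∀ (x y : L) (m : M), C.act ⁅x, y⁆ m = C.act x (C.act y m) - C.act y (C.act x m)

variable (R A L) in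
/-- The `(A, L)`-module structure on `A` itself. -/
def anchor : Conn R A L A where
  act :=
    { toFun := fun x => (LieRinehartAlgebra.anchor R A L x : Derivation R A A).toLinearMap
      map_add' := fun x y => by ext a; simp
      map_smul' := fun a x => by ext b; simp }
  leibniz x a b := by
    simp [mul_comm, add_comm]

/-- The derivation of alternating maps induced by `δN` and `δM`:
`v ↦ δM (f v) - ∑ i, f (v₁, …, δN vᵢ, …, v_q)`. -/
def altDer {q : ℕ} (x : L) (δN : N →ₗ[R] N) (δM : M →ₗ[R] M)
    (hN : ∀ (a : A) n, δN (a • n) = ⁅x, a⁆ • n + a • δN n)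
    (hM : ∀ (a : A) m, δM (a • m) = ⁅x, a⁆ • m + a • δM m) :
    (N [⋀^Fin q]→ₗ[A] M) →ₗ[R] (N [⋀^Fin q]→ₗ[A] M) where
  toFun f :=
    { toFun := fun v => δM (f v) - updSum δN f v
      map_update_add' := by
        intro inst v i m n
        rw [Subsingleton.elim inst (instDecidableEqFin q)]
        rw [updSum_update_add _ (map_add δN), f.map_update_add, map_add]
        abel
      map_update_smul' := by
        intro inst v i a n
        rw [Subsingleton.elim inst (instDecidableEqFin q)]
        rw [updSum_update_smul _ ⁅x, a⁆ a f v i n (by rw [hN, add_comm]),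
          f.map_update_smul, hM, smul_sub]
        abel
      map_eq_zero_of_eq' := by
        intro v i j hv hij
        rw [f.map_eq_zero_of_eq _ hv hij, updSum_eq_zero _ f v i j hv hij, map_zero, sub_zero] }
  map_add' f g := by
    ext v
    simp [updSum, Finset.sum_add_distrib]
    abel
  map_smul' r f := by
    ext v
    simp [updSum, Finset.smul_sum, smul_sub]

lemma altDer_apply {q : ℕ} (x : L) (δN : N →ₗ[R] N) (δM : M →ₗ[R] M)
    (hN : ∀ (a : A) n, δN (a • n) = ⁅x, a⁆ • n + a • δN n)
    (hM : ∀ (a : A) m, δM (a • m) = ⁅x, a⁆ • m + a • δM m) (f : N [⋀^Fin q]→ₗ[A] M)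
    (v : Fin q → N) :
    altDer x δN δM hN hM f v = δM (f v) - ∑ i, f (Function.update v i (δN (v i))) := rfl

/-- The connection on `Alt_A^q(N, M)` induced by connections on `N` and `M`:
`(x f)(v) = x (f v) - ∑ i, f (v₁, …, x vᵢ, …, v_q)`. -/
def alt (CN : Conn R A L N) (CM : Conn R A L M) (q : ℕ) : Conn R A L (N [⋀^Fin q]→ₗ[A] M) where
  act :=
    { toFun := fun x => altDer x (CN.act x) (CM.act x) (CN.leibniz x) (CM.leibniz x)
      map_add' := fun x y => by
        ext f v
        simp [altDer_apply, Finset.sum_add_distrib]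
        abel
      map_smul' := fun a x => by
        ext f v
        simp [altDer_apply, Finset.smul_sum, smul_sub] }
  leibniz x a f := by
    ext v
    simp [altDer_apply, Finset.smul_sum, smul_sub, CM.leibniz]
    abel

lemma alt_act_apply (CN : Conn R A L N) (CM : Conn R A L M) (q : ℕ) (x : L)
    (f : N [⋀^Fin q]→ₗ[A] M) (v : Fin q → N) :
    (CN.alt CM q).act x f v =
      CM.act x (f v) - ∑ i, f (Function.update v i (CN.act x (v i))) := rfl

end Conn

end Connections

/-! ## The induced connection on exterior powers -/

/-- `M × M` with the `A`-module structure `a • (u, w) = (a u, a w + x(a) u)`; auxiliary. -/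
def Twisted (_A : Type*) {L : Type*} (_x : L) (M : Type*) : Type _ := M × M

section Twisted

variable {A L M : Type*} [CommRing A] [LieRing L] [Module A L] [LieRingModule L A]
  [LieRinehartRing A L] [AddCommGroup M] [Module A M] (x : L)

instance : AddCommGroup (Twisted A x M) := inferInstanceAs (AddCommGroup (M × M))

instance : SMul A (Twisted A x M) :=
  ⟨fun a u => ((a • u.1, a • u.2 + ⁅x, a⁆ • u.1) : M × M)⟩

lemma Twisted.smul_def (a : A) (u : Twisted A x M) :
    a • u = ((a • u.1, a • u.2 + ⁅x, a⁆ • u.1) : M × M) := rfl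

lemma lie_one_eq_zero : ⁅x, (1 : A)⁆ = 0 := by
  have h := LieRinehartRing.leibniz_mul_right' x (1 : A) 1
  simpa using h

instance : Module A (Twisted A x M) where
  one_smul u := by
    refine Prod.ext ?_ ?_
    · exact one_smul A u.1
    · change (1 : A) • u.2 + ⁅x, (1 : A)⁆ • u.1 = u.2
      rw [lie_one_eq_zero, one_smul, zero_smul, add_zero]
  mul_smul a b u := by
    refine Prod.ext ?_ ?_
    · exact mul_smul a b u.1
    · change (a * b) • u.2 + ⁅x, a * b⁆ • u.1 =
        a • (b • u.2 + ⁅x, b⁆ • u.1) + ⁅x, a⁆ • (b • u.1)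
      rw [LieRinehartRing.leibniz_mul_right' x a b]
      simp only [smul_add, add_smul, mul_smul, smul_eq_mul]
      abel
  smul_zero a := by
    refine Prod.ext ?_ ?_
    · exact smul_zero a
    · change a • (0 : M) + ⁅x, a⁆ • (0 : M) = 0
      simp
  smul_add a u v := by
    refine Prod.ext ?_ ?_
    · exact smul_add a u.1 v.1
    · change a • (u.2 + v.2) + ⁅x, a⁆ • (u.1 + v.1) =
        (a • u.2 + ⁅x, a⁆ • u.1) + (a • v.2 + ⁅x, a⁆ • v.1)
      simp only [smul_add]
      abel
  add_smul a b u := by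
    refine Prod.ext ?_ ?_
    · exact add_smul a b u.1
    · change (a + b) • u.2 + ⁅x, a + b⁆ • u.1 =
        (a • u.2 + ⁅x, a⁆ • u.1) + (b • u.2 + ⁅x, b⁆ • u.1)
      simp only [lie_add, add_smul]
      abel
  zero_smul u := by
    refine Prod.ext ?_ ?_
    · exact zero_smul A u.1
    · change (0 : A) • u.2 + ⁅x, (0 : A)⁆ • u.1 = 0
      simp

end Twisted

namespace Conn

variable {R A L : Type*} [CommRing R] [CommRing A] [Algebra R A]
  [LieRing L] [LieAlgebra R L] [Module A L] [LieRingModule L A] [LieRinehartRing A L]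
  [LieRinehartAlgebra R A L]
  {N : Type*} [AddCommGroup N] [Module A N] [Module R N] [IsScalarTower R A N]

/-- The `A`-linear map `u ↦ (u, x u)` into the twisted module. -/
def extTwisted (C : Conn R A L N) (p : ℕ) (x : L) :
    ⋀[A]^p N →ₗ[A] Twisted A x (⋀[A]^p N) :=
  exteriorPower.alternatingMapLinearEquiv
    { toFun := fun v => ((exteriorPower.ιMulti A p v,
          updSum (C.act x) (exteriorPower.ιMulti A p) v) : (⋀[A]^p N) × (⋀[A]^p N))
      map_update_add' := by
        intro inst v i m n
        rw [Subsingleton.elim inst (instDecidableEqFin p),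
          updSum_update_add _ (map_add (C.act x)), (exteriorPower.ιMulti A p).map_update_add]
        rfl
      map_update_smul' := by
        intro inst v i a n
        rw [Subsingleton.elim inst (instDecidableEqFin p),
          updSum_update_smul _ ⁅x, a⁆ a _ v i n (by rw [C.leibniz, add_comm]),
          (exteriorPower.ιMulti A p).map_update_smul]
        rfl
      map_eq_zero_of_eq' := by
        intro v i j hv hij
        rw [(exteriorPower.ιMulti A p).map_eq_zero_of_eq _ hv hij,
          updSum_eq_zero _ _ v i j hv hij]
        rfl }

lemma extTwisted_ιMulti (C : Conn R A L N) (p : ℕ) (x : L) (v : Fin p → N) :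
    C.extTwisted p x (exteriorPower.ιMulti A p v) =
      ((exteriorPower.ιMulti A p v,
          updSum (C.act x) (exteriorPower.ιMulti A p) v) : (⋀[A]^p N) × (⋀[A]^p N)) := by
  simp only [extTwisted, exteriorPower.alternatingMapLinearEquiv_apply_ιMulti]
  rfl

lemma ext_induction {p : ℕ} {P : ⋀[A]^p N → Prop}
    (h0 : ∀ v, P (exteriorPower.ιMulti A p v)) (hadd : ∀ u w, P u → P w → P (u + w))
    (hsmul : ∀ (a : A) u, P u → P (a • u)) (hz : P 0) (u : ⋀[A]^p N) : P u := by
  have hu : u ∈ Submodule.span A (Set.range (exteriorPower.ιMulti A p (M := N))) := by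
    rw [exteriorPower.ιMulti_span]; trivial
  induction hu using Submodule.span_induction with
  | mem w hw => obtain ⟨v, rfl⟩ := hw; exact h0 v
  | zero => exact hz
  | add u w _ _ hu hw => exact hadd u w hu hw
  | smul a u _ hu => exact hsmul a u hu

lemma extTwisted_fst (C : Conn R A L N) (p : ℕ) (x : L) (u : ⋀[A]^p N) :
    (C.extTwisted p x u).1 = u := by
  induction u using ext_induction with
  | h0 v => rw [extTwisted_ιMulti]
  | hadd u w hu hw => rw [map_add]; exact congrArg₂ (· + ·) hu hw
  | hsmul a u hu => rw [map_smul]; exact congrArg (a • ·) hu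
  | hz => rw [map_zero]; rfl

/-- The action of `x` on `⋀^p N`. -/
def extAct (C : Conn R A L N) (p : ℕ) (x : L) (u : ⋀[A]^p N) : ⋀[A]^p N :=
  (C.extTwisted p x u).2

lemma extAct_ιMulti (C : Conn R A L N) (p : ℕ) (x : L) (v : Fin p → N) :
    C.extAct p x (exteriorPower.ιMulti A p v) =
      ∑ i, exteriorPower.ιMulti A p (Function.update v i (C.act x (v i))) := by
  rw [extAct, extTwisted_ιMulti, updSum]

lemma extAct_add (C : Conn R A L N) (p : ℕ) (x : L) (u w : ⋀[A]^p N) :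
    C.extAct p x (u + w) = C.extAct p x u + C.extAct p x w := by
  rw [extAct, map_add]; rfl

lemma extAct_smul (C : Conn R A L N) (p : ℕ) (x : L) (a : A) (u : ⋀[A]^p N) :
    C.extAct p x (a • u) = ⁅x, a⁆ • u + a • C.extAct p x u := by
  rw [extAct, map_smul, Twisted.smul_def]
  change a • (C.extTwisted p x u).2 + ⁅x, a⁆ • (C.extTwisted p x u).1 = _
  rw [extTwisted_fst, add_comm]
  rfl

lemma extAct_zero (C : Conn R A L N) (p : ℕ) (x : L) : C.extAct p x 0 = 0 := by
  rw [extAct, map_zero]; rfl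

/-- The connection on `⋀^p N` induced by a connection on `N`:
`x (v₁ ∧ … ∧ v_p) = ∑ i, v₁ ∧ … ∧ x vᵢ ∧ … ∧ v_p`. -/
def ext (C : Conn R A L N) (p : ℕ) : Conn R A L (⋀[A]^p N) where
  act :=
    { toFun := fun x =>
        { toFun := C.extAct p x
          map_add' := C.extAct_add p x
          map_smul' := fun r u => by
            rw [← algebraMap_smul A r u, extAct_smul, RingHom.id_apply,
              ← algebraMap_smul A r (C.extAct p x u),
              show ⁅x, algebraMap R A r⁆ = 0 from
                (LieRinehartAlgebra.anchor R A L x : Derivation R A A).map_algebraMap r,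
              zero_smul, zero_add] }
      map_add' := fun x y => by
        ext u : 1
        change C.extAct p (x + y) u = C.extAct p x u + C.extAct p y u
        induction u using ext_induction with
        | h0 v =>
          simp only [extAct_ιMulti, map_add, LinearMap.add_apply, AlternatingMap.map_update_add,
            Finset.sum_add_distrib]
        | hadd u w hu hw => simp only [extAct_add, hu, hw]; abel
        | hsmul a u hu => simp only [extAct_smul, hu, add_lie, add_smul, smul_add]; abel
        | hz => simp only [extAct_zero, add_zero]
      map_smul' := fun b x => by
        ext u : 1
        change C.extAct p (b • x) u = b • C.extAct p x u
        induction u using ext_induction with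
        | h0 v =>
          simp only [extAct_ιMulti, map_smul, LinearMap.smul_apply, AlternatingMap.map_update_smul,
            Finset.smul_sum]
        | hadd u w hu hw => simp only [extAct_add, hu, hw, smul_add]
        | hsmul a u hu =>
          simp only [extAct_smul, hu, LieRinehartRing.lie_smul_eq_mul, smul_add, mul_smul,
            smul_comm a b]
        | hz => simp only [extAct_zero, smul_zero] }
  leibniz x a u := C.extAct_smul p x a u

lemma ext_act_ιMulti (C : Conn R A L N) (p : ℕ) (x : L) (v : Fin p → N) :
    (C.ext p).act x (exteriorPower.ιMulti A p v) =
      ∑ i, exteriorPower.ιMulti A p (Function.update v i (C.act x (v i))) :=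
  C.extAct_ιMulti p x v

end Conn

/-! ## The Rinehart operator -/

section Rinehart

variable {R A L : Type*} [CommRing R] [CommRing A] [Algebra R A]
  [LieRing L] [LieAlgebra R L] [Module A L] [LieRingModule L A] [LieRinehartRing A L]
  [LieRinehartAlgebra R A L]
  {M : Type*} [AddCommGroup M] [Module A M] [Module R M] [IsScalarTower R A M]

namespace Conn

variable (C : Conn R A L M)

/-- The Cartan-Chevalley-Eilenberg sum, without the global sign:
`∑ k, (-1)^k (v_k (f (…, v̂_k, …)) + ∑ j < k, f (v₀, …, [v_j, v_k], …, v̂_k, …))`,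
with `[v_j, v_k]` in the place of `v_j`. Moving `[v_j, v_k]` to the front turns the second term into
the usual `∑ j < k, (-1)^(j+k) f ([v_j, v_k], …, v̂_j, …, v̂_k, …)`. -/
def ceSum {m : ℕ} (f : L [⋀^Fin m]→ₗ[A] M) (v : Fin (m + 1) → L) : M :=
  ∑ k : Fin (m + 1), (-1 : ℤ) ^ (k : ℕ) •
    (C.act (v k) (f (k.removeNth v)) +
      ∑ j : Fin (m + 1),
        if j < k then f (k.removeNth (Function.update v j ⁅v j, v k⁆)) else 0)

/-- The Lie derivative along `x`. -/
def lieDer {m : ℕ} (x : L) : (L [⋀^Fin m]→ₗ[A] M) →ₗ[R] (L [⋀^Fin m]→ₗ[A] M) :=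
  altDer x (LieAlgebra.ad R L x : L →ₗ[R] L) (C.act x)
    (fun a y => by simp [add_comm]) (C.leibniz x)

lemma lieDer_apply {m : ℕ} (x : L) (f : L [⋀^Fin m]→ₗ[A] M) (w : Fin m → L) :
    C.lieDer x f w = C.act x (f w) - ∑ i, f (Function.update w i ⁅x, w i⁆) := rfl

lemma sign_map_cons_removeNth {m : ℕ} (f : L [⋀^Fin (m + 1)]→ₗ[A] M) (y : L)
    (w : Fin (m + 1) → L) (l : Fin (m + 1)) :
    (-1 : ℤ) ^ (l : ℕ) • f (Matrix.vecCons y (l.removeNth w)) = f (Function.update w l y) := by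
  rw [← AlternatingMap.neg_one_pow_smul_map_insertNth f l y, smul_smul, ← pow_add,
    Even.neg_one_pow ⟨_, rfl⟩, one_smul, Fin.insertNth_removeNth]

lemma removeNth_succ_vecCons {m : ℕ} (x : L) (w : Fin (m + 1) → L) (l : Fin (m + 1)) :
    l.succ.removeNth (Matrix.vecCons x w) = Matrix.vecCons x (l.removeNth w) := by
  funext i
  refine Fin.cases ?_ (fun i => ?_) i
  · simp [Fin.removeNth]
  · simp [Fin.removeNth]

/-- Cartan's formula, as a recursion. -/
lemma ceSum_vecCons {m : ℕ} (f : L [⋀^Fin (m + 1)]→ₗ[A] M) (x : L) (w : Fin (m + 1) → L) :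
    C.ceSum f (Matrix.vecCons x w) = C.lieDer x f w - C.ceSum (f.curryLeft x) w := by
  have hu0 : ∀ y, Function.update (Matrix.vecCons x w) 0 y = Matrix.vecCons y w := fun y => by
    funext i; refine Fin.cases ?_ (fun i => ?_) i <;> simp
  have hus : ∀ (j : Fin (m + 1)) y, Function.update (Matrix.vecCons x w) j.succ y =
      Matrix.vecCons x (Function.update w j y) := fun j y => by
    funext i
    refine Fin.cases ?_ (fun i => ?_) i
    · rw [Function.update_of_ne (Fin.succ_ne_zero j).symm]; rfl
    · simp [Function.update_apply]
  have h0 : Fin.removeNth 0 (Matrix.vecCons x w) = w := by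
    funext i; simp [Fin.removeNth]
  rw [ceSum, Fin.sum_univ_succ, lieDer_apply, ceSum]
  simp only [Fin.sum_univ_succ (n := m + 1), Fin.not_lt_zero, if_false, Fin.succ_pos, if_true,
    Fin.succ_lt_succ_iff, Matrix.cons_val_succ, Matrix.cons_val_zero, hu0, hus,
    removeNth_succ_vecCons, h0, Finset.sum_const_zero, Fin.val_zero, pow_zero, one_smul, add_zero,
    AlternatingMap.curryLeft_apply_apply, Fin.val_succ, pow_succ, mul_neg, mul_one, neg_smul,
    smul_add, Finset.sum_add_distrib, Finset.sum_neg_distrib]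
  rw [Finset.sum_congr rfl fun l _ => sign_map_cons_removeNth f ⁅x, w l⁆ w l]
  abel

lemma ceSum_smul {m : ℕ} (a : A) (f : L [⋀^Fin m]→ₗ[A] M) (v : Fin (m + 1) → L) :
    C.ceSum (a • f) v = a • C.ceSum f v +
      ∑ k : Fin (m + 1), (-1 : ℤ) ^ (k : ℕ) • ⁅v k, a⁆ • f (k.removeNth v) := by
  simp only [ceSum, AlternatingMap.smul_apply, C.leibniz]
  rw [Finset.smul_sum, ← Finset.sum_add_distrib]
  refine Finset.sum_congr rfl fun k _ => ?_
  have hs : (∑ j : Fin (m + 1),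
        if j < k then a • f (k.removeNth (Function.update v j ⁅v j, v k⁆)) else 0) =
      a • ∑ j : Fin (m + 1),
        if j < k then f (k.removeNth (Function.update v j ⁅v j, v k⁆)) else 0 := by
    rw [Finset.smul_sum]
    exact Finset.sum_congr rfl fun j _ => by split_ifs <;> simp
  rw [hs, smul_comm a]
  simp only [smul_add]
  abel

lemma ceSum_add {m : ℕ} (f g : L [⋀^Fin m]→ₗ[A] M) (v : Fin (m + 1) → L) :
    C.ceSum (f + g) v = C.ceSum f v + C.ceSum g v := by
  simp only [ceSum, AlternatingMap.add_apply, map_add, ← Finset.sum_add_distrib]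
  refine Finset.sum_congr rfl fun k _ => ?_
  rw [← smul_add]
  congr 1
  have : ∀ j : Fin (m + 1), (if j < k then
      f (k.removeNth (Function.update v j ⁅v j, v k⁆)) +
        g (k.removeNth (Function.update v j ⁅v j, v k⁆)) else 0) =
      (if j < k then f (k.removeNth (Function.update v j ⁅v j, v k⁆)) else 0) +
      (if j < k then g (k.removeNth (Function.update v j ⁅v j, v k⁆)) else 0) := by
    intro j; split_ifs <;> simp
  simp only [this, Finset.sum_add_distrib]
  abel

lemma ceSum_smul_base {m : ℕ} (r : R) (f : L [⋀^Fin m]→ₗ[A] M) (v : Fin (m + 1) → L) :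
    C.ceSum (r • f) v = r • C.ceSum f v := by
  simp only [ceSum, AlternatingMap.smul_apply, map_smul]
  rw [Finset.smul_sum]
  refine Finset.sum_congr rfl fun k _ => ?_
  have hs : (∑ j : Fin (m + 1),
        if j < k then r • f (k.removeNth (Function.update v j ⁅v j, v k⁆)) else 0) =
      r • ∑ j : Fin (m + 1),
        if j < k then f (k.removeNth (Function.update v j ⁅v j, v k⁆)) else 0 := by
    rw [Finset.smul_sum]
    exact Finset.sum_congr rfl fun j _ => by split_ifs <;> simp
  rw [hs, ← smul_add, smul_comm r]

lemma ceSum_fin_zero (f : L [⋀^Fin 0]→ₗ[A] M) (v : Fin 1 → L) :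
    C.ceSum f v = C.act (v 0) (f ![]) := by
  simp only [ceSum, Fin.sum_univ_succ, Finset.univ_eq_empty, Finset.sum_empty, lt_irrefl,
    if_false, Fin.val_zero, pow_zero, one_smul, add_zero]
  exact congrArg (fun u => C.act (v 0) (f u)) (Subsingleton.elim _ _)

lemma ceSum_zero {m : ℕ} (v : Fin (m + 1) → L) :
    C.ceSum (0 : L [⋀^Fin m]→ₗ[A] M) v = 0 := by
  have h := C.ceSum_smul_base (0 : R) (0 : L [⋀^Fin m]→ₗ[A] M) v
  rwa [zero_smul, zero_smul] at h

lemma update_vecCons_succ {m : ℕ} (x : L) (w : Fin m → L) (j : Fin m) (y : L) :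
    Function.update (Matrix.vecCons x w) j.succ y =
      Matrix.vecCons x (Function.update w j y) := by
  funext i
  refine Fin.cases ?_ (fun i => ?_) i
  · rw [Function.update_of_ne (Fin.succ_ne_zero j).symm]; rfl
  · simp [Function.update_apply]

lemma lieDer_vecCons_same {m : ℕ} (f : L [⋀^Fin (m + 1)]→ₗ[A] M) (x : L) (w : Fin m → L) :
    C.lieDer x f (Matrix.vecCons x w) = C.ceSum (f.curryLeft x) (Matrix.vecCons x w) := by
  have h0 : f (Function.update (Matrix.vecCons x w) 0 0) = 0 :=
    f.map_coord_zero 0 (by simp)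
  rw [lieDer_apply, Fin.sum_univ_succ]
  simp only [Matrix.cons_val_zero, Matrix.cons_val_succ, lie_self, update_vecCons_succ, h0,
    zero_add]
  cases m with
  | zero =>
    rw [ceSum_fin_zero]
    simp only [Finset.univ_eq_empty, Finset.sum_empty, sub_zero]
    exact congrArg (fun u => C.act x (f (Matrix.vecCons x u))) (Subsingleton.elim _ _)
  | succ m =>
    rw [ceSum_vecCons, lieDer_apply, AlternatingMap.curryLeft_same, ceSum_zero, sub_zero]
    rfl

/-- An `A`-linear family of alternating maps vanishing on repeated first arguments uncurries to an
alternating map. -/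
lemma exists_uncurry {m : ℕ} (G : L →ₗ[A] (L [⋀^Fin (m + 1)]→ₗ[A] M))
    (hG : ∀ (x : L) (w : Fin m → L), G x (Matrix.vecCons x w) = 0) :
    ∃ g : L [⋀^Fin (m + 1 + 1)]→ₗ[A] M, ∀ x w, g (Matrix.vecCons x w) = G x w := by
  have key : ∀ (w : Fin (m + 1) → L) (j : Fin (m + 1)), G (w j) w = 0 := by
    intro w j
    have h := sign_map_cons_removeNth (G (w j)) (w j) w j
    rw [hG, smul_zero, Function.update_eq_self] at h
    exact h.symm
  refine ⟨{ LinearMap.uncurryLeft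
      (AlternatingMap.toMultilinearMapLM (S := A) ∘ₗ G) with
    map_eq_zero_of_eq' := ?_ }, fun x w => ?_⟩
  · intro v i j hv hij
    change G (v 0) (Fin.tail v) = 0
    induction i using Fin.cases with
    | zero =>
      induction j using Fin.cases with
      | zero => exact absurd rfl hij
      | succ j => rw [hv]; exact key (Fin.tail v) j
    | succ i =>
      induction j using Fin.cases with
      | zero => rw [← hv]; exact key (Fin.tail v) i
      | succ j => exact (G (v 0)).map_eq_zero_of_eq _ hv (fun h => hij (by rw [h]))
  · change G (Matrix.vecCons x w 0) (Fin.tail (Matrix.vecCons x w)) = _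
    rfl

lemma vecCons_head_tail {m : ℕ} (v : Fin (m + 1) → L) :
    Matrix.vecCons (v 0) (Fin.tail v) = v := Fin.cons_self_tail v

lemma exists_ceSum : ∀ (m : ℕ) (f : L [⋀^Fin m]→ₗ[A] M),
    ∃ g : L [⋀^Fin (m + 1)]→ₗ[A] M, ∀ v, g v = C.ceSum f v := by
  intro m
  induction m with
  | zero =>
    intro f
    refine ⟨AlternatingMap.ofSubsingleton A L M (0 : Fin 1)
      { toFun := fun x => C.act x (f ![])
        map_add' := fun x y => by rw [map_add]; rfl
        map_smul' := fun a x => by rw [map_smul]; rfl }, fun v => ?_⟩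
    rw [ceSum_fin_zero]
    rfl
  | succ m ih =>
    intro f
    choose D hD using ih
    let G : L →ₗ[A] (L [⋀^Fin (m + 1)]→ₗ[A] M) :=
      { toFun := fun x => C.lieDer x f - D (f.curryLeft x)
        map_add' := fun x y => by
          ext w
          simp only [AlternatingMap.sub_apply, AlternatingMap.add_apply, lieDer_apply, hD, map_add,
            ceSum_add, add_lie, AlternatingMap.map_update_add, Finset.sum_add_distrib,
            LinearMap.add_apply]
          abel
        map_smul' := fun a x => by
          ext w
          simp only [AlternatingMap.sub_apply, AlternatingMap.smul_apply, lieDer_apply, hD,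
            map_smul, ceSum_smul, RingHom.id_apply, LinearMap.smul_apply,
            AlternatingMap.curryLeft_apply_apply]
          have h1 : ∀ i, f (Function.update w i ⁅a • x, w i⁆) =
              a • f (Function.update w i ⁅x, w i⁆) -
                ⁅w i, a⁆ • f (Function.update w i x) := by
            intro i
            have : ⁅a • x, w i⁆ = a • ⁅x, w i⁆ - ⁅w i, a⁆ • x := by
              rw [← lie_skew, LieRinehartRing.leibniz_smul_right, ← lie_skew x (w i), smul_neg]
              abel
            rw [this, AlternatingMap.map_update_sub, AlternatingMap.map_update_smul,
              AlternatingMap.map_update_smul]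
          have h2 : ∀ i : Fin (m + 1), (-1 : ℤ) ^ (i : ℕ) • ⁅w i, a⁆ •
              f (Matrix.vecCons x (i.removeNth w)) = ⁅w i, a⁆ • f (Function.update w i x) := by
            intro i
            rw [smul_comm, sign_map_cons_removeNth]
          simp only [h1, h2, Finset.sum_sub_distrib, smul_sub, Finset.smul_sum]
          abel }
    have hG : ∀ x w, G x w = C.ceSum f (Matrix.vecCons x w) := fun x w => by
      rw [ceSum_vecCons]
      change C.lieDer x f w - D (f.curryLeft x) w = _
      rw [hD]
    obtain ⟨g, hg⟩ := exists_uncurry G (fun x w => by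
      change C.lieDer x f _ - D (f.curryLeft x) _ = 0
      rw [hD, lieDer_vecCons_same, sub_self])
    refine ⟨g, fun v => ?_⟩
    rw [← vecCons_head_tail v, hg, hG]

/-- The Rinehart operator `Alt_A^m(L, M) → Alt_A^(m+1)(L, M)` attached to a connection on `M`,
with the global sign `(-1)^(m+1)`:
`(df)(v₀, …, v_m) = (-1)^(m+1) ∑ k, (-1)^k v_k (f (…, v̂_k, …))`
`+ (-1)^(m+1) ∑ j < k, (-1)^(j+k) f ([v_j, v_k], …, v̂_j, …, v̂_k, …)`. -/
def rinehart (m : ℕ) : (L [⋀^Fin m]→ₗ[A] M) →ₗ[R] (L [⋀^Fin (m + 1)]→ₗ[A] M) where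
  toFun f :=
    { toFun := fun v => (-1 : ℤ) ^ (m + 1) • C.ceSum f v
      map_update_add' := by
        intro inst v i x y
        obtain ⟨g, hg⟩ := C.exists_ceSum m f
        rw [Subsingleton.elim inst (instDecidableEqFin _)]
        simp only [← hg, g.map_update_add, smul_add]
      map_update_smul' := by
        intro inst v i a x
        obtain ⟨g, hg⟩ := C.exists_ceSum m f
        rw [Subsingleton.elim inst (instDecidableEqFin _)]
        simp only [← hg, g.map_update_smul, smul_comm a]
      map_eq_zero_of_eq' := by
        intro v i j hv hij
        obtain ⟨g, hg⟩ := C.exists_ceSum m f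
        rw [← hg, g.map_eq_zero_of_eq _ hv hij, smul_zero] }
  map_add' f g := by
    ext v
    simp only [AlternatingMap.coe_mk, MultilinearMap.coe_mk, AlternatingMap.add_apply, ceSum_add,
      smul_add]
  map_smul' r f := by
    ext v
    simp only [AlternatingMap.coe_mk, MultilinearMap.coe_mk, AlternatingMap.smul_apply,
      ceSum_smul_base, RingHom.id_apply, smul_comm r]

lemma rinehart_apply (m : ℕ) (f : L [⋀^Fin m]→ₗ[A] M) (v : Fin (m + 1) → L) :
    C.rinehart m f v = (-1 : ℤ) ^ (m + 1) • ∑ k : Fin (m + 1), (-1 : ℤ) ^ (k : ℕ) •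
      (C.act (v k) (f (k.removeNth v)) +
        ∑ j : Fin (m + 1),
          if j < k then f (k.removeNth (Function.update v j ⁅v j, v k⁆)) else 0) := rfl

end Conn

end Rinehart

/-! ## Twilled Lie-Rinehart algebras -/

/-- The bracket `br` and the pairing `anc : L × A → A` turn the `A`-module `L` into an
`(R, A)`-Lie algebra, that is, `(A, L)` into a Lie-Rinehart algebra. -/
structure IsLieRinehart (R A L : Type*) [CommRing R] [CommRing A] [Algebra R A]
    [AddCommGroup L] [Module R L] [Module A L] (br : L → L → L) (anc : L → A → A) : Prop where
  br_add_left : ∀ x y z, br (x + y) z = br x z + br y z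
  br_add_right : ∀ x y z, br x (y + z) = br x y + br x z
  br_smul_left : ∀ (r : R) x y, br (r • x) y = r • br x y
  br_smul_right : ∀ (r : R) x y, br x (r • y) = r • br x y
  br_self : ∀ x, br x x = 0
  br_jacobi : ∀ x y z, br x (br y z) = br (br x y) z + br y (br x z)
  anc_add_left : ∀ x y a, anc (x + y) a = anc x a + anc y a
  anc_add_right : ∀ x a b, anc x (a + b) = anc x a + anc x b
  anc_smul_right : ∀ (r : R) x a, anc x (r • a) = r • anc x a
  anc_mul : ∀ x a b, anc x (a * b) = anc x a * b + a * anc x b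
  anc_br : ∀ x y a, anc (br x y) a = anc x (anc y a) - anc y (anc x a)
  anc_smul_left : ∀ (a : A) x b, anc (a • x) b = a * anc x b
  br_smul : ∀ x (a : A) y, br x (a • y) = anc x a • y + a • br x y

/-- An almost twilled Lie-Rinehart algebra `(A, L₁, L₂)`: Lie-Rinehart algebras `(A, L₁)` and
`(A, L₂)` together with an `(A, L₁)`-module structure on `L₂` and an `(A, L₂)`-module structure
on `L₁`. -/
structure AlmostTwilled (R A L₁ L₂ : Type*) [CommRing R] [CommRing A] [Algebra R A]
    [LieRing L₁] [LieAlgebra R L₁] [Module A L₁] [LieRingModule L₁ A] [LieRinehartRing A L₁]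
    [LieRinehartAlgebra R A L₁]
    [LieRing L₂] [LieAlgebra R L₂] [Module A L₂] [LieRingModule L₂ A] [LieRinehartRing A L₂]
    [LieRinehartAlgebra R A L₂] where
  /-- The action of `L₁` on `L₂`. -/
  act₁ : Conn R A L₁ L₂
  flat₁ : act₁.IsFlat
  /-- The action of `L₂` on `L₁`. -/
  act₂ : Conn R A L₂ L₁
  flat₂ : act₂.IsFlat

section Forms

variable (R A L₁ L₂ : Type*) [CommRing R] [CommRing A] [Algebra R A]
  [LieRing L₁] [LieAlgebra R L₁] [Module A L₁] [LieRingModule L₁ A] [LieRinehartRing A L₁]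
  [LieRinehartAlgebra R A L₁]
  [LieRing L₂] [LieAlgebra R L₂] [Module A L₂] [LieRingModule L₂ A] [LieRinehartRing A L₂]
  [LieRinehartAlgebra R A L₂]

/-- `Alt_A^q(L₂, Λ_A^p L₁)`, for `i = (q, p)`. -/
abbrev PolyForm (i : ℕ × ℕ) : Type _ := L₂ [⋀^Fin i.1]→ₗ[A] ⋀[A]^i.2 L₁

/-- `Alt_A^q(L₂, Alt_A^m(L₁, Λ_A^n L₁))`, for `i = (q, m)`. -/
abbrev DualForm (n : ℕ) (i : ℕ × ℕ) : Type _ :=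
  L₂ [⋀^Fin i.1]→ₗ[A] (L₁ [⋀^Fin i.2]→ₗ[A] ⋀[A]^n L₁)

/-- The bigraded object `Alt_A(L₂, Λ_A L₁)`. -/
abbrev PolyForms : Type _ := ⨁ i, PolyForm A L₁ L₂ i

/-- The bigraded object `Alt_A(L₂, Alt_A(L₁, Λ_A^n L₁))`. -/
abbrev DualForms (n : ℕ) : Type _ := ⨁ i, DualForm A L₁ L₂ n i

/-- The product `Λ^p × Λ^p' → Λ^(p+p')` of the exterior algebra. -/
def extMul (p p' : ℕ) : ⋀[A]^p L₁ →ₗ[A] ⋀[A]^p' L₁ →ₗ[A] ⋀[A]^(p + p') L₁ :=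
  LinearMap.mk₂ A (fun u w => ⟨u.1 * w.1, SetLike.mul_mem_graded u.2 w.2⟩)
    (fun u u' w => Subtype.ext (add_mul u.1 u'.1 w.1))
    (fun a u w => Subtype.ext (smul_mul_assoc a u.1 w.1))
    (fun u w w' => Subtype.ext (mul_add u.1 w.1 w'.1))
    (fun a u w => Subtype.ext (mul_smul_comm a u.1 w.1))

/-- The shuffle product of a `q`-form and a `q'`-form with respect to the pairing `b`. -/
def shuffle {A L₂ N₁ N₂ N₃ : Type*} [CommRing A] [AddCommGroup L₂] [Module A L₂]
    [AddCommGroup N₁] [Module A N₁] [AddCommGroup N₂] [Module A N₂] [AddCommGroup N₃] [Module A N₃]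
    (b : N₁ →ₗ[A] N₂ →ₗ[A] N₃) {q q' : ℕ} (f : L₂ [⋀^Fin q]→ₗ[A] N₁) (g : L₂ [⋀^Fin q']→ₗ[A] N₂) :
    L₂ [⋀^Fin (q + q')]→ₗ[A] N₃ :=
  ((TensorProduct.lift b).compAlternatingMap (f.domCoprod g)).domDomCongr finSumFinEquiv

section shuffle

variable {A L₂ N₁ N₂ N₃ : Type*} [CommRing A] [AddCommGroup L₂] [Module A L₂]
    [AddCommGroup N₁] [Module A N₁] [AddCommGroup N₂] [Module A N₂] [AddCommGroup N₃] [Module A N₃]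
    (b : N₁ →ₗ[A] N₂ →ₗ[A] N₃) {q q' : ℕ}

lemma shuffle_add_left (f f' : L₂ [⋀^Fin q]→ₗ[A] N₁) (g : L₂ [⋀^Fin q']→ₗ[A] N₂) :
    shuffle b (f + f') g = shuffle b f g + shuffle b f' g := by
  ext v
  simp only [shuffle, ← AlternatingMap.domCoprod'_apply, TensorProduct.add_tmul, map_add,
    AlternatingMap.domDomCongr_apply, LinearMap.compAlternatingMap_apply, AlternatingMap.add_apply]

lemma shuffle_add_right (f : L₂ [⋀^Fin q]→ₗ[A] N₁) (g g' : L₂ [⋀^Fin q']→ₗ[A] N₂) :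
    shuffle b f (g + g') = shuffle b f g + shuffle b f g' := by
  ext v
  simp only [shuffle, ← AlternatingMap.domCoprod'_apply, TensorProduct.tmul_add, map_add,
    AlternatingMap.domDomCongr_apply, LinearMap.compAlternatingMap_apply, AlternatingMap.add_apply]

lemma shuffle_smul_left (a : A) (f : L₂ [⋀^Fin q]→ₗ[A] N₁) (g : L₂ [⋀^Fin q']→ₗ[A] N₂) :
    shuffle b (a • f) g = a • shuffle b f g := by
  ext v
  simp only [shuffle, ← AlternatingMap.domCoprod'_apply, ← TensorProduct.smul_tmul', map_smul,
    AlternatingMap.domDomCongr_apply, LinearMap.compAlternatingMap_apply, AlternatingMap.smul_apply]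

lemma shuffle_smul_right (a : A) (f : L₂ [⋀^Fin q]→ₗ[A] N₁) (g : L₂ [⋀^Fin q']→ₗ[A] N₂) :
    shuffle b f (a • g) = a • shuffle b f g := by
  ext v
  simp only [shuffle, ← AlternatingMap.domCoprod'_apply, TensorProduct.tmul_smul, map_smul,
    AlternatingMap.domDomCongr_apply, LinearMap.compAlternatingMap_apply, AlternatingMap.smul_apply]

end shuffle

/-- The product of `f` of bidegree `(q, p)` and `g` of bidegree `(q', p')`: the shuffle product with
the Eilenberg-Koszul sign `(-1)^((q + p) q')`. -/
def formMul (i j : ℕ × ℕ) : PolyForm A L₁ L₂ i →ₗ[R] PolyForm A L₁ L₂ j →ₗ[R]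
    PolyForm A L₁ L₂ (i.1 + j.1, i.2 + j.2) :=
  LinearMap.mk₂ R (fun f g => (-1 : ℤ) ^ ((i.1 + i.2) * j.1) • shuffle (extMul A L₁ i.2 j.2) f g)
    (fun f f' g => by rw [shuffle_add_left, smul_add])
    (fun r f g => by
      rw [← algebraMap_smul A r f, shuffle_smul_left, algebraMap_smul, smul_comm])
    (fun f g g' => by rw [shuffle_add_right, smul_add])
    (fun r f g => by
      rw [← algebraMap_smul A r g, shuffle_smul_right, algebraMap_smul, smul_comm])

lemma formMul_apply (i j : ℕ × ℕ) (f : PolyForm A L₁ L₂ i) (g : PolyForm A L₁ L₂ j) :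
    formMul R A L₁ L₂ i j f g =
      (-1 : ℤ) ^ ((i.1 + i.2) * j.1) • shuffle (extMul A L₁ i.2 j.2) f g := rfl

/-- The product of the bigraded algebra `Alt_A(L₂, Λ_A L₁)`. -/
def formsMul : PolyForms A L₁ L₂ →ₗ[R] PolyForms A L₁ L₂ →ₗ[R] PolyForms A L₁ L₂ :=
  DirectSum.toModule R (ℕ × ℕ) _ fun i =>
    (DirectSum.toModule R (ℕ × ℕ) _ fun j =>
      (formMul R A L₁ L₂ i j).flip.compr₂
        (DirectSum.lof R (ℕ × ℕ) (PolyForm A L₁ L₂) (i.1 + j.1, i.2 + j.2))).flip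

lemma formsMul_hom (i j : ℕ × ℕ) (f : PolyForm A L₁ L₂ i) (g : PolyForm A L₁ L₂ j) :
    formsMul R A L₁ L₂ (hom R i f) (hom R j g) =
      hom R (i.1 + j.1, i.2 + j.2) (formMul R A L₁ L₂ i j f g) := by
  simp [formsMul, hom]

/-- `a ∈ Alt_A^q(L₂, A)` as an element of `Alt_A^q(L₂, Λ_A^0 L₁)`. -/
def ofForm (q : ℕ) (a : L₂ [⋀^Fin q]→ₗ[A] A) : PolyForm A L₁ L₂ (q, 0) :=
  (LinearMap.toSpanSingleton A (⋀[A]^0 L₁) (exteriorPower.ιMulti A 0 ![])).compAlternatingMap a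

/-- `x ∈ L₁` as an element of `Alt_A^0(L₂, Λ_A^1 L₁)`. -/
def ofVec (x : L₁) : PolyForm A L₁ L₂ (0, 1) :=
  AlternatingMap.constOfIsEmpty A L₂ (Fin 0) (exteriorPower.ιMulti A 1 ![x])

/-- The unit of `Alt_A(L₂, Λ_A L₁)`. -/
def formsOne : PolyForms A L₁ L₂ :=
  hom R (0, 0) (ofForm A L₁ L₂ 0 (AlternatingMap.constOfIsEmpty A L₂ (Fin 0) (1 : A)))

/-- `φ_u (y₁, …, y_m) = (y₁ ∧ … ∧ y_m) ∧ u`, for `u ∈ Λ^p` and `m + p = n`: the adjoint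
`Λ^p L₁ → Alt_A^m(L₁, Λ^n L₁)` of the exterior pairing. -/
def adjointPairing {n m p : ℕ} (h : m + p = n) :
    ⋀[A]^p L₁ →ₗ[A] (L₁ [⋀^Fin m]→ₗ[A] ⋀[A]^n L₁) where
  toFun u := (Submodule.inclusion (le_of_eq (by rw [h])) ∘ₗ
    (extMul A L₁ m p).flip u).compAlternatingMap (exteriorPower.ιMulti A m)
  map_add' u w := by
    ext v : 1
    simp
  map_smul' a u := by
    ext v : 1
    simp

/-- The map `Alt_A^q(L₂, Λ^p L₁) → Alt_A^q(L₂, Alt_A^(n-p)(L₁, Λ^n L₁))` induced by `φ` on the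
values, in all bidegrees `(q, p)` (for `p > n` it is zero). -/
def duality (n : ℕ) : PolyForms A L₁ L₂ →ₗ[A] DualForms A L₁ L₂ n :=
  DirectSum.toModule A (ℕ × ℕ) _ fun i =>
    if h : i.2 ≤ n then
      DirectSum.lof A (ℕ × ℕ) (DualForm A L₁ L₂ n) (i.1, n - i.2) ∘ₗ
        { toFun := fun f => (adjointPairing A L₁ (Nat.sub_add_cancel h)).compAlternatingMap f
          map_add' := fun f g => by ext v : 1; simp
          map_smul' := fun a f => by ext v : 1; simp }
    else 0

/-- Interchanging the arguments of a form on `L₂` whose values are forms on `L₁`. -/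
def swapForms {A L₁ L₂ M : Type*} [CommRing A] [AddCommGroup L₁] [Module A L₁]
    [AddCommGroup L₂] [Module A L₂] [AddCommGroup M] [Module A M] {q m : ℕ}
    (f : L₂ [⋀^Fin q]→ₗ[A] (L₁ [⋀^Fin m]→ₗ[A] M)) : L₁ [⋀^Fin m]→ₗ[A] (L₂ [⋀^Fin q]→ₗ[A] M) where
  toFun v :=
    { toFun := fun w => f w v
      map_update_add' := fun w i x y => by rw [f.map_update_add]; rfl
      map_update_smul' := fun w i a x => by rw [f.map_update_smul]; rfl
      map_eq_zero_of_eq' := fun w i j hw hij => by rw [f.map_eq_zero_of_eq w hw hij]; rfl }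
  map_update_add' v i x y := by
    ext w; exact (f w).map_update_add v i x y
  map_update_smul' v i a x := by
    ext w; exact (f w).map_update_smul v i a x
  map_eq_zero_of_eq' v i j hv hij := by
    ext w; exact (f w).map_eq_zero_of_eq v hv hij

end Forms

namespace AlmostTwilled

variable {R A L₁ L₂ : Type*} [CommRing R] [CommRing A] [Algebra R A]
  [LieRing L₁] [LieAlgebra R L₁] [Module A L₁] [LieRingModule L₁ A] [LieRinehartRing A L₁]
  [LieRinehartAlgebra R A L₁]
  [LieRing L₂] [LieAlgebra R L₂] [Module A L₂] [LieRingModule L₂ A] [LieRinehartRing A L₂]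
  [LieRinehartAlgebra R A L₂]
  (S : AlmostTwilled R A L₁ L₂)

/-- The bracket on `L₂ ⊕ L₁`. -/
def twBracket (u v : L₂ × L₁) : L₂ × L₁ :=
  (⁅u.1, v.1⁆ + S.act₁.act u.2 v.1 - S.act₁.act v.2 u.1,
   ⁅u.2, v.2⁆ + S.act₂.act u.1 v.2 - S.act₂.act v.1 u.2)

/-- `(A, L₁, L₂)` is a twilled Lie-Rinehart algebra: the sum `L₂ ⊕ L₁`, with the above bracket and
the sum of the actions on `A`, is an `(R, A)`-Lie algebra. -/
def IsTwilled : Prop :=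
  IsLieRinehart R A (L₂ × L₁) S.twBracket (fun u a => ⁅u.1, a⁆ + ⁅u.2, a⁆)

/-- The Lie-Rinehart differential `d''` on `Alt_A(L₂, Λ_A L₁)`, of bidegree `(1, 0)`, for the induced
`(A, L₂)`-module structure on `Λ_A L₁`. -/
def dPoly : PolyForms A L₁ L₂ →ₗ[R] PolyForms A L₁ L₂ :=
  DirectSum.toModule R (ℕ × ℕ) _ fun i =>
    DirectSum.lof R (ℕ × ℕ) (PolyForm A L₁ L₂) (i.1 + 1, i.2) ∘ₗ (S.act₂.ext i.2).rinehart i.1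

/-- The Lie-Rinehart differential `d''` on `Alt_A(L₂, Alt_A(L₁, Λ_A^n L₁))`, of bidegree `(1, 0)`, for
the induced `(A, L₂)`-module structure on `Alt_A(L₁, Λ_A^n L₁)`. -/
def dDual (n : ℕ) : DualForms A L₁ L₂ n →ₗ[R] DualForms A L₁ L₂ n :=
  DirectSum.toModule R (ℕ × ℕ) _ fun i =>
    DirectSum.lof R (ℕ × ℕ) (DualForm A L₁ L₂ n) (i.1 + 1, i.2) ∘ₗ
      (S.act₂.alt (S.act₂.ext n) i.2).rinehart i.1

/-- The component of the operator of covariant derivative on `Alt_A^q(L₂, Alt_A^m(L₁, M))`, for an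
`(A, L₁)`-connection on `M`: it is the Rinehart operator of the induced
`(A, L₁)`-connection on `Alt_A^q(L₂, M)`, transported along the graded interchange
isomorphism `Alt^q(L₂, Alt^m(L₁, M)) ≅ Alt^m(L₁, Alt^q(L₂, M))`, which carries the
sign `(-1)^(q m)`; this results in the sign `(-1)^q`. -/
def covDerAt {M : Type*} [AddCommGroup M] [Module A M] [Module R M] [IsScalarTower R A M]
    (C : Conn R A L₁ M) (q m : ℕ) :
    (L₂ [⋀^Fin q]→ₗ[A] (L₁ [⋀^Fin m]→ₗ[A] M)) →ₗ[R]
      (L₂ [⋀^Fin q]→ₗ[A] (L₁ [⋀^Fin (m + 1)]→ₗ[A] M)) where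
  toFun f := (-1 : ℤ) ^ q • swapForms ((S.act₁.alt C q).rinehart m (swapForms f))
  map_add' f g := by
    rw [← smul_add]
    congr 1
    exact congrArg swapForms (map_add ((S.act₁.alt C q).rinehart m) (swapForms f) (swapForms g))
  map_smul' r f := by
    rw [RingHom.id_apply, smul_comm]
    congr 1
    exact congrArg swapForms (map_smul ((S.act₁.alt C q).rinehart m) r (swapForms f))

/-- The operator of covariant derivative on `Alt_A(L₂, Alt_A(L₁, Λ_A^n L₁))`, of bidegree `(0, 1)`,
for an `(A, L₁)`-connection on `Λ_A^n L₁`. -/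
def covDer (n : ℕ) (C : Conn R A L₁ (⋀[A]^n L₁)) :
    DualForms A L₁ L₂ n →ₗ[R] DualForms A L₁ L₂ n :=
  DirectSum.toModule R (ℕ × ℕ) _ fun i =>
    DirectSum.lof R (ℕ × ℕ) (DualForm A L₁ L₂ n) (i.1, i.2 + 1) ∘ₗ S.covDerAt C i.1 i.2

/-- `B` is the bigraded crossed product Gerstenhaber bracket on `Alt_A(L₂, Λ_A L₁)`: the bigraded
Gerstenhaber bracket which extends the bracket of `L₁` and satisfies `[x, a] = x(a)` for `x ∈ L₁`
and `a ∈ Alt_A(L₂, A)`, where `L₁` acts on `Alt_A(L₂, A)` through its actions on `A` and `L₂`. -/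
structure IsCrossedBracket
    (B : PolyForms A L₁ L₂ →ₗ[R] PolyForms A L₁ L₂ →ₗ[R] PolyForms A L₁ L₂) : Prop where
  gerstenhaber : IsBigradedGerstenhaber (T := PolyForm A L₁ L₂) (formsOne R A L₁ L₂) (formsMul R A L₁ L₂) B
  vec_vec : ∀ x y : L₁, B (hom R (0, 1) (ofVec A L₁ L₂ x)) (hom R (0, 1) (ofVec A L₁ L₂ y)) =
    hom R (0, 1) (ofVec A L₁ L₂ ⁅x, y⁆)
  vec_form : ∀ (x : L₁) (q : ℕ) (a : L₂ [⋀^Fin q]→ₗ[A] A),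
    B (hom R (0, 1) (ofVec A L₁ L₂ x)) (hom R (q, 0) (ofForm A L₁ L₂ q a)) =
      hom R (q, 0) (ofForm A L₁ L₂ q ((S.act₁.alt (Conn.anchor R A L₁) q).act x a))

/-- The connection `∇` on `Λ_A^n L₁` is `L₂`-invariant: for `x ∈ L₁`, `ξ ∈ L₂` and `w ∈ Λ_A^n L₁`,
`ξ(∇_x w) - ∇_(ξ·x) w = ∇_x(ξ(w)) - (x·ξ)(w)`.
The left-hand side is the value at `x` of the `ξ`-derivative of `∇ w ∈ Hom_A(L₁, Λ_A^n L₁)`, the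
right-hand side is the value at `ξ` of the `x`-derivative of the form
`ξ ↦ ξ(w)` in `Hom_A(L₂, Λ_A^n L₁)`. -/
def IsInvariant (n : ℕ) (C : Conn R A L₁ (⋀[A]^n L₁)) : Prop :=
  ∀ (x : L₁) (ξ : L₂) (w : ⋀[A]^n L₁),
    (S.act₂.ext n).act ξ (C.act x w) - C.act (S.act₂.act ξ x) w =
      C.act x ((S.act₂.ext n).act ξ w) - (S.act₂.ext n).act (S.act₁.act x ξ) w

/-- The operator `Δ` corresponds to the connection `∇` under the duality. -/
def Corresponds (n : ℕ) (Δ : PolyForms A L₁ L₂ →ₗ[R] PolyForms A L₁ L₂)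
    (C : Conn R A L₁ (⋀[A]^n L₁)) : Prop :=
  ∀ x, duality A L₁ L₂ n (Δ x) = S.covDer n C (duality A L₁ L₂ n x)

end AlmostTwilled

end

end LieRinehartBV

open LieRinehartBV

namespace LieRinehartBV

noncomputable section

set_option linter.unusedSectionVars false

/-! ## Cosets of shuffles -/

section Cosets

open Equiv Equiv.Perm

variable {a b a' b' : Type*} [Fintype a] [Fintype b] [Fintype a'] [Fintype b']
  [DecidableEq a] [DecidableEq b] [DecidableEq a'] [DecidableEq b']

/-! Everything is transported through the duality Φ to forms with values in `Λ^n L₁`. There, left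
multiplication by a vector of `L₁` becomes insertion of that vector, up to sign, and Cartan calculus
is available.

Φ is bijective because exterior multiplication `Λ^m × Λ^p → Λ^n` with `m + p = n` is a perfect
pairing. Over a free module this is read off complementary basis monomials (`exists_basis_mul`). In
general it is checked at each maximal ideal, with a frame that is defined over `A` up to a factor
`s` outside the ideal (`exists_local_frame`). Φ commutes with `d''` because `L₂` acts on exterior
products by derivations (`adjointPairing_act`).

Given a connection, put `Δ = Φ⁻¹ ∂ Φ`. Cartan's formula for `∂` turns into `Δ(x w) = -x Δ(w) - ℓ_x
w`, where `ℓ_x` obeys Leibniz rules over vectors and forms that do not involve the connection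
(`isLieGenerator_connGenerator`). Since `L₁` is finitely generated projective, the algebra is
generated by the forms of bidegree `(q, 0)` and by the vectors (`isGeneratedBy_forms`), so
identities between derivations need checking on generators only. In this way the bracket generated
by `Δ` is seen to be a Gerstenhaber bracket; for Jacobi, the Jacobiator is a derivation whose
vanishing is symmetric in its arguments (`jacobi_of_generators`). On generators this bracket is the
crossed product bracket, and a bracket by derivations is determined there (`eq_of_generators`). As
`Λ^n L₁` admits a connection (`exists_conn`), the crossed product bracket exists; it is unique, and
every connection yields a generator of it.

Conversely, two generators of the same bracket differ by an odd derivation which vanishes on forms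
of bidegree `(q, 0)`. Such a derivation is determined by its values on `Λ^n L₁`: for `w` in the top
power `x w = 0`, so `D(x) w = 0` as soon as `D(w) = 0`, and the top power is faithful
(`derivation_eq_zero_of_top`). On the top power the difference is a tensor, and correcting a chosen
connection by this tensor gives the connection that belongs to a given generator
(`exists_corresponds`). Exactness of `Δ` means `∂∂ = 0`, which is flatness by Cartan calculus.

In the twilled case `d''` is a derivation of the bracket, again by a check on generators. For two
vectors this is a component of the Jacobi identity of `L₂ ⊕ L₁`; for a vector and a form it is an
induction on the degree of the form (`eq_zero_of_cartan`). Then `d''Δ + Δd''` is an even derivation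
vanishing on forms, so it too is determined on `Λ^n L₁`, where Φ turns it into the difference of the
two sides of the invariance equation (`exists_duality_commutator`).

The algebra structure itself is handled by contractions with `ξ ∈ L₂`: they are odd derivations and,
together with the part of form degree zero, separate points. Each identity thus reduces by induction
on the form degree to one in the exterior algebra (`IsContraction`). -/

lemma mem_range_sumCongrHom_iff (σ : Perm (a ⊕ b)) :
    σ ∈ (sumCongrHom a b).range ↔ ∀ x, (σ x).isLeft = x.isLeft := by
  constructor
  · rintro ⟨⟨s, t⟩, rfl⟩ x
    cases x <;> simp
  · intro h
    refine mem_sumCongrHom_range_of_perm_mapsTo_inl ?_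
    rintro _ ⟨x, rfl⟩
    obtain ⟨y, hy⟩ := Sum.isLeft_iff.1 ((h (Sum.inl x)).trans rfl)
    exact ⟨y, hy.symm⟩

/-- Whether the position `s` is filled from the left summand. -/
def fillLeft (s : a ⊕ b) (σ : ModSumCongr a b) : Bool :=
  Quotient.liftOn' σ (fun σ => (σ⁻¹ s).isLeft) fun σ τ h => by
    rw [QuotientGroup.leftRel_apply] at h
    have := (mem_range_sumCongrHom_iff _).1 h (τ⁻¹ s)
    simpa using this

lemma fillLeft_mk (s : a ⊕ b) (σ : Perm (a ⊕ b)) :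
    fillLeft s (Quotient.mk'' σ : ModSumCongr a b) = (σ⁻¹ s).isLeft := rfl

/-- Extension of a permutation by a fixed point. -/
def extPerm (e : Option (a' ⊕ b') ≃ a ⊕ b) (τ : Perm (a' ⊕ b')) : Perm (a ⊕ b) :=
  e.permCongr (optionCongr τ)

lemma extPerm_none (e : Option (a' ⊕ b') ≃ a ⊕ b) (τ : Perm (a' ⊕ b')) :
    extPerm e τ (e none) = e none := by simp [extPerm]

lemma extPerm_some (e : Option (a' ⊕ b') ≃ a ⊕ b) (τ : Perm (a' ⊕ b')) (x) :
    extPerm e τ (e (some x)) = e (some (τ x)) := by simp [extPerm]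

lemma sign_extPerm (e : Option (a' ⊕ b') ≃ a ⊕ b) (τ : Perm (a' ⊕ b')) :
    sign (extPerm e τ) = sign τ := by
  rw [extPerm, sign_permCongr, optionCongr_sign]

lemma extPerm_inv_mul (e : Option (a' ⊕ b') ≃ a ⊕ b) (σ τ : Perm (a' ⊕ b')) :
    (extPerm e σ)⁻¹ * extPerm e τ = extPerm e (σ⁻¹ * τ) := by
  rw [inv_mul_eq_iff_eq_mul]
  ext x
  obtain ⟨y, rfl⟩ := e.surjective x
  cases y <;> simp [extPerm_none, extPerm_some]

lemma extPerm_mem_iff (e : Option (a' ⊕ b') ≃ a ⊕ b)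
    (he : ∀ x, (e (some x)).isLeft = x.isLeft) (τ : Perm (a' ⊕ b')) :
    extPerm e τ ∈ (sumCongrHom a b).range ↔ τ ∈ (sumCongrHom a' b').range := by
  rw [mem_range_sumCongrHom_iff, mem_range_sumCongrHom_iff]
  constructor
  · intro h x
    have := h (e (some x))
    rwa [extPerm_some, he, he] at this
  · intro h x
    obtain ⟨y, rfl⟩ := e.surjective x
    cases y with
    | none => rw [extPerm_none]
    | some y => rw [extPerm_some, he, he, h]

lemma exists_extPerm (e : Option (a' ⊕ b') ≃ a ⊕ b) (σ : Perm (a ⊕ b)) (h : σ (e none) = e none) :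
    ∃ τ, extPerm e τ = σ := by
  refine ⟨removeNone (e.symm.permCongr σ), ?_⟩
  rw [extPerm, map_equiv_removeNone]
  have h0 : (e.symm.permCongr σ) none = none := by simp [h]
  rw [h0, swap_self]
  ext x
  simp

/-- Extending permutations by a fixed point induces a bijection from the shuffles of the smaller set
onto those shuffles of the larger one which fill the new position from its own side. Both sorts of
shuffles are cosets modulo permutations of the two summands, so injectivity and well-definedness are
the two directions of `extPerm_mem_iff`. -/
lemma sum_fillLeft_eq {M : Type*} [AddCommMonoid M] (e : Option (a' ⊕ b') ≃ a ⊕ b)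
    (he : ∀ x, (e (some x)).isLeft = x.isLeft) (F : ModSumCongr a b → M)
    (F' : ModSumCongr a' b' → M)
    (hF : ∀ τ : Perm (a' ⊕ b'), F' (Quotient.mk'' τ) = F (Quotient.mk'' (extPerm e τ))) :
    ∑ σ with fillLeft (e none) σ = (e none).isLeft, F σ = ∑ τ, F' τ := by
  symm
  have hwd : ∀ σ τ : Perm (a' ⊕ b'), (QuotientGroup.leftRel (sumCongrHom a' b').range) σ τ ↔
      (QuotientGroup.leftRel (sumCongrHom a b).range) (extPerm e σ) (extPerm e τ) := by
    intro σ τ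
    rw [QuotientGroup.leftRel_apply, QuotientGroup.leftRel_apply, extPerm_inv_mul,
      extPerm_mem_iff e he]
  refine Finset.sum_nbij (Quotient.map' (extPerm e) fun σ τ h => (hwd σ τ).1 h) ?_ ?_ ?_ ?_
  · intro τ _
    induction τ using Quotient.inductionOn' with
    | h τ =>
      rw [Finset.mem_filter]
      refine ⟨Finset.mem_univ _, ?_⟩
      rw [Quotient.map'_mk'', fillLeft_mk,
        show (extPerm e τ)⁻¹ (e none) = e none by rw [inv_eq_iff_eq, extPerm_none]]
  · intro σ _ τ _ h
    induction σ using Quotient.inductionOn' with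
    | h σ =>
    induction τ using Quotient.inductionOn' with
    | h τ =>
      rw [Quotient.map'_mk'', Quotient.map'_mk''] at h
      exact Quotient.sound' ((hwd σ τ).2 (Quotient.exact' h))
  · intro σ hσ
    induction σ using Quotient.inductionOn' with
    | h σ =>
      have hσ' : (σ⁻¹ (e none)).isLeft = (e none).isLeft := by
        simpa [fillLeft_mk] using hσ
      -- `σ⁻¹ (e none)` and `e none` lie in the same summand, so multiplying on the right by their
      -- transposition does not change the coset and gives a representative that fixes `e none`.
      obtain ⟨τ, hτ⟩ := exists_extPerm e (σ * swap (σ⁻¹ (e none)) (e none)) (by simp)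
      refine ⟨Quotient.mk'' τ, by simp, ?_⟩
      rw [Quotient.map'_mk'', hτ]
      refine Quotient.sound' ?_
      rw [QuotientGroup.leftRel_apply, mem_range_sumCongrHom_iff]
      intro x
      rw [mul_inv_rev, inv_mul_cancel_right, swap_inv]
      rcases eq_or_ne x (σ⁻¹ (e none)) with rfl | h1
      · rw [swap_apply_left, hσ']
      · rcases eq_or_ne x (e none) with rfl | h2
        · rw [swap_apply_right, hσ']
        · rw [swap_apply_of_ne_of_ne h1 h2]
  · intro τ _
    induction τ using Quotient.inductionOn' with
    | h τ => rw [hF, Quotient.map'_mk'']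

/-- `Option (Fin q ⊕ b) ≃ Fin (q + 1) ⊕ b`, the new element being `0` on the left. -/
def optLeft (q : ℕ) (b : Type*) : Option (Fin q ⊕ b) ≃ Fin (q + 1) ⊕ b where
  toFun := fun x => x.elim (Sum.inl 0) (Sum.map Fin.succ id)
  invFun := Sum.elim (Fin.cases none fun i => some (Sum.inl i)) fun j => some (Sum.inr j)
  left_inv x := by rcases x with _ | _ | _ <;> rfl
  right_inv x := by
    rcases x with i | j
    · refine Fin.cases ?_ (fun i => ?_) i <;> rfl
    · rfl

/-- `Option (a ⊕ Fin q) ≃ a ⊕ Fin (q + 1)`, the new element being `0` on the right. -/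
def optRight (a : Type*) (q : ℕ) : Option (a ⊕ Fin q) ≃ a ⊕ Fin (q + 1) where
  toFun := fun x => x.elim (Sum.inr 0) (Sum.map id Fin.succ)
  invFun := Sum.elim (fun j => some (Sum.inl j)) (Fin.cases none fun i => some (Sum.inr i))
  left_inv x := by rcases x with _ | _ | _ <;> rfl
  right_inv x := by
    rcases x with i | j
    · rfl
    · refine Fin.cases ?_ (fun i => ?_) j <;> rfl

end Cosets

/-! ## The shuffle product as a sum over cosets -/

section ShuffleSum

open Equiv Equiv.Perm

variable {A N N₁ N₂ N₃ : Type*} [CommRing A] [AddCommGroup N] [Module A N]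
    [AddCommGroup N₁] [Module A N₁] [AddCommGroup N₂] [Module A N₂] [AddCommGroup N₃] [Module A N₃]
    (b : N₁ →ₗ[A] N₂ →ₗ[A] N₃) {q q' : ℕ}

/-- The summand of the shuffle product belonging to a coset. -/
def shTerm (f : N [⋀^Fin q]→ₗ[A] N₁) (g : N [⋀^Fin q']→ₗ[A] N₂) (w : Fin q ⊕ Fin q' → N)
    (σ : ModSumCongr (Fin q) (Fin q')) : N₃ :=
  TensorProduct.lift b (AlternatingMap.domCoprod.summand f g σ w)

lemma shTerm_mk (f : N [⋀^Fin q]→ₗ[A] N₁) (g : N [⋀^Fin q']→ₗ[A] N₂) (w : Fin q ⊕ Fin q' → N)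
    (σ : Perm (Fin q ⊕ Fin q')) :
    shTerm b f g w (Quotient.mk'' σ) =
      sign σ • b (f fun i => w (σ (Sum.inl i))) (g fun i => w (σ (Sum.inr i))) := by
  change TensorProduct.lift b (sign σ • ((f fun i => w (σ (Sum.inl i))) ⊗ₜ[A]
    (g fun i => w (σ (Sum.inr i))))) = _
  rw [Units.smul_def, Units.smul_def, map_zsmul, TensorProduct.lift.tmul]

lemma shuffle_apply (f : N [⋀^Fin q]→ₗ[A] N₁) (g : N [⋀^Fin q']→ₗ[A] N₂) (v : Fin (q + q') → N) :
    shuffle b f g v = ∑ σ, shTerm b f g (fun s => v (finSumFinEquiv s)) σ := by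
  rw [shuffle, AlternatingMap.domDomCongr_apply, LinearMap.compAlternatingMap_apply,
    AlternatingMap.domCoprod_apply, sum_apply, map_sum]
  rfl

lemma shTerm_mul_left (f : N [⋀^Fin q]→ₗ[A] N₁) (g : N [⋀^Fin q']→ₗ[A] N₂) (w : Fin q ⊕ Fin q' → N)
    (c : Perm (Fin q ⊕ Fin q')) (σ : ModSumCongr (Fin q) (Fin q')) :
    shTerm b f g w (c • σ) = sign c • shTerm b f g (fun s => w (c s)) σ := by
  induction σ using Quotient.inductionOn' with
  | h σ =>
    rw [MulAction.Quotient.smul_mk, shTerm_mk, shTerm_mk, smul_smul]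
    simp

lemma sum_shTerm_left (f : N [⋀^Fin (q + 1)]→ₗ[A] N₁) (g : N [⋀^Fin q']→ₗ[A] N₂)
    (w : Fin (q + 1) ⊕ Fin q' → N) :
    ∑ σ with fillLeft (Sum.inl 0) σ = true, shTerm b f g w σ =
      ∑ τ, shTerm b (f.curryLeft (w (Sum.inl 0))) g (fun s => w (Sum.map Fin.succ id s)) τ := by
  refine sum_fillLeft_eq (optLeft q (Fin q')) (fun x => by rcases x with _ | _ <;> rfl) _ _
    fun τ => ?_
  rw [shTerm_mk, shTerm_mk, sign_extPerm, AlternatingMap.curryLeft_apply_apply]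
  have h1 : (Matrix.vecCons (w (Sum.inl 0)) fun i => w (Sum.map Fin.succ id (τ (Sum.inl i)))) =
      fun i => w (extPerm (optLeft q (Fin q')) τ (Sum.inl i)) := by
    funext i
    refine Fin.cases ?_ (fun i => ?_) i
    · exact congrArg w (extPerm_none (optLeft q (Fin q')) τ).symm
    · exact congrArg w (extPerm_some (optLeft q (Fin q')) τ (Sum.inl i)).symm
  have h2 : (fun i => w (Sum.map Fin.succ id (τ (Sum.inr i)))) =
      fun i => w (extPerm (optLeft q (Fin q')) τ (Sum.inr i)) := by
    funext i
    exact congrArg w (extPerm_some (optLeft q (Fin q')) τ (Sum.inr i)).symm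
  rw [h1, h2]

lemma sum_shTerm_right (f : N [⋀^Fin q]→ₗ[A] N₁) (g : N [⋀^Fin (q' + 1)]→ₗ[A] N₂)
    (w : Fin q ⊕ Fin (q' + 1) → N) :
    ∑ σ with fillLeft (Sum.inr 0) σ = false, shTerm b f g w σ =
      ∑ τ, shTerm b f (g.curryLeft (w (Sum.inr 0))) (fun s => w (Sum.map id Fin.succ s)) τ := by
  refine sum_fillLeft_eq (optRight (Fin q) q') (fun x => by rcases x with _ | _ <;> rfl) _ _
    fun τ => ?_
  rw [shTerm_mk, shTerm_mk, sign_extPerm, AlternatingMap.curryLeft_apply_apply]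
  have h1 : (Matrix.vecCons (w (Sum.inr 0)) fun i => w (Sum.map id Fin.succ (τ (Sum.inr i)))) =
      fun i => w (extPerm (optRight (Fin q) q') τ (Sum.inr i)) := by
    funext i
    refine Fin.cases ?_ (fun i => ?_) i
    · exact congrArg w (extPerm_none (optRight (Fin q) q') τ).symm
    · exact congrArg w (extPerm_some (optRight (Fin q) q') τ (Sum.inr i)).symm
  have h2 : (fun i => w (Sum.map id Fin.succ (τ (Sum.inl i)))) =
      fun i => w (extPerm (optRight (Fin q) q') τ (Sum.inl i)) := by
    funext i
    exact congrArg w (extPerm_some (optRight (Fin q) q') τ (Sum.inl i)).symm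
  rw [h1, h2]

lemma shuffle_eq_add (f : N [⋀^Fin (q + 1)]→ₗ[A] N₁) (g : N [⋀^Fin q']→ₗ[A] N₂)
    (v : Fin (q + 1 + q') → N) :
    shuffle b f g v =
      (∑ σ with fillLeft (Sum.inl 0) σ = true, shTerm b f g (fun s => v (finSumFinEquiv s)) σ) +
      ∑ σ with fillLeft (Sum.inl 0) σ = false, shTerm b f g (fun s => v (finSumFinEquiv s)) σ := by
  rw [shuffle_apply, ← Finset.sum_filter_add_sum_filter_not _ (fun σ => fillLeft (Sum.inl 0) σ = true)]
  simp only [Bool.not_eq_true]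

/-- The cyclic permutation moving the first element of the right summand to the front. -/
def frontPerm (q q' : ℕ) : Perm (Fin (q + 1) ⊕ Fin (q' + 1)) :=
  finSumFinEquiv.symm.permCongr (Fin.cycleRange (Fin.natAdd (q + 1) 0))

lemma sign_frontPerm (q q' : ℕ) : sign (frontPerm q q') = (-1) ^ (q + 1) := by
  rw [frontPerm, sign_permCongr, Fin.sign_cycleRange]
  simp

lemma frontPerm_inr_zero (q q' : ℕ) : frontPerm q q' (Sum.inr 0) = Sum.inl 0 := by
  rw [frontPerm, permCongr_apply, symm_symm, finSumFinEquiv_apply_right, Fin.cycleRange_self,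
    Equiv.symm_apply_eq, finSumFinEquiv_apply_left]
  rfl

/-- Apart from the position that is brought to the front, the cycle keeps the order of the
positions, so they are enumerated by `Fin.succ`. This identifies the remaining arguments after one
has been split off. -/
lemma finSumFinEquiv_frontPerm (q q' : ℕ) (s : Fin (q + 1) ⊕ Fin q') :
    finSumFinEquiv (frontPerm q q' (Sum.map id Fin.succ s)) = (finSumFinEquiv s).succ := by
  rw [frontPerm, permCongr_apply, symm_symm, Equiv.apply_symm_apply,
    ← Fin.cycleRange_succAbove (Fin.natAdd (q + 1) 0 : Fin (q + 1 + (q' + 1)))]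
  refine congrArg (Fin.cycleRange (Fin.natAdd (q + 1) 0)) ?_
  rcases s with i | j
  · simp only [Sum.map_inl, id, finSumFinEquiv_apply_left]
    rw [Fin.succAbove_of_castSucc_lt]
    · rfl
    · rw [Fin.lt_def]; simp; omega
  · simp only [Sum.map_inr, finSumFinEquiv_apply_right]
    rw [Fin.succAbove_of_le_castSucc]
    · rfl
    · rw [Fin.le_def]; simp

lemma fillLeft_smul (c : Perm (Fin q ⊕ Fin q')) (s : Fin q ⊕ Fin q')
    (σ : ModSumCongr (Fin q) (Fin q')) : fillLeft (c s) (c • σ) = fillLeft s σ := by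
  induction σ using Quotient.inductionOn' with
  | h σ => rw [MulAction.Quotient.smul_mk, fillLeft_mk, fillLeft_mk]; simp

/-- The shuffles are split according to which factor receives the first argument. When it goes to
`g`, a cycle of length `q + 2` first moves it past the `q + 1` slots of `f`, whence the sign. Thus
insertion of a first argument is an antiderivation of the shuffle product. -/
lemma shuffle_vecCons (f : N [⋀^Fin (q + 1)]→ₗ[A] N₁) (g : N [⋀^Fin (q' + 1)]→ₗ[A] N₂) (ξ : N)
    (v : Fin (q + 1 + q') → N) :
    shuffle b f g (Matrix.vecCons ξ v : Fin (q + 1 + q' + 1) → N) =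
      shuffle b (f.curryLeft ξ) g (fun i => v (Fin.cast (by omega) i)) +
        (-1 : ℤ) ^ (q + 1) • shuffle b f (g.curryLeft ξ) v := by
  rw [shuffle_eq_add]
  congr 1
  · rw [sum_shTerm_left, shuffle_apply]
    congr 1
    funext τ
    congr 1
    funext s
    rcases s with i | j
    · rfl
    · simp only [Sum.map_inr, id, finSumFinEquiv_apply_right]
      have : (Fin.natAdd (q + 1) j) =
          (Fin.cast (by omega) (Fin.natAdd q j) : Fin (q + 1 + q')).succ := by
        ext; simp; omega
      rw [this, Matrix.cons_val_succ]
  · have := Finset.sum_equiv (MulAction.toPerm (frontPerm q q'))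
      (s := {σ : ModSumCongr (Fin (q + 1)) (Fin (q' + 1)) | fillLeft (Sum.inr 0) σ = false})
      (t := {σ : ModSumCongr (Fin (q + 1)) (Fin (q' + 1)) | fillLeft (Sum.inl 0) σ = false})
      (f := fun σ => shTerm b f g (fun s => (Matrix.vecCons ξ v : Fin (q + 1 + q' + 1) → N)
        (finSumFinEquiv s)) (frontPerm q q' • σ))
      (g := fun σ => shTerm b f g (fun s => (Matrix.vecCons ξ v : Fin (q + 1 + q' + 1) → N)
        (finSumFinEquiv s)) σ)
      (fun σ => by
        rw [Finset.mem_filter, Finset.mem_filter, MulAction.toPerm_apply, ← frontPerm_inr_zero q q',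
          fillLeft_smul]
        simp)
      (fun σ _ => by rw [MulAction.toPerm_apply])
    rw [← this]
    simp only [shTerm_mul_left, sign_frontPerm]
    rw [← Finset.smul_sum, sum_shTerm_right, shuffle_apply]
    simp only [finSumFinEquiv_frontPerm, frontPerm_inr_zero]
    rw [Units.smul_def]
    push_cast
    rfl

lemma shuffle_vecCons_zero_right (f : N [⋀^Fin (q + 1)]→ₗ[A] N₁) (g : N [⋀^Fin 0]→ₗ[A] N₂) (ξ : N)
    (v : Fin q → N) :
    shuffle b f g (Matrix.vecCons ξ v : Fin (q + 1) → N) = shuffle b (f.curryLeft ξ) g v := by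
  have h : ∀ σ : ModSumCongr (Fin (q + 1)) (Fin 0), fillLeft (Sum.inl 0) σ = true := fun σ => by
    induction σ using Quotient.inductionOn' with
    | h σ =>
      rw [fillLeft_mk]
      rcases σ⁻¹ (Sum.inl 0) with i | i
      · rfl
      · exact i.elim0
  have h' := sum_shTerm_left b f g
    (fun s => (Matrix.vecCons ξ v : Fin (q + 1) → N) (finSumFinEquiv s))
  rw [Finset.filter_true_of_mem fun σ _ => h σ] at h'
  rw [shuffle_apply, h', shuffle_apply]
  congr 1
  funext τ
  congr 1
  funext s
  rcases s with i | i
  · rfl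
  · exact i.elim0

lemma shuffle_vecCons_zero_left (f : N [⋀^Fin 0]→ₗ[A] N₁) (g : N [⋀^Fin (q' + 1)]→ₗ[A] N₂) (ξ : N)
    (v : Fin (0 + q') → N) :
    shuffle b f g (Matrix.vecCons ξ v : Fin (0 + q' + 1) → N) = shuffle b f (g.curryLeft ξ) v := by
  have h : ∀ σ : ModSumCongr (Fin 0) (Fin (q' + 1)), fillLeft (Sum.inr 0) σ = false := fun σ => by
    induction σ using Quotient.inductionOn' with
    | h σ =>
      rw [fillLeft_mk]
      rcases σ⁻¹ (Sum.inr 0) with i | i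
      · exact i.elim0
      · rfl
  have h' := sum_shTerm_right b f g
    (fun s => (Matrix.vecCons ξ v : Fin (0 + q' + 1) → N) (finSumFinEquiv s))
  rw [Finset.filter_true_of_mem fun σ _ => h σ] at h'
  have h0 : (Fin.natAdd 0 0 : Fin (0 + (q' + 1))) = (0 : Fin (0 + q' + 1)) := by ext; simp
  rw [shuffle_apply, h', shuffle_apply, finSumFinEquiv_apply_right]
  refine Finset.sum_congr rfl fun τ _ => ?_
  rw [h0, Matrix.cons_val_zero]
  congr 1
  funext s
  rcases s with i | i
  · exact i.elim0
  · simp only [Sum.map_inr, finSumFinEquiv_apply_right]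
    rw [show (Fin.natAdd 0 i.succ : Fin (0 + (q' + 1))) = (Fin.natAdd 0 i : Fin (0 + q')).succ from
      Fin.ext (by simp), Matrix.cons_val_succ]

lemma shuffle_zero_zero (f : N [⋀^Fin 0]→ₗ[A] N₁) (g : N [⋀^Fin 0]→ₗ[A] N₂) (v : Fin 0 → N) :
    shuffle b f g v = b (f ![]) (g ![]) := by
  rw [shuffle_apply]
  refine (Finset.sum_eq_single (Quotient.mk'' 1) (fun σ _ hσ => ?_)
    fun h => absurd (Finset.mem_univ _) h).trans ?_
  · induction σ using Quotient.inductionOn' with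
    | h σ => exact absurd (congrArg Quotient.mk'' (Subsingleton.elim σ 1)) hσ
  rw [shTerm_mk]
  rw [Perm.sign_one, one_smul]
  have hf : (fun i => v (finSumFinEquiv ((1 : Perm (Fin 0 ⊕ Fin 0)) (Sum.inl i)))) = ![] :=
    Subsingleton.elim _ _
  have hg : (fun i => v (finSumFinEquiv ((1 : Perm (Fin 0 ⊕ Fin 0)) (Sum.inr i)))) = ![] :=
    Subsingleton.elim _ _
  rw [hf, hg]

lemma compAlternatingMap_shuffle {M₁ M₂ M₃ : Type*} [AddCommGroup M₁] [Module A M₁]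
    [AddCommGroup M₂] [Module A M₂] [AddCommGroup M₃] [Module A M₃] (b' : M₁ →ₗ[A] M₂ →ₗ[A] M₃)
    (c₁ : N₁ →ₗ[A] M₁) (c₂ : N₂ →ₗ[A] M₂) (c₃ : N₃ →ₗ[A] M₃)
    (h : ∀ u w, c₃ (b u w) = b' (c₁ u) (c₂ w))
    (f : N [⋀^Fin q]→ₗ[A] N₁) (g : N [⋀^Fin q']→ₗ[A] N₂) :
    c₃.compAlternatingMap (shuffle b f g) =
      shuffle b' (c₁.compAlternatingMap f) (c₂.compAlternatingMap g) := by
  ext v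
  rw [LinearMap.compAlternatingMap_apply, shuffle_apply, shuffle_apply, map_sum]
  refine Finset.sum_congr rfl fun σ _ => ?_
  induction σ using Quotient.inductionOn' with
  | h σ =>
    rw [shTerm_mk, shTerm_mk, Units.smul_def, Units.smul_def, map_zsmul, h]
    rfl

variable {R L : Type*} [CommRing R] [Algebra R A]
  [LieRing L] [LieAlgebra R L] [Module A L] [LieRingModule L A] [LieRinehartRing A L]
  [LieRinehartAlgebra R A L] [Module R N] [IsScalarTower R A N] [Module R N₁] [IsScalarTower R A N₁]
  [Module R N₂] [IsScalarTower R A N₂] [Module R N₃] [IsScalarTower R A N₃]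

/-- Holds coset by coset: a representative `σ` splits the arguments between `f` and `g`, and the
correction sum over all arguments splits along with them. It serves the derivations coming from `L₂`
and from `L₁` alike, hence the general coefficients. -/
lemma altDer_shuffle (x : L) (δ : N →ₗ[R] N) (δ₁ : N₁ →ₗ[R] N₁) (δ₂ : N₂ →ₗ[R] N₂)
    (δ₃ : N₃ →ₗ[R] N₃)
    (h : ∀ (a : A) n, δ (a • n) = ⁅x, a⁆ • n + a • δ n)
    (h₁ : ∀ (a : A) n, δ₁ (a • n) = ⁅x, a⁆ • n + a • δ₁ n)
    (h₂ : ∀ (a : A) n, δ₂ (a • n) = ⁅x, a⁆ • n + a • δ₂ n)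
    (h₃ : ∀ (a : A) n, δ₃ (a • n) = ⁅x, a⁆ • n + a • δ₃ n)
    (hb : ∀ u w, δ₃ (b u w) = b (δ₁ u) w + b u (δ₂ w))
    (f : N [⋀^Fin q]→ₗ[A] N₁) (g : N [⋀^Fin q']→ₗ[A] N₂) :
    Conn.altDer x δ δ₃ h h₃ (shuffle b f g) =
      shuffle b (Conn.altDer x δ δ₁ h h₁ f) g + shuffle b f (Conn.altDer x δ δ₂ h h₂ g) := by
  ext v
  rw [Conn.altDer_apply, AlternatingMap.add_apply]
  simp only [shuffle_apply]
  rw [Finset.sum_comm, map_sum, ← Finset.sum_sub_distrib, ← Finset.sum_add_distrib]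
  refine Finset.sum_congr rfl fun σ _ => ?_
  induction σ using Quotient.inductionOn' with
  | h σ =>
    simp only [shTerm_mk]
    rw [← Finset.smul_sum, Units.smul_def, Units.smul_def, Units.smul_def, Units.smul_def,
      map_zsmul, ← smul_sub, ← smul_add]
    congr 1
    rw [← Equiv.sum_comp (σ.trans finSumFinEquiv), Fintype.sum_sum_type]
    have hll : ∀ (k : Fin q) (y : N),
        (fun i => Function.update v (finSumFinEquiv (σ (Sum.inl k))) y
          (finSumFinEquiv (σ (Sum.inl i)))) =
          Function.update (fun i => v (finSumFinEquiv (σ (Sum.inl i)))) k y := fun k y => by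
      funext i; simp only [Function.update_apply, EmbeddingLike.apply_eq_iff_eq, Sum.inl.injEq]
    have hlr : ∀ (k : Fin q) (y : N),
        (fun i => Function.update v (finSumFinEquiv (σ (Sum.inl k))) y
          (finSumFinEquiv (σ (Sum.inr i)))) =
          fun i => v (finSumFinEquiv (σ (Sum.inr i))) := fun k y => by
      funext i; simp only [Function.update_apply, EmbeddingLike.apply_eq_iff_eq, reduceCtorEq,
        if_false]
    have hrl : ∀ (k : Fin q') (y : N),
        (fun i => Function.update v (finSumFinEquiv (σ (Sum.inr k))) y
          (finSumFinEquiv (σ (Sum.inl i)))) =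
          fun i => v (finSumFinEquiv (σ (Sum.inl i))) := fun k y => by
      funext i; simp only [Function.update_apply, EmbeddingLike.apply_eq_iff_eq, reduceCtorEq,
        if_false]
    have hrr : ∀ (k : Fin q') (y : N),
        (fun i => Function.update v (finSumFinEquiv (σ (Sum.inr k))) y
          (finSumFinEquiv (σ (Sum.inr i)))) =
          Function.update (fun i => v (finSumFinEquiv (σ (Sum.inr i)))) k y := fun k y => by
      funext i; simp only [Function.update_apply, EmbeddingLike.apply_eq_iff_eq, Sum.inr.injEq]
    simp only [Equiv.trans_apply, hll, hlr, hrl, hrr, hb, Conn.altDer_apply, map_sub, map_sum,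
      LinearMap.sub_apply, LinearMap.sum_apply]
    abel

end ShuffleSum

/-! ## Exterior powers -/

section Exterior

variable {A N : Type*} [CommRing A] [AddCommGroup N] [Module A N]

/-- Left exterior multiplication by a vector. -/
def wedge (p : ℕ) : N →ₗ[A] ⋀[A]^p N →ₗ[A] ⋀[A]^(p + 1) N :=
  LinearMap.mk₂ A (fun x u => ⟨ExteriorAlgebra.ι A x * u.1, by
      rw [ExteriorAlgebra.exteriorPower, pow_succ']
      exact Submodule.mul_mem_mul ⟨x, rfl⟩ u.2⟩)
    (fun x y u => Subtype.ext (by simp [add_mul]))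
    (fun a x u => Subtype.ext (by simp))
    (fun x u w => Subtype.ext (by simp [mul_add]))
    (fun a x u => Subtype.ext (by simp))

@[simp] lemma coe_wedge (p : ℕ) (x : N) (u : ⋀[A]^p N) :
    (wedge p x u : ExteriorAlgebra A N) = ExteriorAlgebra.ι A x * u := rfl

lemma vecCons_zero_tail {α : Type*} {m : ℕ} (v : Fin (m + 1) → α) :
    Matrix.vecCons (v 0) (Fin.tail v) = v := Fin.cons_self_tail v

lemma update_vecCons {α : Type*} {m : ℕ} (x : α) (w : Fin m → α) (j : Fin m) (y : α) :
    Function.update (Matrix.vecCons x w) j.succ y = Matrix.vecCons x (Function.update w j y) :=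
  (Fin.cons_update (α := fun _ => α) x w j y).symm

lemma update_vecCons_zero {α : Type*} {m : ℕ} (x : α) (w : Fin m → α) (y : α) :
    Function.update (Matrix.vecCons x w) 0 y = Matrix.vecCons y w :=
  Fin.update_cons_zero (α := fun _ => α) x w y

lemma exterior_mul_mem {p p' : ℕ} (u : ⋀[A]^p N) (w : ⋀[A]^p' N) :
    (u : ExteriorAlgebra A N) * w ∈ ⋀[A]^(p + p') N := SetLike.mul_mem_graded u.2 w.2

lemma ιMulti_vecCons (p : ℕ) (x : N) (v : Fin p → N) :
    exteriorPower.ιMulti A (p + 1) (Matrix.vecCons x v) = wedge p x (exteriorPower.ιMulti A p v) :=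
  Subtype.ext (by
    rw [exteriorPower.ιMulti_apply_coe, ExteriorAlgebra.ιMulti_succ_apply, coe_wedge,
      exteriorPower.ιMulti_apply_coe]
    simp)

lemma wedge_induction {p : ℕ} {P : ⋀[A]^(p + 1) N → Prop} (h : ∀ x u, P (wedge p x u))
    (hadd : ∀ u w, P u → P w → P (u + w)) (hz : P 0) (u : ⋀[A]^(p + 1) N) : P u := by
  -- `P` is not assumed to be stable under scalars. Quantifying over `a` makes the induction work,
  -- because a scalar can be absorbed into the second factor of a wedge.
  suffices H : ∀ a : A, P (a • u) by simpa using H 1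
  induction u using Conn.ext_induction with
  | h0 v =>
    intro a
    rw [← vecCons_zero_tail v, ιMulti_vecCons, ← LinearMap.smul_apply, ← map_smul]
    exact h _ _
  | hadd u w hu hw => intro a; rw [smul_add]; exact hadd _ _ (hu a) (hw a)
  | hsmul b u hu => intro a; rw [smul_smul]; exact hu _
  | hz => intro a; rw [smul_zero]; exact hz

lemma eq_smul_ιMulti_zero (u : ⋀[A]^0 N) : ∃ a : A, u = a • exteriorPower.ιMulti A 0 ![] := by
  refine ⟨exteriorPower.zeroEquiv A N u, (exteriorPower.zeroEquiv A N).injective ?_⟩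
  simp

lemma coe_ιMulti_zero (v : Fin 0 → N) :
    (exteriorPower.ιMulti A 0 v : ExteriorAlgebra A N) = 1 := by
  simp

lemma ι_mul_ι_swap (x y : N) :
    ExteriorAlgebra.ι A x * ExteriorAlgebra.ι A y =
      -(ExteriorAlgebra.ι A y * ExteriorAlgebra.ι A x) :=
  eq_neg_of_add_eq_zero_left (ExteriorAlgebra.ι_add_mul_swap x y)

lemma ι_mul_comm {p : ℕ} (x : N) (u : ⋀[A]^p N) :
    ExteriorAlgebra.ι A x * (u : ExteriorAlgebra A N) =
      (-1 : ℤ) ^ p • ((u : ExteriorAlgebra A N) * ExteriorAlgebra.ι A x) := by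
  induction p with
  | zero =>
    obtain ⟨a, rfl⟩ := eq_smul_ιMulti_zero u
    simp
  | succ p ih =>
    induction u using wedge_induction with
    | h y u =>
      rw [coe_wedge, ← mul_assoc, ι_mul_ι_swap, neg_mul, mul_assoc, ih, pow_succ, mul_smul_comm,
        mul_neg_one, neg_smul, mul_assoc]
    | hadd u w hu hw => simp only [Submodule.coe_add, mul_add, add_mul, hu, hw, smul_add]
    | hz => simp

lemma exterior_mul_comm {p p' : ℕ} (u : ⋀[A]^p N) (w : ⋀[A]^p' N) :
    (u : ExteriorAlgebra A N) * w = (-1 : ℤ) ^ (p * p') • ((w : ExteriorAlgebra A N) * u) := by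
  induction p with
  | zero =>
    obtain ⟨a, rfl⟩ := eq_smul_ιMulti_zero u
    simp
  | succ p ih =>
    induction u using wedge_induction with
    | h y u =>
      rw [coe_wedge, mul_assoc, ih, mul_smul_comm, ← mul_assoc, ι_mul_comm, smul_mul_assoc,
        smul_smul, mul_assoc, ← pow_add, Nat.succ_mul]
    | hadd u w hu hw => simp only [Submodule.coe_add, mul_add, add_mul, hu, hw, smul_add]
    | hz => simp

end Exterior

/-! ### The action on exterior powers as a derivation. -/

namespace Conn

variable {R A L : Type*} [CommRing R] [CommRing A] [Algebra R A]
  [LieRing L] [LieAlgebra R L] [Module A L] [LieRingModule L A] [LieRinehartRing A L]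
  [LieRinehartAlgebra R A L]
  {N : Type*} [AddCommGroup N] [Module A N] [Module R N] [IsScalarTower R A N]
  (C : Conn R A L N)

lemma ext_act_zero (x : L) (a : A) (v : Fin 0 → N) :
    (C.ext 0).act x (a • exteriorPower.ιMulti A 0 v) = ⁅x, a⁆ • exteriorPower.ιMulti A 0 v := by
  rw [(C.ext 0).leibniz, ext_act_ιMulti]
  simp

lemma ext_act_wedge (p : ℕ) (x : L) (y : N) (u : ⋀[A]^p N) :
    (C.ext (p + 1)).act x (wedge p y u) =
      wedge p (C.act x y) u + wedge p y ((C.ext p).act x u) := by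
  induction u using ext_induction with
  | h0 v =>
    rw [← ιMulti_vecCons, ext_act_ιMulti, Fin.sum_univ_succ, ext_act_ιMulti, ← ιMulti_vecCons,
      map_sum]
    congr 1
    · congr 1
      funext i
      refine Fin.cases ?_ (fun i => ?_) i <;> simp
    · refine Finset.sum_congr rfl fun i _ => ?_
      rw [update_vecCons, ιMulti_vecCons]
      rfl
  | hadd u w hu hw => simp only [map_add, hu, hw]; abel
  | hsmul a u hu => simp only [map_smul, (C.ext _).leibniz, hu, map_add, smul_add]; abel
  | hz => simp

/-- The Leibniz rule is stated for values in the exterior algebra and for an arbitrary `k` with `k =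
p + p'`. This lets the induction on `p` pass between `p + 1 + p'` and `p + p' + 1`, and later
between `n` and `m + p`, without transporting elements. -/
lemma coe_ext_act_of_coe_eq_mul {p p' k : ℕ} (hk : k = p + p') (x : L) (u : ⋀[A]^p N)
    (w : ⋀[A]^p' N) (z : ⋀[A]^k N) (hz : (z : ExteriorAlgebra A N) = u * w) :
    ((C.ext k).act x z : ExteriorAlgebra A N) =
      ((C.ext p).act x u : ExteriorAlgebra A N) * w + u * ((C.ext p').act x w) := by
  induction p generalizing k with
  | zero =>
    obtain rfl : k = p' := by omega
    obtain ⟨a, rfl⟩ := eq_smul_ιMulti_zero u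
    obtain rfl : z = a • w := Subtype.ext (by simp [hz])
    rw [ext_act_zero, (C.ext k).leibniz]
    simp
  | succ p ih =>
    obtain rfl : k = p + p' + 1 := by omega
    induction u using wedge_induction generalizing z with
    | h y u =>
      obtain rfl : z = wedge (p + p') y ⟨_, exterior_mul_mem u w⟩ :=
        Subtype.ext (by simp [hz, mul_assoc])
      rw [ext_act_wedge, ext_act_wedge]
      simp only [Submodule.coe_add, coe_wedge, ih rfl u ⟨_, exterior_mul_mem u w⟩ rfl,
        mul_add, add_mul, mul_assoc, add_assoc]
    | hadd u₁ u₂ h₁ h₂ =>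
      have hm : ∀ u : ⋀[A]^(p + 1) N, (u : ExteriorAlgebra A N) * w ∈ ⋀[A]^(p + p' + 1) N :=
        fun u => by
          have := exterior_mul_mem u w
          rwa [Nat.add_right_comm] at this
      have e₁ := h₁ ⟨_, hm u₁⟩ rfl
      have e₂ := h₂ ⟨_, hm u₂⟩ rfl
      obtain rfl : z = ⟨_, hm u₁⟩ + ⟨_, hm u₂⟩ := Subtype.ext (by simp [hz, add_mul])
      simp only [map_add, Submodule.coe_add, e₁, e₂, add_mul]
      abel
    | hz =>
      obtain rfl : z = 0 := Subtype.ext (by simp [hz])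
      simp

variable {C}

lemma IsFlat.ext (hC : C.IsFlat) (p : ℕ) : (C.ext p).IsFlat := by
  intro x y u
  induction p with
  | zero =>
    obtain ⟨a, rfl⟩ := eq_smul_ιMulti_zero u
    simp only [ext_act_zero, lie_lie x y a]
    exact sub_smul (⁅x, ⁅y, a⁆⁆ : A) ⁅y, ⁅x, a⁆⁆ (exteriorPower.ιMulti A 0 (![] : Fin 0 → N))
  | succ p ih =>
    induction u using wedge_induction with
    | h z u =>
      simp only [ext_act_wedge, map_add, ih, hC x y z, map_sub, LinearMap.sub_apply]
      abel
    | hadd u w hu hw => simp only [map_add, hu, hw]; abel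
    | hz => simp

end Conn

section ExtMul

variable {R A L L₁ : Type*} [CommRing R] [CommRing A] [Algebra R A]
  [LieRing L] [LieAlgebra R L] [Module A L] [LieRingModule L A] [LieRinehartRing A L]
  [LieRinehartAlgebra R A L]
  [LieRing L₁] [LieAlgebra R L₁] [Module A L₁] [IsScalarTower R A L₁]

@[simp] lemma coe_extMul (p p' : ℕ) (u : ⋀[A]^p L₁) (w : ⋀[A]^p' L₁) :
    (extMul A L₁ p p' u w : ExteriorAlgebra A L₁) = u * w := rfl

lemma Conn.ext_act_extMul (C : Conn R A L L₁) (p p' : ℕ) (x : L) (u : ⋀[A]^p L₁) (w : ⋀[A]^p' L₁) :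
    (C.ext (p + p')).act x (extMul A L₁ p p' u w) =
      extMul A L₁ p p' ((C.ext p).act x u) w + extMul A L₁ p p' u ((C.ext p').act x w) :=
  Subtype.ext (C.coe_ext_act_of_coe_eq_mul rfl x u w _ rfl)

end ExtMul

/-! ## Calculus of derivations of alternating maps -/

section Calculus

variable {R A L : Type*} [CommRing R] [CommRing A] [Algebra R A]
  [LieRing L] [LieAlgebra R L] [Module A L] [LieRingModule L A] [LieRinehartRing A L]
  [LieRinehartAlgebra R A L]
  {M M' N : Type*} [AddCommGroup M] [Module A M] [Module R M] [IsScalarTower R A M]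
  [AddCommGroup M'] [Module A M'] [Module R M'] [IsScalarTower R A M']
  [AddCommGroup N] [Module A N] [Module R N] [IsScalarTower R A N]

lemma eq_of_curryLeft_eq {m : ℕ} {f g : N [⋀^Fin (m + 1)]→ₗ[A] M}
    (h : ∀ y, f.curryLeft y = g.curryLeft y) : f = g := by
  ext v
  rw [← vecCons_zero_tail v]
  exact DFunLike.congr_fun (h (v 0)) (Fin.tail v)

lemma curryLeft_sub {m : ℕ} (f g : N [⋀^Fin (m + 1)]→ₗ[A] M) :
    (f - g).curryLeft = f.curryLeft - g.curryLeft := rfl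

namespace Conn

/-- The correction term at the first argument is set apart from the others. This commutation rule
drives all inductions on the degree of alternating maps. -/
lemma curryLeft_altDer {m : ℕ} (x : L) (δN : N →ₗ[R] N) (δM : M →ₗ[R] M)
    (hN : ∀ (a : A) n, δN (a • n) = ⁅x, a⁆ • n + a • δN n)
    (hM : ∀ (a : A) m, δM (a • m) = ⁅x, a⁆ • m + a • δM m) (f : N [⋀^Fin (m + 1)]→ₗ[A] M) (y : N) :
    (altDer x δN δM hN hM f).curryLeft y =
      altDer x δN δM hN hM (f.curryLeft y) - f.curryLeft (δN y) := by
  ext v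
  rw [AlternatingMap.curryLeft_apply_apply, altDer_apply, Fin.sum_univ_succ,
    AlternatingMap.sub_apply, altDer_apply]
  simp only [AlternatingMap.curryLeft_apply_apply, update_vecCons, update_vecCons_zero,
    Matrix.cons_val_succ, Matrix.cons_val_zero]
  abel

lemma altDer_commutator {m : ℕ} {x y z : L} (δN δN' δN'' : N →ₗ[R] N) (δM δM' δM'' : M →ₗ[R] M)
    (hN : ∀ (a : A) n, δN (a • n) = ⁅x, a⁆ • n + a • δN n)
    (hM : ∀ (a : A) m, δM (a • m) = ⁅x, a⁆ • m + a • δM m)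
    (hN' : ∀ (a : A) n, δN' (a • n) = ⁅y, a⁆ • n + a • δN' n)
    (hM' : ∀ (a : A) m, δM' (a • m) = ⁅y, a⁆ • m + a • δM' m)
    (hN'' : ∀ (a : A) n, δN'' (a • n) = ⁅z, a⁆ • n + a • δN'' n)
    (hM'' : ∀ (a : A) m, δM'' (a • m) = ⁅z, a⁆ • m + a • δM'' m)
    (cN : ∀ n, δN'' n = δN (δN' n) - δN' (δN n)) (cM : ∀ n, δM'' n = δM (δM' n) - δM' (δM n))
    (f : N [⋀^Fin m]→ₗ[A] M) :
    altDer z δN'' δM'' hN'' hM'' f =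
      altDer x δN δM hN hM (altDer y δN' δM' hN' hM' f) -
        altDer y δN' δM' hN' hM' (altDer x δN δM hN hM f) := by
  induction m with
  | zero => ext v; simp [altDer_apply, cM]
  | succ m ih =>
    refine eq_of_curryLeft_eq fun n => ?_
    rw [curryLeft_altDer, ih, curryLeft_sub, LinearMap.sub_apply]
    simp only [curryLeft_altDer, cN, map_sub]
    abel

lemma IsFlat.alt {CN : Conn R A L N} {CM : Conn R A L M} (hN : CN.IsFlat) (hM : CM.IsFlat)
    (q : ℕ) : (CN.alt CM q).IsFlat := fun x y f =>
  altDer_commutator (x := x) (y := y) (z := ⁅x, y⁆) (CN.act x) (CN.act y) (CN.act ⁅x, y⁆)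
    (CM.act x) (CM.act y) (CM.act ⁅x, y⁆) (CN.leibniz x) (CM.leibniz x) (CN.leibniz y)
    (CM.leibniz y) (CN.leibniz _) (CM.leibniz _) (hN x y) (hM x y) f

lemma compAlternatingMap_altDer {m : ℕ} (x : L) (δN : N →ₗ[R] N) (δM : M →ₗ[R] M)
    (δM' : M' →ₗ[R] M') (hN : ∀ (a : A) n, δN (a • n) = ⁅x, a⁆ • n + a • δN n)
    (hM : ∀ (a : A) m, δM (a • m) = ⁅x, a⁆ • m + a • δM m)
    (hM' : ∀ (a : A) m, δM' (a • m) = ⁅x, a⁆ • m + a • δM' m)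
    (c : M →ₗ[A] M') (hc : ∀ m, c (δM m) = δM' (c m)) (f : N [⋀^Fin m]→ₗ[A] M) :
    c.compAlternatingMap (altDer x δN δM hN hM f) =
      altDer x δN δM' hN hM' (c.compAlternatingMap f) := by
  ext v
  simp [altDer_apply, hc]

lemma map_ceSum {C : Conn R A L M} {C' : Conn R A L M'} (c : M →ₗ[A] M')
    (hc : ∀ x m, c (C.act x m) = C'.act x (c m)) {m : ℕ} (f : L [⋀^Fin m]→ₗ[A] M)
    (v : Fin (m + 1) → L) : c (C.ceSum f v) = C'.ceSum (c.compAlternatingMap f) v := by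
  rw [ceSum, ceSum, map_sum]
  refine Finset.sum_congr rfl fun k _ => ?_
  rw [map_zsmul, map_add, hc, map_sum]
  congr 2
  refine Finset.sum_congr rfl fun j _ => ?_
  split_ifs
  · rfl
  · exact map_zero c

lemma rinehart_eq_ceSum (C : Conn R A L M) {m : ℕ} (f : L [⋀^Fin m]→ₗ[A] M) (v : Fin (m + 1) → L) :
    C.rinehart m f v = (-1 : ℤ) ^ (m + 1) • C.ceSum f v := rfl

lemma compAlternatingMap_rinehart {C : Conn R A L M} {C' : Conn R A L M'} (c : M →ₗ[A] M')
    (hc : ∀ x m, c (C.act x m) = C'.act x (c m)) {m : ℕ} (f : L [⋀^Fin m]→ₗ[A] M) :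
    c.compAlternatingMap (C.rinehart m f) = C'.rinehart m (c.compAlternatingMap f) := by
  ext v
  rw [LinearMap.compAlternatingMap_apply, rinehart_eq_ceSum, rinehart_eq_ceSum, map_zsmul,
    map_ceSum c hc]

variable (C : Conn R A L M)

lemma curryLeft_lieDer {m : ℕ} (x y : L) (f : L [⋀^Fin (m + 1)]→ₗ[A] M) :
    (C.lieDer x f).curryLeft y = C.lieDer x (f.curryLeft y) - f.curryLeft ⁅x, y⁆ :=
  curryLeft_altDer _ _ _ _ _ _ _

lemma curryLeft_rinehart_zero (x : L) (f : L [⋀^Fin 0]→ₗ[A] M) :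
    (C.rinehart 0 f).curryLeft x = -C.lieDer x f := by
  ext v
  rw [AlternatingMap.curryLeft_apply_apply, rinehart_eq_ceSum, ceSum_fin_zero,
    AlternatingMap.neg_apply, lieDer_apply]
  simp [Subsingleton.elim v ![]]

/-- Cartan's formula from `ceSum_vecCons`, with the global signs `(-1)^(m+2)` and `(-1)^(m+1)` of
the two Rinehart operators taken into account. -/
lemma curryLeft_rinehart_succ {m : ℕ} (x : L) (f : L [⋀^Fin (m + 1)]→ₗ[A] M) :
    (C.rinehart (m + 1) f).curryLeft x =
      (-1 : ℤ) ^ m • C.lieDer x f + C.rinehart m (f.curryLeft x) := by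
  ext v
  rw [AlternatingMap.curryLeft_apply_apply, rinehart_eq_ceSum, ceSum_vecCons,
    AlternatingMap.add_apply, AlternatingMap.smul_apply, rinehart_eq_ceSum]
  simp only [pow_succ, mul_neg, mul_one, neg_neg, smul_add, smul_neg, neg_smul, sub_eq_add_neg]

variable {C}

lemma IsFlat.lieDer_lie (hC : C.IsFlat) {m : ℕ} (x y : L) (f : L [⋀^Fin m]→ₗ[A] M) :
    C.lieDer ⁅x, y⁆ f = C.lieDer x (C.lieDer y f) - C.lieDer y (C.lieDer x f) :=
  altDer_commutator _ _ _ _ _ _ _ _ _ _ _ _ (fun n => lie_lie x y n) (hC x y) f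

/-- Induction on the degree by inserting an argument `y`: Cartan's formula leaves a commutator of
Lie derivatives, and flatness identifies it with the Lie derivative along `⁅x, y⁆`. -/
lemma IsFlat.lieDer_rinehart (hC : C.IsFlat) {m : ℕ} (x : L) (f : L [⋀^Fin m]→ₗ[A] M) :
    C.lieDer x (C.rinehart m f) = C.rinehart m (C.lieDer x f) := by
  induction m with
  | zero =>
    refine eq_of_curryLeft_eq fun y => ?_
    rw [curryLeft_lieDer]
    simp only [curryLeft_rinehart_zero, hC.lieDer_lie, map_neg]
    abel
  | succ m ih =>
    refine eq_of_curryLeft_eq fun y => ?_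
    rw [curryLeft_lieDer]
    simp only [curryLeft_rinehart_succ, hC.lieDer_lie, map_add, map_zsmul, ih, curryLeft_lieDer,
      map_sub, smul_sub]
    abel

/-- After inserting an argument, the two mixed terms in the Lie derivative and `d` carry opposite
signs and cancel, since these operators commute; what remains is the same statement in lower degree.
-/
lemma IsFlat.rinehart_rinehart (hC : C.IsFlat) {m : ℕ} (f : L [⋀^Fin m]→ₗ[A] M) :
    C.rinehart (m + 1) (C.rinehart m f) = 0 := by
  induction m with
  | zero =>
    refine eq_of_curryLeft_eq fun y => ?_
    rw [curryLeft_rinehart_succ, curryLeft_rinehart_zero, hC.lieDer_rinehart, map_neg]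
    simp
  | succ m ih =>
    refine eq_of_curryLeft_eq fun y => ?_
    rw [curryLeft_rinehart_succ, curryLeft_rinehart_succ, hC.lieDer_rinehart, map_add, ih, pow_succ]
    simp

end Conn

end Calculus

/-! ## The duality for modules of constant rank -/

section LocalGlobal

variable {A M : Type*} [CommRing A] [AddCommGroup M] [Module A M]

/-- The scalars that carry `x` into `N` form an ideal, which is contained in no maximal ideal. -/
lemma mem_of_forall_maximal (N : Submodule A M) (x : M)
    (h : ∀ I : Ideal A, I.IsMaximal → ∃ s, s ∉ I ∧ s • x ∈ N) : x ∈ N := by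
  by_contra hx
  have hI : N.comap (LinearMap.toSpanSingleton A M x) ≠ (⊤ : Ideal A) := fun hI => hx (by
    have : (1 : A) ∈ N.comap (LinearMap.toSpanSingleton A M x) := by rw [hI]; trivial
    simpa using this)
  obtain ⟨I, hm, hle⟩ := Ideal.exists_le_maximal _ hI
  obtain ⟨s, hs, hsx⟩ := h I hm
  exact hs (hle (by simpa using hsx))

/-- The localization at `I` is free of rank `n`. By finite presentation, a basis isomorphism and its
inverse lift to maps over `A` once denominators are cleared, and they are mutually inverse up to
`s`. Keeping the frame over `A` makes it unnecessary to compare exterior powers or alternating maps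
with their localizations. -/
lemma exists_local_frame [Module.Finite A M] [Module.Projective A M] (n : ℕ)
    (hn : ∀ 𝔭 : PrimeSpectrum A, Module.rankAtStalk (R := A) M 𝔭 = n)
    (I : Ideal A) (hI : I.IsMaximal) :
    ∃ s, s ∉ I ∧ ∃ (θ : (Fin n →₀ A) →ₗ[A] M) (η : M →ₗ[A] (Fin n →₀ A)),
      (∀ y, θ (η y) = s • y) ∧ ∀ z, η (θ z) = s • z := by
  have hp : I.IsPrime := hI.isPrime
  have hfree : Module.Free (Localization.AtPrime I) (LocalizedModule I.primeCompl M) :=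
    Module.mem_freeLocus.1 (show (⟨I, hp⟩ : PrimeSpectrum A) ∈ Module.freeLocus A M by
      rw [Module.freeLocus_eq_univ]; trivial)
  have hfin : Module.Finite (Localization.AtPrime I) (LocalizedModule I.primeCompl M) :=
    Module.Finite.of_isLocalizedModule I.primeCompl (LocalizedModule.mkLinearMap I.primeCompl M)
  have hrank : Module.finrank (Localization.AtPrime I) (LocalizedModule I.primeCompl M) = n :=
    hn ⟨I, hp⟩
  let b := Module.finBasisOfFinrankEq (Localization.AtPrime I) (LocalizedModule I.primeCompl M) hrank
  let f : (Fin n →₀ A) →ₗ[A] (Fin n →₀ Localization.AtPrime I) :=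
    Finsupp.mapRange.linearMap (Algebra.linearMap A (Localization.AtPrime I))
  let g := LocalizedModule.mkLinearMap I.primeCompl M
  let e : LocalizedModule I.primeCompl M ≃ₗ[A] (Fin n →₀ Localization.AtPrime I) :=
    b.repr.restrictScalars A
  have : Module.FinitePresentation A M := Module.finitePresentation_of_projective A M
  have : Module.FinitePresentation A (Fin n →₀ A) := Module.finitePresentation_of_projective _ _
  obtain ⟨θ, s₁, h₁⟩ := Module.FinitePresentation.exists_lift_of_isLocalizedModule I.primeCompl g
    (e.symm.toLinearMap ∘ₗ f)
  obtain ⟨η, s₂, h₂⟩ := Module.FinitePresentation.exists_lift_of_isLocalizedModule I.primeCompl f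
    (e.toLinearMap ∘ₗ g)
  have h₁' : ∀ z, g (θ z) = s₁.1 • e.symm (f z) := fun z => LinearMap.congr_fun h₁ z
  have h₂' : ∀ y, f (η y) = s₂.1 • e (g y) := fun y => LinearMap.congr_fun h₂ y
  have H₁ : g.comp (θ ∘ₗ η) = g.comp ((s₁.1 * s₂.1) • LinearMap.id) := by
    ext y
    change g (θ (η y)) = g ((s₁.1 * s₂.1) • y)
    rw [h₁', h₂', map_smul, map_smul, LinearEquiv.symm_apply_apply, smul_smul]
  have H₂ : f.comp (η ∘ₗ θ) = f.comp ((s₁.1 * s₂.1) • LinearMap.id) := by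
    refine LinearMap.ext fun z => ?_
    change f (η (θ z)) = f ((s₁.1 * s₂.1) • z)
    rw [h₂', h₁', map_smul, map_smul, LinearEquiv.apply_symm_apply, smul_smul, mul_comm]
  -- The composites agree with multiplication by `s₁ s₂` only after localization; `t₁` and `t₂`
  -- repair this. Rescaling `θ` by both of them makes one and the same `s` serve for the two
  -- composites.
  obtain ⟨t₁, k₁⟩ := Module.Finite.exists_smul_of_comp_eq_of_isLocalizedModule I.primeCompl g _ _ H₁
  obtain ⟨t₂, k₂⟩ := Module.Finite.exists_smul_of_comp_eq_of_isLocalizedModule I.primeCompl f _ _ H₂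
  have k₁' : ∀ y, t₁.1 • θ (η y) = t₁.1 • (s₁.1 * s₂.1) • y := fun y => LinearMap.congr_fun k₁ y
  have k₂' : ∀ z, t₂.1 • η (θ z) = t₂.1 • (s₁.1 * s₂.1) • z := fun z => LinearMap.congr_fun k₂ z
  refine ⟨t₂ * t₁ * (s₁ * s₂), (t₂ * t₁ * (s₁ * s₂)).2, (t₂.1 * t₁.1) • θ, η, fun y => ?_,
    fun z => ?_⟩
  · change (t₂.1 * t₁.1) • θ (η y) = _
    rw [mul_smul, k₁', smul_smul, smul_smul]
  · rw [LinearMap.smul_apply, map_smul, mul_comm t₂.1, mul_smul, k₂', smul_smul, smul_smul]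

end LocalGlobal

/-! ### Linear maps on exterior powers. -/

section Map

variable {A M N : Type*} [CommRing A] [AddCommGroup M] [Module A M] [AddCommGroup N] [Module A N]

lemma coe_exteriorPower_map (p : ℕ) (θ : M →ₗ[A] N) (u : ⋀[A]^p M) :
    (exteriorPower.map p θ u : ExteriorAlgebra A N) = ExteriorAlgebra.map θ u := by
  induction u using Conn.ext_induction with
  | h0 v => simp [ExteriorAlgebra.map_apply_ιMulti]
  | hadd u w hu hw => simp [hu, hw]
  | hsmul a u hu => simp [hu]
  | hz => simp

lemma exteriorPower_map_map_of_smul (p : ℕ) (θ : M →ₗ[A] N) (η : N →ₗ[A] M) (s : A)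
    (h : ∀ y, θ (η y) = s • y) (u : ⋀[A]^p N) :
    exteriorPower.map p θ (exteriorPower.map p η u) = s ^ p • u := by
  induction u using Conn.ext_induction with
  | h0 v =>
    rw [exteriorPower.map_apply_ιMulti, exteriorPower.map_apply_ιMulti]
    have : (⇑θ ∘ ⇑η ∘ v) = fun i => s • v i := funext fun i => h (v i)
    rw [this, AlternatingMap.map_smul_univ]
    simp
  | hadd u w hu hw => simp [hu, hw]
  | hsmul a u hu => rw [map_smul, map_smul, hu, smul_comm]
  | hz => simp

end Map

/-! ### The exterior pairing over a free module. -/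

section Free

open Set Set.powersetCard

variable {A F : Type*} [CommRing A] [AddCommGroup F] [Module A F] {n m p : ℕ}
  (b : Module.Basis (Fin n) A F)

include b

lemma exteriorPower_eq_zero_of_lt (h : n < p) (u : ⋀[A]^p F) : u = 0 := by
  have : IsEmpty (powersetCard (Fin n) p) := ⟨fun s => by
    have h1 := s.2
    have h2 := Finset.card_le_univ s.1
    rw [Set.powersetCard.mem_iff] at h1
    simp at h2
    omega⟩
  apply (b.exteriorPower p).repr.injective
  exact Subsingleton.elim _ _

/-- A product of two basis monomials vanishes unless their index sets are disjoint. In complementary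
degrees only the complement of `s` contributes, and it gives the top monomial up to the sign of a
permutation. -/
lemma exists_basis_mul (h : m + p = n) (s : powersetCard (Fin n) m) :
    ∃ ε : ℤˣ, ∀ u : ⋀[A]^p F, b.ExteriorAlgebra s * (u : ExteriorAlgebra A F) =
      ε • (b.exteriorPower p).repr u ((powersetCard.compl (by simpa using h)).symm s) •
        b.ExteriorAlgebra Finset.univ := by
  have hm : m + p = Fintype.card (Fin n) := by simpa using h
  have hd : Disjoint s.val ((powersetCard.compl hm).symm s).val := disjoint_compl_right
  refine ⟨(permOfDisjoint hd).sign, fun u => ?_⟩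
  conv_lhs => rw [← (b.exteriorPower p).sum_repr u]
  rw [Submodule.coe_sum, Finset.mul_sum, Finset.sum_eq_single ((powersetCard.compl hm).symm s)]
  · rw [Submodule.coe_smul, mul_smul_comm, ← ExteriorAlgebra.basis_eq_coe_basis,
      ExteriorAlgebra.basis_mul_of_disjoint _ _ _ hd, smul_comm]
    congr 3
    ext i
    simp only [Set.powersetCard.coe_disjUnion, Finset.mem_disjUnion, Finset.mem_univ, iff_true]
    exact em _ |>.imp id fun h => Finset.mem_compl.2 h
  · intro t _ ht
    rw [Submodule.coe_smul, mul_smul_comm, ← ExteriorAlgebra.basis_eq_coe_basis,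
      ExteriorAlgebra.basis_mul_of_not_disjoint, smul_zero]
    intro hst
    refine ht ((Set.powersetCard.eq_iff_subset).2 fun i hi => ?_)
    exact Finset.mem_compl.2 fun hs => Finset.disjoint_left.1 hst hs hi
  · intro h
    exact absurd (Finset.mem_univ _) h

lemma basis_exteriorAlgebra_eq_ιMulti (s : powersetCard (Fin n) m) :
    b.ExteriorAlgebra s = (exteriorPower.ιMulti A m (b ∘ ofFinEmbEquiv.symm s) :
      ExteriorAlgebra A F) := by
  rw [ExteriorAlgebra.basis_eq_coe_basis, exteriorPower.basis_apply]
  rfl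

/-- Multiplication by the monomial of the complement of `t` reads off the coefficient of `u` at `t`,
up to sign. -/
lemma eq_zero_of_forall_mul_eq_zero (h : m + p = n) (u : ⋀[A]^p F)
    (hu : ∀ v : Fin m → F, (exteriorPower.ιMulti A m v : ExteriorAlgebra A F) * u = 0) : u = 0 := by
  apply (b.exteriorPower p).repr.injective
  ext t
  have hm : m + p = Fintype.card (Fin n) := by simpa using h
  obtain ⟨ε, hε⟩ := exists_basis_mul b h (powersetCard.compl hm t)
  have h1 := hε u
  rw [Equiv.symm_apply_apply, basis_exteriorAlgebra_eq_ιMulti, hu] at h1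
  have h2 := congrArg (fun x => b.ExteriorAlgebra.repr (ε⁻¹ • x) Finset.univ) h1
  simp only [smul_zero, inv_smul_smul] at h2
  simpa using h2.symm

lemma exists_eq_mul (h : m + p = n) (f : F [⋀^Fin m]→ₗ[A] ⋀[A]^n F) :
    ∃ u : ⋀[A]^p F, ∀ v, (f v : ExteriorAlgebra A F) = exteriorPower.ιMulti A m v * u := by
  have hm : m + p = Fintype.card (Fin n) := by simpa using h
  choose ε hε using fun s => exists_basis_mul b h s
  -- The degree `n` part is spanned by the top monomial: this is the pairing in the case `m = 0`,
  -- with the empty monomial.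
  have htop : ∀ w : ⋀[A]^n F, ∃ c : A, (w : ExteriorAlgebra A F) =
      c • b.ExteriorAlgebra Finset.univ := fun w => by
    obtain ⟨ε, hε⟩ := exists_basis_mul (m := 0) b (zero_add n) ⟨∅, by simp⟩
    have h1 := hε w
    rw [basis_exteriorAlgebra_eq_ιMulti, coe_ιMulti_zero, one_mul] at h1
    rcases Int.units_eq_one_or ε with rfl | rfl
    · exact ⟨_, by rw [h1, one_smul]⟩
    · exact ⟨-_, by rw [h1, neg_smul, Units.neg_smul, one_smul]⟩
  let e := (b.exteriorPower m)
  let F' : ⋀[A]^m F →ₗ[A] ⋀[A]^n F := exteriorPower.alternatingMapLinearEquiv f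
  choose c hc using fun s : powersetCard (Fin n) m => htop (F' (e s))
  -- The coefficient at `t` is the value of `f` on the complementary monomial, as a multiple of the
  -- top monomial, with the sign of `exists_basis_mul`; that sign is its own inverse.
  let u : ⋀[A]^p F := (b.exteriorPower p).repr.symm
    (Finsupp.equivFunOnFinite.symm fun t => ((ε (powersetCard.compl hm t) : ℤ) : A) * c (powersetCard.compl hm t))
  have key : (⋀[A]^n F).subtype ∘ₗ F' =
      (LinearMap.mulRight A (u : ExteriorAlgebra A F)) ∘ₗ (⋀[A]^m F).subtype := by
    refine e.ext fun s => ?_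
    change (F' (e s) : ExteriorAlgebra A F) = (e s : ExteriorAlgebra A F) * u
    rw [hc, ← ExteriorAlgebra.basis_eq_coe_basis, hε]
    simp only [u, LinearEquiv.apply_symm_apply, Finsupp.equivFunOnFinite_symm_apply_apply,
      Equiv.apply_symm_apply]
    rcases Int.units_eq_one_or (ε s) with h | h <;> rw [h] <;> simp
  refine ⟨u, fun v => ?_⟩
  have := LinearMap.congr_fun key (exteriorPower.ιMulti A m v)
  simpa [F'] using this

end Free

/-! ### The exterior pairing over a projective module of constant rank. -/

section Dual

variable {A L₁ : Type*} [CommRing A] [LieRing L₁] [Module A L₁] {n m p : ℕ}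

@[simp] lemma coe_adjointPairing (h : m + p = n) (u : ⋀[A]^p L₁) (v : Fin m → L₁) :
    (adjointPairing A L₁ h u v : ExteriorAlgebra A L₁) =
      exteriorPower.ιMulti A m v * u := by
  subst h
  rfl

variable [Module.Finite A L₁] [Module.Projective A L₁]
  (hn : ∀ 𝔭 : PrimeSpectrum A, Module.rankAtStalk (R := A) L₁ 𝔭 = n)

include hn

lemma exteriorPower_eq_zero_of_rank_lt (h : n < p) (u : ⋀[A]^p L₁) : u = 0 := by
  refine (Submodule.mem_bot A).1 (mem_of_forall_maximal _ u fun I hI => ?_)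
  obtain ⟨s, hs, θ, η, h₁, -⟩ := exists_local_frame n hn I hI
  refine ⟨s ^ p, fun h => hs (hI.isPrime.mem_of_pow_mem _ h), ?_⟩
  rw [Submodule.mem_bot, ← exteriorPower_map_map_of_smul p θ η s h₁,
    exteriorPower_eq_zero_of_lt Finsupp.basisSingleOne h (exteriorPower.map p η u), map_zero]

/-- If `u` pairs to zero, then `s^m` times its image in the free module pairs to zero with all
monomials, because `s^m z₁ ∧ … ∧ z_m` comes from `L₁` through `η`. So this multiple is zero, and
going back through `θ` costs a further factor `s^p`. -/
lemma adjointPairing_injective (h : m + p = n) :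
    Function.Injective (adjointPairing A L₁ h) := by
  refine (injective_iff_map_eq_zero _).2 fun u hu => ?_
  refine (Submodule.mem_bot A).1 (mem_of_forall_maximal _ u fun I hI => ?_)
  obtain ⟨s, hs, θ, η, h₁, h₂⟩ := exists_local_frame n hn I hI
  refine ⟨s ^ p * s ^ m, fun h => hs ?_, ?_⟩
  · rw [← pow_add] at h
    exact hI.isPrime.mem_of_pow_mem _ h
  have h0 : s ^ m • exteriorPower.map p η u = 0 := by
    refine eq_zero_of_forall_mul_eq_zero Finsupp.basisSingleOne h _ fun z => ?_
    have e₁ : s ^ m • (exteriorPower.ιMulti A m z : ExteriorAlgebra A (Fin n →₀ A)) =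
        ExteriorAlgebra.map η (exteriorPower.ιMulti A m (θ ∘ z)) := by
      rw [← Submodule.coe_smul, ← exteriorPower_map_map_of_smul m η θ s h₂,
        coe_exteriorPower_map, exteriorPower.map_apply_ιMulti]
    rw [Submodule.coe_smul, mul_smul_comm, ← smul_mul_assoc, e₁, coe_exteriorPower_map, ← map_mul,
      ← coe_adjointPairing h, hu]
    simp
  rw [Submodule.mem_bot, mul_comm, mul_smul, ← exteriorPower_map_map_of_smul p θ η s h₁,
    ← map_smul, h0, map_zero]

lemma adjointPairing_surjective (h : m + p = n) :
    Function.Surjective (adjointPairing A L₁ h) := by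
  intro f
  refine mem_of_forall_maximal (LinearMap.range (adjointPairing A L₁ h)) f fun I hI => ?_
  obtain ⟨s, hs, θ, η, h₁, h₂⟩ := exists_local_frame n hn I hI
  refine ⟨s ^ n * s ^ m, fun h => hs ?_, ?_⟩
  · rw [← pow_add] at h
    exact hI.isPrime.mem_of_pow_mem _ h
  obtain ⟨w, hw⟩ := exists_eq_mul Finsupp.basisSingleOne h
    ((exteriorPower.map n η).compAlternatingMap (f.compLinearMap θ))
  -- `w` represents `f` in the frame. The factor `s^m` lets `y₁ ∧ … ∧ y_m` be written as an image
  -- under `θ`. In the target multiple `s^n s^m` of `f`, the power `s^n` comes from the values in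
  -- `Λ^n` and `s^m` from the arguments `θ (η (y i))`.
  refine ⟨s ^ m • exteriorPower.map p θ w, ?_⟩
  ext y : 1
  refine Subtype.ext ?_
  have e₁ : s ^ m • (exteriorPower.ιMulti A m y : ExteriorAlgebra A L₁) =
      ExteriorAlgebra.map θ (exteriorPower.ιMulti A m (η ∘ y)) := by
    rw [← Submodule.coe_smul, ← exteriorPower_map_map_of_smul m θ η s h₁,
      coe_exteriorPower_map, exteriorPower.map_apply_ιMulti]
  have e₂ : f (fun i => θ (η (y i))) = s ^ m • f y := by
    simp only [h₁]
    rw [f.map_smul_univ]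
    simp
  rw [map_smul, AlternatingMap.smul_apply, Submodule.coe_smul, coe_adjointPairing, ← smul_mul_assoc,
    e₁, coe_exteriorPower_map, ← map_mul, ← hw, LinearMap.compAlternatingMap_apply,
    ← coe_exteriorPower_map, exteriorPower_map_map_of_smul n θ η s h₁]
  change ((s ^ n • f (fun i => θ (η (y i))) : ⋀[A]^n L₁) : ExteriorAlgebra A L₁) = _
  rw [e₂, smul_smul]
  rfl

lemma adjointPairing_bijective (h : m + p = n) : Function.Bijective (adjointPairing A L₁ h) :=
  ⟨adjointPairing_injective hn h, adjointPairing_surjective hn h⟩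

end Dual

/-! ## Contractions and the algebra of forms -/

section Hom

variable {R : Type*} [CommRing R]
  {T : ℕ × ℕ → Type*} [∀ i, AddCommGroup (T i)] [∀ i, Module R (T i)]

lemma hom_induction {P : (⨁ i, T i) → Prop} (hz : P 0) (hh : ∀ i f, P (hom R i f))
    (ha : ∀ a b, P a → P b → P (a + b)) (a : ⨁ i, T i) : P a :=
  DirectSum.induction_on a hz (fun i f => hh i f) ha

lemma linearMap_eq_of_hom {M : Type*} [AddCommGroup M] [Module R M] {φ ψ : (⨁ i, T i) →ₗ[R] M}
    (h : ∀ i f, φ (hom R i f) = ψ (hom R i f)) : φ = ψ :=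
  DirectSum.linearMap_ext R fun i => LinearMap.ext fun f => h i f

lemma hom_add (i : ℕ × ℕ) (f g : T i) : hom R i (f + g) = hom R i f + hom R i g := map_add _ f g

lemma hom_smul (i : ℕ × ℕ) (r : R) (f : T i) : hom R i (r • f) = r • hom R i f := map_smul _ r f

lemma hom_zsmul (i : ℕ × ℕ) (r : ℤ) (f : T i) : hom R i (r • f) = r • hom R i f := map_zsmul _ r f

lemma hom_zero (i : ℕ × ℕ) : hom R i (0 : T i) = 0 := map_zero _

lemma hom_apply_same (i : ℕ × ℕ) (f : T i) : hom R i f i = f := DirectSum.lof_apply R i f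

lemma hom_apply_ne {i j : ℕ × ℕ} (h : j ≠ i) (f : T i) : hom R i f j = 0 :=
  DirectSum.of_eq_of_ne i j f h

end Hom

section FormInstances

variable (R A L₁ L₂ : Type*) [CommRing R] [CommRing A] [Algebra R A]
  [LieRing L₁] [LieAlgebra R L₁] [Module A L₁] [LieRingModule L₁ A] [LieRinehartRing A L₁]
  [LieRinehartAlgebra R A L₁]
  [LieRing L₂] [LieAlgebra R L₂] [Module A L₂] [LieRingModule L₂ A] [LieRinehartRing A L₂]
  [LieRinehartAlgebra R A L₂] (n : ℕ) (i : ℕ × ℕ)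

/-! Shortcuts for instance search. -/

abbrev polyFormsModule : Module R (PolyForms A L₁ L₂) := inferInstance

abbrev polyFormsAddCommMonoid : AddCommMonoid (PolyForms A L₁ L₂) := inferInstance

abbrev polyFormModule : Module R (PolyForm A L₁ L₂ i) := inferInstance

abbrev polyFormAddCommMonoid : AddCommMonoid (PolyForm A L₁ L₂ i) := inferInstance

abbrev polyFormAddCommGroup : AddCommGroup (PolyForm A L₁ L₂ i) := inferInstance

abbrev dualFormsModule : Module R (DualForms A L₁ L₂ n) := inferInstance

abbrev dualFormsAddCommMonoid : AddCommMonoid (DualForms A L₁ L₂ n) := inferInstance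

end FormInstances

attribute [local instance] polyFormsModule polyFormsAddCommMonoid polyFormModule
  polyFormAddCommMonoid polyFormAddCommGroup dualFormsModule dualFormsAddCommMonoid

/-! ### Contractions of forms with elements of `L₂`. -/

section Contr

variable (R : Type*) {A L₁ L₂ : Type*} [CommRing R] [CommRing A] [Algebra R A]
  [LieRing L₁] [LieAlgebra R L₁] [Module A L₁] [LieRingModule L₁ A] [LieRinehartRing A L₁]
  [LieRinehartAlgebra R A L₁]
  [LieRing L₂] [LieAlgebra R L₂] [Module A L₂] [LieRingModule L₂ A] [LieRinehartRing A L₂]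
  [LieRinehartAlgebra R A L₂]

instance polyFormsAddCommGroup : AddCommGroup (PolyForms A L₁ L₂) :=
  DirectSum.instAddCommGroup (β := fun i => PolyForm A L₁ L₂ i)

instance dualFormsAddCommGroup (n : ℕ) : AddCommGroup (DualForms A L₁ L₂ n) :=
  Module.addCommMonoidToAddCommGroup A

variable (A L₁ L₂) in
/-- The homogeneous element of `Alt_A(L₂, Λ_A L₁)` given by `f`. -/
abbrev phom (i : ℕ × ℕ) (f : PolyForm A L₁ L₂ i) : PolyForms A L₁ L₂ :=
  hom R (T := PolyForm A L₁ L₂) i f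

/-- The component of `contr`. -/
def contrAt (ξ : L₂) : ∀ i : ℕ × ℕ, PolyForm A L₁ L₂ i →ₗ[R] PolyForms A L₁ L₂
  | (0, _) => 0
  | (q + 1, p) =>
    { toFun := fun f => (-1 : ℤ) ^ (q + 1) • phom R A L₁ L₂ (q, p) (f.curryLeft ξ)
      map_add' := fun f g => by
        rw [AlternatingMap.curryLeft_add, LinearMap.add_apply, ← smul_add]
        exact congrArg _ (hom_add (T := PolyForm A L₁ L₂) (q, p) _ _)
      map_smul' := fun r f => by
        rw [RingHom.id_apply, smul_comm]
        exact congrArg _ (hom_smul (T := PolyForm A L₁ L₂) (q, p) r (f.curryLeft ξ)) }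

/-- The contraction with `ξ`, inserted in the last place: an operator of bidegree `(-1, 0)`. -/
def contr (ξ : L₂) : PolyForms A L₁ L₂ →ₗ[R] PolyForms A L₁ L₂ :=
  DirectSum.toModule R (ℕ × ℕ) _ (contrAt R ξ)

variable {R}

lemma contr_hom_zero (ξ : L₂) (p : ℕ) (f : PolyForm A L₁ L₂ (0, p)) :
    contr R ξ (phom R A L₁ L₂ (0, p) f) = 0 := by
  rw [contr, phom, hom, DirectSum.toModule_lof]; rfl

lemma contr_hom_succ (ξ : L₂) (q p : ℕ) (f : PolyForm A L₁ L₂ (q + 1, p)) :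
    contr R ξ (phom R A L₁ L₂ (q + 1, p) f) = (-1 : ℤ) ^ (q + 1) • phom R A L₁ L₂ (q, p) (f.curryLeft ξ) := by
  rw [contr, phom, hom, DirectSum.toModule_lof]; rfl

lemma contr_hom_cases (ξ : L₂) (i : ℕ × ℕ) (f : PolyForm A L₁ L₂ i) :
    contr R ξ (phom R A L₁ L₂ i f) = 0 ∨
      ∃ (q : ℕ) (g : PolyForm A L₁ L₂ (q, i.2)), i.1 = q + 1 ∧
        contr R ξ (phom R A L₁ L₂ i f) = phom R A L₁ L₂ (q, i.2) g := by
  obtain ⟨_ | q, p⟩ := i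
  · exact Or.inl (contr_hom_zero ξ p f)
  · exact Or.inr ⟨q, (-1 : ℤ) ^ (q + 1) • f.curryLeft ξ, rfl, by
      rw [contr_hom_succ]; exact (hom_zsmul (T := PolyForm A L₁ L₂) (q, p) _ _).symm⟩

lemma contr_apply (ξ : L₂) (a : PolyForms A L₁ L₂) (q p : ℕ) :
    (contr R ξ a) (q, p) = (-1 : ℤ) ^ (q + 1) • (a (q + 1, p)).curryLeft ξ := by
  induction a using hom_induction (R := R) (T := PolyForm A L₁ L₂) with
  | hz => simp
  | hh i f =>
    obtain ⟨_ | q', p'⟩ := i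
    · rw [contr_hom_zero, hom_apply_ne (by simp)]
      simp
    · rw [contr_hom_succ]
      by_cases h : (q', p') = (q, p)
      · cases h
        change (-1 : ℤ) ^ (q + 1) • (phom R A L₁ L₂ (q, p) (f.curryLeft ξ)) (q, p) = _
        rw [hom_apply_same, hom_apply_same]
      · change (-1 : ℤ) ^ (q' + 1) • (phom R A L₁ L₂ (q', p') (f.curryLeft ξ)) (q, p) = _
        rw [hom_apply_ne (fun e => h e.symm), hom_apply_ne (fun e => h (by simpa [eq_comm] using e))]
        simp
  | ha a b ha hb =>
    rw [map_add]
    change (contr R ξ a) (q, p) + (contr R ξ b) (q, p) = _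
    rw [ha, hb, ← smul_add]
    rfl

variable (R) in
/-- The component of `evalZero`. -/
def evalZeroAt : ∀ i : ℕ × ℕ, PolyForm A L₁ L₂ i →ₗ[R] ExteriorAlgebra A L₁
  | (0, _) =>
    { toFun := fun f => (f ![] : ExteriorAlgebra A L₁)
      map_add' := fun _ _ => rfl
      map_smul' := fun _ _ => rfl }
  | (_ + 1, _) => 0

variable (R) in
/-- The projection onto the forms of degree zero. -/
def evalZero : PolyForms A L₁ L₂ →ₗ[R] ExteriorAlgebra A L₁ :=
  DirectSum.toModule R (ℕ × ℕ) _ (evalZeroAt R)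

lemma evalZero_hom_zero (p : ℕ) (f : PolyForm A L₁ L₂ (0, p)) :
    evalZero R (phom R A L₁ L₂ (0, p) f) = (f ![] : ExteriorAlgebra A L₁) := by
  rw [evalZero, phom, hom, DirectSum.toModule_lof]; rfl

lemma evalZero_hom_succ (q p : ℕ) (f : PolyForm A L₁ L₂ (q + 1, p)) :
    evalZero R (phom R A L₁ L₂ (q + 1, p) f) = 0 := by
  rw [evalZero, phom, hom, DirectSum.toModule_lof]; rfl

lemma decompose_evalZero (a : PolyForms A L₁ L₂) (p : ℕ) :
    DirectSum.decompose (fun p => ⋀[A]^p L₁) (evalZero R a) p = a (0, p) ![] := by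
  induction a using hom_induction (R := R) (T := PolyForm A L₁ L₂) with
  | hz => simp
  | hh i f =>
    obtain ⟨_ | q', p'⟩ := i
    · rw [evalZero_hom_zero, DirectSum.decompose_coe]
      by_cases h : p' = p
      · subst h
        rw [DirectSum.of_eq_same, hom_apply_same]
      · rw [DirectSum.of_eq_of_ne _ _ _ (Ne.symm h), hom_apply_ne (fun e => h (by simpa [eq_comm] using e))]
        rfl
    · rw [evalZero_hom_succ, hom_apply_ne (by simp)]
      simp
  | ha a b ha hb =>
    rw [map_add, DirectSum.decompose_add]
    change _ + _ = (a (0, p)) ![] + (b (0, p)) ![]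
    rw [← ha, ← hb]

/-- The components of form degree zero are seen by `evalZero`, those of positive degree by the
contractions. This is the separation property on which the inductions on form degree rest. -/
lemma forms_ext {a b : PolyForms A L₁ L₂} (h0 : evalZero R a = evalZero R b)
    (h : ∀ ξ, contr R ξ a = contr R ξ b) : a = b := by
  refine DFinsupp.ext fun i => ?_
  obtain ⟨_ | q, p⟩ := i
  · ext v : 1
    have h1 := decompose_evalZero (R := R) a p
    rw [h0, decompose_evalZero] at h1
    rw [Subsingleton.elim v ![]]
    exact h1.symm
  · refine eq_of_curryLeft_eq fun ξ => ?_
    have h1 := congrArg (fun c : PolyForms A L₁ L₂ => c (q, p)) (h ξ)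
    simp only [contr_apply] at h1
    rcases neg_one_pow_eq_or ℤ (q + 1) with h2 | h2 <;> rw [h2] at h1
    · simpa using h1
    · rw [neg_smul, neg_smul, one_smul, one_smul] at h1
      exact neg_injective h1

lemma evalZero_mul (a b : PolyForms A L₁ L₂) :
    evalZero R (formsMul R A L₁ L₂ a b) = evalZero R a * evalZero R b := by
  induction a using hom_induction (R := R) (T := PolyForm A L₁ L₂) with
  | hz => simp
  | ha a a' h h' => simp only [map_add, LinearMap.add_apply, h, h', add_mul]
  | hh i f =>
    induction b using hom_induction (R := R) (T := PolyForm A L₁ L₂) with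
    | hz => simp
    | ha b b' h h' => simp only [map_add, h, h', mul_add]
    | hh j g =>
      rw [formsMul_hom]
      obtain ⟨_ | q, p⟩ := i <;> obtain ⟨_ | q', p'⟩ := j
      · refine (evalZero_hom_zero _ _).trans ?_
        rw [evalZero_hom_zero, evalZero_hom_zero, formMul_apply]
        simp only [mul_zero, pow_zero, one_smul]
        rw [shuffle_zero_zero]
        rfl
      · refine (evalZero_hom_succ _ _ _).trans ?_
        rw [evalZero_hom_succ, mul_zero]
      · refine (evalZero_hom_succ _ _ _).trans ?_
        rw [evalZero_hom_succ, zero_mul]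
      · refine (evalZero_hom_succ _ _ _).trans ?_
        rw [evalZero_hom_succ, zero_mul]

section curryLeft

variable {N N₁ N₂ N₃ : Type*} [AddCommGroup N] [Module A N] [AddCommGroup N₁] [Module A N₁]
  [AddCommGroup N₂] [Module A N₂] [AddCommGroup N₃] [Module A N₃] (b : N₁ →ₗ[A] N₂ →ₗ[A] N₃)
  {q q' : ℕ}

lemma curryLeft_shuffle (f : N [⋀^Fin (q + 1)]→ₗ[A] N₁) (g : N [⋀^Fin (q' + 1)]→ₗ[A] N₂) (ξ : N) :
    AlternatingMap.curryLeft (n := q + 1 + q') (shuffle b f g) ξ =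
      (shuffle b (f.curryLeft ξ) g).domDomCongr
        (finCongr (show q + (q' + 1) = q + 1 + q' by omega)) +
      (-1 : ℤ) ^ (q + 1) • shuffle b f (g.curryLeft ξ) := by
  ext v : 1
  exact shuffle_vecCons b f g ξ v

lemma curryLeft_shuffle_zero_left (f : N [⋀^Fin 0]→ₗ[A] N₁) (g : N [⋀^Fin (q' + 1)]→ₗ[A] N₂)
    (ξ : N) :
    AlternatingMap.curryLeft (n := 0 + q') (shuffle b f g) ξ = shuffle b f (g.curryLeft ξ) := by
  ext v : 1
  exact shuffle_vecCons_zero_left b f g ξ v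

lemma curryLeft_shuffle_zero_right (f : N [⋀^Fin (q + 1)]→ₗ[A] N₁) (g : N [⋀^Fin 0]→ₗ[A] N₂)
    (ξ : N) :
    AlternatingMap.curryLeft (n := q) (shuffle b f g) ξ = shuffle b (f.curryLeft ξ) g := by
  ext v : 1
  exact shuffle_vecCons_zero_right b f g ξ v

end curryLeft

/-- Bidegrees of products often agree only propositionally. The homogeneous elements are therefore
compared through their values in the ungraded exterior algebra. -/
lemma phom_congr {k k' p p' : ℕ} (h : k = k') (hp : p = p') (f : PolyForm A L₁ L₂ (k, p))
    (g : PolyForm A L₁ L₂ (k', p'))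
    (hfg : ∀ v, (f v : ExteriorAlgebra A L₁) = g (fun i => v (Fin.cast h.symm i))) :
    phom R A L₁ L₂ (k, p) f = phom R A L₁ L₂ (k', p') g := by
  subst h hp
  congr 1
  ext v : 2
  exact hfg v

/-- The sign in `contr`, which amounts to inserting in the last place, and the Eilenberg-Koszul sign
of the product together convert the rule `shuffle_vecCons` into an antiderivation rule with respect
to the total degree. Form degree zero in either factor is treated separately, since contraction then
vanishes on that factor. -/
lemma contr_mul_hom (ξ : L₂) (i j : ℕ × ℕ) (f : PolyForm A L₁ L₂ i) (g : PolyForm A L₁ L₂ j) :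
    contr R ξ (formsMul R A L₁ L₂ (phom R A L₁ L₂ i f) (phom R A L₁ L₂ j g)) =
      formsMul R A L₁ L₂ (contr R ξ (phom R A L₁ L₂ i f)) (phom R A L₁ L₂ j g) +
        (-1 : ℤ) ^ tdeg i • formsMul R A L₁ L₂ (phom R A L₁ L₂ i f)
          (contr R ξ (phom R A L₁ L₂ j g)) := by
  rw [formsMul_hom, formMul_apply, hom_zsmul, map_zsmul]
  obtain ⟨_ | q, p⟩ := i <;> obtain ⟨_ | q', p'⟩ := j
  · refine (congrArg (_ • ·) (contr_hom_zero _ _ _)).trans ?_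
    rw [contr_hom_zero, contr_hom_zero]
    simp
  · refine (congrArg (_ • ·) (contr_hom_succ ξ (0 + q') (p + p') _)).trans ?_
    rw [curryLeft_shuffle_zero_left, contr_hom_zero, contr_hom_succ, map_zero,
      LinearMap.zero_apply, zero_add ((-1 : ℤ) ^ _ • _), map_zsmul, formsMul_hom, formMul_apply,
      hom_zsmul]
    simp only [smul_smul]
    refine congrArg₂ (· • ·) ?_ rfl
    rcases neg_one_pow_eq_or ℤ p with h1 | h1 <;> rcases neg_one_pow_eq_or ℤ q' with h2 | h2 <;>
      simp [pow_succ, pow_add, mul_add, pow_mul, h1, h2]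
  · refine (congrArg (_ • ·) (contr_hom_succ ξ q (p + p') _)).trans ?_
    rw [curryLeft_shuffle_zero_right, contr_hom_zero, contr_hom_succ, map_zero, smul_zero,
      map_zsmul, LinearMap.smul_apply, formsMul_hom, formMul_apply, hom_zsmul]
    refine Eq.trans ?_ (add_zero _).symm
    simp only [smul_smul]
    refine congrArg₂ (· • ·) ?_ rfl
    simp
  · refine (congrArg (_ • ·) (contr_hom_succ ξ (q + 1 + q') (p + p') _)).trans ?_
    have h := phom_congr (R := R) (show (q + (q' + 1) = q + 1 + q') by omega) rfl
      (shuffle (extMul A L₁ p p') (f.curryLeft ξ) g)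
      ((shuffle (extMul A L₁ p p') (f.curryLeft ξ) g).domDomCongr
        (finCongr (show (q + (q' + 1) = q + 1 + q') by omega))) (fun v => by
          rw [AlternatingMap.domDomCongr_apply]
          rfl)
    rw [curryLeft_shuffle]
    refine (congrArg (fun z => (_ : ℤ) • (_ : ℤ) • z) ((hom_add (R := R) (T := PolyForm A L₁ L₂) (q + 1 + q', p + p') _ _).trans
      (congrArg₂ (· + ·) h.symm (hom_zsmul (R := R) (T := PolyForm A L₁ L₂) (q + 1 + q', p + p') _ _)))).trans ?_
    rw [contr_hom_succ, contr_hom_succ, map_zsmul, map_zsmul, LinearMap.smul_apply,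
      formsMul_hom, formsMul_hom, formMul_apply, formMul_apply, hom_zsmul, hom_zsmul]
    simp only [smul_add, smul_smul]
    refine congrArg₂ (· + ·) (congrArg₂ (· • ·) ?_ rfl) (congrArg₂ (· • ·) ?_ rfl) <;>
    rcases neg_one_pow_eq_or ℤ p with h1 | h1 <;> rcases neg_one_pow_eq_or ℤ q' with h2 | h2 <;>
    rcases neg_one_pow_eq_or ℤ q with h3 | h3 <;>
      simp [pow_succ, pow_add, mul_add, add_mul, pow_mul, h1, h2, h3]

end Contr

/-! ## Bigraded algebras with contractions -/

section Contraction

variable {R : Type*} [CommRing R]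
  {T : ℕ × ℕ → Type*} [∀ i, AddCommGroup (T i)] [∀ i, Module R (T i)]
  {X E : Type*} [Ring E]

/-- The operators `j ξ` are antiderivations of bidegree `(-1, 0)` of the product `μ` which,
together with the multiplicative map `e`, separate points. -/
structure IsContraction (μ : (⨁ i, T i) →ₗ[R] (⨁ i, T i) →ₗ[R] (⨁ i, T i))
    (j : X → (⨁ i, T i) →ₗ[R] (⨁ i, T i)) (e : (⨁ i, T i) →+ E) : Prop where
  mul_hom : ∀ (i k : ℕ × ℕ) (f : T i) (g : T k), ∃ h : T (i.1 + k.1, i.2 + k.2),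
    μ (hom R i f) (hom R k g) = hom R (i.1 + k.1, i.2 + k.2) h
  ext : ∀ a b, e a = e b → (∀ ξ, j ξ a = j ξ b) → a = b
  cases : ∀ ξ (i : ℕ × ℕ) (f : T i), j ξ (hom R i f) = 0 ∨
    ∃ (q : ℕ) (g : T (q, i.2)), i.1 = q + 1 ∧ j ξ (hom R i f) = hom R (q, i.2) g
  map_mul : ∀ (i k : ℕ × ℕ) (f : T i) (g : T k),
    e (μ (hom R i f) (hom R k g)) = e (hom R i f) * e (hom R k g)
  contr_mul : ∀ ξ (i k : ℕ × ℕ) (f : T i) (g : T k),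
    j ξ (μ (hom R i f) (hom R k g)) = μ (j ξ (hom R i f)) (hom R k g) +
      (-1 : ℤ) ^ tdeg i • μ (hom R i f) (j ξ (hom R k g))

namespace IsContraction

variable {μ : (⨁ i, T i) →ₗ[R] (⨁ i, T i) →ₗ[R] (⨁ i, T i)}
  {j : X → (⨁ i, T i) →ₗ[R] (⨁ i, T i)} {e : (⨁ i, T i) →+ E} (hj : IsContraction μ j e)

include hj

lemma contr_hom_mul (ξ : X) (i : ℕ × ℕ) (f : T i) (b : ⨁ i, T i) :
    j ξ (μ (hom R i f) b) =
      μ (j ξ (hom R i f)) b + (-1 : ℤ) ^ tdeg i • μ (hom R i f) (j ξ b) := by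
  induction b using hom_induction (R := R) (T := T) with
  | hz => simp
  | hh k g => exact hj.contr_mul ξ i k f g
  | ha b c hb hc => simp only [map_add, hb, hc, smul_add]; abel

lemma e_mul (a b : ⨁ i, T i) : e (μ a b) = e a * e b := by
  induction a using hom_induction (R := R) (T := T) with
  | hz => simp
  | ha a a' h h' => simp only [map_add, LinearMap.add_apply, h, h', add_mul]
  | hh i f =>
    induction b using hom_induction (R := R) (T := T) with
    | hz => simp
    | ha b b' h h' => simp only [map_add, h, h', mul_add]
    | hh k g => exact hj.map_mul i k f g

/-- Induction on the sum of the three form degrees: `e` reduces the identity to associativity in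
`E`, and a contraction distributes over both sides, lowering the degree of one factor at a time.
Commutativity, the unit law and the derivation property of differentials follow the same scheme. -/
lemma mul_assoc_hom (N : ℕ) : ∀ (i k l : ℕ × ℕ) (f : T i) (g : T k) (h : T l),
    i.1 + k.1 + l.1 = N →
    μ (μ (hom R i f) (hom R k g)) (hom R l h) = μ (hom R i f) (μ (hom R k g) (hom R l h)) := by
  induction N using Nat.strong_induction_on with
  | _ N ih =>
  intro i k l f g h hN
  refine hj.ext _ _ ?_ fun ξ => ?_
  · simp only [hj.e_mul, mul_assoc]
  · have h1 : μ (μ (j ξ (hom R i f)) (hom R k g)) (hom R l h) =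
        μ (j ξ (hom R i f)) (μ (hom R k g) (hom R l h)) := by
      rcases hj.cases ξ i f with h0 | ⟨q, f', hq, h0⟩
      · simp [h0]
      · rw [h0]
        exact ih (q + k.1 + l.1) (by omega) _ _ _ f' g h rfl
    have h2 : μ (μ (hom R i f) (j ξ (hom R k g))) (hom R l h) =
        μ (hom R i f) (μ (j ξ (hom R k g)) (hom R l h)) := by
      rcases hj.cases ξ k g with h0 | ⟨q, g', hq, h0⟩
      · simp [h0]
      · rw [h0]
        exact ih (i.1 + q + l.1) (by omega) _ _ _ f g' h rfl
    have h3 : μ (μ (hom R i f) (hom R k g)) (j ξ (hom R l h)) =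
        μ (hom R i f) (μ (hom R k g) (j ξ (hom R l h))) := by
      rcases hj.cases ξ l h with h0 | ⟨q, h', hq, h0⟩
      · simp [h0]
      · rw [h0]
        exact ih (i.1 + k.1 + q) (by omega) _ _ _ f g h' rfl
    -- The contraction rule requires a homogeneous left factor, so the product of `f` and `g` has to
    -- be named as one.
    obtain ⟨fg, hfg⟩ := hj.mul_hom i k f g
    have hs : (-1 : ℤ) ^ tdeg (i.1 + k.1, i.2 + k.2) = (-1 : ℤ) ^ tdeg i * (-1 : ℤ) ^ tdeg k := by
      rw [← pow_add]; congr 1; simp only [tdeg]; omega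
    rw [hj.contr_hom_mul, hj.contr_hom_mul]
    conv_lhs => rw [hfg, hj.contr_hom_mul, ← hfg, hj.contr_hom_mul]
    simp only [map_add, map_zsmul, LinearMap.add_apply, LinearMap.smul_apply, h1, h2, h3, hs,
      smul_add, smul_smul]
    abel

lemma mul_assoc' (a b c : ⨁ i, T i) : μ (μ a b) c = μ a (μ b c) := by
  induction a using hom_induction (R := R) (T := T) with
  | hz => simp
  | ha a a' h h' => simp only [map_add, LinearMap.add_apply, h, h']
  | hh i f =>
    induction b using hom_induction (R := R) (T := T) with
    | hz => simp
    | ha b b' h h' => simp only [map_add, LinearMap.add_apply, h, h']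
    | hh k g =>
      induction c using hom_induction (R := R) (T := T) with
      | hz => simp
      | ha c c' h h' => simp only [map_add, h, h']
      | hh l h => exact hj.mul_assoc_hom _ i k l f g h rfl

lemma mul_comm_hom (hcomm : ∀ (i k : ℕ × ℕ) (f : T i) (g : T k),
      e (hom R i f) * e (hom R k g) =
        (-1 : ℤ) ^ (tdeg i * tdeg k) • (e (hom R k g) * e (hom R i f)))
    (N : ℕ) : ∀ (i k : ℕ × ℕ) (f : T i) (g : T k), i.1 + k.1 = N →
    μ (hom R i f) (hom R k g) = (-1 : ℤ) ^ (tdeg i * tdeg k) • μ (hom R k g) (hom R i f) := by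
  induction N using Nat.strong_induction_on with
  | _ N ih =>
  intro i k f g hN
  refine hj.ext _ _ ?_ fun ξ => ?_
  · rw [map_zsmul, hj.e_mul, hj.e_mul, hcomm]
  · rw [map_zsmul, hj.contr_hom_mul, hj.contr_hom_mul]
    have h1 : μ (j ξ (hom R i f)) (hom R k g) =
        (-1 : ℤ) ^ ((tdeg i + 1) * tdeg k) • μ (hom R k g) (j ξ (hom R i f)) := by
      rcases hj.cases ξ i f with h0 | ⟨q, f', hq, h0⟩
      · simp [h0]
      · rw [h0, ih (q + k.1) (by omega) (q, i.2) _ f' g rfl]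
        congr 1
        simp only [tdeg, hq]
        rcases neg_one_pow_eq_or ℤ (k.1 + k.2) with h | h <;>
          simp [mul_comm _ (k.1 + k.2), pow_mul, h, pow_succ, pow_add]
    have h2 : μ (hom R i f) (j ξ (hom R k g)) =
        (-1 : ℤ) ^ (tdeg i * (tdeg k + 1)) • μ (j ξ (hom R k g)) (hom R i f) := by
      rcases hj.cases ξ k g with h0 | ⟨q, g', hq, h0⟩
      · simp [h0]
      · rw [h0, ih (i.1 + q) (by omega) _ (q, k.2) f g' rfl]
        congr 1
        simp only [tdeg, hq]
        rcases neg_one_pow_eq_or ℤ (i.1 + i.2) with h | h <;>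
          simp [pow_mul, h, pow_succ, pow_add]
    rw [h1, h2, smul_add, smul_smul, smul_smul, add_comm]
    congr 2
    · rcases neg_one_pow_eq_or ℤ (tdeg i) with h | h <;> simp [pow_mul, h, pow_succ]
    · rcases neg_one_pow_eq_or ℤ (tdeg k) with h | h <;>
        simp [mul_comm _ (tdeg k), pow_mul, h, pow_succ]

lemma one_mul' {u : T (0, 0)} (hu : e (hom R (0, 0) u) = 1) (a : ⨁ i, T i) :
    μ (hom R (0, 0) u) a = a := by
  have h0 : ∀ ξ, j ξ (hom R (0, 0) u) = 0 := fun ξ => by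
    rcases hj.cases ξ (0, 0) u with h | ⟨q, f', hq, h0⟩
    · exact h
    · exact absurd hq.symm (Nat.succ_ne_zero q)
  suffices H : ∀ (N : ℕ) (i : ℕ × ℕ) (f : T i), i.1 = N →
      μ (hom R (0, 0) u) (hom R i f) = hom R i f by
    induction a using hom_induction (R := R) (T := T) with
    | hz => simp
    | ha a a' h h' => simp only [map_add, h, h']
    | hh i f => exact H _ i f rfl
  intro N
  induction N using Nat.strong_induction_on with
  | _ N ih =>
  intro i f hi
  refine hj.ext _ _ ?_ fun ξ => ?_
  · rw [hj.e_mul, hu, one_mul]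
  · rw [hj.contr_hom_mul, h0, map_zero, LinearMap.zero_apply, zero_add]
    rcases hj.cases ξ i f with h | ⟨q, f', hq, h⟩
    · simp [h]
    · rw [h, ih q (by omega) (q, i.2) f' rfl]
      simp

theorem isBigradedCommAlgebra {u : T (0, 0)} (hu : e (hom R (0, 0) u) = 1)
    (hcomm : ∀ (i k : ℕ × ℕ) (f : T i) (g : T k),
      e (hom R i f) * e (hom R k g) =
        (-1 : ℤ) ^ (tdeg i * tdeg k) • (e (hom R k g) * e (hom R i f))) :
    IsBigradedCommAlgebra (hom R (0, 0) u) μ where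
  one_bidegree := ⟨u, rfl⟩
  mul_bidegree i k f g l hl := by
    obtain ⟨h, hfg⟩ := hj.mul_hom i k f g
    rw [hfg]
    exact hom_apply_ne hl h
  one_mul := hj.one_mul' hu
  mul_one a := by
    induction a using hom_induction (R := R) (T := T) with
    | hz => simp
    | ha a a' h h' => simp only [map_add, LinearMap.add_apply, h, h']
    | hh i f =>
      rw [hj.mul_comm_hom hcomm _ i (0, 0) f u rfl, hj.one_mul' hu]
      simp
  mul_assoc := hj.mul_assoc'
  mul_comm i k f g := hj.mul_comm_hom hcomm _ i k f g rfl

/-- A differential related to derivations by Cartan's formula is a derivation. -/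
lemma d_mul_of_cartan {d : (⨁ i, T i) →ₗ[R] (⨁ i, T i)} {ℓ : X → (⨁ i, T i) →ₗ[R] (⨁ i, T i)}
    (hd : ∀ (i : ℕ × ℕ) (f : T i), ∃ g : T (i.1 + 1, i.2),
      d (hom R i f) = hom R (i.1 + 1, i.2) g)
    (he : ∀ a, e (d a) = 0) (hc : ∀ ξ a, j ξ (d a) = ℓ ξ a - d (j ξ a))
    (hℓ : ∀ ξ a b, ℓ ξ (μ a b) = μ (ℓ ξ a) b + μ a (ℓ ξ b)) (i : ℕ × ℕ) (f : T i)
    (b : ⨁ i, T i) :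
    d (μ (hom R i f) b) = μ (d (hom R i f)) b + (-1 : ℤ) ^ tdeg i • μ (hom R i f) (d b) := by
  suffices H : ∀ (N : ℕ) (i k : ℕ × ℕ) (f : T i) (g : T k), i.1 + k.1 = N →
      d (μ (hom R i f) (hom R k g)) = μ (d (hom R i f)) (hom R k g) +
        (-1 : ℤ) ^ tdeg i • μ (hom R i f) (d (hom R k g)) by
    induction b using hom_induction (R := R) (T := T) with
    | hz => simp
    | ha b c hb hc => simp only [map_add, hb, hc, smul_add]; abel
    | hh k g => exact H _ i k f g rfl
  intro N
  induction N using Nat.strong_induction_on with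
  | _ N ih =>
  intro i k f g hN
  refine hj.ext _ _ ?_ fun ξ => ?_
  · rw [map_add, map_zsmul]
    simp only [hj.e_mul, he, zero_mul, mul_zero, smul_zero, add_zero]
  · have h1 : d (μ (j ξ (hom R i f)) (hom R k g)) = μ (d (j ξ (hom R i f))) (hom R k g) -
        (-1 : ℤ) ^ tdeg i • μ (j ξ (hom R i f)) (d (hom R k g)) := by
      rcases hj.cases ξ i f with h0 | ⟨q, f', hq, h0⟩
      · simp [h0]
      · rw [h0, ih (q + k.1) (by omega) (q, i.2) _ f' g rfl]
        rw [show tdeg i = tdeg (q, i.2) + 1 by simp only [tdeg]; omega, pow_succ, mul_neg_one,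
          neg_smul, sub_neg_eq_add]
    have h2 : d (μ (hom R i f) (j ξ (hom R k g))) = μ (d (hom R i f)) (j ξ (hom R k g)) +
        (-1 : ℤ) ^ tdeg i • μ (hom R i f) (d (j ξ (hom R k g))) := by
      rcases hj.cases ξ k g with h0 | ⟨q, g', hq, h0⟩
      · simp [h0]
      · rw [h0]
        exact ih (i.1 + q) (by omega) _ (q, k.2) f g' rfl
    obtain ⟨df, hdf⟩ := hd i f
    have hs : (-1 : ℤ) ^ tdeg (i.1 + 1, i.2) = -(-1) ^ tdeg i := by
      rw [show tdeg (i.1 + 1, i.2) = tdeg i + 1 by simp only [tdeg]; omega, pow_succ, mul_neg_one]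
    have h3 := hj.contr_hom_mul ξ (i.1 + 1, i.2) df (hom R k g)
    rw [← hdf, hs, hc] at h3
    rw [hc, hj.contr_hom_mul, map_add, map_add, map_zsmul, map_zsmul, hj.contr_hom_mul, hℓ, h1, h2,
      h3, hc]
    rcases neg_one_pow_eq_or ℤ (tdeg i) with h | h <;>
      simp only [h, one_smul, neg_smul, map_sub, LinearMap.sub_apply, neg_neg] <;> abel

end IsContraction

end Contraction

/-! ## The bigraded algebra of forms and its differential -/

section Algebra

variable (R A L₁ L₂ : Type*) [CommRing R] [CommRing A] [Algebra R A]
  [LieRing L₁] [LieAlgebra R L₁] [Module A L₁] [LieRingModule L₁ A] [LieRinehartRing A L₁]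
  [LieRinehartAlgebra R A L₁]
  [LieRing L₂] [LieAlgebra R L₂] [Module A L₂] [LieRingModule L₂ A] [LieRinehartRing A L₂]
  [LieRinehartAlgebra R A L₂]

lemma isContraction_forms :
    IsContraction (T := PolyForm A L₁ L₂) (formsMul R A L₁ L₂) (contr R)
      (evalZero R).toAddMonoidHom where
  mul_hom i k f g := ⟨_, formsMul_hom R A L₁ L₂ i k f g⟩
  ext _ _ h0 h := forms_ext h0 h
  cases ξ i f := contr_hom_cases ξ i f
  map_mul i k f g := evalZero_mul (phom R A L₁ L₂ i f) (phom R A L₁ L₂ k g)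
  contr_mul ξ i k f g := contr_mul_hom ξ i k f g

lemma evalZero_formsOne : evalZero R (formsOne R A L₁ L₂) = 1 := by
  rw [formsOne, evalZero_hom_zero]
  simp [ofForm]

lemma evalZero_mul_comm (i k : ℕ × ℕ) (f : PolyForm A L₁ L₂ i) (g : PolyForm A L₁ L₂ k) :
    evalZero R (phom R A L₁ L₂ i f) * evalZero R (phom R A L₁ L₂ k g) =
      (-1 : ℤ) ^ (tdeg i * tdeg k) •
        (evalZero R (phom R A L₁ L₂ k g) * evalZero R (phom R A L₁ L₂ i f)) := by
  obtain ⟨_ | q, p⟩ := i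
  · obtain ⟨_ | q', p'⟩ := k
    · rw [evalZero_hom_zero, evalZero_hom_zero, exterior_mul_comm]
      simp only [tdeg, zero_add]
    · rw [evalZero_hom_succ, mul_zero, zero_mul, smul_zero]
  · rw [evalZero_hom_succ, mul_zero, zero_mul, smul_zero]

theorem isBigradedCommAlgebra_forms :
    IsBigradedCommAlgebra (T := PolyForm A L₁ L₂) (formsOne R A L₁ L₂) (formsMul R A L₁ L₂) :=
  (isContraction_forms R A L₁ L₂).isBigradedCommAlgebra (evalZero_formsOne R A L₁ L₂)
    (evalZero_mul_comm R A L₁ L₂)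

end Algebra

lemma neg_one_pow_smul_smul_add {M : Type*} [AddCommGroup M] (q : ℕ) (x y : M) :
    (-1 : ℤ) ^ (q + 1 + 1) • ((-1 : ℤ) ^ q • x + y) = x - (-1 : ℤ) ^ (q + 1) • y := by
  rcases neg_one_pow_eq_or ℤ q with h | h <;> simp [pow_succ, h, sub_eq_add_neg]

/-! ### Cartan calculus for `d''` on the algebra of forms. -/

namespace AlmostTwilled

variable {R A L₁ L₂ : Type*} [CommRing R] [CommRing A] [Algebra R A]
  [LieRing L₁] [LieAlgebra R L₁] [Module A L₁] [LieRingModule L₁ A] [LieRinehartRing A L₁]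
  [LieRinehartAlgebra R A L₁]
  [LieRing L₂] [LieAlgebra R L₂] [Module A L₂] [LieRingModule L₂ A] [LieRinehartRing A L₂]
  [LieRinehartAlgebra R A L₂]
  (S : AlmostTwilled R A L₁ L₂)

/-- The Lie derivative along `ξ ∈ L₂`. -/
def polyLie (ξ : L₂) : PolyForms A L₁ L₂ →ₗ[R] PolyForms A L₁ L₂ :=
  DirectSum.toModule R (ℕ × ℕ) _ fun i =>
    DirectSum.lof R (ℕ × ℕ) (PolyForm A L₁ L₂) i ∘ₗ (S.act₂.ext i.2).lieDer ξ

lemma polyLie_phom (ξ : L₂) (i : ℕ × ℕ) (f : PolyForm A L₁ L₂ i) :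
    S.polyLie ξ (phom R A L₁ L₂ i f) = phom R A L₁ L₂ i ((S.act₂.ext i.2).lieDer ξ f) := by
  rw [polyLie, phom, hom, DirectSum.toModule_lof]; rfl

lemma dPoly_phom (i : ℕ × ℕ) (f : PolyForm A L₁ L₂ i) :
    S.dPoly (phom R A L₁ L₂ i f) =
      phom R A L₁ L₂ (i.1 + 1, i.2) ((S.act₂.ext i.2).rinehart i.1 f) := by
  rw [dPoly, phom, hom, DirectSum.toModule_lof]; rfl

lemma evalZero_dPoly (a : PolyForms A L₁ L₂) : evalZero R (S.dPoly a) = 0 := by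
  have h : evalZero R ∘ₗ S.dPoly = 0 :=
    linearMap_eq_of_hom (T := PolyForm A L₁ L₂) fun i f =>
      (congrArg (evalZero R) (S.dPoly_phom i f)).trans (evalZero_hom_succ _ _ _)
  exact DFunLike.congr_fun h a

lemma contr_dPoly_hom (ξ : L₂) (i : ℕ × ℕ) (f : PolyForm A L₁ L₂ i) :
    contr R ξ (S.dPoly (phom R A L₁ L₂ i f)) =
      S.polyLie ξ (phom R A L₁ L₂ i f) - S.dPoly (contr R ξ (phom R A L₁ L₂ i f)) := by
  obtain ⟨_ | q, p⟩ := i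
  · rw [dPoly_phom, contr_hom_zero, map_zero, polyLie_phom]
    refine (contr_hom_succ ξ 0 p _).trans ?_
    rw [Conn.curryLeft_rinehart_zero]
    refine (hom_zsmul (R := R) (T := PolyForm A L₁ L₂) (0, p) _ _).symm.trans ?_
    rw [sub_zero]
    congr 1
    rw [zero_add, pow_one, neg_smul, one_smul]
    exact neg_neg ((S.act₂.ext p).lieDer ξ f)
  · have h1 := contr_hom_succ (R := R) ξ q p f
    rw [h1, dPoly_phom, map_zsmul, polyLie_phom, dPoly_phom]
    refine (contr_hom_succ ξ (q + 1) p _).trans ?_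
    rw [Conn.curryLeft_rinehart_succ]
    refine (congrArg (_ • ·) ((hom_add (R := R) (T := PolyForm A L₁ L₂) (q + 1, p) _ _).trans
      (congrArg (· + _) (hom_zsmul (R := R) (T := PolyForm A L₁ L₂) (q + 1, p) _ _)))).trans ?_
    exact neg_one_pow_smul_smul_add q _ _

lemma contr_dPoly (ξ : L₂) (a : PolyForms A L₁ L₂) :
    contr R ξ (S.dPoly a) = S.polyLie ξ a - S.dPoly (contr R ξ a) := by
  have h : contr R ξ ∘ₗ S.dPoly = S.polyLie ξ - S.dPoly ∘ₗ contr R ξ :=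
    linearMap_eq_of_hom (T := PolyForm A L₁ L₂) fun i f => S.contr_dPoly_hom ξ i f
  exact DFunLike.congr_fun h a

lemma polyLie_mul_hom (ξ : L₂) (i k : ℕ × ℕ) (f : PolyForm A L₁ L₂ i) (g : PolyForm A L₁ L₂ k) :
    S.polyLie ξ (formsMul R A L₁ L₂ (phom R A L₁ L₂ i f) (phom R A L₁ L₂ k g)) =
      formsMul R A L₁ L₂ (S.polyLie ξ (phom R A L₁ L₂ i f)) (phom R A L₁ L₂ k g) +
        formsMul R A L₁ L₂ (phom R A L₁ L₂ i f) (S.polyLie ξ (phom R A L₁ L₂ k g)) := by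
  rw [polyLie_phom, polyLie_phom, formsMul_hom, formsMul_hom, formsMul_hom]
  refine (S.polyLie_phom ξ _ _).trans ?_
  refine Eq.trans ?_ (hom_add (R := R) (T := PolyForm A L₁ L₂) _ _ _)
  congr 1
  simp only [formMul_apply]
  rw [← smul_add, map_zsmul]
  congr 1
  exact altDer_shuffle _ ξ _ _ _ _ _ _ _ _ (fun u w => S.act₂.ext_act_extMul _ _ ξ u w) f g

end AlmostTwilled

section Derivation

variable {R : Type*} [CommRing R]
  {T : ℕ × ℕ → Type*} [∀ i, AddCommGroup (T i)] [∀ i, Module R (T i)]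
  {μ : (⨁ i, T i) →ₗ[R] (⨁ i, T i) →ₗ[R] (⨁ i, T i)}

lemma derivation_of_hom {ℓ : (⨁ i, T i) →ₗ[R] (⨁ i, T i)}
    (h : ∀ (i k : ℕ × ℕ) (f : T i) (g : T k), ℓ (μ (hom R i f) (hom R k g)) =
      μ (ℓ (hom R i f)) (hom R k g) + μ (hom R i f) (ℓ (hom R k g))) (a b : ⨁ i, T i) :
    ℓ (μ a b) = μ (ℓ a) b + μ a (ℓ b) := by
  induction a using hom_induction (R := R) (T := T) with
  | hz => simp
  | ha a a' h h' => simp only [map_add, LinearMap.add_apply, h, h']; abel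
  | hh i f =>
    induction b using hom_induction (R := R) (T := T) with
    | hz => simp
    | ha b b' h h' => simp only [map_add, h, h']; abel
    | hh k g => exact h i k f g

end Derivation

namespace AlmostTwilled

variable {R A L₁ L₂ : Type*} [CommRing R] [CommRing A] [Algebra R A]
  [LieRing L₁] [LieAlgebra R L₁] [Module A L₁] [LieRingModule L₁ A] [LieRinehartRing A L₁]
  [LieRinehartAlgebra R A L₁]
  [LieRing L₂] [LieAlgebra R L₂] [Module A L₂] [LieRingModule L₂ A] [LieRinehartRing A L₂]
  [LieRinehartAlgebra R A L₂]
  (S : AlmostTwilled R A L₁ L₂)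

lemma dPoly_mul (i : ℕ × ℕ) (f : PolyForm A L₁ L₂ i) (b : PolyForms A L₁ L₂) :
    S.dPoly (formsMul R A L₁ L₂ (phom R A L₁ L₂ i f) b) =
      formsMul R A L₁ L₂ (S.dPoly (phom R A L₁ L₂ i f)) b +
        (-1 : ℤ) ^ tdeg i • formsMul R A L₁ L₂ (phom R A L₁ L₂ i f) (S.dPoly b) :=
  (isContraction_forms R A L₁ L₂).d_mul_of_cartan (d := S.dPoly) (ℓ := S.polyLie)
    (fun i f => ⟨_, S.dPoly_phom i f⟩) S.evalZero_dPoly S.contr_dPoly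
    (fun ξ => derivation_of_hom (T := PolyForm A L₁ L₂) (S.polyLie_mul_hom ξ)) i f b

lemma dPoly_bidegree : HasBidegree (T := PolyForm A L₁ L₂) (1, 0) S.dPoly := by
  intro i f k hk
  rw [S.dPoly_phom]
  refine hom_apply_ne (fun e => hk ?_) _
  rw [e]
  simp

lemma dPoly_comp_dPoly : S.dPoly ∘ₗ S.dPoly = 0 :=
  linearMap_eq_of_hom (T := PolyForm A L₁ L₂) fun i f => by
    refine (congrArg S.dPoly (S.dPoly_phom i f)).trans ?_
    refine (S.dPoly_phom (i.1 + 1, i.2) _).trans ?_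
    exact (congrArg _ ((S.flat₂.ext i.2).rinehart_rinehart f)).trans (hom_zero _)

end AlmostTwilled

/-! ## The duality map -/

section Duality

variable (R : Type*) {A L₁ L₂ : Type*} [CommRing R] [CommRing A] [Algebra R A]
  [LieRing L₁] [LieAlgebra R L₁] [Module A L₁] [LieRingModule L₁ A] [LieRinehartRing A L₁]
  [LieRinehartAlgebra R A L₁]
  [LieRing L₂] [LieAlgebra R L₂] [Module A L₂] [LieRingModule L₂ A] [LieRinehartRing A L₂]
  [LieRinehartAlgebra R A L₂] {n : ℕ}

variable (A L₁ L₂ n) in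
/-- The homogeneous element of `Alt_A(L₂, Alt_A(L₁, Λ_A^n L₁))` given by `f`. -/
abbrev dhom (i : ℕ × ℕ) (f : DualForm A L₁ L₂ n i) : DualForms A L₁ L₂ n :=
  DirectSum.lof R (ℕ × ℕ) (DualForm A L₁ L₂ n) i f

omit R [CommRing R] [Algebra R A] [LieAlgebra R L₁] [LieRinehartAlgebra R A L₁]
  [LieAlgebra R L₂] [LieRinehartAlgebra R A L₂] in
-- Stated with a free `m` such that `m + p = n` in place of `n - p`, so that degrees can shift by
-- one without truncated subtraction.
lemma duality_lof {m q p : ℕ} (h : m + p = n) (f : PolyForm A L₁ L₂ (q, p)) :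
    duality A L₁ L₂ n (DirectSum.lof A (ℕ × ℕ) (PolyForm A L₁ L₂) (q, p) f) =
      DirectSum.lof A (ℕ × ℕ) (DualForm A L₁ L₂ n) (q, m)
        ((adjointPairing A L₁ h).compAlternatingMap f) := by
  obtain rfl : m = n - p := by omega
  have hp : p ≤ n := by omega
  rw [duality, DirectSum.toModule_lof, dif_pos hp]
  rfl

lemma duality_phom {m q p : ℕ} (h : m + p = n) (f : PolyForm A L₁ L₂ (q, p)) :
    duality A L₁ L₂ n (phom R A L₁ L₂ (q, p) f) =
      dhom R A L₁ L₂ n (q, m) ((adjointPairing A L₁ h).compAlternatingMap f) := by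
  exact duality_lof h f

variable [Module.Finite A L₁] [Module.Projective A L₁]
  (hn : ∀ 𝔭 : PrimeSpectrum A, Module.rankAtStalk (R := A) L₁ 𝔭 = n)

include hn

lemma phom_eq_zero_of_rank_lt {q p : ℕ} (h : n < p) (f : PolyForm A L₁ L₂ (q, p)) :
    phom R A L₁ L₂ (q, p) f = 0 := by
  have : f = 0 := by
    ext v : 1
    exact exteriorPower_eq_zero_of_rank_lt hn h _
  rw [this]
  exact hom_zero _

lemma alternatingMap_eq_zero_of_rank_lt {m : ℕ} {M : Type*} [AddCommGroup M] [Module A M]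
    (h : n < m) (f : L₁ [⋀^Fin m]→ₗ[A] M) : f = 0 := by
  ext v
  rw [← exteriorPower.alternatingMapLinearEquiv_apply_ιMulti f v,
    exteriorPower_eq_zero_of_rank_lt hn h (exteriorPower.ιMulti A m v), map_zero]
  rfl

omit [Module.Finite A L₁] [Module.Projective A L₁] hn in
lemma duality_apply {m q p : ℕ} (h : m + p = n) (a : PolyForms A L₁ L₂) :
    duality A L₁ L₂ n a (q, m) = (adjointPairing A L₁ h).compAlternatingMap (a (q, p)) := by
  induction a using hom_induction (R := A) (T := PolyForm A L₁ L₂) with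
  | hz => ext v w : 2; simp
  | ha a b ha hb =>
    rw [map_add]
    refine (congrArg₂ (· + ·) ha hb).trans ?_
    ext v w : 2
    exact (DFunLike.congr_fun (map_add (adjointPairing A L₁ h) (a (q, p) v) (b (q, p) v)) w).symm
  | hh i f =>
    obtain ⟨q', p'⟩ := i
    by_cases hp : p' ≤ n
    · refine (congrArg (fun z : DualForms A L₁ L₂ n => z (q, m))
        (duality_lof (Nat.sub_add_cancel hp) f)).trans ?_
      by_cases he : (q', p') = (q, p)
      · cases he
        obtain rfl : m = n - p := by omega
        refine (DirectSum.lof_apply A (M := DualForm A L₁ L₂ n) (q, n - p) _).trans ?_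
        rw [hom_apply_same]
      · refine (DirectSum.of_eq_of_ne (β := DualForm A L₁ L₂ n) _ _ _ ?_).trans ?_
        · intro h'
          refine he ?_
          simp only [Prod.mk.injEq] at h' ⊢
          omega
        · rw [hom_apply_ne (fun h' => he h'.symm)]
          ext v w : 2
          simp
    · refine (congrArg (fun z : DualForms A L₁ L₂ n => z (q, m))
        (DirectSum.toModule_lof A (q', p') f)).trans ?_
      rw [dif_neg hp, hom_apply_ne (by simp only [ne_eq, Prod.mk.injEq]; omega)]
      ext v w : 2
      simp

/-- The pairing settles the bidegrees with `p ≤ n`, respectively `m ≤ n`. In the others both sides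
vanish: exterior powers beyond the rank are zero, and alternating maps factor through them. -/
theorem duality_bijective : Function.Bijective (duality A L₁ L₂ n) := by
  constructor
  · refine (injective_iff_map_eq_zero _).2 fun a ha => DFinsupp.ext fun i => ?_
    obtain ⟨q, p⟩ := i
    ext v : 1
    by_cases hp : p ≤ n
    · have h1 := duality_apply (q := q) (Nat.sub_add_cancel hp) a
      rw [ha] at h1
      refine adjointPairing_injective hn (Nat.sub_add_cancel hp) ?_
      rw [← LinearMap.compAlternatingMap_apply, ← h1]
      exact (map_zero _).symm
    · exact exteriorPower_eq_zero_of_rank_lt hn (not_le.1 hp) _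
  · intro b
    induction b using DirectSum.induction_on with
    | zero => exact ⟨0, map_zero _⟩
    | add a b ha hb =>
      obtain ⟨a, rfl⟩ := ha
      obtain ⟨b, rfl⟩ := hb
      exact ⟨a + b, map_add _ _ _⟩
    | of i g =>
      obtain ⟨q, m⟩ := i
      by_cases hm : m ≤ n
      · have h : m + (n - m) = n := by omega
        let e := LinearEquiv.ofBijective _ (adjointPairing_bijective hn h)
        refine ⟨DirectSum.lof A (ℕ × ℕ) (PolyForm A L₁ L₂) (q, n - m)
          (e.symm.toLinearMap.compAlternatingMap g), ?_⟩
        rw [duality_lof h]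
        refine congrArg (DirectSum.of (DualForm A L₁ L₂ n) (q, m)) ?_
        ext v : 1
        exact e.apply_symm_apply (g v)
      · refine ⟨0, ?_⟩
        rw [map_zero]
        have : g = 0 := by
          ext v : 1
          exact alternatingMap_eq_zero_of_rank_lt hn (not_le.1 hm) _
        rw [this]
        exact (map_zero _).symm

end Duality

/-! ### The duality map and `d''`. -/

namespace AlmostTwilled

variable {R A L₁ L₂ : Type*} [CommRing R] [CommRing A] [Algebra R A]
  [LieRing L₁] [LieAlgebra R L₁] [Module A L₁] [LieRingModule L₁ A] [LieRinehartRing A L₁]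
  [LieRinehartAlgebra R A L₁]
  [LieRing L₂] [LieAlgebra R L₂] [Module A L₂] [LieRingModule L₂ A] [LieRinehartRing A L₂]
  [LieRinehartAlgebra R A L₂]
  (S : AlmostTwilled R A L₁ L₂) {n : ℕ}

lemma dDual_dhom (i : ℕ × ℕ) (f : DualForm A L₁ L₂ n i) :
    S.dDual n (dhom R A L₁ L₂ n i f) =
      dhom R A L₁ L₂ n (i.1 + 1, i.2) ((S.act₂.alt (S.act₂.ext n) i.2).rinehart i.1 f) := by
  rw [dDual, dhom, DirectSum.toModule_lof]; rfl

lemma dDual_comp_dDual : S.dDual n ∘ₗ S.dDual n = 0 :=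
  DirectSum.linearMap_ext R fun i => LinearMap.ext fun f => by
    refine (congrArg (S.dDual n) (S.dDual_dhom i f)).trans ?_
    refine (S.dDual_dhom (i.1 + 1, i.2) _).trans ?_
    exact (congrArg _ ((S.flat₂.alt (S.flat₂.ext n) i.2).rinehart_rinehart f)).trans (map_zero _)

/-- By the Leibniz rule for `y₁ ∧ … ∧ y_m ∧ u`, the terms in which `ξ` acts on some `yᵢ` are the
ones subtracted in the action on alternating maps; the term in which it acts on `u` is left. -/
lemma adjointPairing_act {m p : ℕ} (h : m + p = n) (ξ : L₂) (u : ⋀[A]^p L₁) :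
    adjointPairing A L₁ h ((S.act₂.ext p).act ξ u) =
      (S.act₂.alt (S.act₂.ext n) m).act ξ (adjointPairing A L₁ h u) := by
  ext v : 2
  have h1 := S.act₂.coe_ext_act_of_coe_eq_mul h.symm ξ (exteriorPower.ιMulti A m v) u
    (adjointPairing A L₁ h u v) (coe_adjointPairing h u v)
  rw [Conn.alt_act_apply, coe_adjointPairing, AddSubgroupClass.coe_sub, h1,
    AddSubmonoidClass.coe_finsetSum, Conn.ext_act_ιMulti, AddSubmonoidClass.coe_finsetSum,
    Finset.sum_mul]
  simp only [coe_adjointPairing]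
  abel

theorem duality_dPoly [Module.Finite A L₁] [Module.Projective A L₁]
    (hn : ∀ 𝔭 : PrimeSpectrum A, Module.rankAtStalk (R := A) L₁ 𝔭 = n) (a : PolyForms A L₁ L₂) :
    duality A L₁ L₂ n (S.dPoly a) = S.dDual n (duality A L₁ L₂ n a) := by
  induction a using hom_induction (R := R) (T := PolyForm A L₁ L₂) with
  | hz => simp only [map_zero]
  | ha a b ha hb => rw [map_add, map_add, map_add, map_add, ha, hb]
  | hh i f =>
    obtain ⟨q, p⟩ := i
    by_cases hp : p ≤ n
    · have h := Nat.sub_add_cancel hp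
      refine (congrArg _ (S.dPoly_phom (q, p) f)).trans ?_
      refine (duality_phom R h _).trans ?_
      refine Eq.trans ?_ (congrArg (S.dDual n) (duality_phom R h f).symm)
      rw [dDual_dhom]
      congr 1
      exact Conn.compAlternatingMap_rinehart (C := S.act₂.ext p)
        (C' := S.act₂.alt (S.act₂.ext n) (n - p)) _ (S.adjointPairing_act h) f
    · have h1 := phom_eq_zero_of_rank_lt (R := R) (L₂ := L₂) hn (not_le.1 hp) f
      change duality A L₁ L₂ n (S.dPoly (phom R A L₁ L₂ (q, p) f)) =
        S.dDual n (duality A L₁ L₂ n (phom R A L₁ L₂ (q, p) f))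
      rw [h1]
      simp only [map_zero]

end AlmostTwilled

/-! ## Bigraded algebras generated in degrees `(q, 0)` and `(0, 1)` -/

section Generated

variable {R : Type*} [CommRing R]
  {T : ℕ × ℕ → Type*} [∀ i, AddCommGroup (T i)] [∀ i, Module R (T i)]
  {V : Type*}

/-- The bigraded algebra `(T, μ)` is generated by the elements of bidegree `(q, 0)` and the elements
`v x` of bidegree `(0, 1)`. -/
def IsGeneratedBy (μ : (⨁ i, T i) →ₗ[R] (⨁ i, T i) →ₗ[R] (⨁ i, T i)) (v : V → T (0, 1)) : Prop :=
  ∀ P : ∀ i, T i → Prop, (∀ i, P i 0) → (∀ i f g, P i f → P i g → P i (f + g)) →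
    (∀ q α, P (q, 0) α) →
    (∀ x q p (f : T (q, p)) (g : T (q, p + 1)),
      hom R (q, p + 1) g = μ (hom R (0, 1) (v x)) (hom R (q, p) f) → P (q, p) f →
        P (q, p + 1) g) →
    ∀ i f, P i f

lemma exists_eq_hom {a : ⨁ i, T i} {i : ℕ × ℕ} (h : ∀ k, k ≠ i → a k = 0) :
    ∃ f, a = hom R i f := by
  refine ⟨a i, DFinsupp.ext fun k => ?_⟩
  by_cases hk : k = i
  · subst hk
    exact (hom_apply_same k _).symm
  · exact (h k hk).trans (hom_apply_ne hk _).symm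

lemma eq_zero_of_apply {a : ⨁ i, T i} (h : ∀ k, a k = 0) : a = 0 :=
  DFinsupp.ext h

lemma HasBidegree.hom_zero {Δ : (⨁ i, T i) →ₗ[R] (⨁ i, T i)} (hΔ : HasBidegree (0, -1) Δ) (q : ℕ)
    (f : T (q, 0)) : Δ (hom R (q, 0) f) = 0 :=
  eq_zero_of_apply fun k => hΔ _ f k fun h => by
    simp only [Prod.mk.injEq] at h
    omega

lemma HasBidegree.hom_succ {Δ : (⨁ i, T i) →ₗ[R] (⨁ i, T i)} (hΔ : HasBidegree (0, -1) Δ) (q p : ℕ)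
    (f : T (q, p + 1)) : ∃ g, Δ (hom R (q, p + 1) f) = hom R (q, p) g :=
  exists_eq_hom fun k hk => hΔ _ f k fun h => hk (by
    simp only [Prod.mk.injEq] at h
    ext <;> simp only <;> omega)

namespace IsBigradedCommAlgebra

variable {one : ⨁ i, T i} {μ : (⨁ i, T i) →ₗ[R] (⨁ i, T i) →ₗ[R] (⨁ i, T i)}
  (hA : IsBigradedCommAlgebra one μ)

include hA

lemma mul_hom (i j : ℕ × ℕ) (f : T i) (g : T j) :
    ∃ h, μ (hom R i f) (hom R j g) = hom R (i.1 + j.1, i.2 + j.2) h :=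
  exists_eq_hom fun k hk => hA.mul_bidegree i j f g k hk

lemma mul_left_comm (i j : ℕ × ℕ) (f : T i) (g : T j) (z : ⨁ i, T i) :
    μ (hom R i f) (μ (hom R j g) z) =
      (-1 : ℤ) ^ (tdeg i * tdeg j) • μ (hom R j g) (μ (hom R i f) z) := by
  rw [← hA.mul_assoc, hA.mul_comm, map_zsmul, LinearMap.smul_apply, hA.mul_assoc]

end IsBigradedCommAlgebra

namespace IsGeneratedBy

variable {μ : (⨁ i, T i) →ₗ[R] (⨁ i, T i) →ₗ[R] (⨁ i, T i)} {v : V → T (0, 1)}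
  (hv : IsGeneratedBy μ v)

include hv

lemma induction {P : (⨁ i, T i) → Prop} (hz : P 0) (ha : ∀ a b, P a → P b → P (a + b))
    (hform : ∀ q α, P (hom R (q, 0) α)) (hvec : ∀ x a, P a → P (μ (hom R (0, 1) (v x)) a))
    (a : ⨁ i, T i) : P a := by
  induction a using hom_induction (R := R) (T := T) with
  | hz => exact hz
  | ha a b h h' => exact ha a b h h'
  | hh i f =>
    refine hv (fun i f => P (hom R i f)) (fun i => ?_) (fun i f g hf hg => ?_) hform
      (fun x q p f g hg hf => ?_) i f
    · rw [LieRinehartBV.hom_zero]; exact hz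
    · rw [hom_add]; exact ha _ _ hf hg
    · rw [hg]; exact hvec x _ hf

end IsGeneratedBy

end Generated

/-! ## The bracket generated by an operator -/

section Generator

variable {R : Type*} [CommRing R]
  {T : ℕ × ℕ → Type*} [∀ i, AddCommGroup (T i)] [∀ i, Module R (T i)]

/-- Multiplication by `(-1)^|a|`. -/
def parity : (⨁ i, T i) →ₗ[R] (⨁ i, T i) :=
  DirectSum.toModule R (ℕ × ℕ) _ fun i =>
    ((-1 : ℤ) ^ tdeg i) • DirectSum.lof R (ℕ × ℕ) T i

lemma parity_hom (i : ℕ × ℕ) (f : T i) :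
    parity (R := R) (hom R i f) = (-1 : ℤ) ^ tdeg i • hom R i f := by
  rw [parity, hom, DirectSum.toModule_lof]; rfl

/-- The bracket measuring the deviation of `Δ` from being a derivation. -/
def generatedBracket (μ : (⨁ i, T i) →ₗ[R] (⨁ i, T i) →ₗ[R] (⨁ i, T i))
    (Δ : (⨁ i, T i) →ₗ[R] (⨁ i, T i)) : (⨁ i, T i) →ₗ[R] (⨁ i, T i) →ₗ[R] (⨁ i, T i) :=
  (μ ∘ₗ parity).compr₂ Δ - μ ∘ₗ Δ ∘ₗ parity - μ.compl₂ Δ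

variable {μ : (⨁ i, T i) →ₗ[R] (⨁ i, T i) →ₗ[R] (⨁ i, T i)} {Δ : (⨁ i, T i) →ₗ[R] (⨁ i, T i)}

lemma generatedBracket_hom (i : ℕ × ℕ) (f : T i) (b : ⨁ i, T i) :
    generatedBracket μ Δ (hom R i f) b = (-1 : ℤ) ^ tdeg i •
      (Δ (μ (hom R i f) b) - μ (Δ (hom R i f)) b) - μ (hom R i f) (Δ b) := by
  simp only [generatedBracket, LinearMap.sub_apply, LinearMap.compr₂_apply, LinearMap.comp_apply,
    LinearMap.compl₂_apply, parity_hom, map_zsmul, LinearMap.smul_apply, smul_sub]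

lemma isGenerator_generatedBracket (hΔ : HasBidegree (0, -1) Δ) :
    IsGenerator μ (generatedBracket μ Δ) Δ :=
  ⟨hΔ, fun i j f g => by
    rw [generatedBracket_hom]
    rcases neg_one_pow_eq_or ℤ (tdeg i) with h | h <;>
      simp only [h, one_smul, neg_smul, sub_neg_eq_add] <;> abel⟩

lemma IsGenerator.eq_generatedBracket {B : (⨁ i, T i) →ₗ[R] (⨁ i, T i) →ₗ[R] (⨁ i, T i)}
    (h : IsGenerator μ B Δ) : B = generatedBracket μ Δ :=
  linearMap_eq_of_hom fun i f => linearMap_eq_of_hom fun j g => by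
    rw [h.2, (isGenerator_generatedBracket h.1).2]

end Generator

/-! ### The bracket of a Lie generator: skew symmetry and Leibniz rule. -/

section BV

variable {R : Type*} [CommRing R]
  {T : ℕ × ℕ → Type*} [∀ i, AddCommGroup (T i)] [∀ i, Module R (T i)]
  {V : Type*}

/-- `Δ` is an operator of bidegree `(0, -1)` with `Δ (x w) = -x (Δ w) - ℓ_x w`, for operators `ℓ_x`
which are derivations over operators on the generators of bidegrees `(0, 1)` and `(q, 0)`. -/
structure IsLieGenerator (μ : (⨁ i, T i) →ₗ[R] (⨁ i, T i) →ₗ[R] (⨁ i, T i)) (v : V → T (0, 1))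
    (Δ : (⨁ i, T i) →ₗ[R] (⨁ i, T i)) (ℓ : V → (⨁ i, T i) →ₗ[R] (⨁ i, T i))
    (br : V → V → V) (ρ : V → ∀ q, T (q, 0) → T (q, 0)) : Prop where
  bidegree : HasBidegree (0, -1) Δ
  apply_vec : ∀ x w, Δ (μ (hom R (0, 1) (v x)) w) = -μ (hom R (0, 1) (v x)) (Δ w) - ℓ x w
  lie_vec : ∀ x y w, ℓ x (μ (hom R (0, 1) (v y)) w) =
    μ (hom R (0, 1) (v (br x y))) w + μ (hom R (0, 1) (v y)) (ℓ x w)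
  lie_form : ∀ x q (α : T (q, 0)) w, ℓ x (μ (hom R (q, 0) α) w) =
    μ (hom R (q, 0) (ρ x q α)) w + μ (hom R (q, 0) α) (ℓ x w)

namespace IsLieGenerator

variable {one : ⨁ i, T i} {μ : (⨁ i, T i) →ₗ[R] (⨁ i, T i) →ₗ[R] (⨁ i, T i)} {v : V → T (0, 1)}
  {Δ : (⨁ i, T i) →ₗ[R] (⨁ i, T i)} {ℓ : V → (⨁ i, T i) →ₗ[R] (⨁ i, T i)}
  {br : V → V → V} {ρ : V → ∀ q, T (q, 0) → T (q, 0)}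
  (h : IsLieGenerator μ v Δ ℓ br ρ) (hA : IsBigradedCommAlgebra one μ)

include h hA

/-- `Δ` kills the unit for reasons of bidegree, so `ℓ x one` is minus `Δ` of the vector: a
divergence of bidegree `(0, 0)`. Bracketing with the vector is `ℓ x` minus multiplication by this
divergence, and this correction is what turns `ℓ x` into a derivation. -/
lemma exists_lie_one (x : V) : ∃ c : T (0, 0), ℓ x one = hom R (0, 0) c ∧
    Δ (hom R (0, 1) (v x)) = -hom R (0, 0) c := by
  obtain ⟨u, hu⟩ := hA.one_bidegree
  have h1 := h.apply_vec x one
  obtain ⟨g, hg⟩ := h.bidegree.hom_succ 0 0 (v x)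
  rw [hA.mul_one, hu, h.bidegree.hom_zero, map_zero, neg_zero, zero_sub, ← hu] at h1
  refine ⟨-g, ?_, ?_⟩
  · rw [hg] at h1
    rw [← neg_neg (ℓ x one), ← h1]
    exact (map_neg _ g).symm
  · rw [hg, eq_neg_iff_add_eq_zero]
    exact (hom_add (R := R) (0, 0) _ _).symm.trans (by rw [add_neg_cancel]; exact hom_zero _)

lemma bracket_vec (x : V) (w : ⨁ i, T i) :
    generatedBracket μ Δ (hom R (0, 1) (v x)) w = ℓ x w - μ (ℓ x one) w := by
  obtain ⟨c, hc, hc'⟩ := h.exists_lie_one hA x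
  rw [generatedBracket_hom, h.apply_vec, hc', hc]
  simp only [tdeg, zero_add, pow_one, neg_smul, one_smul, map_neg, LinearMap.neg_apply]
  abel

lemma bracket_vec_vec_mul (x y : V) (w : ⨁ i, T i) :
    generatedBracket μ Δ (hom R (0, 1) (v x)) (μ (hom R (0, 1) (v y)) w) =
      μ (hom R (0, 1) (v (br x y))) w +
        μ (hom R (0, 1) (v y)) (generatedBracket μ Δ (hom R (0, 1) (v x)) w) := by
  obtain ⟨c, hc, -⟩ := h.exists_lie_one hA x
  rw [h.bracket_vec hA, h.bracket_vec hA, h.lie_vec, hc, hA.mul_left_comm]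
  simp only [tdeg, zero_add, zero_mul, pow_zero, one_smul, map_sub]
  abel

lemma bracket_vec_form_mul (x : V) (q : ℕ) (α : T (q, 0)) (w : ⨁ i, T i) :
    generatedBracket μ Δ (hom R (0, 1) (v x)) (μ (hom R (q, 0) α) w) =
      μ (hom R (q, 0) (ρ x q α)) w +
        μ (hom R (q, 0) α) (generatedBracket μ Δ (hom R (0, 1) (v x)) w) := by
  obtain ⟨c, hc, -⟩ := h.exists_lie_one hA x
  rw [h.bracket_vec hA, h.bracket_vec hA, h.lie_form, hc, hA.mul_left_comm]
  simp only [tdeg, zero_add, zero_mul, pow_zero, one_smul, map_sub]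
  abel

lemma bracket_vec_one (x : V) : generatedBracket μ Δ (hom R (0, 1) (v x)) one = 0 := by
  rw [h.bracket_vec hA, hA.mul_one, sub_self]

lemma bracket_vec_vec (x y : V) :
    generatedBracket μ Δ (hom R (0, 1) (v x)) (hom R (0, 1) (v y)) =
      hom R (0, 1) (v (br x y)) := by
  have h1 := h.bracket_vec_vec_mul hA x y one
  rwa [h.bracket_vec_one hA, map_zero, add_zero, hA.mul_one, hA.mul_one] at h1

lemma bracket_vec_form (x : V) (q : ℕ) (α : T (q, 0)) :
    generatedBracket μ Δ (hom R (0, 1) (v x)) (hom R (q, 0) α) = hom R (q, 0) (ρ x q α) := by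
  have h1 := h.bracket_vec_form_mul hA x q α one
  rwa [h.bracket_vec_one hA, map_zero, add_zero, hA.mul_one, hA.mul_one] at h1

lemma bracket_form_vec_mul (q : ℕ) (α : T (q, 0)) (x : V) (w : ⨁ i, T i) :
    generatedBracket μ Δ (hom R (q, 0) α) (μ (hom R (0, 1) (v x)) w) =
      -μ (hom R (q, 0) (ρ x q α)) w -
        (-1 : ℤ) ^ q • μ (hom R (0, 1) (v x)) (generatedBracket μ Δ (hom R (q, 0) α) w) := by
  rw [generatedBracket_hom, generatedBracket_hom, h.bidegree.hom_zero, hA.mul_left_comm, map_zsmul,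
    h.apply_vec, h.apply_vec, h.lie_form]
  simp only [map_zero, LinearMap.zero_apply, sub_zero, map_sub, map_neg, map_zsmul]
  rw [hA.mul_left_comm (q, 0) (0, 1)]
  rcases neg_one_pow_eq_or ℤ q with h | h <;> simp [tdeg, h] <;> abel

omit h in
-- Expresses a bracket with `x f` on the left by brackets with `x` and with `f`; it is the step by
-- which the left argument is built up from generators. That `x` brackets by derivations is a
-- hypothesis, since it is proved afterwards by induction on generators.
lemma bracket_vec_mul_left (h : IsLieGenerator μ v Δ ℓ br ρ)
    (hD : ∀ x u w, generatedBracket μ Δ (hom R (0, 1) (v x)) (μ u w) =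
      μ (generatedBracket μ Δ (hom R (0, 1) (v x)) u) w +
        μ u (generatedBracket μ Δ (hom R (0, 1) (v x)) w))
    (x : V) (q p : ℕ) (f : T (q, p)) (g : T (q, p + 1))
    (hg : hom R (q, p + 1) g = μ (hom R (0, 1) (v x)) (hom R (q, p) f)) (b : ⨁ i, T i) :
    generatedBracket μ Δ (hom R (q, p + 1) g) b =
      μ (hom R (0, 1) (v x)) (generatedBracket μ Δ (hom R (q, p) f) b) +
        (-1 : ℤ) ^ (q + p) •
          μ (hom R (q, p) f) (generatedBracket μ Δ (hom R (0, 1) (v x)) b) := by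
  have h1 := hD x (hom R (q, p) f) b
  rw [h.bracket_vec hA x (μ (hom R (q, p) f) b), h.bracket_vec hA x (hom R (q, p) f)] at h1
  have h2 : μ (hom R (q, p) f) (generatedBracket μ Δ (hom R (0, 1) (v x)) b) =
      ℓ x (μ (hom R (q, p) f) b) - μ (ℓ x (hom R (q, p) f)) b := by
    rw [map_sub, LinearMap.sub_apply, hA.mul_assoc] at h1
    rw [sub_eq_iff_eq_add] at h1
    rw [h1]
    abel
  rw [h2, generatedBracket_hom, hg, generatedBracket_hom, hA.mul_assoc, hA.mul_assoc, h.apply_vec,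
    h.apply_vec]
  simp only [map_sub, map_neg, LinearMap.sub_apply, LinearMap.neg_apply, hA.mul_assoc, map_zsmul]
  rw [show tdeg (q, p + 1) = q + p + 1 from rfl, show tdeg (q, p) = q + p from rfl, pow_succ]
  rcases neg_one_pow_eq_or ℤ (q + p) with h | h <;> simp [h] <;> abel

variable (hv : IsGeneratedBy μ v)

include hv

lemma bracket_vec_mul (x : V) (u w : ⨁ i, T i) :
    generatedBracket μ Δ (hom R (0, 1) (v x)) (μ u w) =
      μ (generatedBracket μ Δ (hom R (0, 1) (v x)) u) w +
        μ u (generatedBracket μ Δ (hom R (0, 1) (v x)) w) := by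
  induction u using hv.induction with
  | hz => simp
  | ha a b ha hb => simp only [map_add, LinearMap.add_apply, ha, hb]; abel
  | hform q α => rw [h.bracket_vec_form_mul hA, h.bracket_vec_form hA]
  | hvec y a ha =>
    rw [hA.mul_assoc, h.bracket_vec_vec_mul hA, ha, h.bracket_vec_vec_mul hA]
    simp only [map_add, LinearMap.add_apply, hA.mul_assoc]
    abel

lemma bracket_vec_left (x : V) (q p : ℕ) (f : T (q, p)) (g : T (q, p + 1))
    (hg : hom R (q, p + 1) g = μ (hom R (0, 1) (v x)) (hom R (q, p) f)) (b : ⨁ i, T i) :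
    generatedBracket μ Δ (hom R (q, p + 1) g) b =
      μ (hom R (0, 1) (v x)) (generatedBracket μ Δ (hom R (q, p) f) b) +
        (-1 : ℤ) ^ (q + p) •
          μ (hom R (q, p) f) (generatedBracket μ Δ (hom R (0, 1) (v x)) b) :=
  bracket_vec_mul_left hA h (h.bracket_vec_mul hA hv) x q p f g hg b

omit hv in
lemma bracket_form_form (q q' : ℕ) (α : T (q, 0)) (β : T (q', 0)) :
    generatedBracket μ Δ (hom R (q, 0) α) (hom R (q', 0) β) = 0 := by
  obtain ⟨γ, hγ⟩ := hA.mul_hom _ _ α β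
  rw [generatedBracket_hom, hγ, h.bidegree.hom_zero q', h.bidegree.hom_zero q]
  have : Δ (hom R (q + q', 0) γ) = 0 := h.bidegree.hom_zero _ _
  simp [this]

/-- Induction on `w` over the generators. If `w` is a form, both sides vanish for reasons of
bidegree; if `w` is a vector times something, the vector is moved to the front and
`bracket_form_vec_mul` applies on both sides. -/
lemma bracket_form_form_mul (q q' : ℕ) (α : T (q, 0)) (β : T (q', 0)) (w : ⨁ i, T i) :
    generatedBracket μ Δ (hom R (q, 0) α) (μ (hom R (q', 0) β) w) =
      (-1 : ℤ) ^ ((q + 1) * q') •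
        μ (hom R (q', 0) β) (generatedBracket μ Δ (hom R (q, 0) α) w) := by
  induction w using hv.induction with
  | hz => simp
  | ha a b ha hb => simp only [map_add, ha, hb, smul_add]
  | hform q'' γ =>
    obtain ⟨δ, hδ⟩ := hA.mul_hom _ _ β γ
    rw [hδ, h.bracket_form_form hA, map_zero, smul_zero]
    exact h.bracket_form_form hA _ (q' + q'') α δ
  | hvec x a ha =>
    rw [hA.mul_left_comm, map_zsmul, h.bracket_form_vec_mul hA, h.bracket_form_vec_mul hA, ha]
    simp only [map_sub, map_neg, map_zsmul]
    rw [hA.mul_left_comm (q', 0) (q, 0), hA.mul_left_comm (q', 0) (0, 1)]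
    simp only [tdeg, add_zero, zero_add, mul_one]
    rw [show (q + 1) * q' = q * q' + q' by ring, pow_add, mul_comm q' q]
    rcases neg_one_pow_eq_or ℤ q' with h1 | h1 <;> rcases neg_one_pow_eq_or ℤ (q * q') with h2 | h2
      <;> simp only [h1, h2, one_smul, neg_smul, mul_neg, mul_one, smul_neg, smul_sub, neg_neg]

lemma bracket_form_mul (q : ℕ) (α : T (q, 0)) (j : ℕ × ℕ) (g : T j) (z : ⨁ i, T i) :
    generatedBracket μ Δ (hom R (q, 0) α) (μ (hom R j g) z) =
      μ (generatedBracket μ Δ (hom R (q, 0) α) (hom R j g)) z +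
      (-1 : ℤ) ^ ((q + 1) * tdeg j) •
        μ (hom R j g) (generatedBracket μ Δ (hom R (q, 0) α) z) := by
  refine hv (fun j g => generatedBracket μ Δ (hom R (q, 0) α) (μ (hom R j g) z) =
      μ (generatedBracket μ Δ (hom R (q, 0) α) (hom R j g)) z +
      (-1 : ℤ) ^ ((q + 1) * tdeg j) •
        μ (hom R j g) (generatedBracket μ Δ (hom R (q, 0) α) z)) (fun i => ?_)
    (fun i f g hf hg => ?_) (fun q' β => ?_) (fun x q' p f g hg hf => ?_) j g
  · simp
  · simp only [map_add, LinearMap.add_apply, hf, hg, smul_add]; abel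
  · rw [h.bracket_form_form_mul hA hv, h.bracket_form_form hA, map_zero, LinearMap.zero_apply,
      zero_add]
    rfl
  · simp only [hg, hA.mul_assoc, h.bracket_form_vec_mul hA, hf, map_add, map_sub, map_neg,
      LinearMap.sub_apply, LinearMap.neg_apply, map_zsmul, LinearMap.smul_apply, smul_add]
    rw [show (-1 : ℤ) ^ ((q + 1) * tdeg (q', p + 1)) =
        (-1) ^ ((q + 1) * tdeg (q', p)) * ((-1) ^ q * (-1)) by
      rw [show tdeg (q', p + 1) = tdeg (q', p) + 1 from rfl, ← pow_succ, ← pow_add]; congr 1]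
    rcases neg_one_pow_eq_or ℤ q with h1 | h1 <;>
    rcases neg_one_pow_eq_or ℤ ((q + 1) * tdeg (q', p)) with h2 | h2
      <;> simp [h1, h2] <;> abel

/-- Induction on the left argument. Forms are covered by `bracket_form_mul`, itself an induction on
the middle argument, and multiplication by a vector by the recursion `bracket_vec_left`. -/
theorem bracket_leibniz (i j : ℕ × ℕ) (f : T i) (g : T j) (z : ⨁ i, T i) :
    generatedBracket μ Δ (hom R i f) (μ (hom R j g) z) =
      μ (generatedBracket μ Δ (hom R i f) (hom R j g)) z +
      (-1 : ℤ) ^ ((tdeg i + 1) * tdeg j) •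
        μ (hom R j g) (generatedBracket μ Δ (hom R i f) z) := by
  refine hv (fun i f => generatedBracket μ Δ (hom R i f) (μ (hom R j g) z) =
      μ (generatedBracket μ Δ (hom R i f) (hom R j g)) z +
      (-1 : ℤ) ^ ((tdeg i + 1) * tdeg j) •
        μ (hom R j g) (generatedBracket μ Δ (hom R i f) z)) (fun i => ?_)
    (fun i f g hf hg => ?_) (fun q' β => ?_) (fun x q p f g' hg hf => ?_) i f
  · simp
  · simp only [map_add, LinearMap.add_apply, hf, hg, smul_add]; abel
  · exact h.bracket_form_mul hA hv q' β j g z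
  · rw [h.bracket_vec_left hA hv x q p f g' hg, h.bracket_vec_left hA hv x q p f g' hg,
      h.bracket_vec_left hA hv x q p f g' hg, hf, h.bracket_vec_mul hA hv]
    simp only [map_add, LinearMap.add_apply, map_zsmul, LinearMap.smul_apply, smul_add,
      hA.mul_assoc]
    rw [hA.mul_left_comm (0, 1) j, hA.mul_left_comm (q, p) j]
    rw [show tdeg (q, p + 1) = q + p + 1 from rfl, show tdeg (q, p) = q + p from rfl,
      show tdeg ((0, 1) : ℕ × ℕ) = 1 from rfl]
    simp only [add_mul (q + p), add_mul (q + p + 1), one_mul, pow_add _ _ (tdeg j)]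
    rcases neg_one_pow_eq_or ℤ (tdeg j) with h1 | h1 <;>
    rcases neg_one_pow_eq_or ℤ ((q + p) * tdeg j) with h2 | h2 <;>
    rcases neg_one_pow_eq_or ℤ (q + p) with h3 | h3
      <;> simp [h1, h2, h3] <;> abel

omit hv in
-- Needs no induction: graded commutativity, together with the fact that `Δ` lowers the degree by
-- one, exchanges the terms in the definition of the generated bracket.
theorem bracket_skew (i j : ℕ × ℕ) (f : T i) (g : T j) :
    generatedBracket μ Δ (hom R i f) (hom R j g) =
      -((-1 : ℤ) ^ ((tdeg i + 1) * (tdeg j + 1)) •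
        generatedBracket μ Δ (hom R j g) (hom R i f)) := by
  have key : ∀ (i j : ℕ × ℕ) (f : T i) (g : T j), μ (Δ (hom R i f)) (hom R j g) =
      (-1 : ℤ) ^ ((tdeg i + 1) * tdeg j) • μ (hom R j g) (Δ (hom R i f)) := by
    rintro ⟨q, _ | p⟩ j f g
    · rw [h.bidegree.hom_zero]; simp
    · obtain ⟨f', hf'⟩ := h.bidegree.hom_succ q p f
      rw [hf', hA.mul_comm, show tdeg (q, p + 1) = tdeg (q, p) + 1 from rfl]
      generalize tdeg (q, p) = a
      generalize tdeg j = b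
      rw [show (a + 1 + 1) * b = a * b + (b + b) by ring, pow_add _ _ (b + b),
        Even.neg_one_pow ⟨b, rfl⟩, mul_one]
  rw [generatedBracket_hom, generatedBracket_hom, key i j, key j i, hA.mul_comm i j, map_zsmul]
  rw [show (tdeg i + 1) * (tdeg j + 1) = tdeg i * tdeg j + tdeg i + tdeg j + 1 by ring,
    show (tdeg i + 1) * tdeg j = tdeg i * tdeg j + tdeg j by ring,
    show (tdeg j + 1) * tdeg i = tdeg i * tdeg j + tdeg i by ring]
  generalize tdeg i = a
  generalize tdeg j = b
  generalize a * b = c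
  simp only [pow_add, pow_one]
  rcases neg_one_pow_eq_or ℤ a with h1 | h1 <;>
    rcases neg_one_pow_eq_or ℤ b with h2 | h2 <;>
    rcases neg_one_pow_eq_or ℤ c with h3 | h3
      <;> simp only [h1, h2, h3, one_smul, neg_smul, mul_neg, mul_one, smul_neg, smul_sub, neg_neg,
        neg_sub] <;> abel

omit hv in
lemma bracket_bidegree (i j : ℕ × ℕ) (f : T i) (g : T j) (k : ℕ × ℕ)
    (hk : ((k.1 : ℤ), (k.2 : ℤ)) ≠ ((i.1 : ℤ) + j.1, (i.2 : ℤ) + j.2 - 1)) :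
    generatedBracket μ Δ (hom R i f) (hom R j g) k = 0 := by
  have h1 : Δ (μ (hom R i f) (hom R j g)) k = 0 := by
    obtain ⟨fg, hfg⟩ := hA.mul_hom i j f g
    rw [hfg]
    refine h.bidegree _ fg k fun e => hk ?_
    rw [e]
    simp only [Prod.mk.injEq]
    push_cast
    omega
  have h2 : μ (Δ (hom R i f)) (hom R j g) k = 0 := by
    obtain ⟨q, _ | p⟩ := i
    · rw [h.bidegree.hom_zero, map_zero]; rfl
    · obtain ⟨f', hf'⟩ := h.bidegree.hom_succ q p f
      rw [hf']
      refine hA.mul_bidegree _ _ _ _ k fun e => hk ?_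
      rw [e]
      simp only [Prod.mk.injEq]
      push_cast
      omega
  have h3 : μ (hom R i f) (Δ (hom R j g)) k = 0 := by
    obtain ⟨q, _ | p⟩ := j
    · rw [h.bidegree.hom_zero, map_zero]; rfl
    · obtain ⟨f', hf'⟩ := h.bidegree.hom_succ q p g
      rw [hf']
      refine hA.mul_bidegree _ _ _ _ k fun e => hk ?_
      rw [e]
      simp only [Prod.mk.injEq]
      push_cast
      omega
  rw [generatedBracket_hom]
  change ((-1 : ℤ) ^ tdeg i • (Δ (μ (hom R i f) (hom R j g)) k - μ (Δ (hom R i f)) (hom R j g) k)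
    - μ (hom R i f) (Δ (hom R j g)) k) = 0
  rw [h1, h2, h3]
  simp

end IsLieGenerator

end BV

/-! ## Brackets on bigraded algebras generated in degrees `(q, 0)` and `(0, 1)` -/

section Chain

variable {R : Type*} [CommRing R]
  {T : ℕ × ℕ → Type*} [∀ i, AddCommGroup (T i)] [∀ i, Module R (T i)]
  {V : Type*} {μ : (⨁ i, T i) →ₗ[R] (⨁ i, T i) →ₗ[R] (⨁ i, T i)} {v : V → T (0, 1)}

/-- `φ` is a derivation of parity `e`. -/
def IsGradedDerivation (μ : (⨁ i, T i) →ₗ[R] (⨁ i, T i) →ₗ[R] (⨁ i, T i)) (e : ℕ)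
    (φ : (⨁ i, T i) →ₗ[R] (⨁ i, T i)) : Prop :=
  ∀ (j : ℕ × ℕ) (g : T j) (z : ⨁ i, T i), φ (μ (hom R j g) z) =
    μ (φ (hom R j g)) z + (-1 : ℤ) ^ (e * tdeg j) • μ (hom R j g) (φ z)

lemma IsGeneratedBy.derivation_eq_zero (hv : IsGeneratedBy μ v) {e : ℕ}
    {φ : (⨁ i, T i) →ₗ[R] (⨁ i, T i)} (hφ : IsGradedDerivation μ e φ)
    (hvec : ∀ x, φ (hom R (0, 1) (v x)) = 0) (hform : ∀ q α, φ (hom R (q, 0) α) = 0) :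
    φ = 0 := by
  refine LinearMap.ext fun a => ?_
  induction a using hv.induction with
  | hz => simp
  | ha a b ha hb => rw [map_add, ha, hb]; simp
  | hform q α => exact hform q α
  | hvec x a ha => rw [hφ, hvec, ha]; simp

/-- A family of derivations which is symmetric up to signs vanishes if it vanishes on pairs of
generators. -/
lemma IsGeneratedBy.family_eq_zero (hv : IsGeneratedBy μ v) {e : ℕ × ℕ → ℕ}
    {F : ∀ i, T i → (⨁ i, T i) →ₗ[R] (⨁ i, T i)}
    (hF : ∀ i f, IsGradedDerivation μ (e i) (F i f))
    (hs : ∀ i j (f : T i) (g : T j), F i f (hom R j g) = 0 → F j g (hom R i f) = 0)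
    (hvv : ∀ x y, F (0, 1) (v x) (hom R (0, 1) (v y)) = 0)
    (hvf : ∀ x q α, F (0, 1) (v x) (hom R (q, 0) α) = 0)
    (hff : ∀ q (α : T (q, 0)) q' (β : T (q', 0)), F (q, 0) α (hom R (q', 0) β) = 0) (i : ℕ × ℕ)
    (f : T i) : F i f = 0 := by
  have h1 : ∀ x, F (0, 1) (v x) = 0 := fun x =>
    hv.derivation_eq_zero (hF _ _) (hvv x) (hvf x)
  have h2 : ∀ q α, F (q, 0) α = 0 := fun q α =>
    hv.derivation_eq_zero (hF _ _) (fun x => hs _ _ _ _ (hvf x q α)) (hff q α)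
  refine hv.derivation_eq_zero (hF _ _) (fun x => hs _ _ _ _ ?_) fun q α => hs _ _ _ _ ?_
  · rw [h1, LinearMap.zero_apply]
  · rw [h2, LinearMap.zero_apply]

end Chain

/-! ### Brackets by derivations: uniqueness, Jacobi identity and compatible differentials from
generators. -/

section Bracket

variable {R : Type*} [CommRing R]
  {T : ℕ × ℕ → Type*} [∀ i, AddCommGroup (T i)] [∀ i, Module R (T i)]
  {V : Type*}

/-- A skew-symmetric bracket of bidegree `(0, -1)` by derivations, not necessarily satisfying the
Jacobi identity. -/
structure IsSkewDerivationBracket (μ B : (⨁ i, T i) →ₗ[R] (⨁ i, T i) →ₗ[R] (⨁ i, T i)) : Prop where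
  bidegree : ∀ (i j : ℕ × ℕ) (f : T i) (g : T j) (k : ℕ × ℕ),
    ((k.1 : ℤ), (k.2 : ℤ)) ≠ ((i.1 : ℤ) + j.1, (i.2 : ℤ) + j.2 - 1) →
      B (hom R i f) (hom R j g) k = 0
  skew : ∀ (i j : ℕ × ℕ) (f : T i) (g : T j),
    B (hom R i f) (hom R j g) =
      -((-1 : ℤ) ^ ((tdeg i + 1) * (tdeg j + 1)) • B (hom R j g) (hom R i f))
  leibniz : ∀ (i j : ℕ × ℕ) (f : T i) (g : T j) (z : ⨁ i, T i),
    B (hom R i f) (μ (hom R j g) z) = μ (B (hom R i f) (hom R j g)) z +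
      (-1 : ℤ) ^ ((tdeg i + 1) * tdeg j) • μ (hom R j g) (B (hom R i f) z)

lemma IsBigradedGerstenhaber.isSkewDerivationBracket {one : ⨁ i, T i}
    {μ B : (⨁ i, T i) →ₗ[R] (⨁ i, T i) →ₗ[R] (⨁ i, T i)} (h : IsBigradedGerstenhaber one μ B) :
    IsSkewDerivationBracket μ B :=
  ⟨h.bracket_bidegree, h.bracket_skew, h.bracket_leibniz⟩

namespace IsSkewDerivationBracket

variable {μ B B' : (⨁ i, T i) →ₗ[R] (⨁ i, T i) →ₗ[R] (⨁ i, T i)} {v : V → T (0, 1)}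
  (hB : IsSkewDerivationBracket μ B)

include hB

lemma form_form (q q' : ℕ) (α : T (q, 0)) (β : T (q', 0)) :
    B (hom R (q, 0) α) (hom R (q', 0) β) = 0 :=
  eq_zero_of_apply fun k => hB.bidegree _ _ α β k fun h => by
    simp only [Prod.mk.injEq] at h
    omega

lemma exists_hom (i j : ℕ × ℕ) (f : T i) (g : T j) : B (hom R i f) (hom R j g) = 0 ∨
    ∃ (k : ℕ × ℕ) (h : T k), tdeg k + 1 = tdeg i + tdeg j ∧
      B (hom R i f) (hom R j g) = hom R k h := by
  obtain ⟨q, p⟩ := i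
  obtain ⟨q', p'⟩ := j
  by_cases hp : p + p' = 0
  · obtain ⟨rfl, rfl⟩ : p = 0 ∧ p' = 0 := by omega
    exact Or.inl (hB.form_form q q' f g)
  · obtain ⟨h, hh⟩ := exists_eq_hom (R := R) (T := T) (a := B (hom R (q, p) f) (hom R (q', p') g))
      (i := (q + q', p + p' - 1)) fun k hk => hB.bidegree _ _ f g k fun h => hk (by
        simp only [Prod.mk.injEq] at h
        ext <;> simp only <;> omega)
    exact Or.inr ⟨_, h, by simp only [tdeg]; omega, hh⟩

lemma leibniz_bracket_left (i j k : ℕ × ℕ) (f : T i) (g : T j) (h : T k) (z : ⨁ i, T i) :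
    B (B (hom R i f) (hom R j g)) (μ (hom R k h) z) =
      μ (B (B (hom R i f) (hom R j g)) (hom R k h)) z +
        (-1 : ℤ) ^ ((tdeg i + tdeg j) * tdeg k) •
          μ (hom R k h) (B (B (hom R i f) (hom R j g)) z) := by
  rcases hB.exists_hom i j f g with h0 | ⟨l, u, hl, h0⟩
  · simp [h0]
  · rw [h0, hB.leibniz, hl]

lemma leibniz_bracket_right (i j k : ℕ × ℕ) (f : T i) (g : T j) (h : T k) (z : ⨁ i, T i) :
    B (hom R i f) (μ (B (hom R j g) (hom R k h)) z) =
      μ (B (hom R i f) (B (hom R j g) (hom R k h))) z +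
        (-1 : ℤ) ^ ((tdeg i + 1) * (tdeg j + 1 + tdeg k)) •
          μ (B (hom R j g) (hom R k h)) (B (hom R i f) z) := by
  rcases hB.exists_hom j k g h with h0 | ⟨l, u, hl, h0⟩
  · simp [h0]
  · rw [h0, hB.leibniz, show tdeg j + 1 + tdeg k = tdeg l + 2 by omega, mul_add _ _ 2,
      pow_add _ _ (_ * 2), pow_mul' (-1 : ℤ) _ 2]
    simp

lemma skew_bracket_left (i j k : ℕ × ℕ) (f : T i) (g : T j) (h : T k) :
    B (B (hom R i f) (hom R j g)) (hom R k h) =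
      -((-1 : ℤ) ^ ((tdeg i + tdeg j) * (tdeg k + 1)) •
        B (hom R k h) (B (hom R i f) (hom R j g))) := by
  rcases hB.exists_hom i j f g with h0 | ⟨l, u, hl, h0⟩
  · simp [h0]
  · rw [h0, hB.skew, hl]

/-- The difference of the two brackets is a skew family of derivations, and on pairs of forms both
brackets vanish because their second degree would be negative. -/
lemma eq_of_generators (hB' : IsSkewDerivationBracket μ B') (hv : IsGeneratedBy μ v)
    (hvv : ∀ x y, B (hom R (0, 1) (v x)) (hom R (0, 1) (v y)) =
      B' (hom R (0, 1) (v x)) (hom R (0, 1) (v y)))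
    (hvf : ∀ x q α, B (hom R (0, 1) (v x)) (hom R (q, 0) α) =
      B' (hom R (0, 1) (v x)) (hom R (q, 0) α)) : B = B' := by
  have H := hv.family_eq_zero (e := fun i => tdeg i + 1)
    (F := fun i f => B (hom R i f) - B' (hom R i f))
    (fun i f j g z => by
      simp only [LinearMap.sub_apply, hB.leibniz, hB'.leibniz, map_sub, smul_sub]
      abel)
    (fun i j f g hfg => by
      rw [LinearMap.sub_apply] at hfg ⊢
      rw [hB.skew, hB'.skew, neg_sub_neg, ← smul_sub, ← neg_sub, hfg]
      simp)
    (fun x y => by rw [LinearMap.sub_apply, hvv, sub_self])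
    (fun x q α => by rw [LinearMap.sub_apply, hvf, sub_self])
    (fun q α q' β => by rw [LinearMap.sub_apply, hB.form_form, hB'.form_form, sub_self])
  exact linearMap_eq_of_hom fun i f => sub_eq_zero.1 (H i f)

/-- The deviation of the bracket from the Jacobi identity. -/
def jacobiator (B : (⨁ i, T i) →ₗ[R] (⨁ i, T i) →ₗ[R] (⨁ i, T i)) (i j : ℕ × ℕ) (f : T i)
    (g : T j) : (⨁ i, T i) →ₗ[R] (⨁ i, T i) :=
  B (hom R i f) ∘ₗ B (hom R j g) - B (B (hom R i f) (hom R j g)) -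
    (-1 : ℤ) ^ ((tdeg i + 1) * (tdeg j + 1)) • (B (hom R j g) ∘ₗ B (hom R i f))

omit hB in
lemma jacobiator_apply (i j : ℕ × ℕ) (f : T i) (g : T j) (z : ⨁ i, T i) :
    jacobiator B i j f g z = B (hom R i f) (B (hom R j g) z) -
      B (B (hom R i f) (hom R j g)) z -
      (-1 : ℤ) ^ ((tdeg i + 1) * (tdeg j + 1)) • B (hom R j g) (B (hom R i f) z) := rfl

/-- As for a commutator of derivations: the mixed terms, in which each of the two outer arguments
hits a different factor, cancel. This needs the Leibniz rule but not the Jacobi identity. -/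
lemma jacobiator_isGradedDerivation (i j : ℕ × ℕ) (f : T i) (g : T j) :
    IsGradedDerivation μ (tdeg i + tdeg j) (jacobiator B i j f g) := by
  intro k h z
  simp only [jacobiator_apply, hB.leibniz _ k, map_add, map_zsmul, hB.leibniz_bracket_left,
    hB.leibniz_bracket_right, map_sub, LinearMap.sub_apply, LinearMap.smul_apply]
  generalize tdeg i = a
  generalize tdeg j = b
  generalize tdeg k = c
  rw [show (a + 1) * (b + 1 + c) = (a + 1) * (b + 1) + (a + 1) * c by ring,
    show (b + 1) * (a + 1 + c) = (a + 1) * (b + 1) + (b + 1) * c by ring,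
    show (-1 : ℤ) ^ ((a + b) * c) = (-1) ^ ((a + 1) * c) * (-1) ^ ((b + 1) * c) by
      rw [← pow_add, ← add_mul, show a + 1 + (b + 1) = a + b + 2 by ring, add_mul (a + b) 2,
        pow_add _ _ (2 * c), pow_mul (-1 : ℤ) 2]; simp]
  simp only [pow_add _ ((a + 1) * (b + 1))]
  rcases neg_one_pow_eq_or ℤ ((a + 1) * (b + 1)) with h1 | h1 <;>
    rcases neg_one_pow_eq_or ℤ ((a + 1) * c) with h2 | h2 <;>
    rcases neg_one_pow_eq_or ℤ ((b + 1) * c) with h3 | h3 <;>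
    simp only [h1, h2, h3, one_smul, neg_smul, mul_neg, mul_one, smul_neg, smul_sub, neg_neg,
      smul_add] <;> abel

lemma jacobiator_swap {i j : ℕ × ℕ} {f : T i} {g : T j} {z : ⨁ i, T i}
    (h : jacobiator B i j f g z = 0) : jacobiator B j i g f z = 0 := by
  rw [jacobiator_apply] at h ⊢
  rw [hB.skew j i, map_neg, map_zsmul, LinearMap.neg_apply, LinearMap.smul_apply,
    mul_comm (tdeg j + 1)]
  rcases neg_one_pow_eq_or ℤ ((tdeg i + 1) * (tdeg j + 1)) with h1 | h1 <;> rw [h1] at h ⊢ <;>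
    simp only [one_smul, neg_smul, neg_neg] at h ⊢
  · rw [← neg_eq_zero, ← h]; abel
  · rw [← h]; abel

/-- Follows from skew symmetry alone. Here the last two arguments are exchanged and in
`jacobiator_swap` the first two, so vanishing of the Jacobiator is invariant under all permutations
of homogeneous arguments. -/
lemma jacobiator_rotate {i j k : ℕ × ℕ} {f : T i} {g : T j} {u : T k}
    (h : jacobiator B i j f g (hom R k u) = 0) : jacobiator B i k f u (hom R j g) = 0 := by
  rw [jacobiator_apply] at h ⊢
  rw [hB.skew j k, map_neg, map_zsmul, hB.skew_bracket_left i j k] at h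
  rw [hB.skew_bracket_left i k j]
  generalize tdeg i = a at *
  generalize tdeg j = b at *
  generalize tdeg k = c at *
  rw [show (-1 : ℤ) ^ ((a + b) * (c + 1)) = (-1) ^ ((a + 1) * (c + 1)) * (-1) ^ ((b + 1) * (c + 1))
    by rw [← pow_add, ← add_mul, show a + 1 + (b + 1) = a + b + 2 by ring, add_mul (a + b) 2,
        pow_add _ _ (2 * (c + 1)), pow_mul (-1 : ℤ) 2]; simp] at h
  rw [show (-1 : ℤ) ^ ((a + c) * (b + 1)) = (-1) ^ ((a + 1) * (b + 1)) * (-1) ^ ((b + 1) * (c + 1))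
    by rw [← pow_add, mul_comm (b + 1), ← add_mul, show a + 1 + (c + 1) = a + c + 2 by ring,
        add_mul (a + c) 2, pow_add _ _ (2 * (b + 1)), pow_mul (-1 : ℤ) 2]; simp]
  rcases neg_one_pow_eq_or ℤ ((a + 1) * (b + 1)) with h1 | h1 <;>
    rcases neg_one_pow_eq_or ℤ ((a + 1) * (c + 1)) with h2 | h2 <;>
    rcases neg_one_pow_eq_or ℤ ((b + 1) * (c + 1)) with h3 | h3 <;>
    simp only [h1, h2, h3, one_smul, neg_smul, mul_neg, mul_one, neg_neg,
      sub_neg_eq_add] at h ⊢ <;>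
    first
    | (rw [← h]; abel1)
    | (rw [← neg_eq_zero, ← h]; abel1)

/-- The principle `family_eq_zero` is applied three times, with first argument a vector, then a
form, then arbitrary; the symmetries feed each stage into the next. Triples of forms need no
hypothesis since brackets of forms vanish. -/
theorem jacobi_of_generators (hv : IsGeneratedBy μ v)
    (hvvv : ∀ x y z, jacobiator B (0, 1) (0, 1) (v x) (v y) (hom R (0, 1) (v z)) = 0)
    (hvvf : ∀ x y q α, jacobiator B (0, 1) (0, 1) (v x) (v y) (hom R (q, 0) α) = 0)
    (hvff : ∀ x q α q' β, jacobiator B (0, 1) (q, 0) (v x) α (hom R (q', 0) β) = 0)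
    (i j : ℕ × ℕ) (f : T i) (g : T j) : jacobiator B i j f g = 0 := by
  have hv1 : ∀ x j g, jacobiator B (0, 1) j (v x) g = 0 := fun x =>
    hv.family_eq_zero (hF := fun j g => hB.jacobiator_isGradedDerivation _ j _ g)
      (fun _ _ _ _ h => hB.jacobiator_rotate h) (hvvv x) (hvvf x) (hvff x)
  have hf1 : ∀ q α j g, jacobiator B (q, 0) j α g = 0 := fun q α =>
    hv.family_eq_zero (hF := fun j g => hB.jacobiator_isGradedDerivation _ j _ g)
      (fun _ _ _ _ h => hB.jacobiator_rotate h)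
      (fun x y => hB.jacobiator_swap (by rw [hv1]; rfl))
      (fun x q α => hB.jacobiator_swap (by rw [hv1]; rfl))
      (fun q' β q'' γ => by
        rw [jacobiator_apply, hB.form_form, hB.form_form, hB.form_form]
        simp)
  exact hv.family_eq_zero (F := fun j g => jacobiator B i j f g)
    (hF := fun j g => hB.jacobiator_isGradedDerivation _ j _ g)
    (fun _ _ _ _ h => hB.jacobiator_rotate h)
    (fun x y => hB.jacobiator_swap (by rw [hv1]; rfl))
    (fun x q α => hB.jacobiator_swap (by rw [hv1]; rfl))
    (fun q' β q'' γ => hB.jacobiator_swap (by rw [hf1]; rfl)) j g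

/-- The deviation of `d` from being a derivation of the bracket. -/
def bracketDefect (B : (⨁ i, T i) →ₗ[R] (⨁ i, T i) →ₗ[R] (⨁ i, T i))
    (d : (⨁ i, T i) →ₗ[R] (⨁ i, T i)) (i : ℕ × ℕ) (f : T i) : (⨁ i, T i) →ₗ[R] (⨁ i, T i) :=
  d ∘ₗ B (hom R i f) - B (d (hom R i f)) + (-1 : ℤ) ^ tdeg i • (B (hom R i f) ∘ₗ d)

omit hB in
lemma bracketDefect_apply (d : (⨁ i, T i) →ₗ[R] (⨁ i, T i)) (i : ℕ × ℕ) (f : T i)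
    (z : ⨁ i, T i) : bracketDefect B d i f z =
      d (B (hom R i f) z) - B (d (hom R i f)) z + (-1 : ℤ) ^ tdeg i • B (hom R i f) (d z) := rfl

/-- The defect is a derivation in its second argument and symmetric up to sign, so the generators
suffice. For two forms it vanishes because `d` of a form is again a form, and forms bracket to zero.
Homogeneity of `d f` is needed to apply the Leibniz rule and skew symmetry to it. -/
theorem bracketDefect_eq_zero (hv : IsGeneratedBy μ v) {d : (⨁ i, T i) →ₗ[R] (⨁ i, T i)}
    (hd : ∀ (i : ℕ × ℕ) (f : T i), ∃ g : T (i.1 + 1, i.2),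
      d (hom R i f) = hom R (i.1 + 1, i.2) g)
    (hdm : ∀ (i : ℕ × ℕ) (f : T i) (b : ⨁ i, T i), d (μ (hom R i f) b) =
      μ (d (hom R i f)) b + (-1 : ℤ) ^ tdeg i • μ (hom R i f) (d b))
    (hvv : ∀ x y, bracketDefect B d (0, 1) (v x) (hom R (0, 1) (v y)) = 0)
    (hvf : ∀ x q α, bracketDefect B d (0, 1) (v x) (hom R (q, 0) α) = 0)
    (i : ℕ × ℕ) (f : T i) : bracketDefect B d i f = 0 := by
  have hdeg : ∀ i : ℕ × ℕ, tdeg (i.1 + 1, i.2) = tdeg i + 1 := fun i => by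
    simp only [tdeg]; omega
  refine hv.family_eq_zero (e := tdeg) (fun i f j g z => ?_) (fun i j f g h => ?_) hvv hvf
    (fun q α q' β => ?_) i f
  · have hl : B (d (hom R i f)) (μ (hom R j g) z) = μ (B (d (hom R i f)) (hom R j g)) z +
        (-1 : ℤ) ^ (tdeg i * tdeg j) • μ (hom R j g) (B (d (hom R i f)) z) := by
      obtain ⟨f', hf'⟩ := hd i f
      rw [hf', hB.leibniz, hdeg, show (tdeg i + 1 + 1) * tdeg j = tdeg i * tdeg j + (tdeg j + tdeg j)
        by ring, pow_add _ _ (tdeg j + tdeg j), Even.neg_one_pow ⟨_, rfl⟩, mul_one]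
    have hr : B (hom R i f) (μ (d (hom R j g)) z) = μ (B (hom R i f) (d (hom R j g))) z +
        (-1 : ℤ) ^ ((tdeg i + 1) * (tdeg j + 1)) • μ (d (hom R j g)) (B (hom R i f) z) := by
      obtain ⟨g', hg'⟩ := hd j g
      rw [hg', hB.leibniz, hdeg]
    have hb : d (μ (B (hom R i f) (hom R j g)) z) = μ (d (B (hom R i f) (hom R j g))) z +
        (-1 : ℤ) ^ (tdeg i + tdeg j + 1) • μ (B (hom R i f) (hom R j g)) (d z) := by
      rcases hB.exists_hom i j f g with h0 | ⟨l, u, hl, h0⟩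
      · simp [h0]
      · rw [h0, hdm, ← hl]
        simp only [pow_succ, mul_neg, mul_one, neg_neg]
    simp only [bracketDefect_apply, hdm _ _ z, hB.leibniz _ j, map_add, map_zsmul, hl, hr, hb,
      hdm, map_sub, LinearMap.sub_apply, LinearMap.add_apply, LinearMap.smul_apply]
    generalize tdeg i = a
    generalize tdeg j = b
    rw [show (a + 1) * (b + 1) = a * b + a + b + 1 by ring, show (a + 1) * b = a * b + b by ring]
    generalize a * b = c
    simp only [pow_add, pow_one]
    rcases neg_one_pow_eq_or ℤ a with h1 | h1 <;> rcases neg_one_pow_eq_or ℤ b with h2 | h2 <;>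
      rcases neg_one_pow_eq_or ℤ c with h3 | h3 <;>
      simp only [h1, h2, h3, one_smul, neg_smul, mul_neg, mul_one, smul_neg, smul_sub, neg_neg,
        smul_add] <;> abel
  · have hl : B (d (hom R j g)) (hom R i f) =
        -((-1 : ℤ) ^ (tdeg j * (tdeg i + 1)) • B (hom R i f) (d (hom R j g))) := by
      obtain ⟨g', hg'⟩ := hd j g
      rw [hg', hB.skew, hdeg, show (tdeg j + 1 + 1) * (tdeg i + 1) =
        tdeg j * (tdeg i + 1) + ((tdeg i + 1) + (tdeg i + 1)) by ring,
        pow_add _ _ (tdeg i + 1 + (tdeg i + 1)), Even.neg_one_pow ⟨_, rfl⟩, mul_one]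
    have hr : B (hom R j g) (d (hom R i f)) =
        -((-1 : ℤ) ^ ((tdeg j + 1) * tdeg i) • B (d (hom R i f)) (hom R j g)) := by
      obtain ⟨f', hf'⟩ := hd i f
      rw [hf', hB.skew, hdeg, show (tdeg j + 1) * (tdeg i + 1 + 1) =
        (tdeg j + 1) * tdeg i + ((tdeg j + 1) + (tdeg j + 1)) by ring,
        pow_add _ _ (tdeg j + 1 + (tdeg j + 1)), Even.neg_one_pow ⟨_, rfl⟩, mul_one]
    rw [bracketDefect_apply] at h ⊢
    rw [hB.skew j i, hl, hr, map_neg, map_zsmul]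
    generalize tdeg i = a at *
    generalize tdeg j = b at *
    rw [show (b + 1) * (a + 1) = a * b + a + b + 1 by ring, show b * (a + 1) = a * b + b by ring,
      show (b + 1) * a = a * b + a by ring]
    generalize a * b = c at *
    simp only [pow_add, pow_one] at h ⊢
    rcases neg_one_pow_eq_or ℤ a with h1 | h1 <;> rcases neg_one_pow_eq_or ℤ b with h2 | h2 <;>
      rcases neg_one_pow_eq_or ℤ c with h3 | h3 <;>
      simp only [h1, h2, h3, one_smul, neg_smul, mul_neg, mul_one, neg_neg,
        sub_neg_eq_add, smul_neg] at h ⊢ <;>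
      first
      | (rw [← h]; abel1)
      | (rw [← neg_eq_zero, ← h]; abel1)
  · obtain ⟨α', hα'⟩ := hd (q, 0) α
    obtain ⟨β', hβ'⟩ := hd (q', 0) β
    have h1 := hB.form_form (q + 1) q' α' β
    have h2 := hB.form_form q (q' + 1) α β'
    rw [bracketDefect_apply, hα', hβ', hB.form_form]
    rw [h1, h2]
    simp

end IsSkewDerivationBracket

end Bracket

section BV

variable {R : Type*} [CommRing R]
  {T : ℕ × ℕ → Type*} [∀ i, AddCommGroup (T i)] [∀ i, Module R (T i)]
  {V : Type*}
  {one : ⨁ i, T i} {μ : (⨁ i, T i) →ₗ[R] (⨁ i, T i) →ₗ[R] (⨁ i, T i)} {v : V → T (0, 1)}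
  {Δ : (⨁ i, T i) →ₗ[R] (⨁ i, T i)} {ℓ : V → (⨁ i, T i) →ₗ[R] (⨁ i, T i)}
  {br : V → V → V} {ρ : V → ∀ q, T (q, 0) → T (q, 0)}

/-- On generators the Jacobi identity is the Jacobi identity of `br`, the compatibility of `ρ` with
`br`, or, with one vector and two forms, an identity between zeros. -/
theorem IsLieGenerator.isBigradedGerstenhaber (h : IsLieGenerator μ v Δ ℓ br ρ)
    (hA : IsBigradedCommAlgebra one μ) (hv : IsGeneratedBy μ v)
    (hbr : ∀ x y z, v (br x (br y z)) = v (br (br x y) z) + v (br y (br x z)))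
    (hρ : ∀ x y q α, ρ x q (ρ y q α) = ρ (br x y) q α + ρ y q (ρ x q α)) :
    IsBigradedGerstenhaber one μ (generatedBracket μ Δ) := by
  have hB : IsSkewDerivationBracket μ (generatedBracket μ Δ) :=
    ⟨h.bracket_bidegree hA, h.bracket_skew hA, h.bracket_leibniz hA hv⟩
  have hJ := hB.jacobi_of_generators hv
    (fun x y z => by
      rw [IsSkewDerivationBracket.jacobiator_apply]
      simp only [h.bracket_vec_vec hA]
      rw [hbr x y z, hom_add]
      simp [tdeg])
    (fun x y q α => by
      rw [IsSkewDerivationBracket.jacobiator_apply]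
      simp only [h.bracket_vec_vec hA, h.bracket_vec_form hA]
      rw [hρ x y q α, hom_add]
      simp [tdeg])
    (fun x q α q' β => by
      simp only [IsSkewDerivationBracket.jacobiator_apply, h.bracket_vec_form hA,
        h.bracket_form_form hA, map_zero, sub_zero, smul_zero])
  exact
    { hA with
      bracket_bidegree := hB.bidegree
      bracket_skew := hB.skew
      bracket_leibniz := hB.leibniz
      bracket_jacobi := fun i j f g z => by
        have h1 := DFunLike.congr_fun (hJ i j f g) z
        rw [IsSkewDerivationBracket.jacobiator_apply, LinearMap.zero_apply, sub_sub,
          sub_eq_zero] at h1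
        exact h1 }

end BV

/-! ## Cartan calculus on the dual side -/

lemma hom_neg {R : Type*} [CommRing R]
    {T : ℕ × ℕ → Type*} [∀ i, AddCommGroup (T i)] [∀ i, Module R (T i)] (i : ℕ × ℕ) (f : T i) :
    hom R i (-f) = -hom R i f := map_neg _ f

lemma neg_one_pow_smul_neg_smul {M : Type*} [AddCommGroup M] (q : ℕ) (x : M) :
    (-1 : ℤ) ^ q • -((-1 : ℤ) ^ q • x) = -x := by
  rw [smul_neg, smul_smul, ← pow_add, Even.neg_one_pow ⟨_, rfl⟩, one_smul]

namespace Conn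

variable {R A L : Type*} [CommRing R] [CommRing A] [Algebra R A]
  [LieRing L] [LieAlgebra R L] [Module A L] [LieRingModule L A] [LieRinehartRing A L]
  [LieRinehartAlgebra R A L]
  {M : Type*} [AddCommGroup M] [Module A M] [Module R M] [IsScalarTower R A M]
  (C : Conn R A L M)

lemma lieDer_leibniz {m : ℕ} (x : L) (a : A) (f : L [⋀^Fin m]→ₗ[A] M) :
    C.lieDer x (a • f) = ⁅x, a⁆ • f + a • C.lieDer x f := by
  ext v
  simp only [lieDer_apply, AlternatingMap.smul_apply, AlternatingMap.add_apply, C.leibniz, smul_sub,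
    Finset.smul_sum]
  abel

end Conn

section Curry

variable {A N M : Type*} [CommRing A] [AddCommGroup N] [Module A N] [AddCommGroup M] [Module A M]

/-- Insertion of `x` as the first argument. -/
def insertFirst (M : Type*) [AddCommGroup M] [Module A M] (m : ℕ) (x : N) :
    (N [⋀^Fin (m + 1)]→ₗ[A] M) →ₗ[A] (N [⋀^Fin m]→ₗ[A] M) where
  toFun f := f.curryLeft x
  map_add' f g := by rw [AlternatingMap.curryLeft_add]; rfl
  map_smul' a f := by rw [AlternatingMap.curryLeft_smul]; rfl

@[simp] lemma insertFirst_apply (m : ℕ) (x : N) (f : N [⋀^Fin (m + 1)]→ₗ[A] M) :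
    insertFirst M m x f = f.curryLeft x := rfl

lemma sum_alternatingMap_apply {ι : Type*} {q : ℕ} (s : Finset ι) (f : ι → N [⋀^Fin q]→ₗ[A] M)
    (v : Fin q → N) : (∑ i ∈ s, f i) v = ∑ i ∈ s, f i v :=
  map_sum (AddMonoidHom.mk' (fun z : N [⋀^Fin q]→ₗ[A] M => z v) fun _ _ => rfl) f s

end Curry

instance alternatingMapAddCommGroup {A L₁ L₂ M : Type*} [CommRing A] [AddCommGroup L₁]
    [Module A L₁] [AddCommGroup L₂] [Module A L₂] [AddCommGroup M] [Module A M] (q m : ℕ) :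
    AddCommGroup (L₂ [⋀^Fin q]→ₗ[A] (L₁ [⋀^Fin m]→ₗ[A] M)) :=
  @AlternatingMap.instAddCommGroup A _ L₂ _ _ (L₁ [⋀^Fin m]→ₗ[A] M) _ _ (Fin q)

namespace AlmostTwilled

variable {R A L₁ L₂ : Type*} [CommRing R] [CommRing A] [Algebra R A]
  [LieRing L₁] [LieAlgebra R L₁] [Module A L₁] [LieRingModule L₁ A] [LieRinehartRing A L₁]
  [LieRinehartAlgebra R A L₁]
  [LieRing L₂] [LieAlgebra R L₂] [Module A L₂] [LieRingModule L₂ A] [LieRinehartRing A L₂]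
  [LieRinehartAlgebra R A L₂]

section Component

variable (S : AlmostTwilled R A L₁ L₂)
  {M : Type*} [AddCommGroup M] [Module A M] [Module R M] [IsScalarTower R A M] (C : Conn R A L₁ M)

/-- The component of the Lie derivative along `x ∈ L₁` on forms on `L₂` with values in forms on
`L₁`. -/
def lieDerAt (x : L₁) (q m : ℕ) :
    (L₂ [⋀^Fin q]→ₗ[A] (L₁ [⋀^Fin m]→ₗ[A] M)) →ₗ[R] (L₂ [⋀^Fin q]→ₗ[A] (L₁ [⋀^Fin m]→ₗ[A] M)) :=
  Conn.altDer x (S.act₁.act x) (C.lieDer x) (S.act₁.leibniz x) (C.lieDer_leibniz x)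

/-- Interchanging the arguments matches the two descriptions of the Lie derivative: corrections over
the arguments in `L₁` and over those in `L₂` may be made in either order. Cartan's formula for the
induced connection thereby passes to `covDerAt`. -/
lemma lieDerAt_eq_swapForms (x : L₁) (q m : ℕ) (f : L₂ [⋀^Fin q]→ₗ[A] (L₁ [⋀^Fin m]→ₗ[A] M)) :
    S.lieDerAt C x q m f = swapForms ((S.act₁.alt C q).lieDer x (swapForms f)) := by
  ext v w
  change (C.lieDer x (f v) - ∑ i, f (Function.update v i (S.act₁.act x (v i)))) w =
    (C.act x (f v w) - ∑ i, f (Function.update v i (S.act₁.act x (v i))) w) -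
      (∑ i, swapForms f (Function.update w i ⁅x, w i⁆)) v
  rw [AlternatingMap.sub_apply, C.lieDer_apply, sum_alternatingMap_apply, sum_alternatingMap_apply]
  exact sub_right_comm _ _ _

lemma insertFirst_swapForms {q m : ℕ} (x : L₁) (f : L₁ [⋀^Fin (m + 1)]→ₗ[A] (L₂ [⋀^Fin q]→ₗ[A] M)) :
    (insertFirst M m x).compAlternatingMap (swapForms f) = swapForms (f.curryLeft x) := rfl

lemma insertFirst_covDerAt_zero (x : L₁) (q : ℕ) (f : L₂ [⋀^Fin q]→ₗ[A] (L₁ [⋀^Fin 0]→ₗ[A] M)) :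
    (insertFirst M 0 x).compAlternatingMap (S.covDerAt C q 0 f) =
      -((-1 : ℤ) ^ q • S.lieDerAt C x q 0 f) := by
  rw [lieDerAt_eq_swapForms]
  have h := Conn.curryLeft_rinehart_zero (S.act₁.alt C q) x (swapForms f)
  ext v w
  exact congrArg (fun z : L₁ [⋀^Fin 0]→ₗ[A] (L₂ [⋀^Fin q]→ₗ[A] M) => (-1 : ℤ) ^ q • z w v) h |>.trans
    (smul_neg ((-1 : ℤ) ^ q) _)

lemma insertFirst_covDerAt_succ (x : L₁) (q m : ℕ)
    (f : L₂ [⋀^Fin q]→ₗ[A] (L₁ [⋀^Fin (m + 1)]→ₗ[A] M)) :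
    (insertFirst M (m + 1) x).compAlternatingMap (S.covDerAt C q (m + 1) f) =
      (-1 : ℤ) ^ (q + m) • S.lieDerAt C x q (m + 1) f +
        S.covDerAt C q m ((insertFirst M m x).compAlternatingMap f) := by
  rw [lieDerAt_eq_swapForms, pow_add, mul_smul]
  have h := Conn.curryLeft_rinehart_succ (S.act₁.alt C q) x (swapForms f)
  ext v w
  refine (congrArg (fun z : L₁ [⋀^Fin (m + 1)]→ₗ[A] (L₂ [⋀^Fin q]→ₗ[A] M) =>
    (-1 : ℤ) ^ q • z w v) h).trans ?_
  exact smul_add ((-1 : ℤ) ^ q) _ _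

lemma insertFirst_lieDerAt (x y : L₁) (q m : ℕ)
    (f : L₂ [⋀^Fin q]→ₗ[A] (L₁ [⋀^Fin (m + 1)]→ₗ[A] M)) :
    (insertFirst M m y).compAlternatingMap (S.lieDerAt C x q (m + 1) f) =
      S.lieDerAt C x q m ((insertFirst M m y).compAlternatingMap f) -
        (insertFirst M m ⁅x, y⁆).compAlternatingMap f := by
  rw [lieDerAt_eq_swapForms, lieDerAt_eq_swapForms, insertFirst_swapForms, Conn.curryLeft_lieDer]
  rfl

end Component

section Dual

variable (R L₂) in
/-- The component of the insertion operator. -/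
def insertDualAt (n : ℕ) (x : L₁) : ∀ i : ℕ × ℕ, DualForm A L₁ L₂ n i →ₗ[R] DualForms A L₁ L₂ n
  | (_, 0) => 0
  | (q, m + 1) =>
    (-1 : ℤ) ^ (q + m) • DirectSum.lof R (ℕ × ℕ) (DualForm A L₁ L₂ n) (q, m) ∘ₗ
      { toFun := fun f => (insertFirst (⋀[A]^n L₁) m x).compAlternatingMap f
        map_add' := fun f g => by ext v w; rfl
        map_smul' := fun r f => by ext v w; rfl }

variable (R L₂) in
/-- The insertion of `x ∈ L₁` into the inner forms. -/
def insertDual (n : ℕ) (x : L₁) : DualForms A L₁ L₂ n →ₗ[R] DualForms A L₁ L₂ n :=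
  DirectSum.toModule R (ℕ × ℕ) _ (insertDualAt R L₂ n x)

variable {n : ℕ}

lemma insertDual_dhom_zero (x : L₁) (q : ℕ) (f : DualForm A L₁ L₂ n (q, 0)) :
    insertDual R L₂ n x (dhom R A L₁ L₂ n (q, 0) f) = 0 := by
  rw [insertDual, dhom, DirectSum.toModule_lof]; rfl

lemma insertDual_dhom_succ (x : L₁) (q m : ℕ) (f : DualForm A L₁ L₂ n (q, m + 1)) :
    insertDual R L₂ n x (dhom R A L₁ L₂ n (q, m + 1) f) = (-1 : ℤ) ^ (q + m) •
      dhom R A L₁ L₂ n (q, m) ((insertFirst (⋀[A]^n L₁) m x).compAlternatingMap f) := by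
  rw [insertDual, dhom, DirectSum.toModule_lof]; rfl

variable (S : AlmostTwilled R A L₁ L₂) (C : Conn R A L₁ (⋀[A]^n L₁))

/-- The Lie derivative along `x ∈ L₁` on the dual side. -/
def lieDual (x : L₁) : DualForms A L₁ L₂ n →ₗ[R] DualForms A L₁ L₂ n :=
  DirectSum.toModule R (ℕ × ℕ) _ fun i =>
    DirectSum.lof R (ℕ × ℕ) (DualForm A L₁ L₂ n) i ∘ₗ S.lieDerAt C x i.1 i.2

lemma lieDual_dhom (x : L₁) (i : ℕ × ℕ) (f : DualForm A L₁ L₂ n i) :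
    S.lieDual C x (dhom R A L₁ L₂ n i f) = dhom R A L₁ L₂ n i (S.lieDerAt C x i.1 i.2 f) := by
  rw [lieDual, dhom, DirectSum.toModule_lof]; rfl

lemma covDer_dhom (i : ℕ × ℕ) (f : DualForm A L₁ L₂ n i) :
    S.covDer n C (dhom R A L₁ L₂ n i f) =
      dhom R A L₁ L₂ n (i.1, i.2 + 1) (S.covDerAt C i.1 i.2 f) := by
  rw [covDer, dhom, DirectSum.toModule_lof]; rfl

lemma insertDual_covDer_dhom (x : L₁) (i : ℕ × ℕ) (f : DualForm A L₁ L₂ n i) :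
    insertDual R L₂ n x (S.covDer n C (dhom R A L₁ L₂ n i f)) =
      -S.lieDual C x (dhom R A L₁ L₂ n i f) -
        S.covDer n C (insertDual R L₂ n x (dhom R A L₁ L₂ n i f)) := by
  obtain ⟨q, _ | m⟩ := i
  · rw [insertDual_dhom_zero, map_zero, sub_zero, covDer_dhom, lieDual_dhom]
    refine (insertDual_dhom_succ x q 0 _).trans ?_
    rw [insertFirst_covDerAt_zero]
    refine (hom_zsmul (R := R) (T := DualForm A L₁ L₂ n) (q, 0) _ _).symm.trans ?_
    refine Eq.trans ?_ (hom_neg (R := R) (T := DualForm A L₁ L₂ n) (q, 0) _)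
    exact congrArg _ (neg_one_pow_smul_neg_smul q _)
  · have h1 := insertDual_dhom_succ (R := R) x q m f
    rw [h1, covDer_dhom, map_zsmul, lieDual_dhom, covDer_dhom]
    refine (insertDual_dhom_succ x q (m + 1) _).trans ?_
    rw [insertFirst_covDerAt_succ]
    refine (congrArg (_ • ·) ((hom_add (R := R) (T := DualForm A L₁ L₂ n) (q, m + 1) _ _).trans
      (congrArg (· + _) (hom_zsmul (R := R) (T := DualForm A L₁ L₂ n) (q, m + 1) _ _)))).trans ?_
    rw [← add_assoc q m 1]
    rcases neg_one_pow_eq_or ℤ (q + m) with h | h <;> simp only [pow_succ, h, one_smul, neg_smul,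
      mul_neg, mul_one, neg_neg, smul_add] <;> abel

/-- Cartan's formula on the dual side. The signs built into `insertDual` and `covDerAt` make it
independent of the bidegree; under the duality it becomes the rule for `Δ` on a product with a
vector. -/
lemma insertDual_covDer (x : L₁) (b : DualForms A L₁ L₂ n) :
    insertDual R L₂ n x (S.covDer n C b) =
      -S.lieDual C x b - S.covDer n C (insertDual R L₂ n x b) := by
  have h : insertDual R L₂ n x ∘ₗ S.covDer n C =
      -S.lieDual C x - S.covDer n C ∘ₗ insertDual R L₂ n x :=
    linearMap_eq_of_hom (T := DualForm A L₁ L₂ n) (S.insertDual_covDer_dhom C x)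
  exact DFunLike.congr_fun h b

lemma insertDual_lieDual (x y : L₁) (b : DualForms A L₁ L₂ n) :
    S.lieDual C x (insertDual R L₂ n y b) =
      insertDual R L₂ n ⁅x, y⁆ b + insertDual R L₂ n y (S.lieDual C x b) := by
  have h : S.lieDual C x ∘ₗ insertDual R L₂ n y =
      insertDual R L₂ n ⁅x, y⁆ + insertDual R L₂ n y ∘ₗ S.lieDual C x :=
    linearMap_eq_of_hom (T := DualForm A L₁ L₂ n) fun i f => by
      obtain ⟨q, _ | m⟩ := i
      · rw [LinearMap.comp_apply, LinearMap.add_apply, LinearMap.comp_apply, lieDual_dhom]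
        refine (congrArg (S.lieDual C x) (insertDual_dhom_zero y q f)).trans ?_
        refine Eq.trans ?_ (congrArg₂ (· + ·) (insertDual_dhom_zero _ q f)
          (insertDual_dhom_zero y q _)).symm
        rw [map_zero, add_zero]
      · rw [LinearMap.comp_apply, LinearMap.add_apply, LinearMap.comp_apply, lieDual_dhom]
        refine (congrArg (S.lieDual C x) (insertDual_dhom_succ y q m f)).trans ?_
        refine Eq.trans ?_ (congrArg₂ (· + ·) (insertDual_dhom_succ _ q m f)
          (insertDual_dhom_succ y q m _)).symm
        rw [map_zsmul, lieDual_dhom, insertFirst_lieDerAt, ← smul_add]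
        refine congrArg (_ • ·) ?_
        refine Eq.trans ?_ (hom_add (R := R) (T := DualForm A L₁ L₂ n) (q, m) _ _)
        refine congrArg _ ?_
        exact (add_sub_cancel ((insertFirst (⋀[A]^n L₁) m ⁅x, y⁆).compAlternatingMap f) _).symm
  exact DFunLike.congr_fun h b

end Dual

end AlmostTwilled

/-! ## Multiplication operators and duality -/

section ShuffleZero

variable {A N N₁ N₂ N₃ : Type*} [CommRing A] [AddCommGroup N] [Module A N]
  [AddCommGroup N₁] [Module A N₁] [AddCommGroup N₂] [Module A N₂] [AddCommGroup N₃] [Module A N₃]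
  (b : N₁ →ₗ[A] N₂ →ₗ[A] N₃)

lemma shuffle_zero_left (f : N [⋀^Fin 0]→ₗ[A] N₁) : ∀ {q : ℕ} (g : N [⋀^Fin q]→ₗ[A] N₂)
    (v : Fin (0 + q) → N), shuffle b f g v = b (f ![]) (g fun i => v (Fin.cast (zero_add q).symm i))
  | 0, g, v => by
    rw [shuffle_zero_zero]
    exact congrArg (fun z => b (f ![]) (g z)) (Subsingleton.elim _ _)
  | q + 1, g, v => by
    have hv : v = (Matrix.vecCons (v 0) (Fin.tail v) : Fin (0 + q + 1) → N) :=
      (Fin.cons_self_tail (n := 0 + q) (α := fun _ => N) v).symm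
    rw [hv, shuffle_vecCons_zero_left, shuffle_zero_left f (g.curryLeft (v 0))]
    rw [AlternatingMap.curryLeft_apply_apply]
    congr 2
    funext i
    refine Fin.cases ?_ (fun i => ?_) i
    · rfl
    · rfl

end ShuffleZero

lemma neg_one_pow_add_smul_smul {M : Type*} [AddCommGroup M] (q m : ℕ) (x : M) :
    (-1 : ℤ) ^ (q + m) • (-1 : ℤ) ^ m • x = (-1 : ℤ) ^ q • x := by
  rw [smul_smul, pow_add, mul_assoc, ← pow_add, Even.neg_one_pow ⟨m, rfl⟩, mul_one]

section VecMul

variable {R A L₁ L₂ : Type*} [CommRing R] [CommRing A] [Algebra R A]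
  [LieRing L₁] [LieAlgebra R L₁] [Module A L₁] [LieRingModule L₁ A] [LieRinehartRing A L₁]
  [LieRinehartAlgebra R A L₁]
  [LieRing L₂] [LieAlgebra R L₂] [Module A L₂] [LieRingModule L₂ A] [LieRinehartRing A L₂]
  [LieRinehartAlgebra R A L₂] {n : ℕ}

variable (R) in
lemma mul_ofVec_phom (x : L₁) (q p : ℕ) (f : PolyForm A L₁ L₂ (q, p)) :
    formsMul R A L₁ L₂ (phom R A L₁ L₂ (0, 1) (ofVec A L₁ L₂ x)) (phom R A L₁ L₂ (q, p) f) =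
      (-1 : ℤ) ^ q • phom R A L₁ L₂ (q, p + 1) ((wedge p x).compAlternatingMap f) := by
  rw [formsMul_hom, formMul_apply, hom_zsmul]
  rw [show (0 + 1) * q = q by ring]
  refine congrArg (_ • ·) ?_
  refine phom_congr (zero_add q) (add_comm 1 p) _ _ fun v => ?_
  rw [shuffle_zero_left, coe_extMul]
  change (exteriorPower.ιMulti A 1 ![x] : ExteriorAlgebra A L₁) * _ = _
  rw [exteriorPower.ιMulti_apply_coe, ExteriorAlgebra.ιMulti_apply]
  simp

lemma insertFirst_adjointPairing {m p : ℕ} (h : m + (p + 1) = n) (h' : m + 1 + p = n) (x : L₁)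
    (u : ⋀[A]^p L₁) : insertFirst (⋀[A]^n L₁) m x (adjointPairing A L₁ h' u) =
      (-1 : ℤ) ^ m • adjointPairing A L₁ h (wedge p x u) := by
  ext v : 2
  rw [insertFirst_apply, AlternatingMap.curryLeft_apply_apply, coe_adjointPairing, ιMulti_vecCons,
    coe_wedge, ι_mul_comm]
  change _ = (((-1 : ℤ) ^ m • adjointPairing A L₁ h (wedge p x u) v : ⋀[A]^n L₁) : ExteriorAlgebra A L₁)
  rw [AddSubgroupClass.coe_zsmul, coe_adjointPairing, coe_wedge, smul_mul_assoc, mul_assoc]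

variable [Module.Finite A L₁] [Module.Projective A L₁]
  (hn : ∀ 𝔭 : PrimeSpectrum A, Module.rankAtStalk (R := A) L₁ 𝔭 = n)

include hn

/-- In `y₁ ∧ … ∧ y_m ∧ x ∧ u` the vector is moved to the front with sign `(-1)^m`, and the product
of forms contributes `(-1)^q`; together this is the sign in `insertDual`. If `p ≥ n`, both sides
vanish, for `p = n` because nothing is left to insert into. -/
lemma duality_mul_ofVec (x : L₁) (a : PolyForms A L₁ L₂) :
    duality A L₁ L₂ n (formsMul R A L₁ L₂ (phom R A L₁ L₂ (0, 1) (ofVec A L₁ L₂ x)) a) =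
      AlmostTwilled.insertDual R L₂ n x (duality A L₁ L₂ n a) := by
  induction a using hom_induction (R := R) (T := PolyForm A L₁ L₂) with
  | hz => simp only [map_zero]
  | ha a b ha hb => rw [map_add, map_add, map_add, map_add, ha, hb]
  | hh i f =>
    obtain ⟨q, p⟩ := i
    refine (congrArg _ (mul_ofVec_phom R x q p f)).trans ?_
    rcases lt_trichotomy p n with hp | rfl | hp
    · have h : n - (p + 1) + (p + 1) = n := by omega
      have h' : n - (p + 1) + 1 + p = n := by omega
      rw [map_zsmul]
      refine (congrArg (_ • ·) (duality_phom R h _)).trans ?_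
      refine Eq.trans ?_
        (congrArg (AlmostTwilled.insertDual R L₂ n x) (duality_phom R h' f)).symm
      refine Eq.trans ?_ (AlmostTwilled.insertDual_dhom_succ x q _ _).symm
      have h2 : (insertFirst (⋀[A]^n L₁) (n - (p + 1)) x).compAlternatingMap
          ((adjointPairing A L₁ h').compAlternatingMap f) = (-1 : ℤ) ^ (n - (p + 1)) •
          (adjointPairing A L₁ h).compAlternatingMap ((wedge p x).compAlternatingMap f) := by
        ext v : 1
        exact insertFirst_adjointPairing h h' x (f v)
      rw [h2]
      refine Eq.trans ?_ (congrArg (_ • ·)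
        (hom_zsmul (R := R) (T := DualForm A L₁ L₂ n) (q, n - (p + 1)) _ _)).symm
      exact (neg_one_pow_add_smul_smul q (n - (p + 1)) _).symm
    · have h1 := phom_eq_zero_of_rank_lt (R := R) hn (Nat.lt_succ_self p)
        ((wedge p x).compAlternatingMap f)
      rw [h1]
      refine Eq.trans ?_
        (congrArg (AlmostTwilled.insertDual R L₂ p x) (duality_phom R (zero_add p) f)).symm
      refine Eq.trans ?_ (AlmostTwilled.insertDual_dhom_zero x q _).symm
      rw [smul_zero, map_zero]
    · have h1 := phom_eq_zero_of_rank_lt (R := R) hn (hp.trans (Nat.lt_succ_self p))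
        ((wedge p x).compAlternatingMap f)
      have h2 := phom_eq_zero_of_rank_lt (R := R) hn hp f
      rw [h1]
      refine Eq.trans ?_
        (congrArg (fun z => AlmostTwilled.insertDual R L₂ n x (duality A L₁ L₂ n z)) h2).symm
      simp only [smul_zero, map_zero]

end VecMul

/-! ### Multiplication by forms of bidegree `(q, 0)` under the duality. -/

section FormMul

variable {R A L₁ L₂ : Type*} [CommRing R] [CommRing A] [Algebra R A]
  [LieRing L₁] [LieAlgebra R L₁] [Module A L₁] [LieRingModule L₁ A] [LieRinehartRing A L₁]
  [LieRinehartAlgebra R A L₁]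
  [LieRing L₂] [LieAlgebra R L₂] [Module A L₂] [LieRingModule L₂ A] [LieRinehartRing A L₂]
  [LieRinehartAlgebra R A L₂] {n : ℕ}

/-- Multiplication by elements of `Λ^0`. -/
def scalarMul (A N M : Type*) [CommRing A] [AddCommGroup N] [Module A N] [AddCommGroup M]
    [Module A M] : ⋀[A]^0 N →ₗ[A] M →ₗ[A] M :=
  (LinearMap.lsmul A M).comp (exteriorPower.zeroEquiv A N).toLinearMap

lemma scalarMul_apply {A N M : Type*} [CommRing A] [AddCommGroup N] [Module A N] [AddCommGroup M]
    [Module A M] (u : ⋀[A]^0 N) (w : M) :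
    scalarMul A N M u w = exteriorPower.zeroEquiv A N u • w := rfl

lemma eq_zeroEquiv_smul {A N : Type*} [CommRing A] [AddCommGroup N] [Module A N] (u : ⋀[A]^0 N) :
    u = exteriorPower.zeroEquiv A N u • exteriorPower.ιMulti A 0 ![] := by
  refine (exteriorPower.zeroEquiv A N).injective ?_
  rw [map_smul, exteriorPower.zeroEquiv_ιMulti, smul_eq_mul, mul_one]

lemma adjointPairing_extMul_zero {m p : ℕ} (h : m + p = n) (h' : m + (0 + p) = n)
    (u : ⋀[A]^0 L₁) (w : ⋀[A]^p L₁) : adjointPairing A L₁ h' (extMul A L₁ 0 p u w) =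
      scalarMul A L₁ _ u (adjointPairing A L₁ h w) := by
  ext v : 2
  rw [scalarMul_apply, AlternatingMap.smul_apply, Submodule.coe_smul, coe_adjointPairing,
    coe_adjointPairing, coe_extMul]
  conv_lhs => rw [eq_zeroEquiv_smul u, Submodule.coe_smul, coe_ιMulti_zero]
  rw [smul_mul_assoc, one_mul, mul_smul_comm]

/-- The product of a form on `L₂` and a form on `L₂` with values in forms on `L₁`. -/
def formDualMul {q q' m : ℕ} (α : PolyForm A L₁ L₂ (q, 0)) (f : DualForm A L₁ L₂ n (q', m)) :
    DualForm A L₁ L₂ n (q + q', m) :=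
  shuffle (A := A) (L₂ := L₂) (N₂ := L₁ [⋀^Fin m]→ₗ[A] ⋀[A]^n L₁)
    (N₃ := L₁ [⋀^Fin m]→ₗ[A] ⋀[A]^n L₁) (q := q) (q' := q') (scalarMul A L₁ _) α f

lemma duality_mul_form {m q q' p : ℕ} (h : m + p = n) (α : PolyForm A L₁ L₂ (q, 0))
    (f : PolyForm A L₁ L₂ (q', p)) :
    duality A L₁ L₂ n
      (formsMul R A L₁ L₂ (phom R A L₁ L₂ (q, 0) α) (phom R A L₁ L₂ (q', p) f)) =
      (-1 : ℤ) ^ (q * q') • dhom R A L₁ L₂ n (q + q', m)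
        (formDualMul α ((adjointPairing A L₁ h).compAlternatingMap f)) := by
  have h' : m + (0 + p) = n := by omega
  rw [formsMul_hom, formMul_apply, hom_zsmul, map_zsmul]
  refine congrArg (_ • ·) ((duality_phom R h' _).trans (congrArg _ ?_))
  refine (compAlternatingMap_shuffle (M₂ := L₁ [⋀^Fin m]→ₗ[A] ⋀[A]^n L₁)
    (M₃ := L₁ [⋀^Fin m]→ₗ[A] ⋀[A]^n L₁) (extMul A L₁ 0 p) (scalarMul A L₁ _) LinearMap.id
    (adjointPairing A L₁ h) (adjointPairing A L₁ h')
    (fun u w => adjointPairing_extMul_zero h h' u w) α f).trans ?_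
  rfl

end FormMul

namespace Conn

variable {R A L M N : Type*} [CommRing R] [CommRing A] [Algebra R A]
  [LieRing L] [LieAlgebra R L] [Module A L] [LieRingModule L A] [LieRinehartRing A L]
  [LieRinehartAlgebra R A L]
  [AddCommGroup M] [Module A M] [Module R M] [IsScalarTower R A M]
  [AddCommGroup N] [Module A N] [Module R N] [IsScalarTower R A N]

/-- The transport of a connection along an isomorphism of modules. -/
def congr (e : M ≃ₗ[A] N) (C : Conn R A L M) : Conn R A L N where
  act :=
    { toFun := fun x =>
        e.toLinearMap.restrictScalars R ∘ₗ C.act x ∘ₗ e.symm.toLinearMap.restrictScalars R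
      map_add' := fun x y => LinearMap.ext fun u => by simp
      map_smul' := fun a x => LinearMap.ext fun u => by simp }
  leibniz x a u := by simp [C.leibniz]

lemma congr_act (e : M ≃ₗ[A] N) (C : Conn R A L M) (x : L) (u : N) :
    (C.congr e).act x u = e (C.act x (e.symm u)) := rfl

variable (R A L N) in
/-- The `(A, L)`-module structure on `Λ^0 N = A`. -/
def zeroExt : Conn R A L (⋀[A]^0 N) := (anchor R A L).congr (exteriorPower.zeroEquiv A N).symm

lemma zeroEquiv_zeroExt_act (x : L) (u : ⋀[A]^0 N) :
    exteriorPower.zeroEquiv A N ((zeroExt R A L N).act x u) =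
      ⁅x, exteriorPower.zeroEquiv A N u⁆ := by
  rw [zeroExt, congr_act, LinearEquiv.apply_symm_apply]
  rfl

lemma zeroExt_act (x : L) (u : ⋀[A]^0 N) : (zeroExt R A L N).act x u =
    ⁅x, exteriorPower.zeroEquiv A N u⁆ • exteriorPower.ιMulti A 0 ![] := by
  rw [← zeroEquiv_zeroExt_act (R := R), ← eq_zeroEquiv_smul]

lemma isFlat_zeroExt : (zeroExt R A L N).IsFlat := fun x y u => by
  refine (exteriorPower.zeroEquiv A N).injective ?_
  rw [map_sub]
  simp only [zeroEquiv_zeroExt_act]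
  exact lie_lie x y _

end Conn

/-! ### The action of `L₁` on forms of bidegree `(q, 0)`. -/

namespace AlmostTwilled

variable {R A L₁ L₂ : Type*} [CommRing R] [CommRing A] [Algebra R A]
  [LieRing L₁] [LieAlgebra R L₁] [Module A L₁] [LieRingModule L₁ A] [LieRinehartRing A L₁]
  [LieRinehartAlgebra R A L₁]
  [LieRing L₂] [LieAlgebra R L₂] [Module A L₂] [LieRingModule L₂ A] [LieRinehartRing A L₂]
  [LieRinehartAlgebra R A L₂]
  (S : AlmostTwilled R A L₁ L₂) {n : ℕ}

/-- The action of `x ∈ L₁` on `Alt_A^q(L₂, Λ^0 L₁)`. -/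
def formAct (x : L₁) (q : ℕ) (α : PolyForm A L₁ L₂ (q, 0)) : PolyForm A L₁ L₂ (q, 0) :=
  (S.act₁.alt (Conn.zeroExt R A L₁ L₁) q).act x α

lemma formAct_ofForm (x : L₁) (q : ℕ) (a : L₂ [⋀^Fin q]→ₗ[A] A) :
    S.formAct x q (ofForm A L₁ L₂ q a) =
      ofForm A L₁ L₂ q ((S.act₁.alt (Conn.anchor R A L₁) q).act x a) := by
  refine (Conn.compAlternatingMap_altDer x (S.act₁.act x) ((Conn.anchor R A L₁).act x)
    ((Conn.zeroExt R A L₁ L₁).act x) (S.act₁.leibniz x) ((Conn.anchor R A L₁).leibniz x)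
    ((Conn.zeroExt R A L₁ L₁).leibniz x)
    (LinearMap.toSpanSingleton A (⋀[A]^0 L₁) (exteriorPower.ιMulti A 0 ![])) (fun b => ?_) a).symm
  rw [Conn.zeroExt_act, LinearMap.toSpanSingleton_apply, LinearMap.toSpanSingleton_apply, map_smul,
    exteriorPower.zeroEquiv_ιMulti, smul_eq_mul, mul_one]
  rfl

/-- Flatness of the action of `L₁` on `L₂` enters here; it gives the Jacobi identity for two vectors
and a form. -/
lemma formAct_lie (x y : L₁) (q : ℕ) (α : PolyForm A L₁ L₂ (q, 0)) :
    S.formAct x q (S.formAct y q α) = S.formAct ⁅x, y⁆ q α + S.formAct y q (S.formAct x q α) :=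
  eq_add_of_sub_eq (S.flat₁.alt (Conn.isFlat_zeroExt) q x y α).symm

lemma lieDerAt_scalarMul_shuffle {M : Type*} [AddCommGroup M] [Module A M] [Module R M]
    [IsScalarTower R A M] {m q q' : ℕ} (C : Conn R A L₁ M) (x : L₁)
    (α : L₂ [⋀^Fin q]→ₗ[A] ⋀[A]^0 L₁) (f : L₂ [⋀^Fin q']→ₗ[A] (L₁ [⋀^Fin m]→ₗ[A] M)) :
    S.lieDerAt C x (q + q') m (shuffle (N₂ := L₁ [⋀^Fin m]→ₗ[A] M)
        (N₃ := L₁ [⋀^Fin m]→ₗ[A] M) (scalarMul A L₁ _) α f) =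
      shuffle (N₂ := L₁ [⋀^Fin m]→ₗ[A] M)
        (N₃ := L₁ [⋀^Fin m]→ₗ[A] M) (scalarMul A L₁ _) (S.formAct x q α) f +
      shuffle (N₂ := L₁ [⋀^Fin m]→ₗ[A] M)
        (N₃ := L₁ [⋀^Fin m]→ₗ[A] M) (scalarMul A L₁ _) α (S.lieDerAt C x q' m f) := by
  have h := altDer_shuffle (R := R) (L := L₁) (N := L₂) (N₁ := ⋀[A]^0 L₁)
    (N₂ := L₁ [⋀^Fin m]→ₗ[A] M)
    (N₃ := L₁ [⋀^Fin m]→ₗ[A] M) (scalarMul A L₁ (L₁ [⋀^Fin m]→ₗ[A] M)) x (S.act₁.act x)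
    ((Conn.zeroExt R A L₁ L₁).act x) (C.lieDer x)
    (C.lieDer x) (S.act₁.leibniz x) ((Conn.zeroExt R A L₁ L₁).leibniz x) (C.lieDer_leibniz x)
    (C.lieDer_leibniz x) (fun u w => by
      rw [scalarMul_apply, scalarMul_apply, scalarMul_apply, C.lieDer_leibniz,
        Conn.zeroEquiv_zeroExt_act]) α f
  exact h

lemma lieDerAt_formDualMul {m q q' : ℕ} (C : Conn R A L₁ (⋀[A]^n L₁)) (x : L₁)
    (α : PolyForm A L₁ L₂ (q, 0)) (f : DualForm A L₁ L₂ n (q', m)) :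
    S.lieDerAt C x (q + q') m (formDualMul α f) =
      formDualMul (S.formAct x q α) f + formDualMul α (S.lieDerAt C x q' m f) :=
  S.lieDerAt_scalarMul_shuffle C x α f

end AlmostTwilled

/-! ## The generator attached to a connection -/

section Projective

variable {A M : Type*} [CommRing A] [AddCommGroup M] [Module A M] [Module.Finite A M]
  [Module.Projective A M]

variable (A M) in
lemma exists_dual_basis : ∃ (k : ℕ) (e : Fin k → M) (c : Fin k → M →ₗ[A] A),
    ∀ m, m = ∑ i, c i m • e i := by
  obtain ⟨k, π, hπ⟩ := Module.Finite.exists_fin' A M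
  obtain ⟨s, hs⟩ := Module.projective_lifting_property π LinearMap.id hπ
  refine ⟨k, fun i => π (Pi.single i 1), fun i => LinearMap.proj i ∘ₗ s, fun m => ?_⟩
  have h : π (s m) = m := DFunLike.congr_fun hs m
  conv_lhs => rw [← h, pi_eq_sum_univ' (s m), map_sum]
  simp only [map_smul, LinearMap.comp_apply, LinearMap.proj_apply]

instance projective_exteriorPower (p : ℕ) : Module.Projective A (⋀[A]^p M) := by
  obtain ⟨k, π, hπ⟩ := Module.Finite.exists_fin' A M
  obtain ⟨s, hs⟩ := Module.projective_lifting_property π LinearMap.id hπ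
  have : Module.Free A (⋀[A]^p (Fin k → A)) := inferInstance
  refine Module.Projective.of_split (exteriorPower.map p s) (exteriorPower.map p π) ?_
  rw [← exteriorPower.map_comp, hs, exteriorPower.map_id]

variable (R L : Type*) [CommRing R] [Algebra R A]
  [LieRing L] [LieAlgebra R L] [Module A L] [LieRingModule L A] [LieRinehartRing A L]
  [LieRinehartAlgebra R A L] [Module R M] [IsScalarTower R A M]

variable (A M) in
-- A dual basis gives the connection `x(m) = ∑ x(c i m) e i`, obtained by differentiating
-- coordinates. It need not be flat, but some connection on `Λ^n L₁` is all that the existence of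
-- the crossed product bracket requires.
lemma exists_conn : Nonempty (Conn R A L M) := by
  obtain ⟨k, e, c, h⟩ := exists_dual_basis A M
  refine ⟨{ act := { toFun := fun x => { toFun := fun m => ∑ i, ⁅x, c i m⁆ • e i
                                         map_add' := fun m m' => ?_
                                         map_smul' := fun r m => ?_ }
                     map_add' := fun x y => ?_
                     map_smul' := fun a x => ?_ }
            leibniz := fun x a m => ?_ }⟩
  · simp only [map_add, lie_add, add_smul, Finset.sum_add_distrib]
  · rw [RingHom.id_apply, Finset.smul_sum]
    refine Finset.sum_congr rfl fun i _ => ?_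
    have h := ((Conn.anchor R A L).act x).map_smul r (c i m)
    rw [← algebraMap_smul A r m, map_smul, algebraMap_smul]
    refine (congrArg (· • e i) h).trans ?_
    rw [smul_assoc]
    rfl
  · refine LinearMap.ext fun m => ?_
    simp only [LinearMap.coe_mk, AddHom.coe_mk, LinearMap.add_apply, add_lie, add_smul,
      Finset.sum_add_distrib]
  · refine LinearMap.ext fun m => ?_
    simp only [LinearMap.coe_mk, AddHom.coe_mk, LinearMap.smul_apply, RingHom.id_apply,
      LieRinehartRing.lie_smul_eq_mul, mul_smul, Finset.smul_sum]
  · simp only [LinearMap.coe_mk, AddHom.coe_mk, map_smul, smul_eq_mul,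
      LieRinehartRing.leibniz_mul_right', add_smul, Finset.sum_add_distrib, mul_smul]
    rw [← Finset.smul_sum, add_comm]
    refine congrArg (· + _) ?_
    conv_rhs => rw [h m, Finset.smul_sum]

end Projective

/-! ### Generation of the algebra of forms. -/

section Generated

variable (R A L₁ L₂ : Type*) [CommRing R] [CommRing A] [Algebra R A]
  [LieRing L₁] [LieAlgebra R L₁] [Module A L₁] [LieRingModule L₁ A] [LieRinehartRing A L₁]
  [LieRinehartAlgebra R A L₁]
  [LieRing L₂] [LieAlgebra R L₂] [Module A L₂] [LieRingModule L₂ A] [LieRinehartRing A L₂]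
  [LieRinehartAlgebra R A L₂] [Module.Finite A L₁] [Module.Projective A L₁]

/-- Induction on `p`. A dual basis of `Λ^(p+1) L₁` writes `f` as a sum of scalar forms times
constant elements; such an element is a sum of wedges `x ∧ u`, and the scalar form can be moved to
`u`, leaving the vector `x` in front. -/
theorem isGeneratedBy_forms :
    IsGeneratedBy (T := PolyForm A L₁ L₂) (formsMul R A L₁ L₂) (ofVec A L₁ L₂) := by
  intro P hz hadd hform hvec
  have key : ∀ (p q : ℕ) (f : PolyForm A L₁ L₂ (q, p)), P (q, p) f := by
    intro p
    induction p with
    | zero => exact hform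
    | succ p ih =>
      intro q f
      have hsum : ∀ (s : Finset ℕ) (F : ℕ → PolyForm A L₁ L₂ (q, p + 1)),
          (∀ i, P (q, p + 1) (F i)) → P (q, p + 1) (∑ i ∈ s, F i) := fun s F hF => by
        induction s using Finset.induction_on with
        | empty => rw [Finset.sum_empty]; exact hz _
        | insert i s hi hs => rw [Finset.sum_insert hi]; exact hadd _ _ _ (hF i) hs
      have hone : ∀ (c : L₂ [⋀^Fin q]→ₗ[A] A) (e : ⋀[A]^(p + 1) L₁),
          P (q, p + 1) ((LinearMap.toSpanSingleton A (⋀[A]^(p + 1) L₁) e).compAlternatingMap c) := by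
        intro c e
        induction e using wedge_induction with
        | h x u =>
          -- The sign cancels the one from multiplying a form of degree `q` by a vector on the left.
          refine hvec x q p ((-1 : ℤ) ^ q •
            (LinearMap.toSpanSingleton A (⋀[A]^p L₁) u).compAlternatingMap c) _ ?_ (ih q _)
          refine Eq.trans ?_ (congrArg (formsMul R A L₁ L₂ (phom R A L₁ L₂ (0, 1) (ofVec A L₁ L₂ x)))
            (hom_zsmul (R := R) (T := PolyForm A L₁ L₂) (q, p) _ _).symm)
          rw [map_zsmul]
          refine Eq.trans ?_ (congrArg (_ • ·) (mul_ofVec_phom R x q p _)).symm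
          rw [smul_smul, ← pow_add, Even.neg_one_pow ⟨_, rfl⟩, one_smul]
          refine congrArg _ ?_
          ext v : 1
          exact (map_smul (wedge p x) (c v) u).symm
        | hadd u w hu hw =>
          convert hadd _ _ _ hu hw using 1
          ext v : 1
          exact smul_add (c v) u w
        | hz =>
          convert hz (q, p + 1) using 1
          ext v : 1
          exact smul_zero (c v)
      obtain ⟨k, e, c, h⟩ := exists_dual_basis A (⋀[A]^(p + 1) L₁)
      have hf : f = ∑ i ∈ Finset.range k, if hi : i < k then
          (LinearMap.toSpanSingleton A (⋀[A]^(p + 1) L₁) (e ⟨i, hi⟩)).compAlternatingMap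
            ((c ⟨i, hi⟩).compAlternatingMap f) else 0 := by
        ext v : 1
        rw [sum_alternatingMap_apply, Finset.sum_range]
        simp only [Fin.is_lt, dite_true, Fin.eta]
        exact h (f v)
      rw [hf]
      refine hsum _ _ fun i => ?_
      split_ifs with hi
      · exact hone _ _
      · exact hz _
  exact fun i => key i.2 i.1

end Generated

section Equiv

variable {R A L₁ L₂ : Type*} [CommRing R] [CommRing A] [Algebra R A]
  [LieRing L₁] [LieAlgebra R L₁] [Module A L₁] [LieRingModule L₁ A] [LieRinehartRing A L₁]
  [LieRinehartAlgebra R A L₁]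
  [LieRing L₂] [LieAlgebra R L₂] [Module A L₂] [LieRingModule L₂ A] [LieRinehartRing A L₂]
  [LieRinehartAlgebra R A L₂] [Module.Finite A L₁] [Module.Projective A L₁] {n : ℕ}

lemma duality_smul_base (r : R) (a : PolyForms A L₁ L₂) :
    duality A L₁ L₂ n (r • a) = r • duality A L₁ L₂ n a := by
  rw [← algebraMap_smul A r a, map_smul]
  refine DFinsupp.ext fun i => DFunLike.ext _ _ fun v => DFunLike.ext _ _ fun w => ?_
  exact algebraMap_smul A r (duality A L₁ L₂ n a i v w)

variable (R)

/-- The duality isomorphism. -/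
def dualityEquiv (hn : ∀ 𝔭 : PrimeSpectrum A, Module.rankAtStalk (R := A) L₁ 𝔭 = n) :
    PolyForms A L₁ L₂ ≃ₗ[R] DualForms A L₁ L₂ n :=
  LinearEquiv.ofBijective
    { toFun := duality A L₁ L₂ n
      map_add' := map_add _
      map_smul' := duality_smul_base } (duality_bijective hn)

lemma dualityEquiv_apply (hn : ∀ 𝔭 : PrimeSpectrum A, Module.rankAtStalk (R := A) L₁ 𝔭 = n)
    (a : PolyForms A L₁ L₂) : dualityEquiv R hn a = duality A L₁ L₂ n a := rfl

lemma duality_dualityEquiv_symm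
    (hn : ∀ 𝔭 : PrimeSpectrum A, Module.rankAtStalk (R := A) L₁ 𝔭 = n)
    (b : DualForms A L₁ L₂ n) : duality A L₁ L₂ n ((dualityEquiv R hn).symm b) = b :=
  (dualityEquiv R hn).apply_symm_apply b

lemma exists_duality_phom (hn : ∀ 𝔭 : PrimeSpectrum A, Module.rankAtStalk (R := A) L₁ 𝔭 = n)
    {m q p : ℕ} (h : m + p = n) (F : DualForm A L₁ L₂ n (q, m)) :
    ∃ f : PolyForm A L₁ L₂ (q, p), (adjointPairing A L₁ h).compAlternatingMap f = F ∧
      (dualityEquiv R hn).symm (dhom R A L₁ L₂ n (q, m) F) = phom R A L₁ L₂ (q, p) f := by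
  let e := LinearEquiv.ofBijective _ (adjointPairing_bijective hn h)
  have h1 : (adjointPairing A L₁ h).compAlternatingMap (e.symm.toLinearMap.compAlternatingMap F) =
      F := by
    ext v : 1
    exact e.apply_symm_apply (F v)
  refine ⟨e.symm.toLinearMap.compAlternatingMap F, h1, ?_⟩
  rw [LinearEquiv.symm_apply_eq, dualityEquiv_apply]
  refine Eq.trans ?_ (duality_phom R h _).symm
  rw [h1]

end Equiv

/-! ### The operator on forms that belongs to a connection. -/

namespace AlmostTwilled

variable {R A L₁ L₂ : Type*} [CommRing R] [CommRing A] [Algebra R A]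
  [LieRing L₁] [LieAlgebra R L₁] [Module A L₁] [LieRingModule L₁ A] [LieRinehartRing A L₁]
  [LieRinehartAlgebra R A L₁]
  [LieRing L₂] [LieAlgebra R L₂] [Module A L₂] [LieRingModule L₂ A] [LieRinehartRing A L₂]
  [LieRinehartAlgebra R A L₂]
  (S : AlmostTwilled R A L₁ L₂) {n : ℕ} [Module.Finite A L₁] [Module.Projective A L₁]
  (hn : ∀ 𝔭 : PrimeSpectrum A, Module.rankAtStalk (R := A) L₁ 𝔭 = n)
  (C : Conn R A L₁ (⋀[A]^n L₁))

/-- The operator corresponding to a connection under duality. -/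
def connGenerator : PolyForms A L₁ L₂ →ₗ[R] PolyForms A L₁ L₂ :=
  (dualityEquiv R hn).symm.toLinearMap ∘ₗ S.covDer n C ∘ₗ (dualityEquiv R hn).toLinearMap

/-- The Lie derivative corresponding to a connection under duality. -/
def connLie (x : L₁) : PolyForms A L₁ L₂ →ₗ[R] PolyForms A L₁ L₂ :=
  (dualityEquiv R hn).symm.toLinearMap ∘ₗ S.lieDual C x ∘ₗ (dualityEquiv R hn).toLinearMap

lemma duality_connGenerator (a : PolyForms A L₁ L₂) :
    duality A L₁ L₂ n (S.connGenerator hn C a) = S.covDer n C (duality A L₁ L₂ n a) :=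
  duality_dualityEquiv_symm R hn _

lemma duality_connLie (x : L₁) (a : PolyForms A L₁ L₂) :
    duality A L₁ L₂ n (S.connLie hn C x a) = S.lieDual C x (duality A L₁ L₂ n a) :=
  duality_dualityEquiv_symm R hn _

lemma corresponds_connGenerator : S.Corresponds n (S.connGenerator hn C) C :=
  S.duality_connGenerator hn C

lemma connLie_phom {m q p : ℕ} (h : m + p = n) (x : L₁) (f : PolyForm A L₁ L₂ (q, p)) :
    ∃ g : PolyForm A L₁ L₂ (q, p), (adjointPairing A L₁ h).compAlternatingMap g =
      S.lieDerAt C x q m ((adjointPairing A L₁ h).compAlternatingMap f) ∧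
      S.connLie hn C x (phom R A L₁ L₂ (q, p) f) = phom R A L₁ L₂ (q, p) g := by
  obtain ⟨g, hg, hg'⟩ := exists_duality_phom R hn h
    (S.lieDerAt C x q m ((adjointPairing A L₁ h).compAlternatingMap f))
  refine ⟨g, hg, Eq.trans ?_ hg'⟩
  refine congrArg (dualityEquiv R hn).symm ?_
  refine (congrArg (S.lieDual C x) (duality_phom R h f)).trans ?_
  rw [lieDual_dhom]

lemma connGenerator_bidegree :
    HasBidegree (T := PolyForm A L₁ L₂) (0, -1) (S.connGenerator hn C) := by
  rintro ⟨q, p⟩ f k hk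
  by_cases hp : p ≤ n
  · have h1 : S.connGenerator hn C (phom R A L₁ L₂ (q, p) f) =
        (dualityEquiv R hn).symm (dhom R A L₁ L₂ n (q, n - p + 1)
          (S.covDerAt C q (n - p)
            ((adjointPairing A L₁ (Nat.sub_add_cancel hp)).compAlternatingMap f))) := by
      refine congrArg (dualityEquiv R hn).symm ?_
      refine (congrArg (S.covDer n C) (duality_phom R (Nat.sub_add_cancel hp) f)).trans ?_
      rw [covDer_dhom]
    change (S.connGenerator hn C (phom R A L₁ L₂ (q, p) f)) k = 0
    rw [h1]
    cases p with
    | zero =>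
      -- For `p = 0` the covariant derivative would be a form of degree `n + 1` on `L₁`, hence zero.
      -- This gives the bidegree condition at the boundary.
      have h2 : ∀ F : DualForm A L₁ L₂ n (q, n - 0 + 1), F = 0 := fun F => by
        ext v : 1
        exact alternatingMap_eq_zero_of_rank_lt hn (by omega) _
      rw [h2 (S.covDerAt C q (n - 0) _)]
      refine (congrArg (fun z => (dualityEquiv R hn).symm z k)
        (map_zero (DirectSum.lof R (ℕ × ℕ) (DualForm A L₁ L₂ n) _))).trans ?_
      rw [map_zero]
      rfl
    | succ p =>
      obtain ⟨g, -, hg⟩ := exists_duality_phom R hn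
        (show n - (p + 1) + 1 + p = n by omega) (S.covDerAt C q (n - (p + 1))
          ((adjointPairing A L₁ (Nat.sub_add_cancel hp)).compAlternatingMap f))
      rw [hg]
      refine hom_apply_ne (fun h => hk ?_) g
      rw [h]
      simp
  · have h1 := phom_eq_zero_of_rank_lt (R := R) (L₂ := L₂) hn (not_le.1 hp) f
    change (S.connGenerator hn C (phom R A L₁ L₂ (q, p) f)) k = 0
    rw [h1, map_zero]
    rfl

lemma connLie_mul_form (x : L₁) (q : ℕ) (α : PolyForm A L₁ L₂ (q, 0)) (a : PolyForms A L₁ L₂) :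
    S.connLie hn C x (formsMul R A L₁ L₂ (phom R A L₁ L₂ (q, 0) α) a) =
      formsMul R A L₁ L₂ (phom R A L₁ L₂ (q, 0) (S.formAct x q α)) a +
        formsMul R A L₁ L₂ (phom R A L₁ L₂ (q, 0) α) (S.connLie hn C x a) := by
  induction a using hom_induction (R := R) (T := PolyForm A L₁ L₂) with
  | hz => simp only [map_zero, add_zero]
  | ha a b ha hb => simp only [map_add, ha, hb]; abel
  | hh i f =>
    obtain ⟨q', p⟩ := i
    by_cases hp : p ≤ n
    · have h := Nat.sub_add_cancel hp
      refine (duality_bijective hn).injective ?_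
      obtain ⟨g, hg, hg'⟩ := S.connLie_phom hn C h x f
      rw [duality_connLie, map_add]
      refine (congrArg (S.lieDual C x) (duality_mul_form h α f)).trans ?_
      refine Eq.trans ?_ (congrArg₂ (· + ·) (duality_mul_form h (S.formAct x q α) f)
        (((congrArg (fun z => duality A L₁ L₂ n
          (formsMul R A L₁ L₂ (phom R A L₁ L₂ (q, 0) α) z)) hg')).trans
            (duality_mul_form h α g))).symm
      rw [map_zsmul, lieDual_dhom, ← smul_add]
      refine congrArg (_ • ·) ?_
      refine Eq.trans ?_ (hom_add (R := R) (T := DualForm A L₁ L₂ n) (q + q', n - p) _ _)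
      refine congrArg _ ?_
      rw [hg]
      exact S.lieDerAt_formDualMul C x α _
    · have h1 := phom_eq_zero_of_rank_lt (R := R) (L₂ := L₂) hn (not_le.1 hp) f
      change S.connLie hn C x (formsMul R A L₁ L₂ _ (phom R A L₁ L₂ (q', p) f)) =
        formsMul R A L₁ L₂ _ (phom R A L₁ L₂ (q', p) f) +
          formsMul R A L₁ L₂ _ (S.connLie hn C x (phom R A L₁ L₂ (q', p) f))
      rw [h1]
      simp only [map_zero, add_zero]

/-- The Cartan calculus of insertions and Lie derivatives on the dual side, carried back through the
duality. Only `ℓ` depends on the connection; the rules for `br` and `ρ` do not. -/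
theorem isLieGenerator_connGenerator :
    IsLieGenerator (T := PolyForm A L₁ L₂) (formsMul R A L₁ L₂) (ofVec A L₁ L₂)
      (S.connGenerator hn C) (S.connLie hn C) (fun x y => ⁅x, y⁆) S.formAct where
  bidegree := S.connGenerator_bidegree hn C
  apply_vec x w := (duality_bijective hn).injective (by
    rw [duality_connGenerator, map_sub, map_neg]
    refine (congrArg (S.covDer n C) (duality_mul_ofVec hn x w)).trans ?_
    refine Eq.trans ?_ (congrArg₂ (fun a b => -a - b) (duality_mul_ofVec hn x _)
      (S.duality_connLie hn C x w)).symm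
    rw [duality_connGenerator, insertDual_covDer]
    abel)
  lie_vec x y w := (duality_bijective hn).injective (by
    rw [duality_connLie, map_add]
    refine (congrArg (S.lieDual C x) (duality_mul_ofVec hn y w)).trans ?_
    refine Eq.trans ?_ (congrArg₂ (· + ·) (duality_mul_ofVec hn _ w)
      (duality_mul_ofVec hn y _)).symm
    rw [duality_connLie, insertDual_lieDual])
  lie_form := S.connLie_mul_form hn C

end AlmostTwilled

/-! ## The crossed product bracket, its generators, and connections -/

section Abstract

variable {R : Type*} [CommRing R]
  {T : ℕ × ℕ → Type*} [∀ i, AddCommGroup (T i)] [∀ i, Module R (T i)]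
  {V : Type*} {one : ⨁ i, T i} {μ B : (⨁ i, T i) →ₗ[R] (⨁ i, T i) →ₗ[R] (⨁ i, T i)}
  {v : V → T (0, 1)} {Δ Δ' : (⨁ i, T i) →ₗ[R] (⨁ i, T i)}

/-- The bracket measures the failure of a generator to be a derivation; the two failures coincide
and cancel. -/
lemma IsGenerator.isGradedDerivation_sub (h : IsGenerator μ B Δ) (h' : IsGenerator μ B Δ') :
    IsGradedDerivation μ 1 (Δ - Δ') := by
  have key : generatedBracket μ Δ = generatedBracket μ Δ' := by
    rw [← h.eq_generatedBracket, h'.eq_generatedBracket]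
  intro i f z
  have h1 := congrArg (fun b => b (hom R i f) z) key
  simp only [generatedBracket_hom] at h1
  simp only [LinearMap.sub_apply, map_sub, one_mul]
  rcases neg_one_pow_eq_or ℤ (tdeg i) with hs | hs <;>
    simp only [hs, one_smul, neg_smul] at h1 ⊢
  · rw [← sub_eq_zero] at h1 ⊢
    rw [← h1]; abel
  · rw [← sub_eq_zero] at h1 ⊢
    rw [← neg_eq_zero, ← h1]; abel

/-- A derivation which vanishes on forms and on a faithful top degree vanishes. -/
lemma IsGeneratedBy.derivation_eq_zero_of_top (hv : IsGeneratedBy μ v) {e q n : ℕ}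
    {φ : (⨁ i, T i) →ₗ[R] (⨁ i, T i)} (hφ : IsGradedDerivation μ e φ)
    (hform : ∀ q α, φ (hom R (q, 0) α) = 0)
    (hvec : ∀ x, ∃ c : T (q, 0), φ (hom R (0, 1) (v x)) = hom R (q, 0) c)
    (htop : ∀ x (w : T (0, n)), μ (hom R (0, 1) (v x)) (hom R (0, n) w) = 0)
    (hfaith : ∀ c : T (q, 0), (∀ w : T (0, n), μ (hom R (q, 0) c) (hom R (0, n) w) = 0) → c = 0)
    (h0 : ∀ w : T (0, n), φ (hom R (0, n) w) = 0) : φ = 0 := by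
  refine hv.derivation_eq_zero hφ (fun x => ?_) hform
  obtain ⟨c, hc⟩ := hvec x
  rw [hc, hfaith c fun w => ?_, hom_zero]
  have h1 := hφ (0, 1) (v x) (hom R (0, n) w)
  rw [htop, map_zero, h0, map_zero, smul_zero, add_zero, hc] at h1
  exact h1.symm

end Abstract

/-! ### The top exterior power inside the algebra of forms. -/

section Top

variable {R A L₁ L₂ : Type*} [CommRing R] [CommRing A] [Algebra R A]
  [LieRing L₁] [LieAlgebra R L₁] [Module A L₁] [LieRingModule L₁ A] [LieRinehartRing A L₁]
  [LieRinehartAlgebra R A L₁]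
  [LieRing L₂] [LieAlgebra R L₂] [Module A L₂] [LieRingModule L₂ A] [LieRinehartRing A L₂]
  [LieRinehartAlgebra R A L₂] {n : ℕ}

variable (L₂) in
lemma ofVec_add (x y : L₁) : ofVec A L₁ L₂ (x + y) = ofVec A L₁ L₂ x + ofVec A L₁ L₂ y := by
  ext v : 2
  change (exteriorPower.ιMulti A 1 ![x + y] : ExteriorAlgebra A L₁) =
    exteriorPower.ιMulti A 1 ![x] + exteriorPower.ιMulti A 1 ![y]
  simp only [exteriorPower.ιMulti_apply_coe, ExteriorAlgebra.ιMulti_apply]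
  simp

lemma exists_ofForm (q : ℕ) (α : PolyForm A L₁ L₂ (q, 0)) : ∃ a, ofForm A L₁ L₂ q a = α := by
  refine ⟨(exteriorPower.zeroEquiv A L₁).toLinearMap.compAlternatingMap α, ?_⟩
  ext v : 1
  exact (eq_zeroEquiv_smul (α v)).symm

variable (L₂) in
/-- `w ∈ Λ^p L₁` as an element of `Alt_A^0(L₂, Λ^p L₁)`. -/
def ofExt (p : ℕ) (w : ⋀[A]^p L₁) : PolyForm A L₁ L₂ (0, p) :=
  AlternatingMap.constOfIsEmpty A L₂ (Fin 0) w

lemma eq_ofExt (p : ℕ) (f : PolyForm A L₁ L₂ (0, p)) : f = ofExt L₂ p (f ![]) := by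
  ext v : 1
  exact congrArg f (Subsingleton.elim _ _)

variable (R) in
lemma mul_ofExt_form (p q : ℕ) (w : ⋀[A]^p L₁) (α : PolyForm A L₁ L₂ (q, 0)) :
    formsMul R A L₁ L₂ (phom R A L₁ L₂ (0, p) (ofExt L₂ p w)) (phom R A L₁ L₂ (q, 0) α) =
      (-1 : ℤ) ^ (p * q) • phom R A L₁ L₂ (q, p) ((LinearMap.toSpanSingleton A (⋀[A]^p L₁) w ∘ₗ
        (exteriorPower.zeroEquiv A L₁).toLinearMap).compAlternatingMap α) := by
  rw [formsMul_hom, formMul_apply, hom_zsmul, zero_add]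
  refine congrArg (_ • ·) ?_
  refine phom_congr (zero_add q) (add_zero p) _ _ fun v => ?_
  rw [shuffle_zero_left, coe_extMul]
  change (w : ExteriorAlgebra A L₁) * _ = ((exteriorPower.zeroEquiv A L₁ _ • w : ⋀[A]^p L₁) :
    ExteriorAlgebra A L₁)
  conv_lhs => rw [eq_zeroEquiv_smul (α _), Submodule.coe_smul, coe_ιMulti_zero]
  rw [mul_smul_comm, mul_one, Submodule.coe_smul]
  rfl

variable (R) in
lemma smul_ofExt (p : ℕ) (a : A) (w : ⋀[A]^p L₁) :
    phom R A L₁ L₂ (0, p) (ofExt L₂ p (a • w)) =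
      formsMul R A L₁ L₂
        (phom R A L₁ L₂ (0, 0) (ofExt L₂ 0 (a • exteriorPower.ιMulti A 0 ![])))
        (phom R A L₁ L₂ (0, p) (ofExt L₂ p w)) := by
  rw [formsMul_hom, formMul_apply, hom_zsmul, mul_zero, pow_zero, one_smul]
  refine (phom_congr (zero_add 0) (zero_add p) _ _ fun v => ?_).symm
  rw [shuffle_zero_left, coe_extMul]
  change ((a • exteriorPower.ιMulti A 0 ![] : ⋀[A]^0 L₁) : ExteriorAlgebra A L₁) * w =
    ((a • w : ⋀[A]^p L₁) : ExteriorAlgebra A L₁)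
  rw [Submodule.coe_smul, Submodule.coe_smul, coe_ιMulti_zero, smul_mul_assoc, one_mul]

variable (R) in
lemma formMul_zero_phom (a : A) (q p : ℕ) (f : PolyForm A L₁ L₂ (q, p)) :
    formsMul R A L₁ L₂
        (phom R A L₁ L₂ (0, 0) (ofExt L₂ 0 (a • exteriorPower.ιMulti A 0 ![])))
        (phom R A L₁ L₂ (q, p) f) = phom R A L₁ L₂ (q, p) (a • f) := by
  rw [formsMul_hom, formMul_apply, hom_zsmul]
  rw [show (0 + 0) * q = 0 by ring, pow_zero, one_smul]
  refine phom_congr (zero_add q) (zero_add p) _ _ fun v => ?_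
  rw [shuffle_zero_left, coe_extMul]
  change ((a • exteriorPower.ιMulti A 0 ![] : ⋀[A]^0 L₁) : ExteriorAlgebra A L₁) * _ =
    ((a • f _ : ⋀[A]^p L₁) : ExteriorAlgebra A L₁)
  rw [Submodule.coe_smul, Submodule.coe_smul, coe_ιMulti_zero, smul_mul_assoc, one_mul]

variable (R) in
lemma formMul_zero (a : A) (b : PolyForms A L₁ L₂) :
    formsMul R A L₁ L₂
        (phom R A L₁ L₂ (0, 0) (ofExt L₂ 0 (a • exteriorPower.ιMulti A 0 ![]))) b = a • b := by
  induction b using hom_induction (R := R) (T := PolyForm A L₁ L₂) with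
  | hz => rw [map_zero, smul_zero]
  | ha b c hb hc => rw [map_add, smul_add, hb, hc]
  | hh i f =>
    refine (formMul_zero_phom R a i.1 i.2 f).trans ?_
    exact map_smul (DirectSum.lof A (ℕ × ℕ) (PolyForm A L₁ L₂) i) a f

lemma HasBidegree.exists_duality_top {Δ : PolyForms A L₁ L₂ →ₗ[R] PolyForms A L₁ L₂}
    (hΔ : HasBidegree (T := PolyForm A L₁ L₂) (0, -1) Δ) (q : ℕ) (f : PolyForm A L₁ L₂ (q, n)) :
    ∃ G, duality A L₁ L₂ n (Δ (phom R A L₁ L₂ (q, n) f)) = dhom R A L₁ L₂ n (q, 1) G := by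
  cases n with
  | zero =>
    have h1 := hΔ.hom_zero q f
    refine ⟨0, (congrArg _ h1).trans ?_⟩
    rw [map_zero]
    exact (map_zero (DirectSum.lof R (ℕ × ℕ) (DualForm A L₁ L₂ 0) (q, 1))).symm
  | succ k =>
    obtain ⟨g, hg⟩ := hΔ.hom_succ q k f
    exact ⟨_, (congrArg _ hg).trans (duality_phom R (add_comm 1 k) g)⟩

variable [Module.Finite A L₁] [Module.Projective A L₁]
  (hn : ∀ 𝔭 : PrimeSpectrum A, Module.rankAtStalk (R := A) L₁ 𝔭 = n)

include hn

lemma ofVec_mul_top (x : L₁) (f : PolyForm A L₁ L₂ (0, n)) :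
    formsMul R A L₁ L₂ (phom R A L₁ L₂ (0, 1) (ofVec A L₁ L₂ x)) (phom R A L₁ L₂ (0, n) f) = 0 := by
  rw [mul_ofVec_phom]
  have h1 := phom_eq_zero_of_rank_lt (R := R) (L₂ := L₂) hn (Nat.lt_succ_self n)
    ((wedge n x).compAlternatingMap f)
  rw [h1, smul_zero]

/-- At each argument the value of `α` is a scalar that annihilates `Λ^n L₁`, and it vanishes by
injectivity of the pairing between `Λ^n` and `Λ^0`. -/
lemma eq_zero_of_forall_mul_top (q : ℕ) (α : PolyForm A L₁ L₂ (q, 0))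
    (h : ∀ f : PolyForm A L₁ L₂ (0, n),
      formsMul R A L₁ L₂ (phom R A L₁ L₂ (q, 0) α) (phom R A L₁ L₂ (0, n) f) = 0) : α = 0 := by
  ext v : 1
  refine adjointPairing_injective hn (add_zero n) ?_
  rw [AlternatingMap.zero_apply, map_zero]
  ext w : 2
  rw [coe_adjointPairing]
  have h1 := h (ofExt L₂ n (exteriorPower.ιMulti A n w))
  rw [(isBigradedCommAlgebra_forms R A L₁ L₂).mul_comm, mul_ofExt_form, smul_smul] at h1
  have h2 := congrArg (fun z : PolyForms A L₁ L₂ => z (q, n) v) h1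
  have h3 : ∀ (k : ℕ) (f : PolyForm A L₁ L₂ (q, n)),
      ((-1 : ℤ) ^ k • phom R A L₁ L₂ (q, n) f) (q, n) v = 0 → f v = 0 := fun k f hf => by
    rcases neg_one_pow_eq_or ℤ k with hk | hk
    · rw [hk, one_smul, hom_apply_same] at hf
      exact hf
    · rw [hk, neg_one_smul] at hf
      refine neg_eq_zero.1 (Eq.trans ?_ hf)
      exact congrArg (fun z => -(z v)) (hom_apply_same (R := R) (T := PolyForm A L₁ L₂) (q, n) f).symm
  have h4 := h3 _ _ ((congrArg (fun z : PolyForms A L₁ L₂ => z (q, n) v)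
    (congrArg (· • _) (pow_add (-1 : ℤ) _ _))).trans h2)
  have h5 : exteriorPower.zeroEquiv A L₁ (α v) • exteriorPower.ιMulti A n w = 0 := h4
  conv_lhs => rw [eq_zeroEquiv_smul (α v), Submodule.coe_smul, coe_ιMulti_zero]
  rw [mul_smul_comm, mul_one, ← Submodule.coe_smul, h5]
  rfl

end Top

/-! ## The correspondence between generators and connections -/

/-- The difference of a connection and a tensor. -/
def Conn.subLinear {R A L M : Type*} [CommRing R] [CommRing A] [Algebra R A]
    [LieRing L] [LieAlgebra R L] [Module A L] [LieRingModule L A] [LieRinehartRing A L]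
    [LieRinehartAlgebra R A L] [AddCommGroup M] [Module A M] [Module R M] [IsScalarTower R A M]
    (C : Conn R A L M) (γ : L →ₗ[A] M →ₗ[A] M) : Conn R A L M where
  act :=
    { toFun := fun x => C.act x - (γ x).restrictScalars R
      map_add' := fun x y => LinearMap.ext fun m => by
        simp only [map_add, LinearMap.sub_apply, LinearMap.add_apply, LinearMap.restrictScalars_apply]
        abel
      map_smul' := fun a x => LinearMap.ext fun m => by
        simp [smul_sub] }
  leibniz x a m := by
    simp only [LinearMap.coe_mk, AddHom.coe_mk, LinearMap.sub_apply,
      LinearMap.restrictScalars_apply, C.leibniz, map_smul, smul_sub]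
    abel

namespace AlmostTwilled

variable {R A L₁ L₂ : Type*} [CommRing R] [CommRing A] [Algebra R A]
  [LieRing L₁] [LieAlgebra R L₁] [Module A L₁] [LieRingModule L₁ A] [LieRinehartRing A L₁]
  [LieRinehartAlgebra R A L₁]
  [LieRing L₂] [LieAlgebra R L₂] [Module A L₂] [LieRingModule L₂ A] [LieRinehartRing A L₂]
  [LieRinehartAlgebra R A L₂]
  (S : AlmostTwilled R A L₁ L₂) {n : ℕ}

section Component

variable {M : Type*} [AddCommGroup M] [Module A M] [Module R M] [IsScalarTower R A M]
  (C : Conn R A L₁ M)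

lemma lieDerAt_zero_zero (x : L₁) (F : L₂ [⋀^Fin 0]→ₗ[A] (L₁ [⋀^Fin 0]→ₗ[A] M)) :
    S.lieDerAt C x 0 0 F ![] ![] = C.act x (F ![] ![]) := by
  change (C.lieDer x (F ![]) - ∑ i : Fin 0, F (Function.update ![] i _)) ![] = _
  rw [Finset.univ_eq_empty, Finset.sum_empty, sub_zero, C.lieDer_apply, Finset.univ_eq_empty,
    Finset.sum_empty, sub_zero]

lemma covDerAt_zero_zero (x : L₁) (F : L₂ [⋀^Fin 0]→ₗ[A] (L₁ [⋀^Fin 0]→ₗ[A] M)) :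
    S.covDerAt C 0 0 F ![] ![x] = -C.act x (F ![] ![]) := by
  have h := congrArg (fun z : L₂ [⋀^Fin 0]→ₗ[A] (L₁ [⋀^Fin 0]→ₗ[A] M) => z ![] ![])
    (S.insertFirst_covDerAt_zero C x 0 F)
  rw [pow_zero, one_smul] at h
  refine Eq.trans h ?_
  rw [← lieDerAt_zero_zero]
  rfl

lemma covDerAt_covDerAt (q m : ℕ) (F : L₂ [⋀^Fin q]→ₗ[A] (L₁ [⋀^Fin m]→ₗ[A] M)) :
    S.covDerAt C q (m + 1) (S.covDerAt C q m F) =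
      swapForms ((S.act₁.alt C q).rinehart (m + 1) ((S.act₁.alt C q).rinehart m (swapForms F))) := by
  ext v w
  change (-1 : ℤ) ^ q • (S.act₁.alt C q).rinehart (m + 1)
    ((-1 : ℤ) ^ q • (S.act₁.alt C q).rinehart m (swapForms F)) w v = _
  rw [map_zsmul]
  change (-1 : ℤ) ^ q • (-1 : ℤ) ^ q • (S.act₁.alt C q).rinehart (m + 1)
    ((S.act₁.alt C q).rinehart m (swapForms F)) w v = _
  rw [smul_smul, ← pow_add, Even.neg_one_pow ⟨_, rfl⟩, one_smul]
  rfl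

end Component

variable (C : Conn R A L₁ (⋀[A]^n L₁))

variable {C} in
lemma covDer_comp_covDer (hC : C.IsFlat) : S.covDer n C ∘ₗ S.covDer n C = 0 :=
  DirectSum.linearMap_ext R fun i => LinearMap.ext fun F => by
    refine (congrArg (S.covDer n C) (S.covDer_dhom C i F)).trans ?_
    refine (S.covDer_dhom C (i.1, i.2 + 1) _).trans ?_
    refine (congrArg _ ?_).trans (map_zero (DirectSum.lof R (ℕ × ℕ) (DualForm A L₁ L₂ n) _))
    refine (S.covDerAt_covDerAt C i.1 i.2 F).trans ?_
    rw [(S.flat₁.alt hC i.1).rinehart_rinehart]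
    rfl

/-- `w ∈ Λ^n L₁` as an element of bidegree `(0, 0)` on the dual side. -/
def ofTop (w : ⋀[A]^n L₁) : DualForm A L₁ L₂ n (0, 0) :=
  AlternatingMap.constOfIsEmpty A L₂ (Fin 0) (AlternatingMap.constOfIsEmpty A L₁ (Fin 0) w)

lemma duality_ofExt (w : ⋀[A]^n L₁) : duality A L₁ L₂ n (phom R A L₁ L₂ (0, n) (ofExt L₂ n w)) =
    dhom R A L₁ L₂ n (0, 0) (ofTop w) := by
  refine (duality_phom R (zero_add n) _).trans (congrArg _ ?_)
  ext v z : 3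
  refine (coe_adjointPairing (zero_add n) w z).trans ?_
  rw [coe_ιMulti_zero, one_mul]
  rfl

variable {C} in
-- The element `F` has form degree zero in both variables, so insertions kill it and its Lie
-- derivatives. From `∂∂F = 0` and Cartan's formula, `∂` commutes with Lie derivatives on `F`;
-- inserting a second vector then gives the commutator formula for Lie derivatives of `F`, which on
-- `Λ^n L₁` is flatness.
lemma isFlat_of_covDer_comp_covDer (h : S.covDer n C ∘ₗ S.covDer n C = 0) : C.IsFlat := by
  intro x y w
  let F := dhom R A L₁ L₂ n (0, 0) (ofTop w)
  let K := insertDual (A := A) (L₁ := L₁) R L₂ n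
  have hK : ∀ x z, K x (S.lieDual C z F) = 0 := fun x z => by
    refine (congrArg (K x) (S.lieDual_dhom C z (0, 0) _)).trans ?_
    exact insertDual_dhom_zero x 0 _
  have hK0 : ∀ x, K x F = 0 := fun x => insertDual_dhom_zero x 0 _
  have h1 : ∀ x, S.covDer n C (S.lieDual C x F) = S.lieDual C x (S.covDer n C F) := fun x => by
    have h2 := S.insertDual_covDer C x (S.covDer n C F)
    have h3 := S.insertDual_covDer C x F
    rw [show S.covDer n C (S.covDer n C F) = 0 from DFunLike.congr_fun h F, map_zero, h3,
      show insertDual R L₂ n x F = 0 from hK0 x] at h2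
    rw [map_zero, sub_zero, map_neg, sub_neg_eq_add] at h2
    exact neg_add_eq_zero.1 h2.symm |>.symm
  have hKd : ∀ x, K x (S.covDer n C F) = -S.lieDual C x F := fun x => by
    refine (S.insertDual_covDer C x F).trans ?_
    rw [show insertDual R L₂ n x F = 0 from hK0 x, map_zero, sub_zero]
  have h4 := congrArg (K y) (h1 x)
  have h5 := S.insertDual_covDer C y (S.lieDual C x F)
  have h6 := S.insertDual_lieDual C x y (S.covDer n C F)
  change S.lieDual C x (K y _) = K ⁅x, y⁆ _ + K y _ at h6
  change K y _ = -_ - S.covDer n C (K y _) at h5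
  rw [hK, map_zero, sub_zero] at h5
  rw [hKd, hKd, ← h4, h5, map_neg] at h6
  have h7 : S.lieDual C ⁅x, y⁆ F =
      S.lieDual C x (S.lieDual C y F) - S.lieDual C y (S.lieDual C x F) := by
    rw [neg_eq_iff_eq_neg] at h6
    rw [h6]
    abel
  have e1 : ∀ z w, S.lieDual C z (dhom R A L₁ L₂ n (0, 0) (ofTop w)) =
      dhom R A L₁ L₂ n (0, 0) (ofTop (C.act z w)) := fun z w => by
    refine (S.lieDual_dhom C z (0, 0) _).trans (congrArg _ ?_)
    ext v u : 2
    rw [Subsingleton.elim v ![], Subsingleton.elim u ![]]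
    exact S.lieDerAt_zero_zero C z _
  rw [e1, e1, e1, e1, e1, eq_sub_iff_add_eq] at h7
  have e2 : ∀ w : ⋀[A]^n L₁, (dhom R A L₁ L₂ n (0, 0) (ofTop w)) (0, 0) ![] ![] = w := fun w => by
    refine (congrArg (fun z : DualForm A L₁ L₂ n (0, 0) => z ![] ![])
      (DirectSum.lof_apply R (M := DualForm A L₁ L₂ n) (0, 0) (ofTop w))).trans ?_
    rfl
  have h8 := congrArg (fun z : DualForms A L₁ L₂ n => z (0, 0) ![] ![]) h7
  refine eq_sub_of_add_eq (Eq.trans ?_ (h8.trans (e2 _)))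
  exact (congrArg₂ (· + ·) (e2 _) (e2 _)).symm

/-! ### Generators of the crossed product bracket versus connections. -/

section Correspondence

variable [Module.Finite A L₁] [Module.Projective A L₁]
  (hn : ∀ 𝔭 : PrimeSpectrum A, Module.rankAtStalk (R := A) L₁ 𝔭 = n)

include hn

theorem isCrossedBracket_generatedBracket : S.IsCrossedBracket
    (generatedBracket (T := PolyForm A L₁ L₂) (formsMul R A L₁ L₂) (S.connGenerator hn C)) where
  gerstenhaber := (S.isLieGenerator_connGenerator hn C).isBigradedGerstenhaber
    (isBigradedCommAlgebra_forms R A L₁ L₂) (isGeneratedBy_forms R A L₁ L₂)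
    (fun x y z => by
      rw [leibniz_lie x y z, ofVec_add]) S.formAct_lie
  vec_vec := (S.isLieGenerator_connGenerator hn C).bracket_vec_vec
    (isBigradedCommAlgebra_forms R A L₁ L₂)
  vec_form x q a := by
    refine ((S.isLieGenerator_connGenerator hn C).bracket_vec_form
      (isBigradedCommAlgebra_forms R A L₁ L₂) x q _).trans ?_
    rw [formAct_ofForm]

omit hn in
theorem IsCrossedBracket.eq {B B' : PolyForms A L₁ L₂ →ₗ[R] PolyForms A L₁ L₂ →ₗ[R]
    PolyForms A L₁ L₂} (h : S.IsCrossedBracket B) (h' : S.IsCrossedBracket B') : B = B' := by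
  refine IsSkewDerivationBracket.eq_of_generators (T := PolyForm A L₁ L₂)
    h.gerstenhaber.isSkewDerivationBracket h'.gerstenhaber.isSkewDerivationBracket
    (isGeneratedBy_forms R A L₁ L₂) (fun x y => (h.vec_vec x y).trans (h'.vec_vec x y).symm)
    fun x q α => ?_
  obtain ⟨a, rfl⟩ := exists_ofForm q α
  exact (h.vec_form x q a).trans (h'.vec_form x q a).symm

/-- An arbitrary connection supplies a crossed product bracket; uniqueness shows that the choice
does not matter. -/
theorem existsUnique_isCrossedBracket : ∃! B : PolyForms A L₁ L₂ →ₗ[R] PolyForms A L₁ L₂ →ₗ[R]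
    PolyForms A L₁ L₂, S.IsCrossedBracket B := by
  obtain ⟨C⟩ := exists_conn A (⋀[A]^n L₁) R L₁
  exact ⟨_, S.isCrossedBracket_generatedBracket C hn,
    fun B hB => hB.eq S (S.isCrossedBracket_generatedBracket C hn)⟩

variable {B : PolyForms A L₁ L₂ →ₗ[R] PolyForms A L₁ L₂ →ₗ[R] PolyForms A L₁ L₂}
  (hB : S.IsCrossedBracket B)

include hB

lemma isGenerator_connGenerator :
    IsGenerator (T := PolyForm A L₁ L₂) (formsMul R A L₁ L₂) B (S.connGenerator hn C) := by
  rw [hB.eq S (S.isCrossedBracket_generatedBracket C hn)]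
  exact isGenerator_generatedBracket (S.connGenerator_bidegree hn C)

omit hB in
lemma Corresponds.eq_connGenerator {Δ : PolyForms A L₁ L₂ →ₗ[R] PolyForms A L₁ L₂}
    (h : S.Corresponds n Δ C) : Δ = S.connGenerator hn C :=
  LinearMap.ext fun a => (duality_bijective hn).injective
    ((h a).trans (S.duality_connGenerator hn C a).symm)

theorem existsUnique_generator :
    ∃! Δ : PolyForms A L₁ L₂ →ₗ[R] PolyForms A L₁ L₂,
      IsGenerator (T := PolyForm A L₁ L₂) (formsMul R A L₁ L₂) B Δ ∧ S.Corresponds n Δ C :=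
  ⟨_, ⟨S.isGenerator_connGenerator C hn hB, S.corresponds_connGenerator hn C⟩,
    fun _ h => h.2.eq_connGenerator S C hn⟩

omit hB in
-- The top power corresponds to bidegree `(0, 0)` on the dual side, where the covariant derivative
-- is the connection itself, with the Rinehart sign `(-1)^(0+1)`. So a generator determines its
-- connection.
lemma Corresponds.duality_apply_top {Δ : PolyForms A L₁ L₂ →ₗ[R] PolyForms A L₁ L₂}
    (h : S.Corresponds n Δ C) (x : L₁) (w : ⋀[A]^n L₁) :
    duality A L₁ L₂ n (Δ (phom R A L₁ L₂ (0, n) (ofExt L₂ n w))) (0, 1) ![] ![x] = -C.act x w := by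
  rw [h, duality_ofExt, covDer_dhom]
  refine (congrArg (fun z : DualForm A L₁ L₂ n (0, 1) => z ![] ![x])
    (DirectSum.lof_apply R (M := DualForm A L₁ L₂ n) (0, 1) _)).trans ?_
  exact S.covDerAt_zero_zero C x _

omit hB in
lemma Corresponds.conn_eq {Δ : PolyForms A L₁ L₂ →ₗ[R] PolyForms A L₁ L₂}
    {C C' : Conn R A L₁ (⋀[A]^n L₁)} (h : S.Corresponds n Δ C) (h' : S.Corresponds n Δ C') :
    C = C' := by
  obtain ⟨c, hc⟩ := C
  obtain ⟨c', hc'⟩ := C'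
  congr 1
  refine LinearMap.ext fun x => LinearMap.ext fun w => ?_
  exact neg_injective ((h.duality_apply_top S _ hn x w).symm.trans
    (h'.duality_apply_top S _ hn x w))

/-- Compared with the generator of some connection `C₀`, the given one differs by a derivation `D`.
On the top power `D` is `A`-linear and amounts to a tensor `γ`; the generator of `C₀ - γ` agrees
with the given one there, and therefore everywhere. -/
lemma exists_corresponds {Δ : PolyForms A L₁ L₂ →ₗ[R] PolyForms A L₁ L₂}
    (hΔ : IsGenerator (T := PolyForm A L₁ L₂) (formsMul R A L₁ L₂) B Δ) :
    ∃ C : Conn R A L₁ (⋀[A]^n L₁), S.Corresponds n Δ C := by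
  obtain ⟨C₀⟩ := exists_conn A (⋀[A]^n L₁) R L₁
  have hA := isBigradedCommAlgebra_forms R A L₁ L₂
  have hv := isGeneratedBy_forms R A L₁ L₂
  have hC₀ := S.isGenerator_connGenerator C₀ hn hB
  have hD := hΔ.isGradedDerivation_sub hC₀
  let D := Δ - S.connGenerator hn C₀
  -- `A`-linearity on the top power: scalars have bidegree `(0, 0)`, where both generators vanish,
  -- so the derivation `D` passes through them.
  have hDsmul : ∀ (a : A) (w : ⋀[A]^n L₁), D (phom R A L₁ L₂ (0, n) (ofExt L₂ n (a • w))) =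
      a • D (phom R A L₁ L₂ (0, n) (ofExt L₂ n w)) := fun a w => by
    rw [smul_ofExt]
    refine (hD (0, 0) _ _).trans ?_
    have h0 : D (phom R A L₁ L₂ (0, 0) (ofExt L₂ 0 (a • exteriorPower.ιMulti A 0 ![]))) = 0 := by
      refine (congrArg₂ (· - ·) (hΔ.1.hom_zero 0 _) (hC₀.1.hom_zero 0 _)).trans (sub_zero _)
    refine (congrArg₂ (· + ·) (congrArg (fun z => formsMul R A L₁ L₂ z _) h0)
      (congrArg (_ • ·) (formMul_zero R a _))).trans ?_
    rw [map_zero, LinearMap.zero_apply, zero_add, tdeg, zero_add, mul_zero, pow_zero, one_smul]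
  let K : ⋀[A]^n L₁ →ₗ[A] (L₁ [⋀^Fin 1]→ₗ[A] ⋀[A]^n L₁) :=
    { toFun := fun w => duality A L₁ L₂ n (D (phom R A L₁ L₂ (0, n) (ofExt L₂ n w))) (0, 1) ![]
      map_add' := fun w w' => by
        have h1 : phom R A L₁ L₂ (0, n) (ofExt L₂ n (w + w')) =
            phom R A L₁ L₂ (0, n) (ofExt L₂ n w) + phom R A L₁ L₂ (0, n) (ofExt L₂ n w') :=
          hom_add (R := R) (T := PolyForm A L₁ L₂) (0, n) (ofExt L₂ n w) (ofExt L₂ n w')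
        rw [h1, map_add, map_add]
        rfl
      map_smul' := fun a w => by
        rw [hDsmul, map_smul]
        rfl }
  let γ : L₁ →ₗ[A] ⋀[A]^n L₁ →ₗ[A] ⋀[A]^n L₁ :=
    LinearMap.mk₂ A (fun x w => (K w).curryLeft x ![])
      (fun x y w => by rw [map_add]; rfl) (fun a x w => by rw [map_smul]; rfl)
      (fun x w w' => by rw [map_add]; rfl) (fun a x w => by rw [map_smul]; rfl)
  -- The tensor is subtracted because in top degree a generator corresponds to minus its connection.
  refine ⟨C₀.subLinear γ, ?_⟩
  suffices h : Δ = S.connGenerator hn (C₀.subLinear γ) by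
    rw [h]
    exact S.corresponds_connGenerator hn _
  have hC := S.isGenerator_connGenerator (C₀.subLinear γ) hn hB
  refine sub_eq_zero.1 (hv.derivation_eq_zero_of_top (hΔ.isGradedDerivation_sub hC) (q := 0)
    (fun q α => (congrArg₂ (· - ·) (hΔ.1.hom_zero q α) (hC.1.hom_zero q α)).trans (sub_zero _))
    (fun x => ?_) (ofVec_mul_top hn) (eq_zero_of_forall_mul_top hn 0) fun f => ?_)
  · obtain ⟨g, hg⟩ := hΔ.1.hom_succ 0 0 (ofVec A L₁ L₂ x)
    obtain ⟨g', hg'⟩ := hC.1.hom_succ 0 0 (ofVec A L₁ L₂ x)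
    exact ⟨g - g', (congrArg₂ (· - ·) hg hg').trans
      (map_sub (DirectSum.lof R (ℕ × ℕ) (PolyForm A L₁ L₂) (0, 0)) g g').symm⟩
  · rw [eq_ofExt n f]
    generalize f ![] = w
    refine sub_eq_zero.2 ((duality_bijective hn).injective ?_)
    obtain ⟨G, hG⟩ := hΔ.1.exists_duality_top 0 (ofExt L₂ n w)
    obtain ⟨G', hG'⟩ := hC.1.exists_duality_top 0 (ofExt L₂ n w)
    refine hG.trans (Eq.trans (congrArg _ ?_) hG'.symm)
    have e : ∀ G : DualForm A L₁ L₂ n (0, 1), (dhom R A L₁ L₂ n (0, 1) G) (0, 1) = G := fun G =>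
      DirectSum.lof_apply R (M := DualForm A L₁ L₂ n) (0, 1) G
    rw [← e G, ← e G', ← hG, ← hG']
    ext v u : 2
    rw [Subsingleton.elim v ![], show u = ![u 0] by ext i; fin_cases i; rfl]
    generalize u 0 = x
    refine Eq.trans ?_
      ((S.corresponds_connGenerator hn (C₀.subLinear γ)).duality_apply_top S _ hn x w).symm
    have h1 : Δ (phom R A L₁ L₂ (0, n) (ofExt L₂ n w)) =
        D (phom R A L₁ L₂ (0, n) (ofExt L₂ n w)) +
          S.connGenerator hn C₀ (phom R A L₁ L₂ (0, n) (ofExt L₂ n w)) := (sub_add_cancel _ _).symm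
    refine (congrArg (fun z => duality A L₁ L₂ n z (0, 1) ![] ![x]) h1).trans ?_
    rw [map_add]
    refine (congrArg (K w ![x] + ·)
      ((S.corresponds_connGenerator hn C₀).duality_apply_top S _ hn x w)).trans ?_
    change K w ![x] + -C₀.act x w = -(C₀.act x w - K w ![x])
    abel

theorem existsUnique_conn {Δ : PolyForms A L₁ L₂ →ₗ[R] PolyForms A L₁ L₂}
    (hΔ : IsGenerator (T := PolyForm A L₁ L₂) (formsMul R A L₁ L₂) B Δ) :
    ∃! C : Conn R A L₁ (⋀[A]^n L₁), S.Corresponds n Δ C := by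
  obtain ⟨C, hC⟩ := S.exists_corresponds hn hB hΔ
  exact ⟨C, hC, fun C' hC' => hC'.conn_eq S hn hC⟩

omit hB in
-- The duality intertwines the squares of the generator and of the covariant derivative, and the
-- latter is zero exactly for flat connections: the induced connection on forms is flat if the given
-- one is, as the action on `L₂` is flat.
theorem Corresponds.isExact_iff {Δ : PolyForms A L₁ L₂ →ₗ[R] PolyForms A L₁ L₂}
    (h : S.Corresponds n Δ C) : IsExact (T := PolyForm A L₁ L₂) Δ ↔ C.IsFlat := by
  constructor
  · intro hΔ
    refine S.isFlat_of_covDer_comp_covDer (LinearMap.ext fun b => ?_)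
    obtain ⟨a, rfl⟩ := (duality_bijective hn).surjective b
    rw [LinearMap.comp_apply, ← h, ← h]
    exact (congrArg _ (DFunLike.congr_fun hΔ a)).trans (map_zero _)
  · intro hC
    refine LinearMap.ext fun a => (duality_bijective hn).injective ?_
    rw [LinearMap.comp_apply, h, h]
    exact (DFunLike.congr_fun (S.covDer_comp_covDer hC) _).trans (map_zero _).symm

end Correspondence

end AlmostTwilled

/-! ## Contractions and the crossed product bracket -/

lemma curryLeft_curryLeft_swap {A N M : Type*} [CommRing A] [AddCommGroup N] [Module A N]
    [AddCommGroup M] [Module A M] {m : ℕ} (f : N [⋀^Fin (m + 2)]→ₗ[A] M) (x y : N) :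
    (f.curryLeft x).curryLeft y = -(f.curryLeft y).curryLeft x := by
  have h := AlternatingMap.curryLeft_same f (x + y)
  simp only [map_add, AlternatingMap.curryLeft_add, LinearMap.add_apply,
    AlternatingMap.curryLeft_same, zero_add, add_zero] at h
  exact eq_neg_of_add_eq_zero_right h

lemma Conn.curryLeft_alt {R A L M N : Type*} [CommRing R] [CommRing A] [Algebra R A]
    [LieRing L] [LieAlgebra R L] [Module A L] [LieRingModule L A] [LieRinehartRing A L]
    [LieRinehartAlgebra R A L] [AddCommGroup M] [Module A M] [Module R M] [IsScalarTower R A M]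
    [AddCommGroup N] [Module A N] [Module R N] [IsScalarTower R A N] (CN : Conn R A L N)
    (CM : Conn R A L M) (x : L) (q : ℕ) (f : N [⋀^Fin (q + 1)]→ₗ[A] M) (y : N) :
    ((CN.alt CM (q + 1)).act x f).curryLeft y =
      (CN.alt CM q).act x (f.curryLeft y) - f.curryLeft (CN.act x y) :=
  Conn.curryLeft_altDer x (CN.act x) (CM.act x) (CN.leibniz x) (CM.leibniz x) f y

section Abstract

variable {R : Type*} [CommRing R]
  {T : ℕ × ℕ → Type*} [∀ i, AddCommGroup (T i)] [∀ i, Module R (T i)]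
  {μ B : (⨁ i, T i) →ₗ[R] (⨁ i, T i) →ₗ[R] (⨁ i, T i)}

lemma IsSkewDerivationBracket.vec_mul (hB : IsSkewDerivationBracket μ B) (u : T (0, 1))
    (a b : ⨁ i, T i) : B (hom R (0, 1) u) (μ a b) =
      μ (B (hom R (0, 1) u) a) b + μ a (B (hom R (0, 1) u) b) := by
  induction a using hom_induction (R := R) (T := T) with
  | hz => simp
  | ha a a' h h' => simp only [map_add, LinearMap.add_apply, h, h']; abel
  | hh i f =>
    rw [hB.leibniz, show (tdeg (0, 1) + 1) * tdeg i = tdeg i + tdeg i by simp only [tdeg]; ring,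
      Even.neg_one_pow ⟨_, rfl⟩, one_smul]

lemma IsSkewDerivationBracket.exists_vec_hom (hB : IsSkewDerivationBracket μ B) (u : T (0, 1))
    (i : ℕ × ℕ) (f : T i) : ∃ g : T i, B (hom R (0, 1) u) (hom R i f) = hom R i g :=
  exists_eq_hom fun k hk => hB.bidegree (0, 1) i u f k fun h => hk (by
    simp only [Prod.mk.injEq] at h
    ext <;> omega)

/-- The commutator of an odd derivation and an even derivation of bidegree zero, up to an odd
derivation, is an odd derivation. -/
lemma IsGradedDerivation.commutator_add {j j' b : (⨁ i, T i) →ₗ[R] (⨁ i, T i)}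
    (hj : IsGradedDerivation μ 1 j) (hj' : IsGradedDerivation μ 1 j')
    (hb : ∀ a c, b (μ a c) = μ (b a) c + μ a (b c))
    (hb' : ∀ i (f : T i), ∃ g : T i, b (hom R i f) = hom R i g) :
    IsGradedDerivation μ 1 (j ∘ₗ b - b ∘ₗ j + j') := by
  intro i f z
  obtain ⟨g, hg⟩ := hb' i f
  have e3 := hj i g z
  rw [← hg] at e3
  simp only [LinearMap.add_apply, LinearMap.sub_apply, LinearMap.comp_apply]
  rw [hb, map_add, hj i f z, hj' i f z, e3, hj i f (b z), map_add, map_zsmul, hb, hb]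
  simp only [map_add, map_sub, LinearMap.add_apply, LinearMap.sub_apply, smul_add, smul_sub]
  abel

end Abstract

/-! ### Forms of bidegree `(q, 0)`, scalars and vectors under contraction. -/

section Contr

variable {R A L₁ L₂ : Type*} [CommRing R] [CommRing A] [Algebra R A]
  [LieRing L₁] [LieAlgebra R L₁] [Module A L₁] [LieRingModule L₁ A] [LieRinehartRing A L₁]
  [LieRinehartAlgebra R A L₁]
  [LieRing L₂] [LieAlgebra R L₂] [Module A L₂] [LieRingModule L₂ A] [LieRinehartRing A L₂]
  [LieRinehartAlgebra R A L₂]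

lemma contr_contr (ξ η : L₂) (a : PolyForms A L₁ L₂) :
    contr R ξ (contr R η a) = -contr R η (contr R ξ a) := by
  refine DFinsupp.ext fun i => ?_
  obtain ⟨q, p⟩ := i
  refine (contr_apply ξ (contr R η a) q p).trans ?_
  refine Eq.trans ?_ (congrArg (fun z => -z) (contr_apply η (contr R ξ a) q p).symm)
  rw [contr_apply, contr_apply]
  ext v : 1
  change (-1 : ℤ) ^ (q + 1) • (-1 : ℤ) ^ (q + 1 + 1) • ((a (q + 2, p)).curryLeft η).curryLeft ξ v =
    -((-1 : ℤ) ^ (q + 1) • (-1 : ℤ) ^ (q + 1 + 1) • ((a (q + 2, p)).curryLeft ξ).curryLeft η v)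
  rw [curryLeft_curryLeft_swap, AlternatingMap.neg_apply, smul_neg, smul_neg]

variable (R A L₁ L₂) in
/-- The contraction as an `A`-linear map in the vector. -/
def contrLin (a : PolyForms A L₁ L₂) : L₂ →ₗ[A] PolyForms A L₁ L₂ where
  toFun ξ := contr R ξ a
  map_add' ξ η := by
    refine DFinsupp.ext fun i => ?_
    obtain ⟨q, p⟩ := i
    refine (contr_apply (ξ + η) a q p).trans ?_
    refine Eq.trans ?_ (congrArg₂ (· + ·) (contr_apply ξ a q p) (contr_apply η a q p)).symm
    rw [map_add, smul_add]
  map_smul' r ξ := by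
    refine DFinsupp.ext fun i => ?_
    obtain ⟨q, p⟩ := i
    refine (contr_apply (r • ξ) a q p).trans ?_
    refine Eq.trans ?_ (congrArg (r • ·) (contr_apply ξ a q p)).symm
    rw [map_smul, smul_comm]

lemma contrLin_apply (a : PolyForms A L₁ L₂) (ξ : L₂) : contrLin R A L₁ L₂ a ξ = contr R ξ a := rfl

variable (R A L₁ L₂)

/-- `x ∈ L₁` as an element of `Alt_A(L₂, Λ_A L₁)`. -/
def vec : L₁ →+ PolyForms A L₁ L₂ :=
  AddMonoidHom.mk' (fun x => phom R A L₁ L₂ (0, 1) (ofVec A L₁ L₂ x)) fun x y => by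
    rw [ofVec_add]
    exact hom_add (R := R) (T := PolyForm A L₁ L₂) (0, 1) _ _

/-- `a ∈ A` as an element of `Alt_A(L₂, Λ_A L₁)`. -/
def scal : A →+ PolyForms A L₁ L₂ :=
  AddMonoidHom.mk' (fun a => phom R A L₁ L₂ (0, 0) (ofExt L₂ 0 (a • exteriorPower.ιMulti A 0 ![])))
    fun a b => by
      rw [add_smul]
      exact hom_add (R := R) (T := PolyForm A L₁ L₂) (0, 0) (ofExt L₂ 0 _) (ofExt L₂ 0 _)

variable {A L₁ L₂}

lemma scal_apply (a : A) : scal R A L₁ L₂ a =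
    phom R A L₁ L₂ (0, 0) (ofExt L₂ 0 (a • exteriorPower.ιMulti A 0 ![])) := rfl

lemma scal_mul (a : A) (b : PolyForms A L₁ L₂) :
    formsMul R A L₁ L₂ (scal R A L₁ L₂ a) b = a • b := formMul_zero R a b

lemma smul_vec (a : A) (x : L₁) : a • vec R A L₁ L₂ x = vec R A L₁ L₂ (a • x) := by
  refine (map_smul (DirectSum.lof A (ℕ × ℕ) (PolyForm A L₁ L₂) (0, 1)) a
    (ofVec A L₁ L₂ x)).symm.trans ?_
  refine congrArg (DirectSum.lof A (ℕ × ℕ) (PolyForm A L₁ L₂) (0, 1)) ?_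
  ext v : 2
  change ((a • exteriorPower.ιMulti A 1 ![x] : ⋀[A]^1 L₁) : ExteriorAlgebra A L₁) =
    exteriorPower.ιMulti A 1 ![a • x]
  rw [Submodule.coe_smul]
  simp only [exteriorPower.ιMulti_apply_coe, ExteriorAlgebra.ιMulti_apply]
  simp

lemma contr_vec (ξ : L₂) (x : L₁) : contr R ξ (vec R A L₁ L₂ x) = 0 := contr_hom_zero ξ 1 _

lemma smul_scal (a b : A) : a • scal R A L₁ L₂ b = scal R A L₁ L₂ (a * b) := by
  refine (map_smul (DirectSum.lof A (ℕ × ℕ) (PolyForm A L₁ L₂) (0, 0)) a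
    (ofExt L₂ 0 _)).symm.trans ?_
  refine congrArg (DirectSum.lof A (ℕ × ℕ) (PolyForm A L₁ L₂) (0, 0)) ?_
  ext v : 1
  exact (mul_smul a b _).symm

lemma exists_scal (α : PolyForm A L₁ L₂ (0, 0)) :
    ∃ a, phom R A L₁ L₂ (0, 0) α = scal R A L₁ L₂ a := by
  obtain ⟨a, ha⟩ := eq_smul_ιMulti_zero (α ![])
  refine ⟨a, ?_⟩
  rw [eq_ofExt 0 α, ha, scal_apply]

lemma exists_oneForm (c : L₂ →ₗ[A] A) : ∃ θ : PolyForm A L₁ L₂ (1, 0),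
    ∀ ξ, contr R ξ (phom R A L₁ L₂ (1, 0) θ) = scal R A L₁ L₂ (c ξ) := by
  -- The minus sign compensates the sign of the contraction in degree one.
  refine ⟨-AlternatingMap.ofSubsingleton A L₂ (⋀[A]^0 L₁) (0 : Fin 1)
    (LinearMap.toSpanSingleton A (⋀[A]^0 L₁) (exteriorPower.ιMulti A 0 ![]) ∘ₗ c), fun ξ => ?_⟩
  refine (contr_hom_succ ξ 0 0 _).trans ?_
  refine (hom_zsmul (R := R) (T := PolyForm A L₁ L₂) (0, 0) _ _).symm.trans (congrArg _ ?_)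
  rw [zero_add, pow_one, neg_one_smul]
  ext v : 1
  exact neg_neg (c ξ • exteriorPower.ιMulti A 0 ![])

/-- The forms of degree `q` with values in `Λ^0 L₁`. -/
def formsOfDegree (A L₁ L₂ : Type*) [CommRing A] [Algebra R A]
    [LieRing L₁] [LieAlgebra R L₁] [Module A L₁] [LieRingModule L₁ A] [LieRinehartRing A L₁]
    [LieRinehartAlgebra R A L₁]
    [LieRing L₂] [LieAlgebra R L₂] [Module A L₂] [LieRingModule L₂ A] [LieRinehartRing A L₂]
    [LieRinehartAlgebra R A L₂] (q : ℕ) : Submodule A (PolyForms A L₁ L₂) :=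
  LinearMap.range (DirectSum.lof A (ℕ × ℕ) (PolyForm A L₁ L₂) (q, 0))

lemma phom_mem_formsOfDegree (q : ℕ) (α : PolyForm A L₁ L₂ (q, 0)) :
    phom R A L₁ L₂ (q, 0) α ∈ formsOfDegree R A L₁ L₂ q := ⟨α, rfl⟩

lemma exists_of_mem_formsOfDegree {q : ℕ} {a : PolyForms A L₁ L₂}
    (h : a ∈ formsOfDegree R A L₁ L₂ q) : ∃ α, a = phom R A L₁ L₂ (q, 0) α := by
  obtain ⟨α, rfl⟩ := h
  exact ⟨α, rfl⟩

variable {R}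

lemma contr_mem_formsOfDegree {q : ℕ} {a : PolyForms A L₁ L₂} (ξ : L₂)
    (h : a ∈ formsOfDegree R A L₁ L₂ (q + 1)) : contr R ξ a ∈ formsOfDegree R A L₁ L₂ q := by
  obtain ⟨α, rfl⟩ := exists_of_mem_formsOfDegree R h
  have h1 := contr_hom_succ (R := R) ξ q 0 α
  rw [h1]
  exact zsmul_mem (phom_mem_formsOfDegree R q _) _

lemma contr_eq_zero_of_mem_formsOfDegree {a : PolyForms A L₁ L₂} (ξ : L₂)
    (h : a ∈ formsOfDegree R A L₁ L₂ 0) : contr R ξ a = 0 := by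
  obtain ⟨α, rfl⟩ := exists_of_mem_formsOfDegree R h
  exact contr_hom_zero ξ 0 α

lemma eq_zero_of_mem_formsOfDegree {q : ℕ} {a : PolyForms A L₁ L₂}
    (h : a ∈ formsOfDegree R A L₁ L₂ (q + 1)) (h' : ∀ ξ, contr R ξ a = 0) : a = 0 := by
  refine forms_ext (R := R) ?_ fun ξ => by rw [h', map_zero]
  obtain ⟨α, rfl⟩ := exists_of_mem_formsOfDegree R h
  have h1 := evalZero_hom_succ (R := R) q 0 α
  rw [h1, map_zero]

lemma mul_mem_formsOfDegree {q : ℕ} {a : PolyForms A L₁ L₂} (θ : PolyForm A L₁ L₂ (1, 0))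
    (h : a ∈ formsOfDegree R A L₁ L₂ q) :
    formsMul R A L₁ L₂ (phom R A L₁ L₂ (1, 0) θ) a ∈ formsOfDegree R A L₁ L₂ (q + 1) := by
  obtain ⟨α, rfl⟩ := exists_of_mem_formsOfDegree R h
  rw [formsMul_hom, add_comm q 1]
  exact phom_mem_formsOfDegree R (1 + q) _

lemma isGradedDerivation_contr (ξ : L₂) :
    IsGradedDerivation (T := PolyForm A L₁ L₂) (formsMul R A L₁ L₂) 1 (contr R ξ) :=
  fun i f z => ((isContraction_forms R A L₁ L₂).contr_hom_mul ξ i f z).trans (by rw [one_mul])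

lemma contr_oneForm_mul (ξ : L₂) (θ : PolyForm A L₁ L₂ (1, 0)) (a : PolyForms A L₁ L₂) :
    contr R ξ (formsMul R A L₁ L₂ (phom R A L₁ L₂ (1, 0) θ) a) =
      formsMul R A L₁ L₂ (contr R ξ (phom R A L₁ L₂ (1, 0) θ)) a -
        formsMul R A L₁ L₂ (phom R A L₁ L₂ (1, 0) θ) (contr R ξ a) := by
  refine ((isContraction_forms R A L₁ L₂).contr_hom_mul ξ (1, 0) θ a).trans ?_
  rw [sub_eq_add_neg]
  refine congrArg₂ (· + ·) rfl ?_
  exact (congrArg (· • _) (by norm_num : (-1 : ℤ) ^ tdeg (1, 0) = -1)).trans (neg_one_smul ℤ _)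

end Contr

namespace AlmostTwilled

variable {R A L₁ L₂ : Type*} [CommRing R] [CommRing A] [Algebra R A]
  [LieRing L₁] [LieAlgebra R L₁] [Module A L₁] [LieRingModule L₁ A] [LieRinehartRing A L₁]
  [LieRinehartAlgebra R A L₁]
  [LieRing L₂] [LieAlgebra R L₂] [Module A L₂] [LieRingModule L₂ A] [LieRinehartRing A L₂]
  [LieRinehartAlgebra R A L₂]
  (S : AlmostTwilled R A L₁ L₂)

lemma contr_polyLie (ξ η : L₂) (a : PolyForms A L₁ L₂) :
    contr R η (S.polyLie ξ a) = S.polyLie ξ (contr R η a) - contr R ⁅ξ, η⁆ a := by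
  have h : contr R η ∘ₗ S.polyLie ξ = S.polyLie ξ ∘ₗ contr R η - contr R ⁅ξ, η⁆ :=
    linearMap_eq_of_hom (T := PolyForm A L₁ L₂) fun i f => by
      rw [LinearMap.comp_apply, LinearMap.sub_apply, LinearMap.comp_apply, polyLie_phom]
      obtain ⟨_ | q, p⟩ := i
      · refine (contr_hom_zero _ _ _).trans ?_
        refine Eq.trans ?_ (congrArg₂ (fun a b => S.polyLie ξ a - b) (contr_hom_zero _ _ _)
          (contr_hom_zero _ _ _)).symm
        rw [map_zero, sub_zero]
      · refine (contr_hom_succ _ _ _ _).trans ?_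
        refine Eq.trans ?_ (congrArg₂ (fun a b => S.polyLie ξ a - b) (contr_hom_succ _ _ _ _)
          (contr_hom_succ _ _ _ _)).symm
        rw [Conn.curryLeft_lieDer, map_zsmul, polyLie_phom, ← smul_sub]
        exact congrArg (_ • ·) (map_sub (DirectSum.lof R (ℕ × ℕ) (PolyForm A L₁ L₂) (q, p)) _ _)
  exact DFunLike.congr_fun h a

lemma polyLie_vec (ξ : L₂) (x : L₁) :
    S.polyLie ξ (vec R A L₁ L₂ x) = vec R A L₁ L₂ (S.act₂.act ξ x) := by
  refine (S.polyLie_phom ξ (0, 1) _).trans (congrArg _ ?_)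
  ext v : 1
  rw [Conn.lieDer_apply, Finset.univ_eq_empty, Finset.sum_empty, sub_zero]
  refine (S.act₂.ext_act_ιMulti 1 ξ ![x]).trans ?_
  rw [Fin.sum_univ_one]
  refine congrArg (exteriorPower.ιMulti A 1) ?_
  ext i
  fin_cases i
  simp

lemma contr_dPoly_vec (ξ : L₂) (x : L₁) :
    contr R ξ (S.dPoly (vec R A L₁ L₂ x)) = vec R A L₁ L₂ (S.act₂.act ξ x) := by
  rw [contr_dPoly, contr_vec, map_zero, sub_zero, polyLie_vec]

lemma polyLie_scal (ξ : L₂) (a : A) :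
    S.polyLie ξ (scal R A L₁ L₂ a) = scal R A L₁ L₂ ⁅ξ, a⁆ := by
  refine (S.polyLie_phom ξ (0, 0) _).trans (congrArg _ ?_)
  ext v : 1
  rw [Conn.lieDer_apply, Finset.univ_eq_empty, Finset.sum_empty, sub_zero]
  exact S.act₂.ext_act_zero ξ a ![]

lemma polyLie_mem_formsOfDegree (ξ : L₂) {q : ℕ} {a : PolyForms A L₁ L₂}
    (h : a ∈ formsOfDegree R A L₁ L₂ q) : S.polyLie ξ a ∈ formsOfDegree R A L₁ L₂ q := by
  obtain ⟨α, rfl⟩ := exists_of_mem_formsOfDegree R h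
  rw [polyLie_phom]
  exact phom_mem_formsOfDegree R q _

lemma dPoly_mem_formsOfDegree {q : ℕ} {a : PolyForms A L₁ L₂}
    (h : a ∈ formsOfDegree R A L₁ L₂ q) : S.dPoly a ∈ formsOfDegree R A L₁ L₂ (q + 1) := by
  obtain ⟨α, rfl⟩ := exists_of_mem_formsOfDegree R h
  rw [dPoly_phom]
  exact phom_mem_formsOfDegree R (q + 1) _

section Bracket

variable {S} [Module.Finite A L₁] [Module.Projective A L₁]
  {B : PolyForms A L₁ L₂ →ₗ[R] PolyForms A L₁ L₂ →ₗ[R] PolyForms A L₁ L₂}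
  (hB : S.IsCrossedBracket B)

include hB

omit [Module.Finite A L₁] [Module.Projective A L₁]

lemma IsCrossedBracket.apply_form (x : L₁) (q : ℕ) (α : PolyForm A L₁ L₂ (q, 0)) :
    B (vec R A L₁ L₂ x) (phom R A L₁ L₂ (q, 0) α) = phom R A L₁ L₂ (q, 0) (S.formAct x q α) := by
  obtain ⟨a, rfl⟩ := exists_ofForm q α
  rw [formAct_ofForm]
  exact hB.vec_form x q a

lemma IsCrossedBracket.apply_mem_formsOfDegree (x : L₁) {q : ℕ} {a : PolyForms A L₁ L₂}
    (h : a ∈ formsOfDegree R A L₁ L₂ q) :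
    B (vec R A L₁ L₂ x) a ∈ formsOfDegree R A L₁ L₂ q := by
  obtain ⟨α, rfl⟩ := exists_of_mem_formsOfDegree R h
  rw [hB.apply_form]
  exact phom_mem_formsOfDegree R q _

lemma IsCrossedBracket.apply_scal (x : L₁) (a : A) :
    B (vec R A L₁ L₂ x) (scal R A L₁ L₂ a) = scal R A L₁ L₂ ⁅x, a⁆ := by
  rw [scal_apply, hB.apply_form]
  refine congrArg _ ?_
  ext v : 1
  refine (Conn.alt_act_apply S.act₁ (Conn.zeroExt R A L₁ L₁) 0 x (ofExt L₂ 0 _) v).trans ?_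
  rw [Finset.univ_eq_empty, Finset.sum_empty, sub_zero, Conn.zeroExt_act, ofExt,
    AlternatingMap.constOfIsEmpty_apply, Function.const_apply, map_smul, exteriorPower.zeroEquiv_ιMulti, smul_eq_mul,
    mul_one]
  rfl

lemma IsCrossedBracket.vec_mul (x : L₁) (a b : PolyForms A L₁ L₂) :
    B (vec R A L₁ L₂ x) (formsMul R A L₁ L₂ a b) =
      formsMul R A L₁ L₂ (B (vec R A L₁ L₂ x) a) b +
        formsMul R A L₁ L₂ a (B (vec R A L₁ L₂ x) b) := by
  have h := IsSkewDerivationBracket.vec_mul (T := PolyForm A L₁ L₂)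
    hB.gerstenhaber.isSkewDerivationBracket (ofVec A L₁ L₂ x) a b
  exact h

variable [Module.Finite A L₁] [Module.Projective A L₁]

/-- The difference of the two sides is an odd derivation, so it is enough to test generators. On
vectors all terms vanish; on forms it is the definition of the induced action of `x`. -/
theorem IsCrossedBracket.contr_bracket_vec (x : L₁) (ξ : L₂) (a : PolyForms A L₁ L₂) :
    contr R ξ (B (vec R A L₁ L₂ x) a) =
      B (vec R A L₁ L₂ x) (contr R ξ a) - contr R (S.act₁.act x ξ) a := by
  have hder : IsGradedDerivation (T := PolyForm A L₁ L₂) (formsMul R A L₁ L₂) 1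
      (contr R ξ ∘ₗ B (vec R A L₁ L₂ x) - B (vec R A L₁ L₂ x) ∘ₗ contr R ξ +
        contr R (S.act₁.act x ξ)) :=
    IsGradedDerivation.commutator_add (T := PolyForm A L₁ L₂) (isGradedDerivation_contr ξ)
      (isGradedDerivation_contr _) (hB.vec_mul x) fun i f =>
        hB.gerstenhaber.isSkewDerivationBracket.exists_vec_hom (ofVec A L₁ L₂ x) i f
  have h0 := (isGeneratedBy_forms R A L₁ L₂).derivation_eq_zero hder (fun y => ?_) fun q α => ?_
  · have h1 := DFunLike.congr_fun h0 a
    simp only [LinearMap.add_apply, LinearMap.sub_apply, LinearMap.comp_apply,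
      LinearMap.zero_apply] at h1
    rw [add_eq_zero_iff_eq_neg, sub_eq_iff_eq_add] at h1
    rw [h1]
    abel
  · change contr R ξ (B (vec R A L₁ L₂ x) (vec R A L₁ L₂ y)) -
      B (vec R A L₁ L₂ x) (contr R ξ (vec R A L₁ L₂ y)) +
        contr R (S.act₁.act x ξ) (vec R A L₁ L₂ y) = 0
    have h1 : B (vec R A L₁ L₂ x) (vec R A L₁ L₂ y) = vec R A L₁ L₂ ⁅x, y⁆ := hB.vec_vec x y
    rw [h1]
    simp only [contr_vec, map_zero, sub_zero, add_zero]
  · change contr R ξ (B (vec R A L₁ L₂ x) (phom R A L₁ L₂ (q, 0) α)) -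
      B (vec R A L₁ L₂ x) (contr R ξ (phom R A L₁ L₂ (q, 0) α)) +
        contr R (S.act₁.act x ξ) (phom R A L₁ L₂ (q, 0) α) = 0
    rw [hB.apply_form]
    cases q with
    | zero => simp only [contr_hom_zero, map_zero, sub_zero, add_zero]
    | succ q =>
      have e1 := contr_hom_succ (R := R) ξ q 0 (S.formAct x (q + 1) α)
      have e2 := contr_hom_succ (R := R) ξ q 0 α
      have e3 := contr_hom_succ (R := R) (S.act₁.act x ξ) q 0 α
      rw [e1, e2, e3, map_zsmul, hB.apply_form, ← smul_sub, ← smul_add]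
      have e4 : (S.formAct x (q + 1) α).curryLeft ξ =
          S.formAct x q (α.curryLeft ξ) - α.curryLeft (S.act₁.act x ξ) :=
        Conn.curryLeft_alt S.act₁ (Conn.zeroExt R A L₁ L₁) x q α ξ
      rw [e4]
      refine (congrArg (_ • ·) (congrArg (· + _) (congrArg (· - _)
        (map_sub (DirectSum.lof R (ℕ × ℕ) (PolyForm A L₁ L₂) (q, 0)) _ _)))).trans ?_
      rw [sub_sub_cancel_left, neg_add_cancel, smul_zero]

end Bracket

end AlmostTwilled

/-! ## Twilled Lie-Rinehart algebras: the differential is a derivation of the bracket -/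

section Abstract

variable {R : Type*} [CommRing R]
  {T : ℕ × ℕ → Type*} [∀ i, AddCommGroup (T i)] [∀ i, Module R (T i)]
  {μ B : (⨁ i, T i) →ₗ[R] (⨁ i, T i) →ₗ[R] (⨁ i, T i)}

/-- Skew symmetry allows expanding the product by the Leibniz rule on the other side, where the term
with the bracket of two forms drops out. -/
lemma IsSkewDerivationBracket.mul_vec_form (hB : IsSkewDerivationBracket μ B) (θ : T (1, 0))
    (u : T (0, 1)) (v : T (1, 1)) (hv : μ (hom R (1, 0) θ) (hom R (0, 1) u) = hom R (1, 1) v)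
    (q : ℕ) (α : T (q, 0)) :
    B (μ (hom R (1, 0) θ) (hom R (0, 1) u)) (hom R (q, 0) α) =
      μ (hom R (1, 0) θ) (B (hom R (0, 1) u) (hom R (q, 0) α)) := by
  rw [hv, hB.skew, ← hv, hB.leibniz, hB.form_form, map_zero, LinearMap.zero_apply, zero_add,
    hB.skew (q, 0) (0, 1), map_neg, map_zsmul]
  simp only [tdeg, add_zero, zero_add, mul_one]
  rcases neg_one_pow_eq_or ℤ q with h | h <;>
    simp [h, pow_succ, pow_mul, mul_add, add_mul]

lemma IsSkewDerivationBracket.bracketDefect_vec_vec (hB : IsSkewDerivationBracket μ B)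
    {d : (⨁ i, T i) →ₗ[R] (⨁ i, T i)} (u v : T (0, 1)) (w : T (1, 1))
    (hd : d (hom R (0, 1) u) = hom R (1, 1) w) :
    bracketDefect B d (0, 1) u (hom R (0, 1) v) =
      d (B (hom R (0, 1) u) (hom R (0, 1) v)) + B (hom R (0, 1) v) (d (hom R (0, 1) u)) -
        B (hom R (0, 1) u) (d (hom R (0, 1) v)) := by
  rw [bracketDefect_apply, hd, hB.skew (1, 1) (0, 1)]
  simp [tdeg, sub_eq_add_neg]

variable {X : Type*} {F : ℕ → Set (⨁ i, T i)} {c : X → (⨁ i, T i) →ₗ[R] (⨁ i, T i)}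

/-- Induction on the degree: contractions separate points in positive degree and commute with `Z`,
so the vanishing propagates from degree zero. -/
lemma eq_zero_of_commute_contraction
    (hc : ∀ ξ q, ∀ a ∈ F (q + 1), c ξ a ∈ F q)
    (hF : ∀ q, ∀ a ∈ F (q + 1), (∀ ξ, c ξ a = 0) → a = 0)
    {Z : X → (⨁ i, T i) → (⨁ i, T i)} (hZ : ∀ ξ q, ∀ a ∈ F q, Z ξ a ∈ F q)
    (hZ0 : ∀ ξ, ∀ a ∈ F 0, Z ξ a = 0)
    (hcZ : ∀ ξ η q, ∀ a ∈ F q, c η (Z ξ a) = Z ξ (c η a)) (q : ℕ) :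
    ∀ ξ, ∀ a ∈ F q, Z ξ a = 0 := by
  induction q with
  | zero => exact hZ0
  | succ q ih =>
    intro ξ a ha
    refine hF q _ (hZ ξ _ a ha) fun η => ?_
    rw [hcZ ξ η _ a ha, ih ξ _ (hc η q a ha)]

/-- The Cartan calculus behind the derivation property of the differential with respect to the
bracket with a vector. -/
lemma eq_zero_of_cartan
    (hc0 : ∀ ξ, ∀ a ∈ F 0, c ξ a = 0) (hc : ∀ ξ q, ∀ a ∈ F (q + 1), c ξ a ∈ F q)
    (hF : ∀ q, ∀ a ∈ F (q + 1), (∀ ξ, c ξ a = 0) → a = 0)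
    {d b : (⨁ i, T i) →ₗ[R] (⨁ i, T i)} {ℓ : X → (⨁ i, T i) →ₗ[R] (⨁ i, T i)}
    {J : (⨁ i, T i) → (⨁ i, T i)} {N Q : X → (⨁ i, T i) → (⨁ i, T i)}
    {σ : X → X} {τ br : X → X → X}
    (hd : ∀ ξ a, c ξ (d a) = ℓ ξ a - d (c ξ a))
    (hb : ∀ ξ a, c ξ (b a) = b (c ξ a) - c (σ ξ) a)
    (hl : ∀ ξ η a, c η (ℓ ξ a) = ℓ ξ (c η a) - c (br ξ η) a)
    (hJ : ∀ ξ a, c ξ (J a) = N ξ a - J (c ξ a) + Q ξ a)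
    (hN : ∀ ξ η a, c η (N ξ a) = N ξ (c η a) - c (τ ξ η) a)
    (hQ : ∀ ξ η a, c η (Q ξ a) = c (τ η ξ) a + Q ξ (c η a))
    (hσ : ∀ ξ η a, c (σ (br ξ η)) a =
      c (br (σ ξ) η) a + c (br ξ (σ η)) a + c (τ η ξ) a - c (τ ξ η) a)
    (hW : ∀ q, ∀ a ∈ F q, d (b a) - J a - b (d a) ∈ F (q + 1)) (hJ0 : J 0 = 0)
    (hZ : ∀ ξ q, ∀ a ∈ F q, ℓ ξ (b a) - b (ℓ ξ a) + ℓ (σ ξ) a - N ξ a - Q ξ a ∈ F q)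
    (hZ0 : ∀ ξ, ∀ a ∈ F 0, ℓ ξ (b a) - b (ℓ ξ a) + ℓ (σ ξ) a - N ξ a - Q ξ a = 0)
    (q : ℕ) :
    ∀ a ∈ F q, d (b a) - J a - b (d a) = 0 := by
  -- Contracting the defect `d b - J - b d` with `ξ` gives this operator minus the defect of the
  -- contracted element. The operator commutes with contractions, by `hσ`, and vanishes in degree
  -- zero, so it vanishes altogether and the defect itself can be treated by induction on the
  -- degree.
  have key : ∀ q ξ, ∀ a ∈ F q, ℓ ξ (b a) - b (ℓ ξ a) + ℓ (σ ξ) a - N ξ a - Q ξ a = 0 :=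
    eq_zero_of_commute_contraction hc hF hZ hZ0 fun ξ η q a _ => by
      simp only [map_sub, map_add, hl, hb, hN, hQ, hσ]
      abel
  have hcW : ∀ q ξ, ∀ a ∈ F q, c ξ (d (b a) - J a - b (d a)) =
      -(d (b (c ξ a)) - J (c ξ a) - b (d (c ξ a))) := fun q ξ a ha => by
    rw [← sub_eq_zero, ← key q ξ a ha]
    simp only [map_sub, hd, hb, hJ]
    abel
  induction q with
  | zero =>
    intro a ha
    refine hF 0 _ (hW 0 a ha) fun ξ => ?_
    rw [hcW 0 ξ a ha, hc0 ξ a ha]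
    simp only [map_zero, hJ0, sub_zero, neg_zero]
  | succ q ih =>
    intro a ha
    refine hF (q + 1) _ (hW _ a ha) fun ξ => ?_
    rw [hcW (q + 1) ξ a ha, ih _ (hc ξ q a ha), neg_zero]

end Abstract

lemma contr_smul {R A L₁ L₂ : Type*} [CommRing R] [CommRing A] [Algebra R A]
    [LieRing L₁] [LieAlgebra R L₁] [Module A L₁] [LieRingModule L₁ A] [LieRinehartRing A L₁]
    [LieRinehartAlgebra R A L₁]
    [LieRing L₂] [LieAlgebra R L₂] [Module A L₂] [LieRingModule L₂ A] [LieRinehartRing A L₂]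
    [LieRinehartAlgebra R A L₂] (ξ : L₂) (r : A) (a : PolyForms A L₁ L₂) :
    contr R ξ (r • a) = r • contr R ξ a := by
  refine DFinsupp.ext fun i => ?_
  obtain ⟨q, p⟩ := i
  refine (contr_apply ξ (r • a) q p).trans ?_
  refine Eq.trans ?_ (congrArg (r • ·) (contr_apply ξ a q p)).symm
  rw [← smul_comm]
  rfl

/-! ### The compatibility conditions of a twilled algebra. -/

namespace AlmostTwilled

variable {R A L₁ L₂ : Type*} [CommRing R] [CommRing A] [Algebra R A]
  [LieRing L₁] [LieAlgebra R L₁] [Module A L₁] [LieRingModule L₁ A] [LieRinehartRing A L₁]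
  [LieRinehartAlgebra R A L₁]
  [LieRing L₂] [LieAlgebra R L₂] [Module A L₂] [LieRingModule L₂ A] [LieRinehartRing A L₂]
  [LieRinehartAlgebra R A L₂]
  {S : AlmostTwilled R A L₁ L₂}

/-- The `L₂`-component of the Jacobi identity for `x`, `ξ`, `η` in `L₂ ⊕ L₁`. Similarly `act_lie₂`
is the `L₁`-component for `ξ`, `x`, `y`, and `lie_lie` expresses that the anchor respects the
bracket of `ξ` and `x`. -/
lemma IsTwilled.act_lie₁ (h : S.IsTwilled) (x : L₁) (ξ η : L₂) :
    S.act₁.act x ⁅ξ, η⁆ = ⁅S.act₁.act x ξ, η⁆ + ⁅ξ, S.act₁.act x η⁆ +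
      S.act₁.act (S.act₂.act η x) ξ - S.act₁.act (S.act₂.act ξ x) η := by
  have h1 := congrArg Prod.fst (h.br_jacobi (0, x) (ξ, 0) (η, 0))
  simp only [twBracket, zero_lie, lie_zero, map_zero, LinearMap.zero_apply, map_neg,
    LinearMap.neg_apply, add_zero, zero_add, sub_zero, zero_sub, Prod.fst_add, sub_neg_eq_add] at h1
  rw [h1]
  abel

lemma IsTwilled.act_lie₂ (h : S.IsTwilled) (ξ : L₂) (x y : L₁) :
    S.act₂.act ξ ⁅x, y⁆ = ⁅S.act₂.act ξ x, y⁆ + ⁅x, S.act₂.act ξ y⁆ +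
      S.act₂.act (S.act₁.act y ξ) x - S.act₂.act (S.act₁.act x ξ) y := by
  have h1 := congrArg Prod.snd (h.br_jacobi (ξ, 0) (0, x) (0, y))
  simp only [twBracket, zero_lie, lie_zero, map_zero, LinearMap.zero_apply, map_neg,
    LinearMap.neg_apply, add_zero, zero_add, sub_zero, zero_sub, sub_neg_eq_add,
    Prod.snd_add] at h1
  rw [h1]
  abel

lemma IsTwilled.lie_lie (h : S.IsTwilled) (ξ : L₂) (x : L₁) (a : A) :
    ⁅ξ, ⁅x, a⁆⁆ - ⁅x, ⁅ξ, a⁆⁆ = ⁅S.act₂.act ξ x, a⁆ - ⁅S.act₁.act x ξ, a⁆ := by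
  have h1 := h.anc_br (ξ, 0) (0, x) a
  simp only [twBracket, zero_lie, lie_zero, map_zero, neg_lie,
    add_zero, zero_add, sub_zero, zero_sub] at h1
  rw [← h1]
  abel

section

variable [Module.Finite A L₁] [Module.Projective A L₁]
  {B : PolyForms A L₁ L₂ →ₗ[R] PolyForms A L₁ L₂ →ₗ[R] PolyForms A L₁ L₂}
  (hB : S.IsCrossedBracket B) {k : ℕ} {e : Fin k → L₁} {f : Fin k → L₁ →ₗ[A] A}
  (he : ∀ m, m = ∑ i, f i m • e i) (x : L₁) {θ : Fin k → PolyForm A L₁ L₂ (1, 0)}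
  (hθ : ∀ i ξ, contr R ξ (phom R A L₁ L₂ (1, 0) (θ i)) =
    scal R A L₁ L₂ (f i (S.act₂.act ξ x)))

include he hθ in
-- `d''x` is, up to sign conventions, the one-form `ξ ↦ ξ·x`; here it is decomposed along a dual
-- basis of `L₁`. This gives access to the bracket with `d''x`, whose value in `L₁` is not constant.
lemma dPoly_vec : S.dPoly (vec R A L₁ L₂ x) =
    ∑ i, formsMul R A L₁ L₂ (phom R A L₁ L₂ (1, 0) (θ i)) (vec R A L₁ L₂ (e i)) := by
  refine forms_ext (R := R) ?_ fun ξ => ?_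
  · rw [evalZero_dPoly, map_sum]
    refine (Finset.sum_eq_zero fun i _ => ?_).symm
    rw [evalZero_mul]
    have h1 := evalZero_hom_succ (R := R) 0 0 (θ i)
    rw [h1, zero_mul]
  · rw [contr_dPoly_vec, map_sum]
    conv_lhs => rw [he (S.act₂.act ξ x), map_sum]
    refine Finset.sum_congr rfl fun i _ => ?_
    rw [contr_oneForm_mul, hθ, contr_vec, map_zero, sub_zero, scal_mul, smul_vec]

include hB in
lemma IsCrossedBracket.mul_vec_form (θ : PolyForm A L₁ L₂ (1, 0)) (y : L₁) {q : ℕ}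
    {a : PolyForms A L₁ L₂} (ha : a ∈ formsOfDegree R A L₁ L₂ q) :
    B (formsMul R A L₁ L₂ (phom R A L₁ L₂ (1, 0) θ) (vec R A L₁ L₂ y)) a =
      formsMul R A L₁ L₂ (phom R A L₁ L₂ (1, 0) θ) (B (vec R A L₁ L₂ y) a) := by
  obtain ⟨α, rfl⟩ := exists_of_mem_formsOfDegree R ha
  have h := IsSkewDerivationBracket.mul_vec_form (T := PolyForm A L₁ L₂)
    hB.gerstenhaber.isSkewDerivationBracket θ (ofVec A L₁ L₂ y) _
    (formsMul_hom R A L₁ L₂ (1, 0) (0, 1) θ (ofVec A L₁ L₂ y)) q α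
  exact h

include hB hθ in
lemma IsCrossedBracket.contr_sum_mul_bracket (ξ : L₂) (a : PolyForms A L₁ L₂) :
    contr R ξ (∑ i, formsMul R A L₁ L₂ (phom R A L₁ L₂ (1, 0) (θ i)) (B (vec R A L₁ L₂ (e i)) a)) =
      ∑ i, f i (S.act₂.act ξ x) • B (vec R A L₁ L₂ (e i)) a -
      ∑ i, formsMul R A L₁ L₂ (phom R A L₁ L₂ (1, 0) (θ i))
        (B (vec R A L₁ L₂ (e i)) (contr R ξ a)) +
      ∑ i, formsMul R A L₁ L₂ (phom R A L₁ L₂ (1, 0) (θ i))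
        (contr R (S.act₁.act (e i) ξ) a) := by
  rw [map_sum, ← Finset.sum_sub_distrib, ← Finset.sum_add_distrib]
  refine Finset.sum_congr rfl fun i _ => ?_
  rw [contr_oneForm_mul, hθ, scal_mul, hB.contr_bracket_vec, map_sub]
  abel

include he in
lemma sum_smul_contr_act (y : L₁) (η : L₂) (a : PolyForms A L₁ L₂) :
    ∑ i, f i y • contr R (S.act₁.act (e i) η) a = contr R (S.act₁.act y η) a := by
  have h : S.act₁.act y η = ∑ i, f i y • S.act₁.act (e i) η := by
    conv_lhs => rw [he y, map_sum, LinearMap.sum_apply]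
    simp only [map_smul, LinearMap.smul_apply]
  rw [h, ← contrLin_apply, map_sum]
  refine Finset.sum_congr rfl fun i _ => ?_
  rw [map_smul, contrLin_apply]

include hB he in
lemma IsCrossedBracket.contr_sum_smul_bracket (y : L₁) (η : L₂) (a : PolyForms A L₁ L₂) :
    contr R η (∑ i, f i y • B (vec R A L₁ L₂ (e i)) a) =
      ∑ i, f i y • B (vec R A L₁ L₂ (e i)) (contr R η a) - contr R (S.act₁.act y η) a := by
  rw [map_sum, ← sum_smul_contr_act he, ← Finset.sum_sub_distrib]
  refine Finset.sum_congr rfl fun i _ => ?_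
  rw [contr_smul, hB.contr_bracket_vec, smul_sub]

include he hθ in
lemma contr_sum_mul_contr (ξ η : L₂) (a : PolyForms A L₁ L₂) :
    contr R η (∑ i, formsMul R A L₁ L₂ (phom R A L₁ L₂ (1, 0) (θ i))
        (contr R (S.act₁.act (e i) ξ) a)) =
      contr R (S.act₁.act (S.act₂.act η x) ξ) a +
      ∑ i, formsMul R A L₁ L₂ (phom R A L₁ L₂ (1, 0) (θ i))
        (contr R (S.act₁.act (e i) ξ) (contr R η a)) := by
  rw [map_sum, ← sum_smul_contr_act he (S.act₂.act η x), ← Finset.sum_add_distrib]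
  refine Finset.sum_congr rfl fun i _ => ?_
  rw [contr_oneForm_mul, hθ, scal_mul, contr_contr, map_neg, sub_neg_eq_add, contr_contr]

end

end AlmostTwilled

namespace AlmostTwilled

variable {R A L₁ L₂ : Type*} [CommRing R] [CommRing A] [Algebra R A]
  [LieRing L₁] [LieAlgebra R L₁] [Module A L₁] [LieRingModule L₁ A] [LieRinehartRing A L₁]
  [LieRinehartAlgebra R A L₁]
  [LieRing L₂] [LieAlgebra R L₂] [Module A L₂] [LieRingModule L₂ A] [LieRinehartRing A L₂]
  [LieRinehartAlgebra R A L₂]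
  {S : AlmostTwilled R A L₁ L₂} [Module.Finite A L₁] [Module.Projective A L₁]
  {B : PolyForms A L₁ L₂ →ₗ[R] PolyForms A L₁ L₂ →ₗ[R] PolyForms A L₁ L₂}

variable (S) in
lemma exists_dPoly_vec (x : L₁) : ∃ w : PolyForm A L₁ L₂ (1, 1),
    S.dPoly (vec R A L₁ L₂ x) = phom R A L₁ L₂ (1, 1) w :=
  ⟨_, S.dPoly_phom (0, 1) (ofVec A L₁ L₂ x)⟩

/-- There is no component of form degree zero. After contraction with `ξ` all terms are vectors, and
their sum vanishes by `act_lie₂`. -/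
lemma IsCrossedBracket.dPoly_bracket_vec_vec (hB : S.IsCrossedBracket B) (h : S.IsTwilled)
    (x y : L₁) : S.dPoly (B (vec R A L₁ L₂ x) (vec R A L₁ L₂ y)) +
      B (vec R A L₁ L₂ y) (S.dPoly (vec R A L₁ L₂ x)) -
        B (vec R A L₁ L₂ x) (S.dPoly (vec R A L₁ L₂ y)) = 0 := by
  have hvv : ∀ u v : L₁, B (vec R A L₁ L₂ u) (vec R A L₁ L₂ v) = vec R A L₁ L₂ ⁅u, v⁆ :=
    hB.vec_vec
  have hev : ∀ u v : L₁, evalZero R (B (vec R A L₁ L₂ u) (S.dPoly (vec R A L₁ L₂ v))) = 0 := by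
    intro u v
    obtain ⟨w, hw⟩ := S.exists_dPoly_vec v
    have h1 := IsSkewDerivationBracket.exists_vec_hom (T := PolyForm A L₁ L₂)
      hB.gerstenhaber.isSkewDerivationBracket (ofVec A L₁ L₂ u) (1, 1) w
    obtain ⟨g, hg⟩ := h1
    rw [hw]
    refine (congrArg (evalZero R) hg).trans ?_
    exact evalZero_hom_succ 0 1 g
  refine forms_ext (R := R) ?_ fun ξ => ?_
  · rw [map_sub, map_add, hev, hev, evalZero_dPoly, map_zero, add_zero, sub_zero]
  · rw [map_sub, map_add, hvv, contr_dPoly_vec, hB.contr_bracket_vec, hB.contr_bracket_vec,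
      contr_dPoly_vec, contr_dPoly_vec, contr_dPoly_vec, contr_dPoly_vec, hvv, hvv, map_zero,
      h.act_lie₂, ← lie_skew y]
    simp only [map_add, map_sub, map_neg]
    abel

-- An instance of `eq_zero_of_cartan`, in which `J` is the bracket with `d''x` written in
-- coordinates. The terms `N` and `Q` arise when `ξ` is contracted into it: `N` from the coordinate
-- one-forms, `Q` from the rule for contracting brackets with the `e i`.
set_option maxHeartbeats 1600000 in
lemma IsCrossedBracket.dPoly_bracket_vec_form (hB : S.IsCrossedBracket B) (h : S.IsTwilled)
    (x : L₁) (q : ℕ) (a : PolyForms A L₁ L₂) (ha : a ∈ formsOfDegree R A L₁ L₂ q) :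
    S.dPoly (B (vec R A L₁ L₂ x) a) - B (S.dPoly (vec R A L₁ L₂ x)) a -
        B (vec R A L₁ L₂ x) (S.dPoly a) = 0 := by
  obtain ⟨k, e, f, he⟩ := exists_dual_basis A L₁
  have hex : ∀ i, ∃ θ : PolyForm A L₁ L₂ (1, 0), ∀ ξ, contr R ξ (phom R A L₁ L₂ (1, 0) θ) =
      scal R A L₁ L₂ (f i (S.act₂.act ξ x)) := fun i =>
    exists_oneForm R { toFun := fun ξ => f i (S.act₂.act ξ x)
                       map_add' := fun ξ η => by rw [map_add, LinearMap.add_apply, map_add]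
                       map_smul' := fun r ξ => by
                        rw [map_smul, LinearMap.smul_apply, map_smul, RingHom.id_apply] }
  choose θ hθ using hex
  have hJ : ∀ q, ∀ a ∈ formsOfDegree R A L₁ L₂ q, B (S.dPoly (vec R A L₁ L₂ x)) a =
      ∑ i, formsMul R A L₁ L₂ (phom R A L₁ L₂ (1, 0) (θ i)) (B (vec R A L₁ L₂ (e i)) a) := by
    intro q a ha
    rw [dPoly_vec he x hθ, map_sum, LinearMap.sum_apply]
    exact Finset.sum_congr rfl fun i _ => hB.mul_vec_form (θ i) (e i) ha
  rw [hJ q a ha]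
  have key := eq_zero_of_cartan (R := R) (T := PolyForm A L₁ L₂)
    (F := fun q => (formsOfDegree R A L₁ L₂ q : Set (PolyForms A L₁ L₂)))
    (c := contr R)
    (d := S.dPoly) (b := B (vec R A L₁ L₂ x)) (ℓ := S.polyLie)
    (J := fun a => ∑ i, formsMul R A L₁ L₂ (phom R A L₁ L₂ (1, 0) (θ i))
      (B (vec R A L₁ L₂ (e i)) a))
    (N := fun ξ a => ∑ i, f i (S.act₂.act ξ x) • B (vec R A L₁ L₂ (e i)) a)
    (Q := fun ξ a => ∑ i, formsMul R A L₁ L₂ (phom R A L₁ L₂ (1, 0) (θ i))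
        (contr R (S.act₁.act (e i) ξ) a))
    (σ := fun ξ => S.act₁.act x ξ) (τ := fun ξ η => S.act₁.act (S.act₂.act ξ x) η)
    (br := fun ξ η => ⁅ξ, η⁆)
    (fun ξ a ha => contr_eq_zero_of_mem_formsOfDegree ξ ha)
    (fun ξ q a ha => contr_mem_formsOfDegree ξ ha)
    (fun q a ha h0 => eq_zero_of_mem_formsOfDegree ha h0)
    S.contr_dPoly (hB.contr_bracket_vec x) S.contr_polyLie
    (hB.contr_sum_mul_bracket x hθ) (fun ξ η a => hB.contr_sum_smul_bracket he _ η a)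
    (fun ξ η a => contr_sum_mul_contr he x hθ ξ η a)
    -- The compatibility condition `act_lie₁`, read through contractions.
    (fun ξ η a => by
      have h1 : ∀ ζ : L₂, contr R ζ a = contrLin R A L₁ L₂ a ζ := fun ζ => rfl
      simp only [h1, h.act_lie₁, map_add, map_sub])
    (fun q a ha => by
      refine sub_mem (sub_mem ?_ (sum_mem fun i _ => ?_)) ?_
      · exact S.dPoly_mem_formsOfDegree (hB.apply_mem_formsOfDegree x ha)
      · exact mul_mem_formsOfDegree _ (hB.apply_mem_formsOfDegree _ ha)
      · exact hB.apply_mem_formsOfDegree x (S.dPoly_mem_formsOfDegree ha))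
    (by simp only [map_zero, Finset.sum_const_zero])
    (fun ξ q a ha => by
      refine sub_mem (sub_mem (add_mem (sub_mem ?_ ?_) ?_) (sum_mem fun i _ => ?_))
        (sum_mem fun i _ => ?_)
      · exact S.polyLie_mem_formsOfDegree _ (hB.apply_mem_formsOfDegree x ha)
      · exact hB.apply_mem_formsOfDegree x (S.polyLie_mem_formsOfDegree _ ha)
      · exact S.polyLie_mem_formsOfDegree _ ha
      · exact Submodule.smul_mem _ _ (hB.apply_mem_formsOfDegree _ ha)
      · cases q with
        | zero =>
          rw [contr_eq_zero_of_mem_formsOfDegree _ ha, map_zero]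
          exact zero_mem _
        | succ q => exact mul_mem_formsOfDegree _ (contr_mem_formsOfDegree _ ha))
    -- In degree zero the elements are scalars. The contractions vanish and what remains is the
    -- compatibility of the two anchors, `lie_lie`, with `ξ·x` expanded in the dual basis.
    (fun ξ a ha => by
      obtain ⟨α, rfl⟩ := exists_of_mem_formsOfDegree R ha
      obtain ⟨r, hr⟩ := exists_scal R α
      have hQ : ∀ i, contr R (S.act₁.act (e i) ξ) (phom R A L₁ L₂ (0, 0) α) = 0 := fun i =>
        contr_eq_zero_of_mem_formsOfDegree _ ha
      simp only [hQ, map_zero, Finset.sum_const_zero, sub_zero]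
      simp only [hr, hB.apply_scal, polyLie_scal, smul_scal]
      rw [← map_sum, ← map_sub, ← map_add, ← map_sub]
      refine (congrArg (scal R A L₁ L₂) ?_).trans (map_zero _)
      rw [h.lie_lie, sub_add_cancel, sub_eq_zero]
      conv_lhs => rw [he (S.act₂.act ξ x), sum_lie]
      exact Finset.sum_congr rfl fun i _ => LieRinehartRing.lie_smul_eq_mul' _ _ _) q
  exact key a ha

theorem IsCrossedBracket.isDiffBigradedGerstenhaber (hB : S.IsCrossedBracket B)
    (h : S.IsTwilled) :
    IsDiffBigradedGerstenhaber (T := PolyForm A L₁ L₂) (formsOne R A L₁ L₂)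
      (formsMul R A L₁ L₂) B S.dPoly where
  toIsBigradedGerstenhaber := hB.gerstenhaber
  d_bidegree := S.dPoly_bidegree
  d_d := S.dPoly_comp_dPoly
  d_mul := S.dPoly_mul
  d_bracket i f z := by
    have hs := IsBigradedGerstenhaber.isSkewDerivationBracket (T := PolyForm A L₁ L₂)
      hB.gerstenhaber
    have h1 := IsSkewDerivationBracket.bracketDefect_eq_zero (T := PolyForm A L₁ L₂) hs
      (isGeneratedBy_forms R A L₁ L₂) (d := S.dPoly) (fun i f => ⟨_, S.dPoly_phom i f⟩) S.dPoly_mul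
      (fun x y => by
        obtain ⟨w, hw⟩ := S.exists_dPoly_vec x
        have h2 := IsSkewDerivationBracket.bracketDefect_vec_vec (T := PolyForm A L₁ L₂) hs
          (ofVec A L₁ L₂ x) (ofVec A L₁ L₂ y) w hw
        exact h2.trans (hB.dPoly_bracket_vec_vec h x y))
      (fun x q α => by
        have h2 := IsSkewDerivationBracket.bracketDefect_apply (T := PolyForm A L₁ L₂) (B := B)
          S.dPoly (0, 1) (ofVec A L₁ L₂ x) (phom R A L₁ L₂ (q, 0) α)
        have h3 := hB.dPoly_bracket_vec_form h x q _ (phom_mem_formsOfDegree R q α)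
        refine h2.trans (Eq.trans ?_ h3)
        rw [sub_eq_add_neg _ (B _ (S.dPoly _))]
        refine congrArg₂ (· + ·) rfl ?_
        exact (congrArg (· • _) (by norm_num : (-1 : ℤ) ^ tdeg (0, 1) = -1)).trans
          (neg_one_smul ℤ _)) i f
    have h2 := DFunLike.congr_fun h1 z
    have h3 := IsSkewDerivationBracket.bracketDefect_apply (T := PolyForm A L₁ L₂) (B := B)
      S.dPoly i f z
    have h4 := h3.symm.trans h2
    rw [LinearMap.zero_apply] at h4
    refine eq_sub_of_add_eq ?_
    refine eq_of_sub_eq_zero (Eq.trans ?_ h4)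
    abel

end AlmostTwilled

/-! ## The commutator of the differential and a generator -/

section Abstract

variable {R : Type*} [CommRing R]
  {T : ℕ × ℕ → Type*} [∀ i, AddCommGroup (T i)] [∀ i, Module R (T i)]
  {V : Type*} {one : ⨁ i, T i} {μ B : (⨁ i, T i) →ₗ[R] (⨁ i, T i) →ₗ[R] (⨁ i, T i)}
  {v : V → T (0, 1)} {Δ d : (⨁ i, T i) →ₗ[R] (⨁ i, T i)}

lemma IsGenerator.apply_mul (h : IsGenerator μ B Δ) (i : ℕ × ℕ) (f : T i) (z : ⨁ i, T i) :
    Δ (μ (hom R i f) z) = μ (Δ (hom R i f)) z + (-1 : ℤ) ^ tdeg i • μ (hom R i f) (Δ z) +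
      (-1 : ℤ) ^ tdeg i • B (hom R i f) z := by
  rw [h.eq_generatedBracket, generatedBracket_hom]
  rcases neg_one_pow_eq_or ℤ (tdeg i) with hs | hs <;>
    simp only [hs, one_smul, neg_smul] <;> abel

lemma HasBidegree.exists_hom (hd : HasBidegree (1, 0) d) (i : ℕ × ℕ) (f : T i) :
    ∃ g : T (i.1 + 1, i.2), d (hom R i f) = hom R (i.1 + 1, i.2) g :=
  exists_eq_hom fun k hk => hd i f k fun h => hk (by
    simp only [Prod.mk.injEq] at h
    ext <;> simp only <;> omega)

lemma IsDiffBigradedGerstenhaber.d_mul_apply (hd : IsDiffBigradedGerstenhaber one μ B d)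
    (hΔ : HasBidegree (0, -1) Δ) (i : ℕ × ℕ) (f : T i) (z : ⨁ i, T i) :
    d (μ (Δ (hom R i f)) z) = μ (d (Δ (hom R i f))) z -
      (-1 : ℤ) ^ tdeg i • μ (Δ (hom R i f)) (d z) := by
  obtain ⟨q, _ | p⟩ := i
  · rw [hΔ.hom_zero]
    simp
  · obtain ⟨g, hg⟩ := hΔ.hom_succ q p f
    rw [hg, hd.d_mul, tdeg, tdeg, ← add_assoc, pow_succ, mul_neg_one, neg_smul, sub_neg_eq_add]

/-- `Δ` fails to be a derivation by the bracket term alone. As `d` is a derivation of the product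
and of the bracket, the bracket terms from the two composites cancel; the composites are even, so no
sign remains. -/
lemma IsDiffBigradedGerstenhaber.isGradedDerivation_commutator
    (hd : IsDiffBigradedGerstenhaber one μ B d) (hΔ : IsGenerator μ B Δ) :
    IsGradedDerivation μ 0 (d ∘ₗ Δ + Δ ∘ₗ d) := by
  intro i f z
  obtain ⟨g, hg⟩ := hd.d_bidegree.exists_hom i f
  have h1 := hΔ.apply_mul _ g z
  have hdeg : tdeg (i.1 + 1, i.2) = tdeg i + 1 := by simp only [tdeg]; omega
  rw [← hg, hdeg] at h1
  simp only [LinearMap.add_apply, LinearMap.comp_apply]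
  rw [hΔ.apply_mul i f z, hd.d_mul i f z]
  simp only [map_add, map_zsmul]
  rw [hd.d_mul_apply hΔ.1, hd.d_mul i f (Δ z), hd.d_bracket, h1, hΔ.apply_mul i f (d z)]
  rcases neg_one_pow_eq_or ℤ (tdeg i) with hs | hs <;>
    simp only [pow_succ, hs, one_smul, neg_smul, one_mul, neg_mul, zero_mul, pow_zero, neg_neg,
      smul_add, smul_sub, LinearMap.add_apply, smul_neg] <;> abel

/-- The commutator is an even derivation of bidegree `(1, -1)`: it kills forms and sends vectors to
forms of bidegree `(1, 0)`, so the faithful top degree decides. -/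
lemma IsDiffBigradedGerstenhaber.commutator_eq_zero_of_top
    (hd : IsDiffBigradedGerstenhaber one μ B d) (hΔ : IsGenerator μ B Δ) (hv : IsGeneratedBy μ v)
    {n : ℕ} (htop : ∀ x (w : T (0, n)), μ (hom R (0, 1) (v x)) (hom R (0, n) w) = 0)
    (hfaith : ∀ c : T (1, 0), (∀ w : T (0, n), μ (hom R (1, 0) c) (hom R (0, n) w) = 0) → c = 0)
    (h0 : ∀ w : T (0, n), d (Δ (hom R (0, n) w)) + Δ (d (hom R (0, n) w)) = 0) :
    d ∘ₗ Δ + Δ ∘ₗ d = 0 := by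
  refine hv.derivation_eq_zero_of_top (hd.isGradedDerivation_commutator hΔ) (fun q α => ?_)
    (fun x => ?_) htop hfaith h0
  · obtain ⟨g, hg⟩ := hd.d_bidegree.exists_hom (q, 0) α
    rw [LinearMap.add_apply, LinearMap.comp_apply, LinearMap.comp_apply, hg, hΔ.1.hom_zero,
      map_zero, zero_add]
    exact hΔ.1.hom_zero (q + 1) g
  · obtain ⟨c, hc⟩ := hΔ.1.hom_succ 0 0 (v x)
    obtain ⟨c', hc'⟩ := hd.d_bidegree.exists_hom (0, 0) c
    obtain ⟨g, hg⟩ := hd.d_bidegree.exists_hom (0, 1) (v x)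
    obtain ⟨g', hg'⟩ := hΔ.1.hom_succ 1 0 g
    refine ⟨c' + g', ?_⟩
    rw [hom_add]
    exact congrArg₂ (· + ·) ((congrArg d hc).trans hc') ((congrArg Δ hg).trans hg')

end Abstract

lemma Conn.rinehart_zero_apply {R A L M : Type*} [CommRing R] [CommRing A] [Algebra R A]
    [LieRing L] [LieAlgebra R L] [Module A L] [LieRingModule L A] [LieRinehartRing A L]
    [LieRinehartAlgebra R A L] [AddCommGroup M] [Module A M] [Module R M] [IsScalarTower R A M]
    (C : Conn R A L M) (f : L [⋀^Fin 0]→ₗ[A] M) (x : L) :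
    C.rinehart 0 f ![x] = -C.act x (f ![]) := by
  rw [rinehart_apply, Fin.sum_univ_one, Fin.sum_univ_one]
  simp [Subsingleton.elim _ (![] : Fin 0 → L)]

/-! ### The commutator in top degree and invariance of the connection. -/

namespace AlmostTwilled

variable {R A L₁ L₂ : Type*} [CommRing R] [CommRing A] [Algebra R A]
  [LieRing L₁] [LieAlgebra R L₁] [Module A L₁] [LieRingModule L₁ A] [LieRinehartRing A L₁]
  [LieRinehartAlgebra R A L₁]
  [LieRing L₂] [LieAlgebra R L₂] [Module A L₂] [LieRingModule L₂ A] [LieRinehartRing A L₂]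
  [LieRinehartAlgebra R A L₂]
  (S : AlmostTwilled R A L₁ L₂) {n : ℕ}

section Component

variable {M : Type*} [AddCommGroup M] [Module A M] [Module R M] [IsScalarTower R A M]
  (C : Conn R A L₁ M)

lemma covDerAt_one_zero (x : L₁) (ξ : L₂) (F : L₂ [⋀^Fin 1]→ₗ[A] (L₁ [⋀^Fin 0]→ₗ[A] M)) :
    S.covDerAt C 1 0 F ![ξ] ![x] = C.act x (F ![ξ] ![]) - F ![S.act₁.act x ξ] ![] := by
  change ((-1 : ℤ) ^ 1 • swapForms ((S.act₁.alt C 1).rinehart 0 (swapForms F))) ![ξ] ![x] = _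
  rw [pow_one, neg_one_smul]
  change -((S.act₁.alt C 1).rinehart 0 (swapForms F) ![x]) ![ξ] = _
  rw [Conn.rinehart_zero_apply, AlternatingMap.neg_apply, neg_neg, Conn.alt_act_apply,
    Fin.sum_univ_one]
  have h : Function.update ![ξ] 0 (S.act₁.act x (![ξ] 0)) = ![S.act₁.act x ξ] := by
    ext i
    fin_cases i
    simp
  rw [h]
  rfl

lemma rinehart_alt_apply (N : Conn R A L₂ M) (x : L₁) (ξ : L₂)
    (F : L₂ [⋀^Fin 0]→ₗ[A] (L₁ [⋀^Fin 1]→ₗ[A] M)) :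
    (S.act₂.alt N 1).rinehart 0 F ![ξ] ![x] =
      F ![] ![S.act₂.act ξ x] - N.act ξ (F ![] ![x]) := by
  rw [Conn.rinehart_zero_apply, AlternatingMap.neg_apply, Conn.alt_act_apply, Fin.sum_univ_one,
    neg_sub]
  have h : Function.update ![x] 0 (S.act₂.act ξ (![x] 0)) = ![S.act₂.act ξ x] := by
    ext i
    fin_cases i
    simp
  rw [h]

lemma rinehart_alt_zero_apply (N : Conn R A L₂ M) (ξ : L₂)
    (F : L₂ [⋀^Fin 0]→ₗ[A] (L₁ [⋀^Fin 0]→ₗ[A] M)) :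
    (S.act₂.alt N 0).rinehart 0 F ![ξ] ![] = -N.act ξ (F ![] ![]) := by
  rw [Conn.rinehart_zero_apply, AlternatingMap.neg_apply, Conn.alt_act_apply, Finset.univ_eq_empty,
    Finset.sum_empty, sub_zero]

end Component

variable (C : Conn R A L₁ (⋀[A]^n L₁)) {Δ : PolyForms A L₁ L₂ →ₗ[R] PolyForms A L₁ L₂}
  [Module.Finite A L₁] [Module.Projective A L₁]
  (hn : ∀ 𝔭 : PrimeSpectrum A, Module.rankAtStalk (R := A) L₁ 𝔭 = n)

include hn

/-- On the dual side the commutator starts in bidegree `(0, 0)` and ends in `(1, 1)`. There `d''∂`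
yields the derivative along `ξ` of the covariant derivative of `w`, and `∂d''` yields minus the
derivative along `x` of `ξ ↦ ξ(w)`. -/
lemma Corresponds.exists_duality_commutator (h : S.Corresponds n Δ C) (w : ⋀[A]^n L₁) :
    ∃ G : DualForm A L₁ L₂ n (1, 1),
      duality A L₁ L₂ n (S.dPoly (Δ (phom R A L₁ L₂ (0, n) (ofExt L₂ n w))) +
        Δ (S.dPoly (phom R A L₁ L₂ (0, n) (ofExt L₂ n w)))) = dhom R A L₁ L₂ n (1, 1) G ∧
      ∀ x ξ, G ![ξ] ![x] = ((S.act₂.ext n).act ξ (C.act x w) - C.act (S.act₂.act ξ x) w) -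
        (C.act x ((S.act₂.ext n).act ξ w) - (S.act₂.ext n).act (S.act₁.act x ξ) w) := by
  refine ⟨(S.act₂.alt (S.act₂.ext n) 1).rinehart 0 (S.covDerAt C 0 0 (ofTop w)) +
    S.covDerAt C 1 0 ((S.act₂.alt (S.act₂.ext n) 0).rinehart 0 (ofTop w)), ?_, fun x ξ => ?_⟩
  · have h1 : S.dDual n (S.covDer n C (dhom R A L₁ L₂ n (0, 0) (ofTop w))) =
        dhom R A L₁ L₂ n (1, 1)
          ((S.act₂.alt (S.act₂.ext n) 1).rinehart 0 (S.covDerAt C 0 0 (ofTop w))) :=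
      (congrArg (S.dDual n) (S.covDer_dhom C (0, 0) (ofTop w))).trans
        (S.dDual_dhom (0, 1) (S.covDerAt C 0 0 (ofTop w)))
    have h2 : S.covDer n C (S.dDual n (dhom R A L₁ L₂ n (0, 0) (ofTop w))) =
        dhom R A L₁ L₂ n (1, 1)
          (S.covDerAt C 1 0 ((S.act₂.alt (S.act₂.ext n) 0).rinehart 0 (ofTop w))) :=
      (congrArg (S.covDer n C) (S.dDual_dhom (0, 0) (ofTop w))).trans
        (S.covDer_dhom C (1, 0) ((S.act₂.alt (S.act₂.ext n) 0).rinehart 0 (ofTop w)))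
    rw [map_add, S.duality_dPoly hn, h, h, S.duality_dPoly hn, duality_ofExt, h1, h2]
    exact (map_add (DirectSum.lof R (ℕ × ℕ) (DualForm A L₁ L₂ n) (1, 1)) _ _).symm
  · refine (congrArg₂ (· + ·) (S.rinehart_alt_apply (S.act₂.ext n) x ξ _)
      (S.covDerAt_one_zero C x ξ _)).trans ?_
    rw [rinehart_alt_zero_apply, rinehart_alt_zero_apply, covDerAt_zero_zero, covDerAt_zero_zero]
    have e : (ofTop w : DualForm A L₁ L₂ n (0, 0)) ![] ![] = w := rfl
    rw [e]
    simp only [map_neg]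
    abel

variable {B : PolyForms A L₁ L₂ →ₗ[R] PolyForms A L₁ L₂ →ₗ[R] PolyForms A L₁ L₂}

theorem Corresponds.commutator_eq_zero_iff (h : S.Corresponds n Δ C)
    (hd : IsDiffBigradedGerstenhaber (T := PolyForm A L₁ L₂) (formsOne R A L₁ L₂)
      (formsMul R A L₁ L₂) B S.dPoly)
    (hΔ : IsGenerator (T := PolyForm A L₁ L₂) (formsMul R A L₁ L₂) B Δ) :
    S.dPoly ∘ₗ Δ + Δ ∘ₗ S.dPoly = 0 ↔ S.IsInvariant n C := by
  constructor
  · intro h0 x ξ w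
    obtain ⟨G, hG, hval⟩ := h.exists_duality_commutator S C hn w
    have h1 := DFunLike.congr_fun h0 (phom R A L₁ L₂ (0, n) (ofExt L₂ n w))
    have h2 : dhom R A L₁ L₂ n (1, 1) G = 0 := hG.symm.trans ((congrArg _ h1).trans (map_zero _))
    have h3 : G = 0 := by
      rw [← DirectSum.lof_apply R (M := DualForm A L₁ L₂ n) (1, 1) G]
      exact congrArg (fun z : DualForms A L₁ L₂ n => z (1, 1)) h2
    have h4 := hval x ξ
    rw [h3] at h4
    exact sub_eq_zero.1 h4.symm
  · intro hC
    refine IsDiffBigradedGerstenhaber.commutator_eq_zero_of_top (T := PolyForm A L₁ L₂) hd hΔ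
      (isGeneratedBy_forms R A L₁ L₂) (ofVec_mul_top hn) (eq_zero_of_forall_mul_top hn 1) fun f => ?_
    rw [eq_ofExt n f]
    obtain ⟨G, hG, hval⟩ := h.exists_duality_commutator S C hn (f ![])
    refine (duality_bijective hn).injective (hG.trans (Eq.trans ?_ (map_zero _).symm))
    have h1 : G = 0 := by
      ext v u : 2
      rw [show v = ![v 0] by ext i; fin_cases i; rfl, show u = ![u 0] by ext i; fin_cases i; rfl,
        hval, hC, sub_self]
      rfl
    rw [h1]
    exact map_zero (DirectSum.lof R (ℕ × ℕ) (DualForm A L₁ L₂ n) (1, 1))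

/-- The twilled condition already provides the differential Gerstenhaber structure, so only the
vanishing of the commutator is at stake. -/
theorem Corresponds.isWeakDiffBV_iff (h : S.Corresponds n Δ C)
    (hΔ : IsGenerator (T := PolyForm A L₁ L₂) (formsMul R A L₁ L₂) B Δ)
    (hB : S.IsCrossedBracket B) (hS : S.IsTwilled) :
    IsWeakDiffBV (T := PolyForm A L₁ L₂) (formsOne R A L₁ L₂) (formsMul R A L₁ L₂) B Δ
      S.dPoly ↔ S.IsInvariant n C := by
  have hd := hB.isDiffBigradedGerstenhaber hS
  rw [← h.commutator_eq_zero_iff S C hn hd hΔ]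
  exact ⟨fun h => h.commutator, fun h0 => { hd with generator := hΔ, commutator := h0 }⟩

theorem Corresponds.isDiffBV_iff (h : S.Corresponds n Δ C)
    (hΔ : IsGenerator (T := PolyForm A L₁ L₂) (formsMul R A L₁ L₂) B Δ)
    (hB : S.IsCrossedBracket B) (hS : S.IsTwilled) :
    IsDiffBV (T := PolyForm A L₁ L₂) (formsOne R A L₁ L₂) (formsMul R A L₁ L₂) B Δ
      S.dPoly ↔ C.IsFlat ∧ S.IsInvariant n C := by
  rw [← h.isWeakDiffBV_iff S C hn hΔ hB hS, ← h.isExact_iff S C hn]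
  exact ⟨fun h => ⟨h.exact_generator, h.toIsWeakDiffBV⟩,
    fun h0 => { h0.2 with exact_generator := h0.1 }⟩

end AlmostTwilled

end

end LieRinehartBV

theorem theorem5p4p6 {R A L₁ L₂ : Type*} [CommRing R] [CommRing A] [Algebra R A]
    [LieRing L₁] [LieAlgebra R L₁] [Module A L₁] [LieRingModule L₁ A] [LieRinehartRing A L₁]
    [LieRinehartAlgebra R A L₁]
    [LieRing L₂] [LieAlgebra R L₂] [Module A L₂] [LieRingModule L₂ A] [LieRinehartRing A L₂]
    [LieRinehartAlgebra R A L₂]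
    (S : AlmostTwilled R A L₁ L₂)
    [Module.Finite A L₁] [Module.Projective A L₁]
    (n : ℕ) (hn : ∀ 𝔭 : PrimeSpectrum A, Module.rankAtStalk (R := A) L₁ 𝔭 = n) :
    -- the duality map is an isomorphism of chain complexes
    (Function.Bijective (duality A L₁ L₂ n) ∧
      S.dPoly ∘ₗ S.dPoly = 0 ∧ S.dDual n ∘ₗ S.dDual n = 0 ∧
      ∀ x, duality A L₁ L₂ n (S.dPoly x) = S.dDual n (duality A L₁ L₂ n x)) ∧
    -- the crossed product bracket exists and is unique
    (∃! B : PolyForms A L₁ L₂ →ₗ[R] PolyForms A L₁ L₂ →ₗ[R] PolyForms A L₁ L₂,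
      S.IsCrossedBracket B) ∧
    ∀ B : PolyForms A L₁ L₂ →ₗ[R] PolyForms A L₁ L₂ →ₗ[R] PolyForms A L₁ L₂,
      S.IsCrossedBracket B →
      -- generators correspond bijectively to connections
      (∀ Δ : PolyForms A L₁ L₂ →ₗ[R] PolyForms A L₁ L₂,
        IsGenerator (T := PolyForm A L₁ L₂) (formsMul R A L₁ L₂) B Δ →
          ∃! C : Conn R A L₁ (⋀[A]^n L₁), S.Corresponds n Δ C) ∧
      (∀ C : Conn R A L₁ (⋀[A]^n L₁), ∃! Δ : PolyForms A L₁ L₂ →ₗ[R] PolyForms A L₁ L₂,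
        IsGenerator (T := PolyForm A L₁ L₂) (formsMul R A L₁ L₂) B Δ ∧ S.Corresponds n Δ C) ∧
      -- properties of corresponding generators and connections
      ∀ (Δ : PolyForms A L₁ L₂ →ₗ[R] PolyForms A L₁ L₂) (C : Conn R A L₁ (⋀[A]^n L₁)),
        IsGenerator (T := PolyForm A L₁ L₂) (formsMul R A L₁ L₂) B Δ → S.Corresponds n Δ C →
          (IsExact (T := PolyForm A L₁ L₂) Δ ↔ C.IsFlat) ∧
          (S.IsTwilled →
            (IsWeakDiffBV (T := PolyForm A L₁ L₂) (formsOne R A L₁ L₂) (formsMul R A L₁ L₂) B Δ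
                S.dPoly ↔ S.IsInvariant n C) ∧
            (IsDiffBV (T := PolyForm A L₁ L₂) (formsOne R A L₁ L₂) (formsMul R A L₁ L₂) B Δ
                S.dPoly ↔ C.IsFlat ∧ S.IsInvariant n C)) := 
  ⟨⟨duality_bijective hn, S.dPoly_comp_dPoly, S.dDual_comp_dDual, S.duality_dPoly hn⟩,
    S.existsUnique_isCrossedBracket hn, fun _ hB =>
    ⟨fun _ hΔ => S.existsUnique_conn hn hB hΔ, fun C => S.existsUnique_generator C hn hB,
      fun _ C hΔ h => ⟨h.isExact_iff S C hn, fun hS =>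
        ⟨h.isWeakDiffBV_iff S C hn hΔ hB hS, h.isDiffBV_iff S C hn hΔ hB hS⟩⟩⟩⟩
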